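/- **Data.** Let $T\ge 1$ and let $\omega$ be a primitive $T$-th root of unity. Let $\mathfrak g$ be a finite-dimensional complex Lie algebra with a nondegenerate invariant symmetric bilinear form $\langle\cdot,\cdot\rangle$, a linear automorphism $\sigma$ with $\sigma^T=1$ and an antilinear involutive automorphism $\tau$ with $\sigma\tau\sigma=\tau$, such that $\langle\sigma x,\sigma y\rangle=\langle x,y\rangle$ and $\langle\tau x,\tau y\rangle=\overline{\langle x,y\rangle}$. Let $I_a$ be a basis of $\mathfrak g$ and $I^a$ the dual basis (sums over $a$ are implicit). Let $\widetilde{\mathfrak g}=\mathfrak g\otimes\mathbb C[t,t^{-1}]\oplus\mathbb C\mathsf K\oplus\mathbb C\mathsf D$ with $x_n=x\otimes t^n$, $[x_m,y_n]=[x,y]_{m+n}+m\,\delta_{m+n,0}\langle x,y\rangle\mathsf K$, $[\mathsf D,x_n]=n\,x_n$, $\mathsf K$ central, with the invariant form $(x_m|y_n)=\delta_{m+n,0}\langle x,y\rangle$, $(\mathsf K|\mathsf D)=1$ (other pairings zero), and with $\sigma x_n=(\sigma x)_n$, $\sigma\mathsf K=\mathsf K$, $\sigma\mathsf D=\mathsf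 D$. Let $\widetilde{\mathfrak g}_{(j)}$ be the $\omega^j$-eigenspace of $\sigma$. Let $\Pi$ be the dihedral group generated by $z\mapsto\omega z$ and $z\mapsto\bar z$ on $\mathbb P^1$, and let $\boldsymbol z\subset\mathbb P^1$ be a finite set containing $\infty$ whose points have pairwise distinct $\Pi$-orbits, with multiplicities $n_x\ge1$ $(x\in\boldsymbol z)$, where $n_\infty\ge 2$ or $\boldsymbol z\neq\{\infty\}$. A point $x\in\mathbb C$ is called real if $x=\omega^k\bar x$ for some $k$, and complex otherwise. Let $\mathcal Z$ be the union of $\boldsymbol z$ and the conjugates of its complex points, with $n_{\bar x}=n_x$, and $\mathcal Z'=\mathcal Z\setminus\{0,\infty\}$; put $n_x=0$ for $x\notin\mathcal Z$. Levels are complex numbers $\ell^x_p$ $(x\in\mathcal Z,\ p\ge0)$ with $\ell^x_p=0$ for $p\ge n_x$, $\ell^\infty_0=0$, $\ell^0_p=\ell^\infty_p=0$ if $T\nmid p$, $\ell^x_{n_x-1}\ne0$ for $x\ne\infty$, $\ell^\infty_{n_\infty-1}\neq0$ if $n_\infty\ge2$, and $\overline{\ell^x_p}=\ell^{\bar x}_p$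 for $x$ complex, $\overline{\ell^x_p}=\omega^{-kp}\ell^x_p$ for real $x=\omega^k\bar x\neq0$, $\ell^0_p,\ell^\infty_p\in\mathbb R$. **Observables.** Let $\widetilde{\mathfrak g}^{\mathcal D}_{\mathbb C}$ be the direct sum over $x\in\mathcal Z'$ of the Lie algebras $\widetilde{\mathfrak g}\otimes\mathbb C[\varepsilon]/\varepsilon^{n_x}$, together with $\bigoplus_{0\le p<n_0}\widetilde{\mathfrak g}_{(p)}\varepsilon^p$ at $0$ and $\bigoplus_{1\le p<n_\infty}\widetilde{\mathfrak g}_{(-p)}\varepsilon^p$ at $\infty$ (both also truncated). For $X\in\widetilde{\mathfrak g}$ let $X^{(x)}_p$ be $X\varepsilon^p$ placed at $x$, projected first onto $\widetilde{\mathfrak g}_{(p)}$, resp. $\widetilde{\mathfrak g}_{(-p)}$, if $x=0$, resp. $x=\infty$; it is $0$ if $p\ge n_x$ and if $(x,p)=(\infty,0)$. Let $\widehat{\mathfrak g}^{\mathcal D}_{\mathbb C}$ be the subalgebra of elements without $\mathsf D$-components. Let $S_\ell$ be the quotient of the Poisson algebra $S(\widehat{\mathfrak g}^{\mathcal D}_{\mathbb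 C})$ by the ideal generated by all $\mathsf K^{(x)}_p-i\ell^x_p$. Let $F_n$, resp. $\bar F_n$, be the subspaces of elements of $\widetilde{\mathfrak g}^{\mathcal D}_{\mathbb C}$ all of whose components are combinations of $x_m$ with $m\ge n$, resp. $m\le -n$. Let $\hat S$ and $\hat S_\ell$ be the completions of $S(\widetilde{\mathfrak g}^{\mathcal D}_{\mathbb C})$ and of $S_\ell$ with respect to the ideals generated by $F_n$, intersected with those generated by $\bar F_n$ (or by their images); $\hat S_\ell$ carries the Poisson bracket extended by continuity. Let $\pi_\ell:\hat S\to\hat S_\ell$ be the continuous algebra morphism with $\pi_\ell(x^{(x')}_{n,p})=x^{(x')}_{n,p}$ for $x\in\mathfrak g$, $\pi_\ell(\mathsf K^{(x)}_r)=i\ell^x_r$ and $$\pi_\ell(\mathsf D^{(x)}_r)=\tfrac i2\sum_{p,q<n_x}\sum_{n\in\mathbb Z}\kappa^x_{p+q-r}\,I^{(x)}_{a,-n,p}\,I^{a(x)}_{n,q},\qquad \kappa^x_k=\sum_{c}(-1)^{|c|}\frac{\prod_j\ell^x_{n_x-1-c_j}}{(\ell^x_{n_x-1})^{|c|+1}}$$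 (for those $r$ with $\mathsf D^{(x)}_r\ne0$), where $c$ runs over the compositions of $k-n_x+1$ and $\kappa^x_k=0$ if $k<n_x-1$. **Fields.** Let $\mathcal A^x_p=\sum I_{\tilde a}\otimes I^{\tilde a(x)}_p$ for dual bases $I_{\tilde a},I^{\tilde a}$ of $\widetilde{\mathfrak g}$; let $\sigma$ act on the first tensor factor, and let $(\Phi|\Psi)\in\hat S$ be the pairing of first tensor factors by the form and product of the second ones. For coefficients $c^{k,x}_p$ put $$\Lambda[c](z)=\frac1T\sum_{k=0}^{T-1}\sum_{x\in\mathcal Z'}\sum_{p\ge0}\frac{\omega^{-k}c^{k,x}_p}{(\omega^{-k}z-x)^{p+1}}+\sum_{p\ge0}c^{0,0}_p z^{-p-1}-\sum_{q\ge0}c^{0,\infty}_{q+1}z^q,$$ $$\mu^x_p[c](z)=\sum_{k=0}^{T-1}\sum_{s\ge0}\frac{c^{k,x}_{p+s}}{(\omega^{-k}z-x)^{s+1}}\ (x\in\mathcal Z'),\qquad \mu^0_p[c](z)=\sum_{s\ge0}c^{0,0}_{p+s}z^{-s-1},\qquad \mu^\infty_p[c](z)=\sum_{s\ge0}c^{0,\infty}_{p+s+2}z^s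 .$$ Let $\mathcal L$, $\mathcal M^x_p$ be $\Lambda[c]$, $\mu^x_p[c]$ with $c^{k,x}_p=\sigma^k\mathcal A^x_p$, and $\varphi$, $\varphi^x_p$ the same expressions with $c^{k,x}_p=\ell^x_p$. Let $\varrho(x_n)=x\otimes e^{in\theta}$, $\varrho(\mathsf K)=0$, $\varrho(\mathsf D)=-i\partial$ with $\partial=d/d\theta$. Then $(\varrho\otimes\pi_\ell)\mathcal L(z)=\varphi(z)(\partial+\mathscr L(z))$ and $(\varrho\otimes\pi_\ell)\mathcal M^x_p(z)=\varphi^x_p(z)(\partial+\mathscr M^x_p(z))$ define the $\mathfrak g$-valued fields $\mathscr L(z)$ and $\varphi^x_p(z)\mathscr M^x_p(z)$ on the circle with coefficients in $\hat S_\ell$, and $\mathscr N^x_p(z)=\varphi^x_p(z)(\mathscr L(z)-\mathscr M^x_p(z))$. **Hamiltonians.** Put $$\mathcal H^x_p=\sum_{l=0}^{T-1}\sum_{\substack{y\in\mathcal Z'\cup\{0\}\\(l,y)\neq(0,x)}}\sum_{q,s\ge0}\binom{q+s}{s}(-1)^s\frac{\omega^{lq}(\mathcal A^x_{p+s}|\sigma^l\mathcal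 A^y_q)}{(x-\omega^ly)^{q+s+1}}-T\sum_{q\ge s\ge0}\binom qs x^{q-s}(\mathcal A^x_{p+s}|\mathcal A^\infty_{q+1})+\tfrac12\sum_{q=0}^{p-1}(\mathcal A^x_q|\mathcal A^x_{p-q-1})$$ for $x\in\mathcal Z'$, $0\le p\le 2n_x-1$; $$\mathcal H^0_p=\sum_{x\in\mathcal Z'}\sum_{q,s\ge0}(-1)^{q+1}\binom{q+s}{s}\frac{(\mathcal A^0_{p+s}|\mathcal A^x_q)}{x^{q+s+1}}-\sum_{q\ge0}(\mathcal A^0_{p+q}|\mathcal A^\infty_{q+1})+\tfrac12\sum_{q=0}^{p-1}(\mathcal A^0_{p-q-1}|\mathcal A^0_q)$$ if $0\in\mathcal Z$, for $0\le p\le2n_0-1$, $p\equiv1\bmod T$; and $$\mathcal H^\infty_p=-\sum_{x\in\mathcal Z'}\sum_{s\ge q\ge0}\binom sq x^{s-q}(\mathcal A^x_q|\mathcal A^\infty_{p+s+2})-\sum_{q\ge0}(\mathcal A^0_q|\mathcal A^\infty_{p+q+2})+\tfrac12\sum_{q=0}^p(\mathcal A^\infty_{q+1}|\mathcal A^\infty_{p-q+1})$$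 for $0\le p\le 2n_\infty-4$, $p+2\equiv0\bmod T$. Let $H^x_p=\pi_\ell(\mathcal H^x_p)\in\hat S_\ell$. **Claim.** The local quadratic Gaudin Hamiltonians Poisson commute: $\{H^x_p,H^y_q\}=0$ for all of the above indices. Moreover the identities $(\varrho\otimes\pi_\ell)\mathcal L(z)=\varphi(z)(\partial+\mathscr L(z))$ and $(\varrho\otimes\pi_\ell)\mathcal M^x_p(z)=\varphi^x_p(z)\partial+\varphi^x_p(z)\mathscr L(z)-\mathscr N^x_p(z)$ and the zero curvature equations $$\{H^x_p,\mathscr L(z)\}=\partial\mathscr N^x_p(z)+[\mathscr L(z),\mathscr N^x_p(z)]$$ hold for every such index $(x,p)$ and every $z\in\mathbb C$ outside the $\Pi$-orbits of the finite points of $\boldsymbol z$ with $\varphi(z)\neq0$. -/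

import Mathlib

noncomputable section

namespace DihedralGaudin

open scoped ComplexConjugate

/-- A complex Lie algebra `𝔤` with the data that defines the action of the dihedral group of
order `2T` on it: a `T`-th order linear automorphism `σ`, an antilinear involutive automorphism `τ`
with `σ τ σ = τ`, and a nondegenerate invariant symmetric bilinear form compatible with both. -/
structure DihedralData (𝔤 : Type*) [LieRing 𝔤] [LieAlgebra ℂ 𝔤] where
  T : ℕ
  T_pos : 0 < T
  ω : ℂ
  ω_primitive : IsPrimitiveRoot ω T
  σ : 𝔤 ≃ₗ[ℂ] 𝔤
  σ_lie : ∀ x y, σ ⁅x, y⁆ = ⁅σ x, σ y⁆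
  σ_pow : σ ^ T = 1
  τ : 𝔤 →ₛₗ[starRingEnd ℂ] 𝔤
  τ_lie : ∀ x y, τ ⁅x, y⁆ = ⁅τ x, τ y⁆
  τ_involutive : ∀ x, τ (τ x) = x
  dihedral : ∀ x, σ (τ (σ x)) = τ x
  form : LinearMap.BilinForm ℂ 𝔤
  form_symm : ∀ x y, form x y = form y x
  form_invariant : ∀ x y z, form ⁅x, y⁆ z = form x ⁅y, z⁆
  form_nondegenerate : form.Nondegenerate
  form_σ : ∀ x y, form (σ x) (σ y) = form x y
  form_τ : ∀ x y, form (τ x) (τ y) = conj (form x y)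

section Affine

variable {𝔤 : Type*} [LieRing 𝔤] [LieAlgebra ℂ 𝔤]

/-- The bracket `[x_m, y_n] = [x, y]_{m+n}` on Laurent polynomials `∑ₙ xₙ tⁿ` in `𝔤`. -/
def loopBracket : (ℤ →₀ 𝔤) →ₗ[ℂ] (ℤ →₀ 𝔤) →ₗ[ℂ] (ℤ →₀ 𝔤) :=
  Finsupp.lsum ℂ fun m =>
    LinearMap.flip (Finsupp.lsum ℂ fun n =>
      LinearMap.flip ((LieModule.toEnd ℂ 𝔤 𝔤 : 𝔤 →ₗ[ℂ] Module.End ℂ 𝔤).compr₂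
        (Finsupp.lsingle (m + n))))

/-- The derivation `t d/dt` of Laurent polynomials. -/
def loopDeg : (ℤ →₀ 𝔤) →ₗ[ℂ] (ℤ →₀ 𝔤) :=
  Finsupp.lsum ℂ fun n => (n : ℂ) • Finsupp.lsingle n

/-- The cocycle `(x_m, y_n) ↦ m δ_{m+n,0} ⟨x, y⟩`. -/
def loopCocycle (B : LinearMap.BilinForm ℂ 𝔤) : (ℤ →₀ 𝔤) →ₗ[ℂ] (ℤ →₀ 𝔤) →ₗ[ℂ] ℂ :=
  Finsupp.lsum ℂ fun m =>
    LinearMap.flip (Finsupp.lsum ℂ fun n =>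
      LinearMap.flip ((if m + n = 0 then (m : ℂ) else 0) • B))

@[simp] lemma loopBracket_single (m n : ℤ) (x y : 𝔤) :
    loopBracket (Finsupp.single m x) (Finsupp.single n y) = Finsupp.single (m + n) ⁅x, y⁆ := by
  simp [loopBracket]

@[simp] lemma loopDeg_single (n : ℤ) (x : 𝔤) :
    loopDeg (Finsupp.single n x) = Finsupp.single n ((n : ℂ) • x) := by
  simp [loopDeg]

@[simp] lemma loopCocycle_single (B : LinearMap.BilinForm ℂ 𝔤) (m n : ℤ) (x y : 𝔤) :
    loopCocycle B (Finsupp.single m x) (Finsupp.single n y)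
      = if m + n = 0 then (m : ℂ) * B x y else 0 := by
  simp only [loopCocycle, Finsupp.lsum_single, LinearMap.flip_apply, LinearMap.smul_apply]
  split_ifs <;> simp

lemma loopBracket_skew (f g : ℤ →₀ 𝔤) : loopBracket f g = -loopBracket g f := by
  induction f using Finsupp.induction_linear with
  | zero => simp
  | add f₁ f₂ h₁ h₂ => simp only [map_add, LinearMap.add_apply, h₁, h₂]; abel
  | single m x =>
    induction g using Finsupp.induction_linear with
    | zero => simp
    | add f₁ f₂ h₁ h₂ => simp only [map_add, LinearMap.add_apply, h₁, h₂]; abel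
    | single n y =>
      rw [loopBracket_single, loopBracket_single, ← lie_skew, add_comm n m, Finsupp.single_neg]

lemma loopBracket_self (f : ℤ →₀ 𝔤) : loopBracket f f = 0 := by
  have h := loopBracket_skew f f
  have h2 : (2 : ℂ) • loopBracket f f = 0 := by
    rw [two_smul]; nth_rewrite 1 [h]; simp
  exact (smul_eq_zero.mp h2).resolve_left two_ne_zero

lemma loopBracket_jacobi (f g h : ℤ →₀ 𝔤) :
    loopBracket f (loopBracket g h)
      = loopBracket (loopBracket f g) h + loopBracket g (loopBracket f h) := by
  induction f using Finsupp.induction_linear with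
  | zero => simp
  | add f₁ f₂ h₁ h₂ => simp only [map_add, LinearMap.add_apply, h₁, h₂]; abel
  | single m x =>
    induction g using Finsupp.induction_linear with
    | zero => simp
    | add f₁ f₂ h₁ h₂ => simp only [map_add, LinearMap.add_apply, h₁, h₂]; abel
    | single n y =>
      induction h using Finsupp.induction_linear with
      | zero => simp
      | add f₁ f₂ h₁ h₂ => simp only [map_add, h₁, h₂]; abel
      | single k z =>
        simp only [loopBracket_single]
        rw [show n + (m + k) = m + n + k by ring, show m + (n + k) = m + n + k by ring,
          ← Finsupp.single_add, ← leibniz_lie]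

lemma loopDeg_bracket (f g : ℤ →₀ 𝔤) :
    loopDeg (loopBracket f g) = loopBracket (loopDeg f) g + loopBracket f (loopDeg g) := by
  induction f using Finsupp.induction_linear with
  | zero => simp
  | add f₁ f₂ h₁ h₂ => simp only [map_add, LinearMap.add_apply, h₁, h₂]; abel
  | single m x =>
    induction g using Finsupp.induction_linear with
    | zero => simp
    | add f₁ f₂ h₁ h₂ => simp only [map_add, h₁, h₂]; abel
    | single n y =>
      simp only [loopBracket_single, loopDeg_single, smul_lie, lie_smul, ← Finsupp.single_add,
        ← add_smul, Int.cast_add]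

lemma loopCocycle_skew (d : DihedralData 𝔤) (f g : ℤ →₀ 𝔤) :
    loopCocycle d.form f g = -loopCocycle d.form g f := by
  induction f using Finsupp.induction_linear with
  | zero => simp
  | add f₁ f₂ h₁ h₂ => simp only [map_add, LinearMap.add_apply, h₁, h₂]; ring
  | single m x =>
    induction g using Finsupp.induction_linear with
    | zero => simp
    | add f₁ f₂ h₁ h₂ => simp only [map_add, LinearMap.add_apply, h₁, h₂]; ring
    | single n y =>
      rw [loopCocycle_single, loopCocycle_single, add_comm n m, d.form_symm y x]
      split_ifs with h
      · obtain rfl : n = -m := by omega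
        push_cast; ring
      · simp

lemma loopCocycle_deg (B : LinearMap.BilinForm ℂ 𝔤) (f g : ℤ →₀ 𝔤) :
    loopCocycle B (loopDeg f) g + loopCocycle B f (loopDeg g) = 0 := by
  induction f using Finsupp.induction_linear with
  | zero => simp
  | add f₁ f₂ h₁ h₂ =>
    simp only [map_add, LinearMap.add_apply]
    linear_combination h₁ + h₂
  | single m x =>
    induction g using Finsupp.induction_linear with
    | zero => simp
    | add f₁ f₂ h₁ h₂ =>
      simp only [map_add]
      linear_combination h₁ + h₂
    | single n y =>
      simp only [loopDeg_single, loopCocycle_single]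
      split_ifs with h
      · obtain rfl : n = -m := by omega
        simp
      · simp

lemma loopCocycle_jacobi (d : DihedralData 𝔤) (f g h : ℤ →₀ 𝔤) :
    loopCocycle d.form f (loopBracket g h)
      = loopCocycle d.form (loopBracket f g) h + loopCocycle d.form g (loopBracket f h) := by
  induction f using Finsupp.induction_linear with
  | zero => simp
  | add f₁ f₂ h₁ h₂ => simp only [map_add, LinearMap.add_apply, h₁, h₂]; ring
  | single m x =>
    induction g using Finsupp.induction_linear with
    | zero => simp
    | add f₁ f₂ h₁ h₂ => simp only [map_add, LinearMap.add_apply, h₁, h₂]; ring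
    | single n y =>
      induction h using Finsupp.induction_linear with
      | zero => simp
      | add f₁ f₂ h₁ h₂ => simp only [map_add, h₁, h₂]; ring
      | single k z =>
        simp only [loopBracket_single, loopCocycle_single]
        have e1 : d.form y ⁅x, z⁆ = - d.form x ⁅y, z⁆ := by
          rw [← d.form_invariant, ← d.form_invariant, ← lie_skew, map_neg, LinearMap.neg_apply]
        rw [e1, d.form_invariant, show n + (m + k) = m + n + k by ring,
          show m + (n + k) = m + n + k by ring]
        split_ifs with hh
        · push_cast; ring
        · simp

/-- The affine Kac-Moody algebra `𝔤 ⊗ ℂ[t, t⁻¹] ⊕ ℂ K ⊕ ℂ D`. -/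
@[ext] structure Affine (d : DihedralData 𝔤) where
  loop : ℤ →₀ 𝔤
  K : ℂ
  D : ℂ

namespace Affine

variable {d : DihedralData 𝔤}

/-- The underlying vector space is the direct sum. -/
def equivProd (d : DihedralData 𝔤) : Affine d ≃ (ℤ →₀ 𝔤) × ℂ × ℂ where
  toFun X := (X.loop, X.K, X.D)
  invFun X := ⟨X.1, X.2.1, X.2.2⟩
  left_inv _ := rfl
  right_inv _ := rfl

instance : AddCommGroup (Affine d) := (equivProd d).addCommGroup
instance : Module ℂ (Affine d) := (equivProd d).module ℂ

@[simp] lemma loop_add (X Y : Affine d) : (X + Y).loop = X.loop + Y.loop := rfl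
@[simp] lemma K_add (X Y : Affine d) : (X + Y).K = X.K + Y.K := rfl
@[simp] lemma D_add (X Y : Affine d) : (X + Y).D = X.D + Y.D := rfl
@[simp] lemma loop_zero : (0 : Affine d).loop = 0 := rfl
@[simp] lemma K_zero : (0 : Affine d).K = 0 := rfl
@[simp] lemma D_zero : (0 : Affine d).D = 0 := rfl
@[simp] lemma loop_smul (c : ℂ) (X : Affine d) : (c • X).loop = c • X.loop := rfl
@[simp] lemma K_smul (c : ℂ) (X : Affine d) : (c • X).K = c * X.K := rfl
@[simp] lemma D_smul (c : ℂ) (X : Affine d) : (c • X).D = c * X.D := rfl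

/-- `[x_m + αK + ξD, y_n + βK + ηD]
  = [x, y]_{m+n} + ξ n y_n - η m x_m + m δ_{m+n,0} ⟨x, y⟩ K`. -/
instance : Bracket (Affine d) (Affine d) where
  bracket X Y :=
    { loop := loopBracket X.loop Y.loop + X.D • loopDeg Y.loop - Y.D • loopDeg X.loop
      K := loopCocycle d.form X.loop Y.loop
      D := 0 }

@[simp] lemma loop_lie (X Y : Affine d) : ⁅X, Y⁆.loop
    = loopBracket X.loop Y.loop + X.D • loopDeg Y.loop - Y.D • loopDeg X.loop := rfl
@[simp] lemma K_lie (X Y : Affine d) : ⁅X, Y⁆.K = loopCocycle d.form X.loop Y.loop := rfl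
@[simp] lemma D_lie (X Y : Affine d) : ⁅X, Y⁆.D = 0 := rfl

instance : LieRing (Affine d) where
  add_lie X Y Z := by
    ext1
    · simp only [loop_lie, loop_add, map_add, LinearMap.add_apply, D_add, add_smul, smul_add]
      abel
    · simp
    · simp
  lie_add X Y Z := by
    ext1
    · simp only [loop_lie, loop_add, map_add, D_add, add_smul, smul_add]
      abel
    · simp
    · simp
  lie_self X := by
    ext1
    · simp [loopBracket_self]
    · have h := loopCocycle_skew d X.loop X.loop
      have h2 : loopCocycle d.form X.loop X.loop = 0 := by linear_combination h / 2
      simpa using h2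
    · simp
  leibniz_lie X Y Z := by
    ext1
    · simp only [loop_lie, loop_add, map_add, map_sub, LinearMap.add_apply, LinearMap.sub_apply,
        D_lie, map_smul, LinearMap.smul_apply, loopDeg_bracket,
        loopBracket_jacobi X.loop Y.loop Z.loop, smul_add, smul_sub, zero_smul, smul_comm Z.D,
        loopBracket_skew (loopDeg X.loop) Y.loop]
      simp only [smul_neg, smul_comm Y.D X.D]
      abel
    · simp only [K_lie, K_add, loop_lie, map_add, map_sub, LinearMap.add_apply,
        LinearMap.sub_apply, map_smul, LinearMap.smul_apply, smul_eq_mul]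
      have h1 := loopCocycle_jacobi d X.loop Y.loop Z.loop
      have h2 := loopCocycle_deg d.form X.loop Y.loop
      have h3 := loopCocycle_deg d.form X.loop Z.loop
      have h4 := loopCocycle_deg d.form Y.loop Z.loop
      have h5 := loopCocycle_skew d Y.loop (loopDeg X.loop)
      linear_combination h1 - X.D * h4 + Y.D * h3 - Z.D * h2 + Z.D * h5
    · simp

instance : LieAlgebra ℂ (Affine d) where
  lie_smul c X Y := by
    ext1
    · simp only [loop_lie, loop_smul, map_smul, D_smul, smul_add, smul_sub, mul_smul,
        smul_comm X.D c]
    · simp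
    · simp

/-- The element `x_n = x ⊗ tⁿ`. -/
def xt (d : DihedralData 𝔤) (n : ℤ) : 𝔤 →ₗ[ℂ] Affine d where
  toFun x := ⟨Finsupp.single n x, 0, 0⟩
  map_add' x y := by ext1 <;> simp
  map_smul' c x := by ext1 <;> simp

/-- The central element. -/
def Kel (d : DihedralData 𝔤) : Affine d := ⟨0, 1, 0⟩

/-- The derivation element. -/
def Del (d : DihedralData 𝔤) : Affine d := ⟨0, 0, 1⟩

/-- The linear projection onto the coefficient of `D`. -/
def coeffD (d : DihedralData 𝔤) : Affine d →ₗ[ℂ] ℂ where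
  toFun X := X.D
  map_add' _ _ := rfl
  map_smul' _ _ := rfl

/-- Erases the coefficient of `D`. -/
def eraseD (d : DihedralData 𝔤) : Affine d →ₗ[ℂ] Affine d where
  toFun X := ⟨X.loop, X.K, 0⟩
  map_add' X Y := by ext1 <;> simp
  map_smul' c X := by ext1 <;> simp

/-- The action of `σ` on the affine algebra: `x_n ↦ (σ x)_n`, `K ↦ K`, `D ↦ D`. -/
def sigma (d : DihedralData 𝔤) : Affine d ≃ₗ[ℂ] Affine d where
  toFun X := ⟨Finsupp.mapRange.linearEquiv d.σ X.loop, X.K, X.D⟩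
  invFun X := ⟨Finsupp.mapRange.linearEquiv d.σ.symm X.loop, X.K, X.D⟩
  map_add' X Y := by
    ext1
    · exact map_add _ _ _
    · rfl
    · rfl
  map_smul' c X := by
    ext1
    · exact map_smul _ _ _
    · rfl
    · rfl
  left_inv X := by
    ext1
    · ext n; simp
    · rfl
    · rfl
  right_inv X := by
    ext1
    · ext n; simp
    · rfl
    · rfl

/-- `F_n`: the span of the `x_m` with `m ≥ n`. -/
def filPos (d : DihedralData 𝔤) (n : ℕ) : Set (Affine d) :=
  {X | X.K = 0 ∧ X.D = 0 ∧ ∀ m : ℤ, m < n → X.loop m = 0}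

/-- The conjugate filtration: the span of the `x_m` with `m ≤ -n`. -/
def filNeg (d : DihedralData 𝔤) (n : ℕ) : Set (Affine d) :=
  {X | X.K = 0 ∧ X.D = 0 ∧ ∀ m : ℤ, -n < m → X.loop m = 0}

end Affine

end Affine

set_option linter.unusedSectionVars false

section Takiff

/-- The truncated current (Takiff) algebra `L ⊗ ℂ[ε] / εⁿ`; the family `v` stands
for `∑ₚ vₚ εᵖ`. -/
def Takiff (L : Type*) (n : ℕ) : Type _ := Fin n → L

namespace Takiff

variable {L : Type*} [LieRing L] [LieAlgebra ℂ L] {n : ℕ}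

instance : AddCommGroup (Takiff L n) := inferInstanceAs (AddCommGroup (Fin n → L))
instance : Module ℂ (Takiff L n) := inferInstanceAs (Module ℂ (Fin n → L))

@[simp] lemma add_apply (u v : Takiff L n) (p : Fin n) : (u + v) p = u p + v p := rfl
@[simp] lemma zero_apply (p : Fin n) : (0 : Takiff L n) p = 0 := rfl
@[simp] lemma smul_apply (c : ℂ) (u : Takiff L n) (p : Fin n) : (c • u) p = c • u p := rfl
@[ext] lemma ext {u v : Takiff L n} (h : ∀ p, u p = v p) : u = v := funext h

/-- `[x εⁱ, y εʲ] = [x, y] εⁱ⁺ʲ`. -/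
instance : Bracket (Takiff L n) (Takiff L n) where
  bracket u v := fun k => ∑ i : Fin n, ∑ j : Fin n, if (i : ℕ) + j = k then ⁅u i, v j⁆ else 0

lemma lie_apply (u v : Takiff L n) (k : Fin n) :
    ⁅u, v⁆ k = ∑ i : Fin n, ∑ j : Fin n, if (i : ℕ) + j = k then ⁅u i, v j⁆ else 0 := rfl

lemma sum_collapse (i s : ℕ) (k : Fin n) (t : L) :
    (∑ a : Fin n, if i + (a : ℕ) = k then (if s = a then t else 0) else 0)
      = if i + s = k then t else 0 := by
  by_cases h : i + s = k
  · have hs : s < n := by have := k.2; omega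
    rw [if_pos h, Finset.sum_eq_single (⟨s, hs⟩ : Fin n)]
    · simp [h]
    · intro b _ hb
      rw [if_neg (c := s = (b : ℕ))]
      · simp
      · intro e; exact hb (Fin.ext e.symm)
    · simp
  · rw [if_neg h]
    refine Finset.sum_eq_zero fun a _ => ?_
    split_ifs with h1 h2
    · exact absurd (h2 ▸ h1) h
    · rfl
    · rfl

lemma lie_lie_right (u v w : Takiff L n) (k : Fin n) :
    ⁅u, ⁅v, w⁆⁆ k = ∑ i : Fin n, ∑ j : Fin n, ∑ l : Fin n,
      if (i : ℕ) + (j + l) = k then ⁅u i, ⁅v j, w l⁆⁆ else 0 := by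
  rw [lie_apply]
  refine Finset.sum_congr rfl fun i _ => ?_
  simp only [lie_apply, lie_sum]
  have e : ∀ a : Fin n, (if (i : ℕ) + a = k then ∑ j : Fin n, ∑ l : Fin n,
      ⁅u i, if (j : ℕ) + l = a then ⁅v j, w l⁆ else 0⁆ else 0)
      = ∑ j : Fin n, ∑ l : Fin n, if (i : ℕ) + a = k then
        (if (j : ℕ) + l = a then ⁅u i, ⁅v j, w l⁆⁆ else 0) else 0 := by
    intro a
    split_ifs
    · refine Finset.sum_congr rfl fun j _ => Finset.sum_congr rfl fun l _ => ?_
      split_ifs <;> simp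
    · simp
  simp only [e]
  rw [Finset.sum_comm]
  refine Finset.sum_congr rfl fun j _ => ?_
  rw [Finset.sum_comm]
  exact Finset.sum_congr rfl fun l _ => sum_collapse _ _ _ _

lemma lie_skew_apply (u v : Takiff L n) : ⁅u, v⁆ = -⁅v, u⁆ := by
  ext k
  change _ = - (⁅v, u⁆ k)
  rw [lie_apply, lie_apply, Finset.sum_comm, ← Finset.sum_neg_distrib]
  refine Finset.sum_congr rfl fun i _ => ?_
  rw [← Finset.sum_neg_distrib]
  refine Finset.sum_congr rfl fun j _ => ?_
  rw [add_comm (j : ℕ) i]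
  split_ifs
  · exact (lie_skew _ _).symm
  · simp

instance : LieRing (Takiff L n) where
  add_lie u v w := by
    ext k
    simp only [lie_apply, add_apply, ← Finset.sum_add_distrib]
    refine Finset.sum_congr rfl fun i _ => Finset.sum_congr rfl fun j _ => ?_
    split_ifs <;> simp
  lie_add u v w := by
    ext k
    simp only [lie_apply, add_apply, ← Finset.sum_add_distrib]
    refine Finset.sum_congr rfl fun i _ => Finset.sum_congr rfl fun j _ => ?_
    split_ifs <;> simp
  lie_self u := by
    have h := lie_skew_apply u u
    have h2 : (2 : ℂ) • ⁅u, u⁆ = 0 := by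
      rw [two_smul]; nth_rewrite 1 [h]; simp
    exact (smul_eq_zero.mp h2).resolve_left two_ne_zero
  leibniz_lie u v w := by
    ext k
    have h1 := lie_lie_right u v w k
    have h2 := lie_lie_right v u w k
    have h3 := lie_lie_right w u v k
    have h4 : ⁅⁅u, v⁆, w⁆ k = - ⁅w, ⁅u, v⁆⁆ k := by
      rw [lie_skew_apply]; rfl
    rw [add_apply, h4, h1, h2, h3]
    have h5 : (∑ i : Fin n, ∑ j : Fin n, ∑ l : Fin n,
        if (i : ℕ) + (j + l) = k then ⁅v i, ⁅u j, w l⁆⁆ else 0)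
        = ∑ i : Fin n, ∑ j : Fin n, ∑ l : Fin n,
          if (i : ℕ) + (j + l) = k then ⁅v j, ⁅u i, w l⁆⁆ else 0 := by
      rw [Finset.sum_comm]
      refine Finset.sum_congr rfl fun i _ => Finset.sum_congr rfl fun j _ =>
        Finset.sum_congr rfl fun l _ => ?_
      rw [show (j : ℕ) + (i + l) = i + (j + l) by ring]
    have h6 : (∑ i : Fin n, ∑ j : Fin n, ∑ l : Fin n,
        if (i : ℕ) + (j + l) = k then ⁅w i, ⁅u j, v l⁆⁆ else 0)
        = ∑ i : Fin n, ∑ j : Fin n, ∑ l : Fin n,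
          if (i : ℕ) + (j + l) = k then ⁅w l, ⁅u i, v j⁆⁆ else 0 := by
      rw [Finset.sum_comm]
      refine Finset.sum_congr rfl fun i _ => ?_
      rw [Finset.sum_comm]
      refine Finset.sum_congr rfl fun j _ => Finset.sum_congr rfl fun l _ => ?_
      rw [show (l : ℕ) + (i + j) = i + (j + l) by ring]
    rw [h5, h6]
    simp only [← Finset.sum_neg_distrib, ← Finset.sum_add_distrib]
    refine Finset.sum_congr rfl fun i _ => Finset.sum_congr rfl fun j _ =>
        Finset.sum_congr rfl fun l _ => ?_
    split_ifs
    · rw [leibniz_lie, ← lie_skew (w l), neg_neg]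
    · simp

instance : LieAlgebra ℂ (Takiff L n) where
  lie_smul c u v := by
    ext k
    simp only [lie_apply, smul_apply, Finset.smul_sum]
    refine Finset.sum_congr rfl fun i _ => Finset.sum_congr rfl fun j _ => ?_
    split_ifs <;> simp

end Takiff

end Takiff

section Divisor

variable {𝔤 : Type*} [LieRing 𝔤] [LieAlgebra ℂ 𝔤]

open scoped OnePoint

/-- A point of `ℂ` is real if it lies on one of the lines fixed by a reflection `z ↦ ωᵏ z̄`
of the dihedral group; otherwise its stabiliser in the dihedral group is trivial, unless it is `0`
(which is also real in this sense). -/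
def IsRealPoint (d : DihedralData 𝔤) (x : ℂ) : Prop := ∃ k : ℕ, x = d.ω ^ k * conj x

/-- The divisor `∑ₓ nₓ x + n_∞ ∞`, with support `z ∪ {∞}` consisting of points of the Riemann
sphere in pairwise distinct orbits of the dihedral group generated by `z ↦ ω z` and `z ↦ z̄`. -/
structure PoleDivisor (d : DihedralData 𝔤) where
  mult : ℂ →₀ ℕ
  multInf : ℕ
  multInf_pos : 1 ≤ multInf
  disjoint_orbits : ∀ x y : ℂ, mult x ≠ 0 → mult y ≠ 0 → x ≠ y →
    ∀ k : ℕ, y ≠ d.ω ^ k * x ∧ y ≠ d.ω ^ k * conj x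
  degree : mult ≠ 0 ∨ 2 ≤ multInf

namespace PoleDivisor

variable {d : DihedralData 𝔤} (P : PoleDivisor d)

open Classical in
/-- The multiplicity `nₓ`, extended to the conjugates of the complex points by `n_{x̄} = nₓ`, and
by zero to all other points of the Riemann sphere. -/
def n (x : OnePoint ℂ) : ℕ :=
  x.elim P.multInf fun x =>
    if IsRealPoint d x ∨ P.mult x ≠ 0 then P.mult x else P.mult (conj x)

open Classical in
/-- The set `𝒵'`: the poles other than `0` and `∞`, including the conjugates of complex poles. -/
def Z' : Finset ℂ :=
  (P.mult.support ∪ P.mult.support.image (starRingEnd ℂ)).filter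
    fun x => x ≠ 0 ∧ P.n x ≠ 0

end PoleDivisor

/-- The levels `ℓˣₚ`. -/
structure Levels (d : DihedralData 𝔤) (P : PoleDivisor d) where
  ℓ : OnePoint ℂ → ℕ → ℂ
  zero_of_le : ∀ x p, P.n x ≤ p → ℓ x p = 0
  inf_zero : ℓ ∞ 0 = 0
  zero_origin : ∀ p, ¬ d.T ∣ p → ℓ (0 : ℂ) p = 0
  zero_infty : ∀ p, ¬ d.T ∣ p → ℓ ∞ p = 0
  top_ne_zero : ∀ x : ℂ, P.n x ≠ 0 → ℓ x (P.n x - 1) ≠ 0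
  top_ne_zero_infty : 2 ≤ P.n ∞ → ℓ ∞ (P.n ∞ - 1) ≠ 0
  conj_complex : ∀ (x : ℂ) (p : ℕ), ¬ IsRealPoint d x →
    conj (ℓ x p) = ℓ (conj x : ℂ) p
  conj_real : ∀ (x : ℂ) (k p : ℕ), x ≠ 0 → x = d.ω ^ k * conj x →
    conj (ℓ x p) = d.ω ^ (-((k * p : ℕ) : ℤ)) * ℓ x p
  conj_origin : ∀ p, conj (ℓ (0 : ℂ) p) = ℓ (0 : ℂ) p
  conj_infty : ∀ p, conj (ℓ ∞ p) = ℓ ∞ p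

end Divisor

section TakiffD

variable {𝔤 : Type*} [LieRing 𝔤] [LieAlgebra ℂ 𝔤] {d : DihedralData 𝔤}

open scoped OnePoint

lemma loopBracket_mapRange (f g : ℤ →₀ 𝔤) :
    Finsupp.mapRange.linearEquiv d.σ (loopBracket f g)
      = loopBracket (Finsupp.mapRange.linearEquiv d.σ f) (Finsupp.mapRange.linearEquiv d.σ g) := by
  induction f using Finsupp.induction_linear with
  | zero => simp
  | add f₁ f₂ h₁ h₂ =>
    simp only [map_add, LinearMap.add_apply] at h₁ h₂ ⊢
    rw [h₁, h₂]
  | single m x =>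
    induction g using Finsupp.induction_linear with
    | zero => simp
    | add f₁ f₂ h₁ h₂ =>
      simp only [map_add] at h₁ h₂ ⊢
      rw [h₁, h₂]
    | single n y => simp [d.σ_lie]

lemma loopDeg_mapRange (f : ℤ →₀ 𝔤) :
    Finsupp.mapRange.linearEquiv d.σ (loopDeg f)
      = loopDeg (Finsupp.mapRange.linearEquiv d.σ f) := by
  induction f using Finsupp.induction_linear with
  | zero => simp
  | add f₁ f₂ h₁ h₂ =>
    simp only [map_add] at h₁ h₂ ⊢
    rw [h₁, h₂]
  | single m x => simp

lemma loopCocycle_mapRange (f g : ℤ →₀ 𝔤) :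
    loopCocycle d.form (Finsupp.mapRange.linearEquiv d.σ f) (Finsupp.mapRange.linearEquiv d.σ g)
      = loopCocycle d.form f g := by
  induction f using Finsupp.induction_linear with
  | zero => simp
  | add f₁ f₂ h₁ h₂ =>
    simp only [map_add, LinearMap.add_apply] at h₁ h₂ ⊢
    rw [h₁, h₂]
  | single m x =>
    induction g using Finsupp.induction_linear with
    | zero => simp
    | add f₁ f₂ h₁ h₂ =>
      simp only [map_add] at h₁ h₂ ⊢
      rw [h₁, h₂]
    | single n y => simp [d.form_σ]

lemma Affine.sigma_lie (X Y : Affine d) :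
    Affine.sigma d ⁅X, Y⁆ = ⁅Affine.sigma d X, Affine.sigma d Y⁆ := by
  ext1
  · change Finsupp.mapRange.linearEquiv d.σ (_ + _ - _) = _ + _ - _
    rw [map_sub, map_add, loopBracket_mapRange, map_smul, map_smul, loopDeg_mapRange,
      loopDeg_mapRange]
    rfl
  · exact (loopCocycle_mapRange _ _).symm
  · rfl

namespace Affine

/-- The projection `T⁻¹ ∑ₖ ω^{-jk} σᵏ` onto the eigenspace of `σ` with eigenvalue `ωʲ`. -/
def eigenproj (d : DihedralData 𝔤) (j : ℤ) : Affine d →ₗ[ℂ] Affine d :=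
  (d.T : ℂ)⁻¹ • ∑ k ∈ Finset.range d.T,
    d.ω ^ (-(j * k)) • (((sigma d) ^ k : Affine d ≃ₗ[ℂ] Affine d) : Affine d →ₗ[ℂ] Affine d)

lemma sigma_pow_T : (sigma d) ^ d.T = 1 := by
  have h : ∀ (k : ℕ) (X : Affine d), ((sigma d) ^ k) X
      = ⟨Finsupp.mapRange.linearEquiv (d.σ ^ k) X.loop, X.K, X.D⟩ := by
    intro k
    induction k with
    | zero => intro X; ext1 <;> simp
    | succ k ih =>
      intro X
      rw [pow_succ', LinearEquiv.mul_apply, ih]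
      ext1
      · ext n
        simp [sigma, pow_succ']
      · rfl
      · rfl
  ext1 X
  rw [h, d.σ_pow]
  ext1 <;> simp

lemma sigma_eigenproj (j : ℤ) (X : Affine d) :
    sigma d (eigenproj d j X) = d.ω ^ j • eigenproj d j X := by
  have hω : d.ω ≠ 0 := d.ω_primitive.ne_zero d.T_pos.ne'
  have hT : d.ω ^ (d.T : ℤ) = 1 := by rw [zpow_natCast]; exact d.ω_primitive.pow_eq_one
  simp only [eigenproj, LinearMap.smul_apply, LinearMap.sum_apply, LinearEquiv.coe_coe, map_smul,
    map_sum]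
  rw [smul_comm (d.ω ^ j)]
  congr 1
  rw [Finset.smul_sum]
  have e : ∀ k : ℕ, d.ω ^ (-(j * k)) • sigma d (((sigma d) ^ k) X)
      = d.ω ^ j • d.ω ^ (-(j * ((k + 1 : ℕ) : ℤ))) • ((sigma d) ^ (k + 1)) X := by
    intro k
    rw [pow_succ', LinearEquiv.mul_apply, smul_smul, ← zpow_add₀ hω]
    congr 2
    push_cast; ring
  simp only [e]
  have h := Finset.sum_range_succ' (fun k : ℕ => d.ω ^ j • d.ω ^ (-(j * (k : ℤ))) •
    ((sigma d) ^ k) X) d.T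
  rw [Finset.sum_range_succ] at h
  have e2 : d.ω ^ (-(j * (d.T : ℤ))) = 1 := by
    rw [← mul_neg, mul_comm, zpow_mul, zpow_neg, hT]; simp
  rw [sigma_pow_T, e2] at h
  simp only [Nat.cast_zero, mul_zero, neg_zero, zpow_zero, pow_zero] at h
  exact (add_right_cancel h).symm

end Affine

variable (P : PoleDivisor d)

/-- The direct sum of the Takiff algebras at all points of the Riemann sphere (it is zero at
points that are not poles). -/
def TakiffSum : Type _ := ∀ x : OnePoint ℂ, Takiff (Affine d) (P.n x)

namespace TakiffSum

variable {P}

instance : AddCommGroup (TakiffSum P) :=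
  inferInstanceAs (AddCommGroup (∀ x : OnePoint ℂ, Takiff (Affine d) (P.n x)))
instance : Module ℂ (TakiffSum P) :=
  inferInstanceAs (Module ℂ (∀ x : OnePoint ℂ, Takiff (Affine d) (P.n x)))
instance : Bracket (TakiffSum P) (TakiffSum P) where
  bracket u v := fun x => ⁅u x, v x⁆

@[simp] lemma add_apply (u v : TakiffSum P) (x : OnePoint ℂ) (p : Fin (P.n x)) :
    (u + v) x p = u x p + v x p := rfl
@[simp] lemma zero_apply (x : OnePoint ℂ) (p : Fin (P.n x)) : (0 : TakiffSum P) x p = 0 := rfl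
@[simp] lemma smul_apply (c : ℂ) (u : TakiffSum P) (x : OnePoint ℂ) (p : Fin (P.n x)) :
    (c • u) x p = c • u x p := rfl
lemma lie_apply (u v : TakiffSum P) (x : OnePoint ℂ) (k : Fin (P.n x)) :
    ⁅u, v⁆ x k = ∑ i : Fin (P.n x), ∑ j : Fin (P.n x),
      if (i : ℕ) + j = k then ⁅u x i, v x j⁆ else 0 := rfl
@[ext] lemma ext {u v : TakiffSum P} (h : ∀ x p, u x p = v x p) : u = v :=
  funext fun x => funext (h x)

instance : LieRing (TakiffSum P) where
  add_lie u v w := funext fun x => add_lie (u x) (v x) (w x)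
  lie_add u v w := funext fun x => lie_add (u x) (v x) (w x)
  lie_self u := funext fun x => lie_self (u x)
  leibniz_lie u v w := funext fun x => leibniz_lie (u x) (v x) (w x)

instance : LieAlgebra ℂ (TakiffSum P) where
  lie_smul c u v := funext fun x => lie_smul c (u x) (v x)

end TakiffSum

/-- The complex Lie algebra `g̃ᴰ`: the direct sum of the Takiff algebras
`g̃ ⊗ ℂ[ε] / ε^{nₓ}` over all `x ∈ 𝒵'`, and of the subalgebras of `σ`-equivariant elements of
`g̃ ⊗ ℂ[ε] / ε^{n₀}` (the coefficient of `εᵖ` is in the `ωᵖ`-eigenspace) at the origin and of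
`g̃ ⊗ ε ℂ[ε] / ε^{n_∞}` (the coefficient of `εᵖ` is in the `ω⁻ᵖ`-eigenspace) at infinity. -/
def gD : LieSubalgebra ℂ (TakiffSum P) where
  carrier := {v | (∀ p : Fin (P.n (0 : ℂ)),
      Affine.sigma d (v (0 : ℂ) p) = d.ω ^ ((p : ℕ) : ℤ) • v (0 : ℂ) p) ∧
    (∀ p : Fin (P.n ∞), Affine.sigma d (v ∞ p) = d.ω ^ (-((p : ℕ) : ℤ)) • v ∞ p) ∧
    ∀ p : Fin (P.n ∞), (p : ℕ) = 0 → v ∞ p = 0}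
  add_mem' {u v} hu hv := by
    refine ⟨fun p => ?_, fun p => ?_, fun p hp => ?_⟩
    · rw [TakiffSum.add_apply, map_add, smul_add, hu.1, hv.1]
    · rw [TakiffSum.add_apply, map_add, smul_add, hu.2.1, hv.2.1]
    · rw [TakiffSum.add_apply, hu.2.2 p hp, hv.2.2 p hp, add_zero]
  zero_mem' := by
    refine ⟨fun p => ?_, fun p => ?_, fun p hp => ?_⟩ <;> simp
  smul_mem' c u hu := by
    refine ⟨fun p => ?_, fun p => ?_, fun p hp => ?_⟩
    · rw [TakiffSum.smul_apply, map_smul, smul_comm, hu.1]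
    · rw [TakiffSum.smul_apply, map_smul, smul_comm, hu.2.1]
    · rw [TakiffSum.smul_apply, hu.2.2 p hp, smul_zero]
  lie_mem' {u v} hu hv := by
    have hω : d.ω ≠ 0 := d.ω_primitive.ne_zero d.T_pos.ne'
    refine ⟨fun p => ?_, fun p => ?_, fun p hp => ?_⟩
    · rw [TakiffSum.lie_apply]
      simp only [map_sum, Finset.smul_sum]
      refine Finset.sum_congr rfl fun i _ => Finset.sum_congr rfl fun j _ => ?_
      split_ifs with h
      · rw [Affine.sigma_lie, hu.1, hv.1, smul_lie, lie_smul, smul_smul, ← zpow_add₀ hω, ← h]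
        push_cast; rfl
      · simp
    · rw [TakiffSum.lie_apply]
      simp only [map_sum, Finset.smul_sum]
      refine Finset.sum_congr rfl fun i _ => Finset.sum_congr rfl fun j _ => ?_
      split_ifs with h
      · rw [Affine.sigma_lie, hu.2.1, hv.2.1, smul_lie, lie_smul, smul_smul, ← zpow_add₀ hω, ← h]
        congr 2
        push_cast; ring
      · simp
    · rw [TakiffSum.lie_apply]
      refine Finset.sum_eq_zero fun i _ => Finset.sum_eq_zero fun j _ => ?_
      split_ifs with h
      · rw [hu.2.2 i (by omega), zero_lie]
      · rfl

/-- The projection of `g̃` onto the space allowed as coefficient of `εᵖ` at the point `x`. -/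
def pointProj (d : DihedralData 𝔤) (x : OnePoint ℂ) (p : ℕ) : Affine d →ₗ[ℂ] Affine d :=
  x.elim (if p = 0 then 0 else Affine.eigenproj d (-(p : ℤ)))
    fun x => if x = 0 then Affine.eigenproj d p else LinearMap.id

open Classical in
/-- `X ↦ X_p^{(x)}`, the element of `g̃ᴰ` given by `X εᵖ` at the point `x`, projected to the
invariant part if `x` is `0` or `∞`. It is zero if `p ≥ nₓ`, and if `x = ∞`, `p = 0`. -/
def emb (x : OnePoint ℂ) (p : ℕ) : Affine d →ₗ[ℂ] gD P where
  toFun X := ⟨fun y q => if y = x ∧ (q : ℕ) = p then pointProj d x p X else 0, by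
    refine ⟨fun q => ?_, fun q => ?_, fun q hq => ?_⟩
    · dsimp only
      split_ifs with h
      · obtain ⟨rfl, rfl⟩ := h
        simp [pointProj, Affine.sigma_eigenproj]
      · simp
    · dsimp only
      split_ifs with h
      · obtain ⟨rfl, rfl⟩ := h
        rcases Nat.eq_zero_or_pos (q : ℕ) with h0 | h0
        · simp [pointProj, h0]
        · simp [pointProj, Affine.sigma_eigenproj, h0.ne']
      · simp
    · dsimp only
      split_ifs with h
      · obtain ⟨rfl, rfl⟩ := h
        simp [pointProj, hq]
      · rfl⟩
  map_add' X Y := by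
    refine Subtype.ext (TakiffSum.ext fun y q => ?_)
    refine Eq.trans ?_ (TakiffSum.add_apply _ _ _ _).symm
    dsimp only
    split_ifs <;> simp
  map_smul' c X := by
    refine Subtype.ext (TakiffSum.ext fun y q => ?_)
    refine Eq.trans ?_ (TakiffSum.smul_apply _ _ _ _).symm
    dsimp only
    split_ifs <;> simp

/-- The Lie subalgebra `ĝᴰ` of `g̃ᴰ`, spanned by the elements with no component along `D`. -/
def hatD : LieSubalgebra ℂ (gD P) where
  carrier := {v | ∀ x p, (v.1 x p).D = 0}
  add_mem' {u v} hu hv x p := by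
    change (u.1 x p + v.1 x p).D = 0
    rw [Affine.D_add, hu, hv, add_zero]
  zero_mem' x p := rfl
  smul_mem' c u hu x p := by
    change (c • u.1 x p).D = 0
    rw [Affine.D_smul, hu, mul_zero]
  lie_mem' {u v} _ _ x p := by
    change (⁅u.1, v.1⁆ x p).D = 0
    rw [TakiffSum.lie_apply]
    change Affine.coeffD d _ = 0
    simp only [map_sum]
    refine Finset.sum_eq_zero fun i _ => Finset.sum_eq_zero fun j _ => ?_
    split_ifs
    · rfl
    · simp

/-- The linear projection of `g̃ᴰ` onto `ĝᴰ` that erases the components along `D`. -/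
def hatPart : gD P →ₗ[ℂ] hatD P where
  toFun v := ⟨⟨fun x p => Affine.eraseD d (v.1 x p), by
    have e : ∀ X : Affine d, Affine.sigma d (Affine.eraseD d X)
        = Affine.eraseD d (Affine.sigma d X) := fun X => rfl
    refine ⟨fun p => ?_, fun p => ?_, fun p hp => ?_⟩
    · dsimp only
      rw [e, v.2.1, map_smul]
    · dsimp only
      rw [e, v.2.2.1, map_smul]
    · dsimp only
      rw [v.2.2.2 p hp, map_zero]⟩, fun _ _ => rfl⟩
  map_add' u v := by
    refine Subtype.ext (Subtype.ext (TakiffSum.ext fun y q => ?_))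
    exact map_add (Affine.eraseD d) (u.1 y q) (v.1 y q)
  map_smul' c u := by
    refine Subtype.ext (Subtype.ext (TakiffSum.ext fun y q => ?_))
    exact map_smul (Affine.eraseD d) c (u.1 y q)

end TakiffD

section Poisson

variable {M : Type*} [AddCommGroup M] [Module ℂ M]

/-- The unique derivation of the symmetric algebra that extends the linear map `φ`, obtained from
the algebra morphism `m ↦ m + φ(m) ε` into `S ⊕ S ε` with `ε² = 0`. -/
def symDer (φ : M →ₗ[ℂ] SymmetricAlgebra ℂ M) :
    SymmetricAlgebra ℂ M →ₗ[ℂ] SymmetricAlgebra ℂ M :=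
  (TrivSqZeroExt.sndHom (SymmetricAlgebra ℂ M) (SymmetricAlgebra ℂ M)).restrictScalars ℂ ∘ₗ
    (SymmetricAlgebra.lift
      (((TrivSqZeroExt.inlAlgHom ℂ (SymmetricAlgebra ℂ M) (SymmetricAlgebra ℂ M)).toLinearMap ∘ₗ
          SymmetricAlgebra.ι ℂ M) +
        ((TrivSqZeroExt.inrHom (SymmetricAlgebra ℂ M) (SymmetricAlgebra ℂ M)).restrictScalars ℂ ∘ₗ
          φ))).toLinearMap

lemma symDer_fst (φ : M →ₗ[ℂ] SymmetricAlgebra ℂ M) (f : SymmetricAlgebra ℂ M) :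
    (SymmetricAlgebra.lift
      (((TrivSqZeroExt.inlAlgHom ℂ (SymmetricAlgebra ℂ M) (SymmetricAlgebra ℂ M)).toLinearMap ∘ₗ
          SymmetricAlgebra.ι ℂ M) +
        ((TrivSqZeroExt.inrHom (SymmetricAlgebra ℂ M) (SymmetricAlgebra ℂ M)).restrictScalars ℂ ∘ₗ
          φ)) f).fst = f := by
  induction f using SymmetricAlgebra.induction with
  | algebraMap r => rw [AlgHom.commutes]; rfl
  | ι x => simp
  | mul a b ha hb => rw [map_mul, TrivSqZeroExt.fst_mul, ha, hb]
  | add a b ha hb => rw [map_add, TrivSqZeroExt.fst_add, ha, hb]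

@[simp] lemma symDer_ι (φ : M →ₗ[ℂ] SymmetricAlgebra ℂ M) (x : M) :
    symDer φ (SymmetricAlgebra.ι ℂ M x) = φ x := by
  simp [symDer]

lemma symDer_mul (φ : M →ₗ[ℂ] SymmetricAlgebra ℂ M) (f g : SymmetricAlgebra ℂ M) :
    symDer φ (f * g) = f * symDer φ g + g * symDer φ f := by
  simp only [symDer, LinearMap.comp_apply, AlgHom.toLinearMap_apply, map_mul,
    LinearMap.restrictScalars_apply, TrivSqZeroExt.sndHom_apply, TrivSqZeroExt.snd_mul, symDer_fst]
  simp [mul_comm]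

lemma symDer_algebraMap (φ : M →ₗ[ℂ] SymmetricAlgebra ℂ M) (r : ℂ) :
    symDer φ (algebraMap ℂ _ r) = 0 := by
  simp only [symDer, LinearMap.comp_apply, AlgHom.toLinearMap_apply, AlgHom.commutes]
  rfl

lemma symDer_add (φ ψ : M →ₗ[ℂ] SymmetricAlgebra ℂ M) (f : SymmetricAlgebra ℂ M) :
    symDer (φ + ψ) f = symDer φ f + symDer ψ f := by
  induction f using SymmetricAlgebra.induction with
  | algebraMap r => simp [symDer_algebraMap]
  | ι x => simp
  | mul a b ha hb => simp only [symDer_mul, ha, hb]; ring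
  | add a b ha hb => simp only [map_add, ha, hb]; ring

lemma symDer_smul (c : ℂ) (φ : M →ₗ[ℂ] SymmetricAlgebra ℂ M) (f : SymmetricAlgebra ℂ M) :
    symDer (c • φ) f = c • symDer φ f := by
  induction f using SymmetricAlgebra.induction with
  | algebraMap r => simp [symDer_algebraMap]
  | ι x => simp
  | mul a b ha hb => simp only [symDer_mul, ha, hb, smul_add, mul_smul_comm]
  | add a b ha hb => simp only [map_add, ha, hb, smul_add]

lemma symDer_mem (φ : M →ₗ[ℂ] SymmetricAlgebra ℂ M) (J : Ideal (SymmetricAlgebra ℂ M))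
    (h : ∀ x, φ x ∈ J) (f : SymmetricAlgebra ℂ M) : symDer φ f ∈ J := by
  induction f using SymmetricAlgebra.induction with
  | algebraMap r => simp [symDer_algebraMap]
  | ι x => simpa using h x
  | mul a b ha hb =>
    rw [symDer_mul]
    exact J.add_mem (J.mul_mem_left _ hb) (J.mul_mem_left _ ha)
  | add a b ha hb => rw [map_add]; exact J.add_mem ha hb

end Poisson

section PoissonLie

variable {M : Type*} [LieRing M] [LieAlgebra ℂ M]

/-- The action of a Lie algebra on its symmetric algebra by derivations, extending the adjoint
action: `x ↦ {x, ·}`. -/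
def symAd : M →ₗ[ℂ] SymmetricAlgebra ℂ M →ₗ[ℂ] SymmetricAlgebra ℂ M where
  toFun x := symDer (SymmetricAlgebra.ι ℂ M ∘ₗ (LieAlgebra.ad ℂ M x))
  map_add' x y := by
    ext f
    rw [LinearMap.add_apply, ← symDer_add, map_add, LinearMap.comp_add]
  map_smul' c x := by
    ext f
    rw [LinearMap.smul_apply, ← symDer_smul, map_smul, LinearMap.comp_smul, RingHom.id_apply]

/-- The Poisson bracket on the symmetric algebra of a Lie algebra: the unique biderivation
with `{x, y} = [x, y]` for `x`, `y` in the Lie algebra. -/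
def poisson (f g : SymmetricAlgebra ℂ M) : SymmetricAlgebra ℂ M :=
  symDer ((symAd (M := M)).flip g) f

lemma poisson_ι_ι (x y : M) :
    poisson (SymmetricAlgebra.ι ℂ M x) (SymmetricAlgebra.ι ℂ M y)
      = SymmetricAlgebra.ι ℂ M ⁅x, y⁆ := by
  simp [poisson, symAd]

lemma poisson_mul_left (f g h : SymmetricAlgebra ℂ M) :
    poisson (f * g) h = f * poisson g h + g * poisson f h := symDer_mul _ _ _

lemma poisson_add_left (f g h : SymmetricAlgebra ℂ M) :
    poisson (f + g) h = poisson f h + poisson g h := map_add _ _ _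

lemma poisson_add_right (f g h : SymmetricAlgebra ℂ M) :
    poisson f (g + h) = poisson f g + poisson f h := by
  rw [poisson, map_add, symDer_add]; rfl

lemma poisson_mul_right (f g h : SymmetricAlgebra ℂ M) :
    poisson f (g * h) = g * poisson f h + h * poisson f g := by
  induction f using SymmetricAlgebra.induction with
  | algebraMap r => simp [poisson, symDer_algebraMap]
  | ι x => simp only [poisson, symDer_ι, LinearMap.flip_apply]; exact symDer_mul _ _ _
  | mul a b ha hb => simp only [poisson_mul_left, ha, hb]; ring
  | add a b ha hb => simp only [poisson_add_left, ha, hb]; ring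

lemma poisson_algebraMap_left (r : ℂ) (g : SymmetricAlgebra ℂ M) :
    poisson (algebraMap ℂ _ r) g = 0 := symDer_algebraMap _ _

lemma poisson_algebraMap_right (r : ℂ) (g : SymmetricAlgebra ℂ M) :
    poisson g (algebraMap ℂ _ r) = 0 := by
  induction g using SymmetricAlgebra.induction with
  | algebraMap r => simp [poisson_algebraMap_left]
  | ι x => simp only [poisson, symDer_ι, LinearMap.flip_apply]; exact symDer_algebraMap _ _
  | mul a b ha hb => simp [poisson_mul_left, ha, hb]
  | add a b ha hb => simp [poisson_add_left, ha, hb]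

lemma poisson_skew (f g : SymmetricAlgebra ℂ M) : poisson f g = -poisson g f := by
  induction f using SymmetricAlgebra.induction with
  | algebraMap r => simp [poisson_algebraMap_left, poisson_algebraMap_right]
  | ι x =>
    induction g using SymmetricAlgebra.induction with
    | algebraMap r => simp [poisson_algebraMap_left, poisson_algebraMap_right]
    | ι y => rw [poisson_ι_ι, poisson_ι_ι, ← lie_skew, map_neg]
    | mul a b ha hb => rw [poisson_mul_left, poisson_mul_right, ha, hb]; ring
    | add a b ha hb => rw [poisson_add_left, poisson_add_right, ha, hb]; ring
  | mul a b ha hb => rw [poisson_mul_left, poisson_mul_right, ha, hb]; ring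
  | add a b ha hb => rw [poisson_add_left, poisson_add_right, ha, hb]; ring

/-- An ideal generated by elements `x - c` with `x` central is a Poisson ideal. -/
lemma poisson_mem_span {s : Set (SymmetricAlgebra ℂ M)}
    (hs : ∀ a ∈ s, ∃ (x : M) (c : ℂ), (∀ y : M, ⁅y, x⁆ = 0) ∧
      a = SymmetricAlgebra.ι ℂ M x - algebraMap ℂ _ c)
    (f g : SymmetricAlgebra ℂ M) (hg : g ∈ Ideal.span s) : poisson f g ∈ Ideal.span s := by
  induction hg using Submodule.span_induction with
  | mem a ha =>
    obtain ⟨x, c, hx, rfl⟩ := hs a ha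
    have h0 : poisson f (SymmetricAlgebra.ι ℂ M x) = 0 := by
      induction f using SymmetricAlgebra.induction with
      | algebraMap r => exact poisson_algebraMap_left _ _
      | ι y => rw [poisson_ι_ι, hx, map_zero]
      | mul a b ha hb => rw [poisson_mul_left, ha, hb]; simp
      | add a b ha hb => rw [poisson_add_left, ha, hb, add_zero]
    have h1 : SymmetricAlgebra.ι ℂ M x - algebraMap ℂ (SymmetricAlgebra ℂ M) c
        = SymmetricAlgebra.ι ℂ M x + algebraMap ℂ (SymmetricAlgebra ℂ M) (-c) := by
      rw [map_neg, sub_eq_add_neg]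
    rw [h1, poisson_add_right, h0, poisson_algebraMap_right, add_zero]
    exact Submodule.zero_mem _
  | zero =>
    have h : poisson f 0 = 0 := by
      rw [← map_zero (algebraMap ℂ (SymmetricAlgebra ℂ M)), poisson_algebraMap_right, map_zero]
    rw [h]
    exact Submodule.zero_mem _
  | add a b ha hb iha ihb => rw [poisson_add_right]; exact Submodule.add_mem _ iha ihb
  | smul c a ha iha =>
    rw [smul_eq_mul, poisson_mul_right]
    exact Ideal.add_mem _ (Ideal.mul_mem_left _ _ iha)
      (Ideal.mul_mem_right _ _ ha)

/-- The Poisson bracket induced on the quotient by a Poisson ideal. -/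
def poissonQuotient (J : Ideal (SymmetricAlgebra ℂ M))
    (hJ : ∀ f g, g ∈ J → poisson f g ∈ J) :
    SymmetricAlgebra ℂ M ⧸ J → SymmetricAlgebra ℂ M ⧸ J → SymmetricAlgebra ℂ M ⧸ J :=
  Quotient.map₂ poisson (by
    intro f f' hf g g' hg
    have hf' : f - f' ∈ J := (Submodule.quotientRel_def J).mp hf
    have hg' : g - g' ∈ J := (Submodule.quotientRel_def J).mp hg
    refine (Submodule.quotientRel_def J).mpr ?_
    have e1 : poisson f g = poisson (f - f') g + poisson f' g := by
      rw [← poisson_add_left, sub_add_cancel]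
    have e2 : poisson f' g = poisson f' (g - g') + poisson f' g' := by
      rw [← poisson_add_right, sub_add_cancel]
    rw [e1, e2, ← add_assoc, add_sub_cancel_right, poisson_skew]
    exact J.add_mem (J.neg_mem (hJ _ _ hf')) (hJ _ _ hg'))

lemma poissonQuotient_mk (J : Ideal (SymmetricAlgebra ℂ M))
    (hJ : ∀ f g, g ∈ J → poisson f g ∈ J) (f g : SymmetricAlgebra ℂ M) :
    poissonQuotient J hJ (Ideal.Quotient.mk J f) (Ideal.Quotient.mk J g)
      = Ideal.Quotient.mk J (poisson f g) := rfl

end PoissonLie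

section LinearTopology

variable {A : Type*} [CommRing A]

/-- A decreasing sequence of ideals is a basis of neighbourhoods of zero of a ring topology. -/
lemma idealBasis {I : ℕ → Ideal A} (hI : Antitone I) :
    RingSubgroupsBasis fun n => (I n).toAddSubgroup :=
  RingSubgroupsBasis.of_comm _
    (fun i j => ⟨max i j, fun _ hx => ⟨hI (le_max_left i j) hx, hI (le_max_right i j) hx⟩⟩)
    (fun i => ⟨i, by
      rintro _ ⟨a, _, b, hb, rfl⟩
      exact (I i).mul_mem_left a hb⟩)
    (fun x i => ⟨i, fun y hy => (I i).mul_mem_left x hy⟩)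

/-- The uniform structure of the ring topology defined by a decreasing sequence of ideals. -/
@[reducible] def idealUniformSpace {I : ℕ → Ideal A} (hI : Antitone I) : UniformSpace A :=
  letI : TopologicalSpace A := (idealBasis hI).topology
  haveI : IsTopologicalRing A := (idealBasis hI).toRingFilterBasis.isTopologicalRing
  IsTopologicalAddGroup.rightUniformSpace A

lemma idealUniformSpace_isTopologicalRing {I : ℕ → Ideal A} (hI : Antitone I) :
    letI := idealUniformSpace hI
    IsTopologicalRing A :=
  (idealBasis hI).toRingFilterBasis.isTopologicalRing

lemma idealUniformSpace_isUniformAddGroup {I : ℕ → Ideal A} (hI : Antitone I) :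
    letI := idealUniformSpace hI
    IsUniformAddGroup A :=
  letI : TopologicalSpace A := (idealBasis hI).topology
  haveI : IsTopologicalRing A := (idealBasis hI).toRingFilterBasis.isTopologicalRing
  isUniformAddGroup_of_addCommGroup

/-- The extension of an operation on a uniform space to its completion by continuity. -/
def completionExtend₂ {S : Type*} [UniformSpace S] (m : S → S → S)
    (f g : UniformSpace.Completion S) : UniformSpace.Completion S :=
  (UniformSpace.Completion.isDenseInducing_coe.prodMap
    UniformSpace.Completion.isDenseInducing_coe).extend
      (fun q : S × S => (m q.1 q.2 : UniformSpace.Completion S)) (f, g)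

end LinearTopology

section Observables

variable {𝔤 : Type*} [LieRing 𝔤] [LieAlgebra ℂ 𝔤] {d : DihedralData 𝔤}

open scoped OnePoint

/-- The subset `F_n` of `g̃ᴰ`: all components lie in `F_n g̃`. -/
def filPosD (P : PoleDivisor d) (n : ℕ) : Set (gD P) :=
  {v | ∀ x p, v.1 x p ∈ Affine.filPos d n}

/-- The conjugate filtration of `g̃ᴰ`. -/
def filNegD (P : PoleDivisor d) (n : ℕ) : Set (gD P) :=
  {v | ∀ x p, v.1 x p ∈ Affine.filNeg d n}

lemma filPosD_antitone (P : PoleDivisor d) : Antitone (filPosD P) :=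
  fun _ _ hmn _ hv x p => ⟨(hv x p).1, (hv x p).2.1, fun k hk => (hv x p).2.2 k (by omega)⟩

lemma filNegD_antitone (P : PoleDivisor d) : Antitone (filNegD P) :=
  fun _ _ hmn _ hv x p => ⟨(hv x p).1, (hv x p).2.1, fun k hk => (hv x p).2.2 k (by omega)⟩

/-- The symmetric algebra `S(g̃ᴰ)`. -/
def FormalPre (P : PoleDivisor d) : Type _ := SymmetricAlgebra ℂ (gD P)

namespace FormalPre

variable (P : PoleDivisor d)

instance : CommRing (FormalPre P) := inferInstanceAs (CommRing (SymmetricAlgebra ℂ (gD P)))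
instance : Algebra ℂ (FormalPre P) := inferInstanceAs (Algebra ℂ (SymmetricAlgebra ℂ (gD P)))

/-- The embedding of `g̃ᴰ` in its symmetric algebra. -/
def ι : gD P →ₗ[ℂ] FormalPre P := SymmetricAlgebra.ι ℂ (gD P)

/-- `F_n(S) = F_n(g̃ᴰ) S ∩ c(F_n(g̃ᴰ)) S`. -/
def fil (n : ℕ) : Ideal (FormalPre P) :=
  Ideal.span (ι P '' filPosD P n) ⊓ Ideal.span (ι P '' filNegD P n)

lemma fil_antitone : Antitone (fil P) := fun _ _ h => inf_le_inf
  (Ideal.span_mono (Set.image_mono (filPosD_antitone P h)))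
  (Ideal.span_mono (Set.image_mono (filNegD_antitone P h)))

instance : UniformSpace (FormalPre P) := idealUniformSpace (fil_antitone P)
instance : IsTopologicalRing (FormalPre P) :=
  idealUniformSpace_isTopologicalRing (fil_antitone P)
instance : IsUniformAddGroup (FormalPre P) :=
  idealUniformSpace_isUniformAddGroup (fil_antitone P)
instance : UniformContinuousConstSMul ℂ (FormalPre P) :=
  haveI : ContinuousConstSMul ℂ (FormalPre P) := ⟨fun c => by
    simp only [Algebra.smul_def]
    exact continuous_const_mul _⟩
  uniformContinuousConstSMul_of_continuousConstSMul _ _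

end FormalPre

/-- The complexified algebra of formal observables `Ŝ(g̃ᴰ)`. -/
abbrev FormalObs (P : PoleDivisor d) : Type _ := UniformSpace.Completion (FormalPre P)

/-- The linear formal observables. -/
def formalLin (P : PoleDivisor d) : gD P →ₗ[ℂ] FormalObs P where
  toFun v := (FormalPre.ι P v : FormalPre P)
  map_add' u v := by rw [map_add, UniformSpace.Completion.coe_add]
  map_smul' c v := by rw [map_smul, UniformSpace.Completion.coe_smul, RingHom.id_apply]

variable {P : PoleDivisor d} (lev : Levels d P)

/-- The ideal `J_ℓ` of `S(ĝᴰ)` generated by the `K^{(x)}_p - i ℓˣₚ`. -/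
def levelIdeal : Ideal (SymmetricAlgebra ℂ (hatD P)) :=
  Ideal.span (Set.range fun q : OnePoint ℂ × ℕ =>
    SymmetricAlgebra.ι ℂ (hatD P) (hatPart P (emb P q.1 q.2 (Affine.Kel d)))
      - algebraMap ℂ _ (Complex.I * lev.ℓ q.1 q.2))

lemma Affine.lie_Kel (X : Affine d) : ⁅X, Affine.Kel d⁆ = 0 := by
  ext1 <;> simp [Affine.Kel]

lemma Affine.sigma_Kel : Affine.sigma d (Affine.Kel d) = Affine.Kel d := by
  simp only [Affine.sigma, Affine.Kel]
  ext1
  · exact map_zero (Finsupp.mapRange.linearEquiv d.σ)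
  · rfl
  · rfl

lemma pointProj_Kel (x : OnePoint ℂ) (p : ℕ) :
    ∃ c : ℂ, pointProj d x p (Affine.Kel d) = c • Affine.Kel d := by
  have hk : ∀ k : ℕ, ((Affine.sigma d) ^ k) (Affine.Kel d) = Affine.Kel d := by
    intro k
    induction k with
    | zero => rfl
    | succ k ih => rw [pow_succ, LinearEquiv.mul_apply, Affine.sigma_Kel, ih]
  have he : ∀ j : ℤ, ∃ c : ℂ, Affine.eigenproj d j (Affine.Kel d) = c • Affine.Kel d := by
    intro j
    simp only [Affine.eigenproj, LinearMap.smul_apply, LinearMap.sum_apply, LinearEquiv.coe_coe, hk]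
    rw [← Finset.sum_smul, smul_smul]
    exact ⟨_, rfl⟩
  induction x using OnePoint.rec with
  | infty =>
    by_cases h : p = 0
    · exact ⟨0, by simp [pointProj, h]⟩
    · simpa [pointProj, h] using he _
  | coe x =>
    by_cases h : x = 0
    · simpa [pointProj, h] using he p
    · exact ⟨1, by simp [pointProj, h]⟩

lemma hatD_lie_K (x : OnePoint ℂ) (p : ℕ) (v : hatD P) :
    ⁅v, hatPart P (emb P x p (Affine.Kel d))⁆ = 0 := by
  classical
  refine Subtype.ext (Subtype.ext (TakiffSum.ext fun y q => ?_))
  change (⁅v.1.1, (hatPart P (emb P x p (Affine.Kel d))).1.1⁆ : TakiffSum P) y q = 0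
  rw [TakiffSum.lie_apply]
  refine Finset.sum_eq_zero fun i _ => Finset.sum_eq_zero fun j _ => ?_
  have h : ∃ c : ℂ, (hatPart P (emb P x p (Affine.Kel d))).1.1 y j = c • Affine.Kel d := by
    change ∃ c : ℂ, Affine.eraseD d (if y = x ∧ (j : ℕ) = p then _ else 0) = _
    split_ifs
    · obtain ⟨c, hc⟩ := pointProj_Kel (d := d) x p
      exact ⟨c, by rw [hc, map_smul]; rfl⟩
    · exact ⟨0, by simp⟩
  obtain ⟨c, hc⟩ := h
  split_ifs
  · rw [hc, lie_smul, Affine.lie_Kel, smul_zero]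
  · rfl

lemma levelIdeal_poisson (f g : SymmetricAlgebra ℂ (hatD P)) (hg : g ∈ levelIdeal lev) :
    poisson f g ∈ levelIdeal lev := by
  refine poisson_mem_span ?_ f g hg
  rintro _ ⟨q, rfl⟩
  exact ⟨_, _, hatD_lie_K q.1 q.2, rfl⟩

/-- The quotient `S_ℓ(ĝᴰ) = S(ĝᴰ) / J_ℓ`. -/
def LocalPre (lev : Levels d P) : Type _ := SymmetricAlgebra ℂ (hatD P) ⧸ levelIdeal lev

namespace LocalPre

instance : CommRing (LocalPre lev) :=
  inferInstanceAs (CommRing (SymmetricAlgebra ℂ (hatD P) ⧸ levelIdeal lev))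
instance : Algebra ℂ (LocalPre lev) :=
  inferInstanceAs (Algebra ℂ (SymmetricAlgebra ℂ (hatD P) ⧸ levelIdeal lev))

/-- The canonical map from `ĝᴰ` to `S_ℓ(ĝᴰ)`. -/
def ι : hatD P →ₗ[ℂ] LocalPre lev :=
  (Ideal.Quotient.mkₐ ℂ (levelIdeal lev)).toLinearMap ∘ₗ SymmetricAlgebra.ι ℂ (hatD P)

/-- The Poisson bracket of `S_ℓ(ĝᴰ)`. -/
def bracket (f g : LocalPre lev) : LocalPre lev :=
  poissonQuotient (levelIdeal lev) (levelIdeal_poisson lev) f g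

/-- `F_n(S_ℓ) = F_n(ĝᴰ) S_ℓ ∩ c(F_n(ĝᴰ)) S_ℓ`. -/
def fil (n : ℕ) : Ideal (LocalPre lev) :=
  Ideal.span (ι lev '' {v | v.1 ∈ filPosD P n}) ⊓ Ideal.span (ι lev '' {v | v.1 ∈ filNegD P n})

lemma fil_antitone : Antitone (fil lev) := fun _ _ h => inf_le_inf
  (Ideal.span_mono (Set.image_mono fun _ hv => filPosD_antitone P h hv))
  (Ideal.span_mono (Set.image_mono fun _ hv => filNegD_antitone P h hv))

instance : UniformSpace (LocalPre lev) := idealUniformSpace (fil_antitone lev)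
instance : IsTopologicalRing (LocalPre lev) :=
  idealUniformSpace_isTopologicalRing (fil_antitone lev)
instance : IsUniformAddGroup (LocalPre lev) :=
  idealUniformSpace_isUniformAddGroup (fil_antitone lev)
instance : UniformContinuousConstSMul ℂ (LocalPre lev) :=
  haveI : ContinuousConstSMul ℂ (LocalPre lev) := ⟨fun c => by
    simp only [Algebra.smul_def]
    exact continuous_const_mul _⟩
  uniformContinuousConstSMul_of_continuousConstSMul _ _

end LocalPre

/-- The complexified algebra of local observables `Ŝ_ℓ(ĝᴰ)`. -/
abbrev LocalObs (lev : Levels d P) : Type _ := UniformSpace.Completion (LocalPre lev)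

/-- The Poisson bracket of the algebra of local observables. -/
def localBracket (f g : LocalObs lev) : LocalObs lev :=
  completionExtend₂ (LocalPre.bracket lev) f g

/-- The class of an element of `ĝᴰ` in the algebra of local observables. -/
def localLin : hatD P →ₗ[ℂ] LocalObs lev where
  toFun v := (LocalPre.ι lev v : LocalPre lev)
  map_add' u v := by rw [map_add, UniformSpace.Completion.coe_add]
  map_smul' c v := by rw [map_smul, UniformSpace.Completion.coe_smul, RingHom.id_apply]

end Observables

section Homomorphism

variable {𝔤 : Type*} [LieRing 𝔤] [LieAlgebra ℂ 𝔤] {d : DihedralData 𝔤} {P : PoleDivisor d}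
variable {I : Type*} [Fintype I] [DecidableEq I]

open scoped OnePoint

/-- The dual basis `Iᵃ` of a basis `I_a` of `𝔤`. -/
def dualB (d : DihedralData 𝔤) (b : Module.Basis I ℂ 𝔤) : Module.Basis I ℂ 𝔤 :=
  d.form.dualBasis d.form_nondegenerate b

/-- The numbers `κ_k(ℓ₀, …, ℓ_{n-1})`, given by the sum over all compositions `c` of `k - n + 1` of
`(-1)^{|c|} ∏ⱼ ℓ_{n-1-cⱼ} / ℓ_{n-1}^{|c|+1}`, with `κ_k = 0` for `k < n - 1`. -/
def kappa (n : ℕ) (ℓ : ℕ → ℂ) (k : ℤ) : ℂ :=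
  if k < (n : ℤ) - 1 then 0 else
    ∑ c : Composition (k - n + 1).toNat,
      (-1) ^ c.length * (c.blocks.map fun m => ℓ (n - 1 - m)).prod / ℓ (n - 1) ^ (c.length + 1)

/-- The local observable `X_p^{(x)}`. -/
def localEmb (lev : Levels d P) (x : OnePoint ℂ) (p : ℕ) (X : Affine d) : LocalObs lev :=
  localLin lev (hatPart P (emb P x p X))

/-- The generalised Segal-Sugawara element
`i/2 ∑_{p,q} ∑ₙ κˣ_{p+q-r} I_{a,-n,p}^{(x)} I^{a(x)}_{n,q}`, the image of `D_r^{(x)}`. -/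
def sugawara (b : Module.Basis I ℂ 𝔤) (lev : Levels d P) (x : OnePoint ℂ) (r : ℕ) :
    LocalObs lev :=
  (Complex.I / 2) • ∑ p ∈ Finset.range (P.n x), ∑ q ∈ Finset.range (P.n x),
    kappa (P.n x) (lev.ℓ x) ((p : ℤ) + q - r) •
      ∑' n : ℤ, ∑ a, localEmb lev x p (Affine.xt d (-n) (b a)) *
        localEmb lev x q (Affine.xt d n (dualB d b a))

open Classical in
/-- A finite set of points of the Riemann sphere that contains all the poles. -/
def poleSet (P : PoleDivisor d) : Finset (OnePoint ℂ) :=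
  P.Z'.image (fun x : ℂ => (x : OnePoint ℂ)) ∪ {((0 : ℂ) : OnePoint ℂ), ∞}

/-- The coefficient of `D_p^{(x)}`. -/
def coeffDD (P : PoleDivisor d) (x : OnePoint ℂ) (p : Fin (P.n x)) : gD P →ₗ[ℂ] ℂ where
  toFun v := (v.1 x p).D
  map_add' _ _ := rfl
  map_smul' _ _ := rfl

/-- The linear map `π_ℓ : g̃ᴰ → Ŝ_ℓ(ĝᴰ)`. It is the identity on the loop generators, it sends
`K_r^{(x)}` to `i ℓˣᵣ` by the definition of the quotient `S_ℓ(ĝᴰ)`, and `D_r^{(x)}` to the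
Segal-Sugawara element. -/
def piLin (b : Module.Basis I ℂ 𝔤) (lev : Levels d P) : gD P →ₗ[ℂ] LocalObs lev :=
  localLin lev ∘ₗ hatPart P +
    ∑ x ∈ poleSet P, ∑ p : Fin (P.n x), (coeffDD P x p).smulRight (sugawara b lev x p)

/-- The extension of `π_ℓ` to a morphism of algebras on `S(g̃ᴰ)`. -/
def piSym (b : Module.Basis I ℂ 𝔤) (lev : Levels d P) : FormalPre P →ₐ[ℂ] LocalObs lev :=
  SymmetricAlgebra.lift (piLin b lev)

/-- The extension of `π_ℓ` to the completion `Ŝ(g̃ᴰ)` by continuity. -/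
def piHat (b : Module.Basis I ℂ 𝔤) (lev : Levels d P) : FormalObs P → LocalObs lev :=
  UniformSpace.Completion.extension (piSym b lev)

end Homomorphism

section Fields

variable {𝔤 : Type*} [LieRing 𝔤] [LieAlgebra ℂ 𝔤] {d : DihedralData 𝔤}
variable {I : Type*} [Fintype I] [DecidableEq I]

open scoped OnePoint

/-- Formal fields: an element `Φ` of the completed tensor product of `g̃` with `g̃ᴰ` is given by the
linear map `X ↦ (X | Φ)`, the contraction of its first tensor factor with `X` by means of the
bilinear form of `g̃`; thus `Φ = ∑ I_ã ⊗ Φ(I^ã)` for any pair of dual bases of `g̃`. -/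
abbrev FormalField (P : PoleDivisor d) : Type _ := Affine d →ₗ[ℂ] gD P

/-- The formal field `𝒜ˣₚ = ∑ I_ã ⊗ I^{ã(x)}_p`, whose contraction with `X` is `X_p^{(x)}`. -/
def fieldA (P : PoleDivisor d) (x : OnePoint ℂ) (p : ℕ) : FormalField P := emb P x p

/-- The action of `σᵏ` on the first tensor factor of a formal field: by the invariance of
the bilinear form, `(X | σᵏ Φ) = (σ⁻ᵏ X | Φ)`. -/
def sigmaField {P : PoleDivisor d} (k : ℕ) (Φ : FormalField P) : FormalField P :=
  Φ ∘ₗ (((Affine.sigma d) ^ k)⁻¹ : Affine d ≃ₗ[ℂ] Affine d).toLinearMap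

/-- The bilinear pairing `(Φ | Ψ)` of formal fields, induced by the bilinear form of `g̃`, for which
`(x_m | y_n) = δ_{m+n,0} ⟨x, y⟩`, `(K | D) = 1`, and all other pairings are zero. -/
def pairing {P : PoleDivisor d} (b : Module.Basis I ℂ 𝔤) (Φ Ψ : FormalField P) : FormalObs P :=
  formalLin P (Φ (Affine.Kel d)) * formalLin P (Ψ (Affine.Del d)) +
    formalLin P (Φ (Affine.Del d)) * formalLin P (Ψ (Affine.Kel d)) +
    ∑' n : ℤ, ∑ a, formalLin P (Φ (Affine.xt d n (dualB d b a))) *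
      formalLin P (Ψ (Affine.xt d (-n) (b a)))

/-- The value at `z` of the rational function
`T⁻¹ ∑_{k<T} ∑_{x∈𝒵'} ∑ₚ ω⁻ᵏ c(k,x,p) / (ω⁻ᵏ z - x)^{p+1} + ∑ₚ c(0,0,p) z^{-p-1}
  - ∑_q c(0,∞,q+1) z^q`. -/
def laxSum {V : Type*} [AddCommGroup V] [Module ℂ V] (P : PoleDivisor d)
    (c : ℕ → OnePoint ℂ → ℕ → V) (z : ℂ) : V :=
  (d.T : ℂ)⁻¹ • ∑ k ∈ Finset.range d.T, ∑ x ∈ P.Z', ∑ p ∈ Finset.range (P.n x),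
      ((d.ω ^ k)⁻¹ / ((d.ω ^ k)⁻¹ * z - x) ^ (p + 1)) • c k x p +
    ∑ p ∈ Finset.range (P.n (0 : ℂ)), (z ^ (p + 1))⁻¹ • c 0 (0 : ℂ) p -
    ∑ q ∈ Finset.range (P.n ∞), z ^ q • c 0 ∞ (q + 1)

/-- The value at `z` of the rational function `∑_{k<T} ∑ₛ c(k,x,p+s) / (ω⁻ᵏ z - x)^{s+1}`
if `x ≠ 0, ∞`, of `∑ₛ c(0,0,p+s) z^{-s-1}` if `x = 0`, and of `∑ₛ c(0,∞,p+s+2) zˢ` if `x = ∞`. -/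
def partnerSum {V : Type*} [AddCommGroup V] [Module ℂ V] (P : PoleDivisor d)
    (c : ℕ → OnePoint ℂ → ℕ → V) (x : OnePoint ℂ) (p : ℕ) (z : ℂ) : V :=
  x.elim (∑ s ∈ Finset.range (P.n ∞), z ^ s • c 0 ∞ (p + s + 2)) fun x =>
    if x = 0 then ∑ s ∈ Finset.range (P.n (0 : ℂ)), (z ^ (s + 1))⁻¹ • c 0 (0 : ℂ) (p + s)
    else ∑ k ∈ Finset.range d.T, ∑ s ∈ Finset.range (P.n x),
      (((d.ω ^ k)⁻¹ * z - x) ^ (s + 1))⁻¹ • c k x (p + s)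

/-- The formal Lax matrix `ℒ(z)`. -/
def formalLax (P : PoleDivisor d) (z : ℂ) : FormalField P :=
  laxSum P (fun k x p => sigmaField k (fieldA P x p)) z

/-- The formal field `ℳˣₚ(z)`. -/
def formalM (P : PoleDivisor d) (x : OnePoint ℂ) (p : ℕ) (z : ℂ) : FormalField P :=
  partnerSum P (fun k x p => sigmaField k (fieldA P x p)) x p z

/-- The twist function `φ(z)`. -/
def twist {P : PoleDivisor d} (lev : Levels d P) (z : ℂ) : ℂ :=
  laxSum P (fun _ x p => lev.ℓ x p) z

/-- The function `φˣₚ(z)`. -/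
def twistM {P : PoleDivisor d} (lev : Levels d P) (x : OnePoint ℂ) (p : ℕ) (z : ℂ) : ℂ :=
  partnerSum P (fun _ x p => lev.ℓ x p) x p z

/-- `ℋˣₚ` for `x ∈ 𝒵'`. -/
def formalHamFinite (b : Module.Basis I ℂ 𝔤) (P : PoleDivisor d) (x : ℂ) (p : ℕ) : FormalObs P :=
  ∑ l ∈ Finset.range d.T, ∑ y ∈ (insert 0 P.Z').filter (fun y => ¬ (l = 0 ∧ y = x)),
      ∑ q ∈ Finset.range (P.n y), ∑ s ∈ Finset.range (P.n x),
        ((Nat.choose (q + s) s : ℂ) * (-1) ^ s * d.ω ^ (l * q) /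
          (x - d.ω ^ l * y) ^ (q + s + 1)) •
            pairing b (fieldA P x (p + s)) (sigmaField l (fieldA P y q)) -
    (d.T : ℂ) • ∑ q ∈ Finset.range (P.n ∞), ∑ s ∈ Finset.range (q + 1),
        ((Nat.choose q s : ℂ) * x ^ (q - s)) •
          pairing b (fieldA P x (p + s)) (fieldA P ∞ (q + 1)) +
    (1 / 2 : ℂ) • ∑ q ∈ Finset.range p, pairing b (fieldA P x q) (fieldA P x (p - q - 1))

/-- `ℋ⁰ₚ`. -/
def formalHamZero (b : Module.Basis I ℂ 𝔤) (P : PoleDivisor d) (p : ℕ) : FormalObs P :=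
  ∑ x ∈ P.Z', ∑ q ∈ Finset.range (P.n x), ∑ s ∈ Finset.range (P.n (0 : ℂ)),
      ((-1) ^ (q + 1) * (Nat.choose (q + s) s : ℂ) / x ^ (q + s + 1)) •
        pairing b (fieldA P (0 : ℂ) (p + s)) (fieldA P x q) -
    ∑ q ∈ Finset.range (P.n ∞), pairing b (fieldA P (0 : ℂ) (p + q)) (fieldA P ∞ (q + 1)) +
    (1 / 2 : ℂ) • ∑ q ∈ Finset.range p,
      pairing b (fieldA P (0 : ℂ) (p - q - 1)) (fieldA P (0 : ℂ) q)

/-- `ℋ^∞_q`. -/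
def formalHamInfty (b : Module.Basis I ℂ 𝔤) (P : PoleDivisor d) (q : ℕ) : FormalObs P :=
  -∑ x ∈ P.Z', ∑ p ∈ Finset.range (P.n x), ∑ s ∈ (Finset.range (P.n ∞)).filter (fun s => p ≤ s),
      ((Nat.choose s p : ℂ) * x ^ (s - p)) •
        pairing b (fieldA P x p) (fieldA P ∞ (q + s + 2)) -
    ∑ p ∈ Finset.range (P.n (0 : ℂ)),
      pairing b (fieldA P (0 : ℂ) p) (fieldA P ∞ (q + p + 2)) +
    (1 / 2 : ℂ) • ∑ p ∈ Finset.range (q + 1),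
      pairing b (fieldA P ∞ (p + 1)) (fieldA P ∞ (q - p + 1))

/-- The formal quadratic Gaudin Hamiltonians `ℋˣₚ`. -/
def formalHam (b : Module.Basis I ℂ 𝔤) (P : PoleDivisor d) (x : OnePoint ℂ) (p : ℕ) :
    FormalObs P :=
  x.elim (formalHamInfty b P p) fun x =>
    if x = 0 then formalHamZero b P p else formalHamFinite b P x p

/-- The index set of the quadratic Gaudin Hamiltonians: `0 ≤ p ≤ 2 nₓ - 1` for a finite pole `x`,
with `p ≡ 1` modulo `T` if `x = 0`, and `0 ≤ p ≤ 2 n_∞ - 4` with `p ≡ -2` modulo `T` if `x = ∞`. -/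
def IsHamIndex (P : PoleDivisor d) (x : OnePoint ℂ) (p : ℕ) : Prop :=
  x.elim (p + 4 ≤ 2 * P.n ∞ ∧ d.T ∣ p + 2) fun x =>
    P.n x ≠ 0 ∧ p < 2 * P.n x ∧ (x = 0 → p ≡ 1 [MOD d.T])

/-- The local quadratic Gaudin Hamiltonians `Hˣₚ = π_ℓ(ℋˣₚ)`. -/
def localHam {P : PoleDivisor d} (b : Module.Basis I ℂ 𝔤) (lev : Levels d P) (x : OnePoint ℂ)
    (p : ℕ) : LocalObs lev :=
  piHat b lev (formalHam b P x p)

/-- Classical `𝔤`-valued fields on the circle with coefficients in the local observables: `X`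
stands for `∑ I_a ⊗ e_n ⊗ X a n`, where `e_n(θ) = exp(i n θ)`. -/
abbrev ClassicalField {P : PoleDivisor d} (I : Type*) (lev : Levels d P) : Type _ :=
  I → ℤ → LocalObs lev

/-- The derivative `∂` with respect to `θ`. -/
def ClassicalField.deriv {P : PoleDivisor d} {lev : Levels d P} (X : ClassicalField I lev) :
    ClassicalField I lev :=
  fun a n => (Complex.I * n) • X a n

/-- The pointwise commutator of `𝔤`-valued fields, `[I_a ⊗ e_m ⊗ f, I_{a'} ⊗ e_n ⊗ g]
  = [I_a, I_{a'}] ⊗ e_{m+n} ⊗ f g`. -/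
def ClassicalField.comm {P : PoleDivisor d} {lev : Levels d P} (b : Module.Basis I ℂ 𝔤)
    (X Y : ClassicalField I lev) : ClassicalField I lev :=
  fun c n => ∑ a, ∑ a', b.repr ⁅b a, b a'⁆ c • ∑' m : ℤ, X a m * Y a' (n - m)

/-- The Poisson bracket `{H, X}` of a local observable with a field, taken in the
second tensor factor. -/
def ClassicalField.poisson {P : PoleDivisor d} {lev : Levels d P} (H : LocalObs lev)
    (X : ClassicalField I lev) : ClassicalField I lev :=
  fun a n => localBracket lev H (X a n)

/-- The image of a formal field under `ϱ ⊗ π_ℓ`, where `ϱ(x_n) = x ⊗ e_n`, `ϱ(K) = 0` and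
`ϱ(D) = -i ∂`: the pair `(f, X)` stands for the connection `f ∂ + X`. -/
def rhoPi {P : PoleDivisor d} (b : Module.Basis I ℂ 𝔤) (lev : Levels d P) (Φ : FormalField P) :
    LocalObs lev × ClassicalField I lev :=
  (-Complex.I • piLin b lev (Φ (Affine.Kel d)),
    fun a n => piLin b lev (Φ (Affine.xt d (-n) (dualB d b a))))

/-- The Lax matrix `L(z)`, defined by `(ϱ ⊗ π_ℓ) ℒ(z) = φ(z) (∂ + L(z))`. -/
def lax {P : PoleDivisor d} (b : Module.Basis I ℂ 𝔤) (lev : Levels d P) (z : ℂ) :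
    ClassicalField I lev :=
  (twist lev z)⁻¹ • (rhoPi b lev (formalLax P z)).2

/-- The field `Nˣₚ(z) = φˣₚ(z) (L(z) - Mˣₚ(z))`, where
`(ϱ ⊗ π_ℓ) ℳˣₚ(z) = φˣₚ(z) ∂ + φˣₚ(z) Mˣₚ(z)`. -/
def laxN {P : PoleDivisor d} (b : Module.Basis I ℂ 𝔤) (lev : Levels d P) (x : OnePoint ℂ) (p : ℕ)
    (z : ℂ) : ClassicalField I lev :=
  twistM lev x p z • lax b lev z - (rhoPi b lev (formalM P x p z)).2

/-- The point `z` is not in the orbit of a finite pole. -/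
def IsRegularPoint (P : PoleDivisor d) (z : ℂ) : Prop :=
  ∀ (x : ℂ) (k : ℕ), P.n x ≠ 0 → z ≠ d.ω ^ k * x

end Fields

end DihedralGaudin

end

open DihedralGaudin

/-!
The proof is the classical argument that a Lax matrix with an `r`-matrix bracket gives commuting
quadratic Hamiltonians, carried out with coefficients in a completed Poisson algebra.

* **The realisation.** The map `π_ℓ` is a homomorphism of Lie algebras from `g̃ᴰ` to the local
  observables (`br_piLin`). Only the elements `D` need an argument. Their images are quadratic, and
  by invariance of the pairing (`pair_adR`) they act on the modes as derivations
  (`br_sugawara_modeField`), because the coefficients `κ` are the convolution inverse of the levels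
  (`sum_kappa_mul`); for the same reason they commute with each other (`br_sugawara`). Hence every
  bracket can be computed in the Lie algebra `g̃ᴰ`.

* **The `r`-matrix.** Contracted with `X` in its first tensor factor, the Lax matrix `ℒ(z)` is the
  average over the cyclic group of the element `X / (z - t)`, expanded in the local coordinate at all
  poles simultaneously (`coe_laxF_apply`). The partial fraction identity
  `1 / ((z - t)(w - t)) = (1 / (z - t) - 1 / (w - t)) / (w - z)` then gives the bracket of two values
  of the Lax matrix (`lie_polarRaw`, `lie_laxF`).

* **The generating function.** By the Leibniz rule for the pairing and its invariance, the flow of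
  `½ (ℒ(z) | ℒ(z))` on `ℒ(w)` is a Lax equation whose partner is the average of
  `ℒ(z) / (z - w)` (`br_generating_lax`). Both `(ℒ(z) | ℒ(z))` and this partner are rational functions
  of `z` with values in infinite-dimensional spaces without useful analytic structure. They are
  expanded formally, as finite sums of vectors multiplied with rational functions; the coefficients
  are determined by the values at almost all points (`HasExpansion.unique`). Each Hamiltonian is a
  Laurent coefficient of the generating function at its pole, and the same coefficient of the partner
  is `-ℳˣₚ(w)` (`exists_hamExpansion`). The conditions on `p` modulo `T` at the fixed points `0` and
  `∞` are those under which the average over the cyclic group does not annihilate the coefficient.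

* **Conclusion.** Comparing coefficients gives the Lax equation of every Hamiltonian
  (`br_localHam_lax`). A Lax equation conserves `(ℒ(w) | ℒ(w))` (`br_pair_self_of_lax`), and the other
  Hamiltonians are coefficients of this function of `w`, so all of them commute
  (`br_localHam_localHam`). Written in components, with `K` acting as `i` times the twist function,
  the same Lax equation is the zero curvature equation (`zero_curvature`): the derivation and the
  cocycle of the affine algebra produce the derivative of the connection.
-/


noncomputable section

namespace DihedralGaudin

open Filter Topology

set_option linter.unusedSectionVars false

/-! ### Homogeneous elements of the affine algebra -/

section AffineGrading

variable {𝔤 : Type*} [LieRing 𝔤] [LieAlgebra ℂ 𝔤] {d : DihedralData 𝔤}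

namespace Affine

lemma xt_add_K_add_D (X : Affine d) :
    X = X.loop.sum (fun n x => xt d n x) + X.K • Kel d + X.D • Del d := by
  have h : ∀ f : ℤ →₀ 𝔤, f.sum (fun n x => xt d n x) = (⟨f, 0, 0⟩ : Affine d) := by
    intro f
    induction f using Finsupp.induction_linear with
    | zero => rfl
    | add f g hf hg =>
      rw [Finsupp.sum_add_index' (by simp) (by simp), hf, hg]
      ext1 <;> simp
    | single n x => rw [Finsupp.sum_single_index (by simp)]; rfl
  rw [h]
  ext1 <;> simp [Kel, Del]

@[elab_as_elim]
lemma induction {p : Affine d → Prop} (xt : ∀ n x, p (Affine.xt d n x)) (K : p (Kel d))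
    (D : p (Del d)) (add : ∀ X Y, p X → p Y → p (X + Y)) (smul : ∀ (c : ℂ) X, p X → p (c • X))
    (X : Affine d) : p X := by
  have h0 : p 0 := by simpa using smul 0 _ K
  rw [xt_add_K_add_D X]
  refine add _ _ (add _ _ ?_ (smul _ _ K)) (smul _ _ D)
  induction X.loop using Finsupp.induction_linear with
  | zero => simpa using h0
  | add f g hf hg =>
    rw [Finsupp.sum_add_index' (by simp) (by simp)]
    exact add _ _ hf hg
  | single n x => rw [Finsupp.sum_single_index (by simp)]; exact xt n x

lemma lie_xt_xt (m n : ℤ) (x y : 𝔤) : ⁅xt d m x, xt d n y⁆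
    = xt d (m + n) ⁅x, y⁆ + (if m + n = 0 then (m : ℂ) * d.form x y else 0) • Kel d := by
  split_ifs with h <;> ext1 <;> simp [xt, Kel, h]

lemma lie_Del_xt (n : ℤ) (x : 𝔤) : ⁅Del d, xt d n x⁆ = (n : ℂ) • xt d n x := by
  ext1 <;> simp [xt, Del]

lemma lie_xt_Del (n : ℤ) (x : 𝔤) : ⁅xt d n x, Del d⁆ = -((n : ℂ) • xt d n x) := by
  rw [← lie_skew, lie_Del_xt]

lemma Kel_lie (X : Affine d) : ⁅Kel d, X⁆ = 0 := by
  rw [← lie_skew, lie_Kel, neg_zero]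

lemma xt_mem_filPos {n : ℤ} {N : ℕ} (h : (N : ℤ) ≤ n) (x : 𝔤) : xt d n x ∈ filPos d N :=
  ⟨rfl, rfl, fun _ hm => Finsupp.single_eq_of_ne (by omega)⟩

lemma xt_mem_filNeg {n : ℤ} {N : ℕ} (h : n ≤ -(N : ℤ)) (x : 𝔤) : xt d n x ∈ filNeg d N :=
  ⟨rfl, rfl, fun _ hm => Finsupp.single_eq_of_ne (by omega)⟩

lemma filPos_antitone : Antitone (filPos d) :=
  fun _ _ h _ hX => ⟨hX.1, hX.2.1, fun m hm => hX.2.2 m (by omega)⟩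

lemma filNeg_antitone : Antitone (filNeg d) :=
  fun _ _ h _ hX => ⟨hX.1, hX.2.1, fun m hm => hX.2.2 m (by omega)⟩

lemma neg_mem_filPos {N : ℕ} {X : Affine d} (h : X ∈ filPos d N) : -X ∈ filPos d N := by
  rw [← neg_one_smul ℂ X]
  refine ⟨by rw [K_smul, h.1, mul_zero], by rw [D_smul, h.2.1, mul_zero], fun m hm => ?_⟩
  rw [loop_smul, Finsupp.smul_apply, h.2.2 m hm, smul_zero]

lemma neg_mem_filNeg {N : ℕ} {X : Affine d} (h : X ∈ filNeg d N) : -X ∈ filNeg d N := by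
  rw [← neg_one_smul ℂ X]
  refine ⟨by rw [K_smul, h.1, mul_zero], by rw [D_smul, h.2.1, mul_zero], fun m hm => ?_⟩
  rw [loop_smul, Finsupp.smul_apply, h.2.2 m hm, smul_zero]

lemma loopBracket_single_apply (f : ℤ →₀ 𝔤) (k j : ℤ) (y : 𝔤) :
    loopBracket f (Finsupp.single k y) j = ⁅f (j - k), y⁆ := by
  induction f using Finsupp.induction_linear with
  | zero => simp
  | add f g hf hg =>
    rw [map_add, LinearMap.add_apply, Finsupp.add_apply, hf, hg, Finsupp.add_apply, add_lie]
  | single m x =>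
    rw [loopBracket_single, Finsupp.single_apply, Finsupp.single_apply]
    by_cases h : m + k = j
    · rw [if_pos h, if_pos (by omega)]
    · rw [if_neg h, if_neg (by omega), zero_lie]

lemma loopCocycle_single_apply (f : ℤ →₀ 𝔤) (k : ℤ) (y : 𝔤) :
    loopCocycle d.form f (Finsupp.single k y) = -(k : ℂ) * d.form (f (-k)) y := by
  induction f using Finsupp.induction_linear with
  | zero => simp
  | add f g hf hg =>
    rw [map_add, LinearMap.add_apply, hf, hg, Finsupp.add_apply, map_add, LinearMap.add_apply,
      mul_add]
  | single m x =>
    rw [loopCocycle_single, Finsupp.single_apply]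
    by_cases h : m + k = 0
    · obtain rfl : m = -k := by omega
      rw [if_pos h, if_pos rfl]; push_cast; rfl
    · rw [if_neg h, if_neg (by omega)]; simp

lemma loopDeg_apply (f : ℤ →₀ 𝔤) (j : ℤ) : loopDeg f j = (j : ℂ) • f j := by
  induction f using Finsupp.induction_linear with
  | zero => simp
  | add f g hf hg => rw [map_add, Finsupp.add_apply, hf, hg, Finsupp.add_apply, smul_add]
  | single m x =>
    rw [loopDeg_single, Finsupp.single_apply, Finsupp.single_apply]
    split_ifs with h
    · rw [h]
    · simp

lemma lie_xt_mem_filPos {M N : ℕ} {k : ℤ} (hN : 1 ≤ N) (h : (N : ℤ) ≤ M + k) (y : 𝔤)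
    {X : Affine d} (hX : X ∈ filPos d M) : ⁅X, xt d k y⁆ ∈ filPos d N := by
  refine ⟨?_, rfl, fun m hm => ?_⟩
  · change loopCocycle d.form X.loop (Finsupp.single k y) = 0
    rw [loopCocycle_single_apply, hX.2.2 _ (by omega)]; simp
  · change (loopBracket X.loop (Finsupp.single k y) + X.D • _ - (0 : ℂ) • _ : ℤ →₀ 𝔤) m = 0
    rw [hX.2.1, zero_smul, zero_smul, add_zero, sub_zero, loopBracket_single_apply,
      hX.2.2 _ (by omega), zero_lie]

lemma lie_xt_mem_filNeg {M N : ℕ} {k : ℤ} (hN : 1 ≤ N) (h : (N : ℤ) ≤ M - k) (y : 𝔤)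
    {X : Affine d} (hX : X ∈ filNeg d M) : ⁅X, xt d k y⁆ ∈ filNeg d N := by
  refine ⟨?_, rfl, fun m hm => ?_⟩
  · change loopCocycle d.form X.loop (Finsupp.single k y) = 0
    rw [loopCocycle_single_apply, hX.2.2 _ (by omega)]; simp
  · change (loopBracket X.loop (Finsupp.single k y) + X.D • _ - (0 : ℂ) • _ : ℤ →₀ 𝔤) m = 0
    rw [hX.2.1, zero_smul, zero_smul, add_zero, sub_zero, loopBracket_single_apply,
      hX.2.2 _ (by omega), zero_lie]

lemma lie_Del_mem_filPos {N : ℕ} {X : Affine d} (hX : X ∈ filPos d N) :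
    ⁅X, Del d⁆ ∈ filPos d N := by
  refine ⟨by simp [Del], rfl, fun m hm => ?_⟩
  rw [loop_lie, hX.2.1, zero_smul, add_zero]
  simp [Del, loopDeg_apply, hX.2.2 m hm]

lemma lie_Del_mem_filNeg {N : ℕ} {X : Affine d} (hX : X ∈ filNeg d N) :
    ⁅X, Del d⁆ ∈ filNeg d N := by
  refine ⟨by simp [Del], rfl, fun m hm => ?_⟩
  rw [loop_lie, hX.2.1, zero_smul, add_zero]
  simp [Del, loopDeg_apply, hX.2.2 m hm]

lemma exists_lie_mem_fil (Z : Affine d) : ∃ M : ℕ, ∀ (N : ℕ) (X : Affine d),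
    (X ∈ filPos d (N + M) → ⁅X, Z⁆ ∈ filPos d N) ∧
      (X ∈ filNeg d (N + M) → ⁅X, Z⁆ ∈ filNeg d N) := by
  induction Z using Affine.induction with
  | xt k y =>
    exact ⟨k.natAbs + 1, fun N X =>
      ⟨fun hX => filPos_antitone (Nat.le_succ N) (lie_xt_mem_filPos (by omega) (by omega) y hX),
        fun hX => filNeg_antitone (Nat.le_succ N) (lie_xt_mem_filNeg (by omega) (by omega) y hX)⟩⟩
  | K => exact ⟨0, fun N X => by simp only [lie_Kel]; exact ⟨fun _ => ⟨rfl, rfl, fun _ _ => rfl⟩,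
      fun _ => ⟨rfl, rfl, fun _ _ => rfl⟩⟩⟩
  | D => exact ⟨0, fun N X => ⟨lie_Del_mem_filPos, lie_Del_mem_filNeg⟩⟩
  | add Y Z hY hZ =>
    obtain ⟨M₁, h₁⟩ := hY
    obtain ⟨M₂, h₂⟩ := hZ
    refine ⟨M₁ + M₂, fun N X => ⟨fun hX => ?_, fun hX => ?_⟩⟩
    · have a := (h₁ N X).1 (filPos_antitone (by omega) hX)
      have c := (h₂ N X).1 (filPos_antitone (by omega) hX)
      rw [lie_add]
      refine ⟨?_, by simp, fun m hm => ?_⟩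
      · rw [K_add, a.1, c.1, add_zero]
      · rw [loop_add, Finsupp.add_apply, a.2.2 m hm, c.2.2 m hm, add_zero]
    · have a := (h₁ N X).2 (filNeg_antitone (by omega) hX)
      have c := (h₂ N X).2 (filNeg_antitone (by omega) hX)
      rw [lie_add]
      refine ⟨?_, by simp, fun m hm => ?_⟩
      · rw [K_add, a.1, c.1, add_zero]
      · rw [loop_add, Finsupp.add_apply, a.2.2 m hm, c.2.2 m hm, add_zero]
  | smul c Z hZ =>
    obtain ⟨M, h⟩ := hZ
    refine ⟨M, fun N X => ⟨fun hX => ?_, fun hX => ?_⟩⟩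
    · have a := (h N X).1 hX
      rw [lie_smul]
      refine ⟨?_, by simp, fun m hm => ?_⟩
      · rw [K_smul, a.1, mul_zero]
      · rw [loop_smul, Finsupp.smul_apply, a.2.2 m hm, smul_zero]
    · have a := (h N X).2 hX
      rw [lie_smul]
      refine ⟨?_, by simp, fun m hm => ?_⟩
      · rw [K_smul, a.1, mul_zero]
      · rw [loop_smul, Finsupp.smul_apply, a.2.2 m hm, smul_zero]

/-- Right bracketing `X ↦ [X, Z]`. -/
def adR (Z : Affine d) : Affine d →ₗ[ℂ] Affine d where
  toFun X := ⁅X, Z⁆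
  map_add' X Y := add_lie X Y Z
  map_smul' c X := smul_lie c X Z

@[simp] lemma adR_apply (Z X : Affine d) : adR Z X = ⁅X, Z⁆ := rfl

lemma sigma_zpow_Kel (k : ℤ) : ((sigma d) ^ k) (Kel d) = Kel d := by
  have h : ∀ n : ℕ, ((sigma d) ^ n) (Kel d) = Kel d := by
    intro n
    induction n with
    | zero => rfl
    | succ n ih => rw [pow_succ, LinearEquiv.mul_apply, sigma_Kel, ih]
  obtain ⟨n, rfl | rfl⟩ := k.eq_nat_or_neg
  · rw [zpow_natCast, h]
  · rw [zpow_neg, zpow_natCast]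
    exact (LinearEquiv.symm_apply_eq _).mpr (h n).symm

lemma sigma_zpow_induction {p : (Affine d ≃ₗ[ℂ] Affine d) → Prop} (one : p 1)
    (mul : ∀ f, p f → p (sigma d * f)) (inv : ∀ f, p f → p f⁻¹) (k : ℤ) : p ((sigma d) ^ k) := by
  have h : ∀ n : ℕ, p ((sigma d) ^ n) := by
    intro n
    induction n with
    | zero => exact one
    | succ n ih => rw [pow_succ']; exact mul _ ih
  obtain ⟨n, rfl | rfl⟩ := k.eq_nat_or_neg
  · rw [zpow_natCast]; exact h n
  · rw [zpow_neg, zpow_natCast]; exact inv _ (h n)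

lemma sigma_zpow_lie (k : ℤ) (X Y : Affine d) :
    ((sigma d) ^ k) ⁅X, Y⁆ = ⁅((sigma d) ^ k) X, ((sigma d) ^ k) Y⁆ := by
  refine sigma_zpow_induction (p := fun f => ∀ X Y, f ⁅X, Y⁆ = ⁅f X, f Y⁆)
    (fun _ _ => rfl) (fun f hf X Y => ?_) (fun f hf X Y => ?_) k X Y
  · simp only [LinearEquiv.mul_apply, hf, sigma_lie]
  · refine (LinearEquiv.symm_apply_eq f).mpr ?_
    rw [hf]
    congr 1 <;> exact (LinearEquiv.apply_symm_apply f _).symm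

/-- `σᵏ` acts on the loop algebra modewise. -/
lemma sigma_zpow_apply (k : ℤ) (X : Affine d) : ((sigma d) ^ k) X
    = ⟨X.loop.mapRange (d.σ ^ k : 𝔤 ≃ₗ[ℂ] 𝔤) (map_zero _), X.K, X.D⟩ := by
  have h : ∀ n : ℕ, ∀ X : Affine d, ((sigma d) ^ n) X
      = ⟨X.loop.mapRange (d.σ ^ n : 𝔤 ≃ₗ[ℂ] 𝔤) (map_zero _), X.K, X.D⟩ := by
    intro n
    induction n with
    | zero => intro X; ext1 <;> simp
    | succ n ih =>
      intro X
      rw [pow_succ', LinearEquiv.mul_apply, ih]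
      ext1
      · ext m
        simp [sigma, pow_succ']
      · rfl
      · rfl
  obtain ⟨n, rfl | rfl⟩ := k.eq_nat_or_neg
  · simp only [zpow_natCast]; exact h n X
  · simp only [zpow_neg, zpow_natCast]
    refine (LinearEquiv.symm_apply_eq _).mpr ?_
    rw [h]
    ext1
    · ext m
      exact (LinearEquiv.apply_symm_apply (d.σ ^ n) _).symm
    · rfl
    · rfl

lemma sigma_zpow_xt (k n : ℤ) (x : 𝔤) : ((sigma d) ^ k) (xt d n x) = xt d n ((d.σ ^ k) x) := by
  rw [sigma_zpow_apply]
  ext1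
  · exact Finsupp.mapRange_single (hf := map_zero _)
  · rfl
  · rfl

lemma sigma_zpow_Del (k : ℤ) : ((sigma d) ^ k) (Del d) = Del d := by
  rw [sigma_zpow_apply]
  ext1
  · exact Finsupp.mapRange_zero (hf := map_zero _)
  · rfl
  · rfl

lemma sigma_zpow_mem_filPos {k : ℤ} {N : ℕ} {X : Affine d} (h : X ∈ filPos d N) :
    ((sigma d) ^ k) X ∈ filPos d N := by
  rw [sigma_zpow_apply]
  refine ⟨h.1, h.2.1, fun m hm => ?_⟩
  rw [Finsupp.mapRange_apply, h.2.2 m hm, map_zero]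

lemma sigma_zpow_mem_filNeg {k : ℤ} {N : ℕ} {X : Affine d} (h : X ∈ filNeg d N) :
    ((sigma d) ^ k) X ∈ filNeg d N := by
  rw [sigma_zpow_apply]
  refine ⟨h.1, h.2.1, fun m hm => ?_⟩
  rw [Finsupp.mapRange_apply, h.2.2 m hm, map_zero]

end Affine

lemma DihedralData.form_σ_zpow (d : DihedralData 𝔤) (k : ℤ) (x y : 𝔤) :
    d.form ((d.σ ^ k) x) y = d.form x ((d.σ ^ (-k)) y) := by
  have h : ∀ n : ℕ, ∀ x y, d.form ((d.σ ^ n) x) ((d.σ ^ n) y) = d.form x y := by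
    intro n
    induction n with
    | zero => simp
    | succ n ih => intro x y; rw [pow_succ', LinearEquiv.mul_apply, LinearEquiv.mul_apply,
        d.form_σ, ih]
  obtain ⟨n, rfl | rfl⟩ := k.eq_nat_or_neg
  · rw [zpow_neg, zpow_natCast, ← h n x]
    congr 1
    exact (LinearEquiv.apply_symm_apply (d.σ ^ n) y).symm
  · rw [zpow_neg, neg_neg, zpow_natCast, ← h n _ y]
    congr 1
    exact congrArg _ (LinearEquiv.apply_symm_apply (d.σ ^ n) x)

end AffineGrading

/-! ### The pairing of fields with coefficients in a filtered algebra -/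

/-- Two sequences of ideals, of elements with "only large positive modes" and with "only large
negative modes", whose intersections are a basis of neighbourhoods of zero. -/
structure ModeFiltration (A : Type*) [CommRing A] [TopologicalSpace A] where
  pos : ℕ → Ideal A
  neg : ℕ → Ideal A
  hasBasis : (𝓝 (0 : A)).HasBasis (fun _ : ℕ => True)
    fun n => ((pos n ⊓ neg n : Ideal A) : Set A)

section Pairing

variable {𝔤 : Type*} [LieRing 𝔤] [LieAlgebra ℂ 𝔤] {d : DihedralData 𝔤}
variable {I : Type*} [Fintype I] [DecidableEq I] (b : Module.Basis I ℂ 𝔤)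
variable {A : Type*} [CommRing A] [Algebra ℂ A] [UniformSpace A] [IsUniformAddGroup A]
  [IsTopologicalRing A] [CompleteSpace A] [T2Space A] (Fil : ModeFiltration A)

namespace ModeFiltration

lemma mem_nhds (n : ℕ) : ((Fil.pos n ⊓ Fil.neg n : Ideal A) : Set A) ∈ 𝓝 (0 : A) :=
  Fil.hasBasis.mem_of_mem trivial

lemma nonarchimedean (Fil : ModeFiltration A) : NonarchimedeanAddGroup A where
  is_nonarchimedean U hU := by
    obtain ⟨n, -, hn⟩ := Fil.hasBasis.mem_iff.mp hU
    exact ⟨⟨(Fil.pos n ⊓ Fil.neg n).toAddSubgroup,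
      AddSubgroup.isOpen_of_mem_nhds _ (Fil.mem_nhds n)⟩, hn⟩

lemma isClosed_pos (n : ℕ) : IsClosed (Fil.pos n : Set A) := by
  refine AddSubgroup.isClosed_of_isOpen (Fil.pos n).toAddSubgroup
    (AddSubgroup.isOpen_of_mem_nhds _ (g := 0) (mem_of_superset (Fil.mem_nhds n) ?_))
  exact fun x hx => hx.1

lemma isClosed_neg (n : ℕ) : IsClosed (Fil.neg n : Set A) := by
  refine AddSubgroup.isClosed_of_isOpen (Fil.neg n).toAddSubgroup
    (AddSubgroup.isOpen_of_mem_nhds _ (g := 0) (mem_of_superset (Fil.mem_nhds n) ?_))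
  exact fun x hx => hx.2

lemma summable {J : Type*} {f : J → A}
    (h : ∀ n, ∀ᶠ j in cofinite, f j ∈ Fil.pos n ∧ f j ∈ Fil.neg n) : Summable f := by
  have := Fil.nonarchimedean
  exact NonarchimedeanAddGroup.summable_of_tendsto_cofinite_zero
    (Fil.hasBasis.tendsto_right_iff.mpr fun n _ => h n)

end ModeFiltration

/-- The fields `Φ = ∑ I_ã ⊗ Φ(I^ã)`, given as linear maps on `g̃`, whose modes tend to zero. -/
def modeFields (d : DihedralData 𝔤) : Submodule ℂ (Affine d →ₗ[ℂ] A) where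
  carrier := {Φ | ∀ n, ∃ N, (∀ X ∈ Affine.filPos d N, Φ X ∈ Fil.pos n) ∧
    ∀ X ∈ Affine.filNeg d N, Φ X ∈ Fil.neg n}
  add_mem' {Φ Ψ} hΦ hΨ n := by
    obtain ⟨N, h₁, h₂⟩ := hΦ n
    obtain ⟨M, h₃, h₄⟩ := hΨ n
    refine ⟨max N M, fun X hX => ?_, fun X hX => ?_⟩
    · exact (Fil.pos n).add_mem (h₁ X (Affine.filPos_antitone (le_max_left _ _) hX))
        (h₃ X (Affine.filPos_antitone (le_max_right _ _) hX))
    · exact (Fil.neg n).add_mem (h₂ X (Affine.filNeg_antitone (le_max_left _ _) hX))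
        (h₄ X (Affine.filNeg_antitone (le_max_right _ _) hX))
  zero_mem' n := ⟨0, fun _ _ => (Fil.pos n).zero_mem, fun _ _ => (Fil.neg n).zero_mem⟩
  smul_mem' c Φ hΦ n := by
    obtain ⟨N, h₁, h₂⟩ := hΦ n
    exact ⟨N, fun X hX => Submodule.smul_of_tower_mem _ c (h₁ X hX),
      fun X hX => Submodule.smul_of_tower_mem _ c (h₂ X hX)⟩

variable {Fil} {Φ Ψ : Affine d →ₗ[ℂ] A}

lemma comp_adR_mem (hΦ : Φ ∈ modeFields Fil d) (Z : Affine d) :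
    Φ ∘ₗ Affine.adR Z ∈ modeFields Fil d := by
  intro n
  obtain ⟨N, h₁, h₂⟩ := hΦ n
  obtain ⟨M, h⟩ := Affine.exists_lie_mem_fil Z
  exact ⟨N + M, fun X hX => h₁ _ ((h N X).1 hX), fun X hX => h₂ _ ((h N X).2 hX)⟩

/-- The action of `σᵏ` on the argument of a field. -/
def twistField (k : ℤ) (Φ : Affine d →ₗ[ℂ] A) : Affine d →ₗ[ℂ] A :=
  Φ ∘ₗ (((Affine.sigma d) ^ k : Affine d ≃ₗ[ℂ] Affine d) : Affine d →ₗ[ℂ] Affine d)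

lemma twistField_mem (hΦ : Φ ∈ modeFields Fil d) (k : ℤ) :
    twistField k Φ ∈ modeFields Fil d := by
  intro n
  obtain ⟨N, h₁, h₂⟩ := hΦ n
  exact ⟨N, fun X hX => h₁ _ (Affine.sigma_zpow_mem_filPos hX),
    fun X hX => h₂ _ (Affine.sigma_zpow_mem_filNeg hX)⟩

/-- Indices for a pair of dual bases of `g̃`, formed by `K`, `D` and the `Iᵃ_n`, and by `D`, `K` and
the `I_{a,-n}`. -/
abbrev CurIndex (I : Type*) : Type _ := Bool ⊕ ℤ × I

/-- The basis `K`, `D`, `Iᵃ_n` of `g̃`. -/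
def cur (d : DihedralData 𝔤) : CurIndex I → Affine d
  | .inl true => Affine.Kel d
  | .inl false => Affine.Del d
  | .inr (n, a) => Affine.xt d n (dualB d b a)

/-- The basis `D`, `K`, `I_{a,-n}` of `g̃`, dual to `cur`. -/
def curDual (d : DihedralData 𝔤) : CurIndex I → Affine d
  | .inl true => Affine.Del d
  | .inl false => Affine.Kel d
  | .inr (n, a) => Affine.xt d (-n) (b a)

/-- The degree of a basis element. -/
def curDeg : CurIndex I → ℤ
  | .inl _ => 0
  | .inr (n, _) => n

lemma finite_curDeg_lt (N : ℕ) : {j : CurIndex I | (curDeg j).natAbs < N}.Finite := by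
  have h1 : (Set.univ : Set Bool).Finite := Set.finite_univ
  have h2 : ((Set.Ioo (-(N : ℤ)) N) ×ˢ (Set.univ : Set I)).Finite :=
    (Set.finite_Ioo _ _).prod Set.finite_univ
  refine ((h1.image Sum.inl).union (h2.image Sum.inr)).subset ?_
  rintro (j | ⟨n, a⟩) h
  · exact Or.inl ⟨j, trivial, rfl⟩
  · refine Or.inr ⟨(n, a), ⟨?_, trivial⟩, rfl⟩
    change n.natAbs < N at h
    simp only [Set.mem_Ioo]
    omega

lemma cur_mem_filPos {N : ℕ} (hN : 1 ≤ N) {j : CurIndex I} (h : (N : ℤ) ≤ curDeg j) :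
    cur b d j ∈ Affine.filPos d N := by
  rcases j with j | ⟨n, a⟩
  · change (N : ℤ) ≤ 0 at h; omega
  · exact Affine.xt_mem_filPos h _

lemma cur_mem_filNeg {N : ℕ} (hN : 1 ≤ N) {j : CurIndex I} (h : curDeg j ≤ -(N : ℤ)) :
    cur b d j ∈ Affine.filNeg d N := by
  rcases j with j | ⟨n, a⟩
  · change 0 ≤ -(N : ℤ) at h; omega
  · exact Affine.xt_mem_filNeg h _

lemma curDual_mem_filNeg {N : ℕ} (hN : 1 ≤ N) {j : CurIndex I} (h : (N : ℤ) ≤ curDeg j) :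
    curDual b d j ∈ Affine.filNeg d N := by
  rcases j with j | ⟨n, a⟩
  · change (N : ℤ) ≤ 0 at h; omega
  · exact Affine.xt_mem_filNeg (neg_le_neg h) _

lemma curDual_mem_filPos {N : ℕ} (hN : 1 ≤ N) {j : CurIndex I} (h : curDeg j ≤ -(N : ℤ)) :
    curDual b d j ∈ Affine.filPos d N := by
  rcases j with j | ⟨n, a⟩
  · change 0 ≤ -(N : ℤ) at h; omega
  · exact Affine.xt_mem_filPos (by change n ≤ _ at h; omega) _

/-- The pairing `(Φ | Ψ)` of fields. -/
def pair (Φ Ψ : Affine d →ₗ[ℂ] A) : A :=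
  ∑' j : CurIndex I, Φ (cur b d j) * Ψ (curDual b d j)

lemma summable_pair (hΦ : Φ ∈ modeFields Fil d) (hΨ : Ψ ∈ modeFields Fil d) :
    Summable fun j : CurIndex I => Φ (cur b d j) * Ψ (curDual b d j) := by
  refine Fil.summable fun n => ?_
  obtain ⟨N, h₁, h₂⟩ := hΦ n
  obtain ⟨M, h₃, h₄⟩ := hΨ n
  refine (finite_curDeg_lt (I := I) (N + M + 1)).subset fun j hj => ?_
  by_contra hlt
  simp only [Set.mem_ofPred_eq, not_lt] at hlt
  apply hj
  rcases le_total 0 (curDeg j) with h0 | h0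
  · have hp := h₁ _ (Affine.filPos_antitone (by omega) (cur_mem_filPos b (d := d) (j := j)
      (N := N + M + 1) (by omega) (by omega)))
    have hn := h₄ _ (Affine.filNeg_antitone (by omega) (curDual_mem_filNeg b (d := d) (j := j)
      (N := N + M + 1) (by omega) (by omega)))
    exact ⟨Ideal.mul_mem_right _ _ hp, Ideal.mul_mem_left _ _ hn⟩
  · have hp := h₂ _ (Affine.filNeg_antitone (by omega) (cur_mem_filNeg b (d := d) (j := j)
      (N := N + M + 1) (by omega) (by omega)))
    have hn := h₃ _ (Affine.filPos_antitone (by omega) (curDual_mem_filPos b (d := d) (j := j)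
      (N := N + M + 1) (by omega) (by omega)))
    exact ⟨Ideal.mul_mem_left _ _ hn, Ideal.mul_mem_right _ _ hp⟩

lemma hasSum_pair (hΦ : Φ ∈ modeFields Fil d) (hΨ : Ψ ∈ modeFields Fil d) :
    HasSum (fun j : CurIndex I => Φ (cur b d j) * Ψ (curDual b d j)) (pair b Φ Ψ) :=
  (summable_pair b hΦ hΨ).hasSum

lemma summable_loop (hΦ : Φ ∈ modeFields Fil d) (hΨ : Ψ ∈ modeFields Fil d) :
    Summable fun n : ℤ => ∑ a, Φ (Affine.xt d n (dualB d b a)) * Ψ (Affine.xt d (-n) (b a)) := by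
  have h := (summable_pair b hΦ hΨ).comp_injective Sum.inr_injective
  have h2 := h.prod
  simp only [tsum_fintype] at h2
  exact h2

/-- The pairing with its terms for `K`, for `D` and for the loop algebra separated. -/
lemma pair_eq (hΦ : Φ ∈ modeFields Fil d) (hΨ : Ψ ∈ modeFields Fil d) :
    pair b Φ Ψ = Φ (Affine.Kel d) * Ψ (Affine.Del d) + Φ (Affine.Del d) * Ψ (Affine.Kel d) +
      ∑' n : ℤ, ∑ a, Φ (Affine.xt d n (dualB d b a)) * Ψ (Affine.xt d (-n) (b a)) := by
  have h := (summable_pair b hΦ hΨ).comp_injective Sum.inr_injective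
  have h2 := h.tsum_prod
  simp only [tsum_fintype] at h2
  have h3 := HasSum.sum (M := A) (f := fun j : CurIndex I => Φ (cur b d j) * Ψ (curDual b d j))
    (hasSum_fintype _) h.hasSum
  rw [pair, h3.tsum_eq, h2, Fintype.sum_bool]
  rfl

variable (d Fil) in
/-- The pairing as a bilinear map. This rests on summability, which is why its arguments are
restricted to `modeFields`. -/
def pairL : modeFields Fil d →ₗ[ℂ] modeFields Fil d →ₗ[ℂ] A :=
  LinearMap.mk₂ ℂ (fun Φ Ψ => pair b Φ.1 Ψ.1)
    (fun Φ Φ' Ψ => by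
      refine HasSum.tsum_eq ?_
      convert (hasSum_pair b Φ.2 Ψ.2).add (hasSum_pair b Φ'.2 Ψ.2) using 2 with j
      exact add_mul _ _ _)
    (fun c Φ Ψ => by
      have h := (hasSum_pair b Φ.2 Ψ.2).mul_left (algebraMap ℂ A c)
      simp only [← Algebra.smul_def, ← smul_mul_assoc] at h
      exact h.tsum_eq)
    (fun Φ Ψ Ψ' => by
      refine HasSum.tsum_eq ?_
      convert (hasSum_pair b Φ.2 Ψ.2).add (hasSum_pair b Φ.2 Ψ'.2) using 2 with j
      exact mul_add _ _ _)
    (fun c Φ Ψ => by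
      have h := (hasSum_pair b Φ.2 Ψ.2).mul_left (algebraMap ℂ A c)
      simp only [← Algebra.smul_def, ← mul_smul_comm] at h
      exact h.tsum_eq)

lemma pairL_apply (Φ Ψ : modeFields Fil d) : pairL d b Fil Φ Ψ = pair b Φ.1 Ψ.1 := rfl

section FiniteDual

variable {M : Type*} [AddCommGroup M] [Module ℂ M]

lemma sum_form_smul_dualB (v : 𝔤) : ∑ c, d.form v (b c) • dualB d b c = v := by
  conv_rhs => rw [← (dualB d b).sum_repr v]
  exact Finset.sum_congr rfl fun c _ => by
    rw [dualB, LinearMap.BilinForm.dualBasis_repr_apply]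

lemma form_dualB_left (a c : I) : d.form (dualB d b a) (b c) = if c = a then 1 else 0 :=
  LinearMap.BilinForm.apply_dualBasis_left _ _ _ _

lemma repr_eq_form (v : 𝔤) (a : I) : b.repr v a = d.form (dualB d b a) v := by
  conv_rhs => rw [← b.sum_repr v]
  simp only [map_sum, map_smul, form_dualB_left, smul_eq_mul, mul_ite, mul_one, mul_zero,
    Finset.sum_ite_eq', Finset.mem_univ, if_true]

lemma sum_form_smul_basis (v : 𝔤) : ∑ a, d.form (dualB d b a) v • b a = v := by
  conv_rhs => rw [← b.sum_repr v]
  exact Finset.sum_congr rfl fun c _ => by rw [repr_eq_form]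

/-- Adjoint maps can be moved from one factor of the canonical element `∑ Iᵃ ⊗ I_a` to the other.
-/
lemma sum_dual_adjoint (β : 𝔤 →ₗ[ℂ] 𝔤 →ₗ[ℂ] M) {S S' : 𝔤 →ₗ[ℂ] 𝔤}
    (h : ∀ x y, d.form (S x) y = d.form x (S' y)) :
    ∑ a, β (S (dualB d b a)) (b a) = ∑ a, β (dualB d b a) (S' (b a)) := by
  have e1 : ∀ a, β (S (dualB d b a)) (b a)
      = ∑ c, d.form (dualB d b a) (S' (b c)) • β (dualB d b c) (b a) := by
    intro a
    conv_lhs => rw [← sum_form_smul_dualB b (d := d) (S (dualB d b a))]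
    simp only [map_sum, map_smul, LinearMap.sum_apply, LinearMap.smul_apply, h]
  simp only [e1]
  rw [Finset.sum_comm]
  refine Finset.sum_congr rfl fun c _ => ?_
  conv_rhs => rw [← sum_form_smul_basis b (d := d) (S' (b c))]
  simp only [map_sum, map_smul]

/-- The canonical element `∑ Iᵃ ⊗ I_a` is symmetric, because the form is. -/
lemma sum_dual_symm (β : 𝔤 →ₗ[ℂ] 𝔤 →ₗ[ℂ] M) :
    ∑ a, β (dualB d b a) (b a) = ∑ a, β (b a) (dualB d b a) := by
  have e1 : ∀ a, β (b a) (dualB d b a)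
      = ∑ c, d.form (b a) (b c) • β (dualB d b c) (dualB d b a) := by
    intro a
    conv_lhs => rw [← sum_form_smul_dualB b (d := d) (b a)]
    simp only [map_sum, map_smul, LinearMap.sum_apply, LinearMap.smul_apply]
  simp only [e1]
  rw [Finset.sum_comm]
  refine Finset.sum_congr rfl fun c _ => ?_
  conv_lhs => rw [← sum_form_smul_dualB b (d := d) (b c)]
  simp only [map_sum, map_smul]
  exact Finset.sum_congr rfl fun a _ => by rw [d.form_symm]

end FiniteDual

/-- The bilinear map `(x, y) ↦ Φ(x_m) Ψ(y_n)`. -/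
def modeMul (Φ Ψ : Affine d →ₗ[ℂ] A) (m n : ℤ) : 𝔤 →ₗ[ℂ] 𝔤 →ₗ[ℂ] A :=
  (LinearMap.mul ℂ A).compl₁₂ (Φ ∘ₗ Affine.xt d m) (Ψ ∘ₗ Affine.xt d n)

lemma modeMul_apply (m n : ℤ) (x y : 𝔤) :
    modeMul Φ Ψ m n x y = Φ (Affine.xt d m x) * Ψ (Affine.xt d n y) := rfl

lemma pair_symm (hΦ : Φ ∈ modeFields Fil d) (hΨ : Ψ ∈ modeFields Fil d) :
    pair b Φ Ψ = pair b Ψ Φ := by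
  rw [pair_eq b hΦ hΨ, pair_eq b hΨ hΦ]
  have e : ∑' n : ℤ, ∑ a, Φ (Affine.xt d n (dualB d b a)) * Ψ (Affine.xt d (-n) (b a))
      = ∑' n : ℤ, ∑ a, Ψ (Affine.xt d n (dualB d b a)) * Φ (Affine.xt d (-n) (b a)) := by
    rw [← (Equiv.neg ℤ).tsum_eq]
    refine tsum_congr fun n => ?_
    have h := sum_dual_symm b (d := d) (modeMul Ψ Φ n (-n))
    simp only [modeMul_apply] at h
    rw [h]
    simp only [Equiv.neg_apply, neg_neg]
    exact Finset.sum_congr rfl fun a _ => mul_comm _ _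
  rw [e]
  ring

/-- The pairing is invariant under `σ`, because the form on `𝔤` is. -/
lemma pair_twist (hΦ : Φ ∈ modeFields Fil d) (hΨ : Ψ ∈ modeFields Fil d) (k : ℤ) :
    pair b (twistField k Φ) Ψ = pair b Φ (twistField (-k) Ψ) := by
  rw [pair_eq b (twistField_mem hΦ k) hΨ, pair_eq b hΦ (twistField_mem hΨ (-k))]
  simp only [twistField, LinearMap.comp_apply, LinearEquiv.coe_coe, Affine.sigma_zpow_Kel,
    Affine.sigma_zpow_Del, Affine.sigma_zpow_xt]
  congr 1
  refine tsum_congr fun n => ?_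
  exact sum_dual_adjoint b (d := d) (modeMul Φ Ψ n (-n))
    (S := ((d.σ ^ k : 𝔤 ≃ₗ[ℂ] 𝔤) : 𝔤 →ₗ[ℂ] 𝔤)) (S' := ((d.σ ^ (-k) : 𝔤 ≃ₗ[ℂ] 𝔤) : 𝔤 →ₗ[ℂ] 𝔤))
    (d.form_σ_zpow k)

/-- The pairing is invariant under the adjoint action. For the action of a loop element the
brackets cancel by invariance of the form on `𝔤`, and the cocycle terms cancel the terms with
`[D, y_m]`. -/
lemma pair_adR (hΦ : Φ ∈ modeFields Fil d) (hΨ : Ψ ∈ modeFields Fil d) (Z : Affine d) :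
    pair b (Φ ∘ₗ Affine.adR Z) Ψ = -pair b Φ (Ψ ∘ₗ Affine.adR Z) := by
  induction Z using Affine.induction with
  | xt m y =>
    rw [pair_eq b (comp_adR_mem hΦ _) hΨ, pair_eq b hΦ (comp_adR_mem hΨ _)]
    have hc : ∀ n : ℤ, ∀ Θ : Affine d →ₗ[ℂ] A, ∀ x, Θ ⁅Affine.xt d n x, Affine.xt d m y⁆
        = Θ (Affine.xt d (n + m) ⁅x, y⁆)
          + (if n + m = 0 then (n : ℂ) * d.form x y else 0) • Θ (Affine.Kel d) := by
      intro n Θ x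
      rw [Affine.lie_xt_xt, map_add, map_smul]
    simp only [LinearMap.comp_apply, Affine.adR_apply, Affine.Kel_lie, map_zero, zero_mul, mul_zero,
      Affine.lie_Del_xt, map_smul, zero_add, add_zero, hc, add_mul, mul_add, Finset.sum_add_distrib]
    -- the two loop sums, split into bracket and cocycle parts
    have hL := summable_loop b (comp_adR_mem hΦ (Affine.xt d m y)) hΨ
    have hR := summable_loop b hΦ (comp_adR_mem hΨ (Affine.xt d m y))
    simp only [LinearMap.comp_apply, Affine.adR_apply, hc, add_mul, mul_add,
      Finset.sum_add_distrib] at hL hR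
    have eL : ∀ n : ℤ, (∑ a, (if n + m = 0 then (n : ℂ) * d.form (dualB d b a) y else 0) •
        Φ (Affine.Kel d) * Ψ (Affine.xt d (-n) (b a)))
        = if n = -m then -((m : ℂ) • (Φ (Affine.Kel d) * Ψ (Affine.xt d m y))) else 0 := by
      intro n
      by_cases h : n + m = 0
      · obtain rfl : n = -m := by omega
        simp only [h, if_true, neg_neg]
        have := sum_form_smul_basis b (d := d) y
        conv_rhs => rw [← this]
        simp only [map_sum, map_smul, Finset.mul_sum, Finset.smul_sum, ← Finset.sum_neg_distrib]
        refine Finset.sum_congr rfl fun a _ => ?_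
        rw [smul_mul_assoc, mul_smul_comm, smul_smul, ← neg_smul]
        push_cast
        rw [neg_mul]
      · rw [if_neg (by omega)]
        simp only [if_neg h, zero_smul, zero_mul, Finset.sum_const_zero]
    have eR : ∀ n : ℤ, (∑ a, Φ (Affine.xt d n (dualB d b a)) *
        ((if -n + m = 0 then ((-n : ℤ) : ℂ) * d.form (b a) y else 0) • Ψ (Affine.Kel d)))
        = if n = m then -((m : ℂ) • (Φ (Affine.xt d m y) * Ψ (Affine.Kel d))) else 0 := by
      intro n
      by_cases h : n = m
      · subst h
        simp only [neg_add_cancel, if_true]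
        have := sum_form_smul_dualB b (d := d) y
        conv_rhs => rw [← this]
        simp only [map_sum, map_smul, Finset.sum_mul, Finset.smul_sum, ← Finset.sum_neg_distrib]
        refine Finset.sum_congr rfl fun a _ => ?_
        rw [smul_mul_assoc, mul_smul_comm, smul_smul, ← neg_smul, d.form_symm]
        push_cast
        rw [neg_mul]
      · rw [if_neg h]
        simp only [if_neg (show ¬ -n + m = 0 by omega), zero_smul, mul_zero, Finset.sum_const_zero]
    simp only [eL] at hL ⊢
    simp only [eR] at hR ⊢
    have sL : Summable fun n : ℤ => if n = -m then
        -((m : ℂ) • (Φ (Affine.Kel d) * Ψ (Affine.xt d m y))) else 0 :=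
      (hasSum_ite_eq (-m) _).summable
    have sR : Summable fun n : ℤ => if n = m then
        -((m : ℂ) • (Φ (Affine.xt d m y) * Ψ (Affine.Kel d))) else 0 :=
      (hasSum_ite_eq m _).summable
    have hL' := hL.sub sL
    have hR' := hR.sub sR
    simp only [add_sub_cancel_right] at hL' hR'
    rw [hL'.tsum_add sL, hR'.tsum_add sR, tsum_ite_eq, tsum_ite_eq]
    have key : ∑' n : ℤ, ∑ a, Φ (Affine.xt d (n + m) ⁅dualB d b a, y⁆) * Ψ (Affine.xt d (-n) (b a))
        = -∑' n : ℤ, ∑ a, Φ (Affine.xt d n (dualB d b a)) * Ψ (Affine.xt d (-n + m) ⁅b a, y⁆) := by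
      rw [← (Equiv.addRight m).tsum_eq (fun n : ℤ => ∑ a, Φ (Affine.xt d n (dualB d b a)) *
        Ψ (Affine.xt d (-n + m) ⁅b a, y⁆)), ← tsum_neg]
      refine tsum_congr fun n => ?_
      have h := sum_dual_adjoint b (d := d) (modeMul Φ Ψ (n + m) (-n))
        (S := -(LieModule.toEnd ℂ 𝔤 𝔤 y)) (S' := LieModule.toEnd ℂ 𝔤 𝔤 y) (fun x z => by
          simp only [LinearMap.neg_apply, LieModule.toEnd_apply_apply]
          rw [lie_skew, d.form_invariant])
      simp only [modeMul_apply, LinearMap.neg_apply, LieModule.toEnd_apply_apply, lie_skew] at h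
      rw [h, ← Finset.sum_neg_distrib]
      refine Finset.sum_congr rfl fun a _ => ?_
      rw [Equiv.coe_addRight, show -(n + m) + m = -n by ring, ← lie_skew (b a) y, map_neg, map_neg,
        mul_neg, neg_neg]
    rw [key, smul_mul_assoc, mul_smul_comm]
    abel
  | K =>
    have h : Affine.adR (Affine.Kel d) = 0 := LinearMap.ext fun X => Affine.lie_Kel X
    simp [h, pair]
  | D =>
    rw [pair_eq b (comp_adR_mem hΦ _) hΨ, pair_eq b hΦ (comp_adR_mem hΨ _), neg_add, ← tsum_neg]
    simp only [LinearMap.comp_apply, Affine.adR_apply, Affine.Kel_lie, lie_self, map_zero, zero_mul,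
      mul_zero, add_zero, neg_zero, Affine.lie_xt_Del]
    congr 1
    refine tsum_congr fun n => ?_
    rw [← Finset.sum_neg_distrib]
    refine Finset.sum_congr rfl fun a _ => ?_
    simp
  | add Y Z hY hZ =>
    have h : Affine.adR (Y + Z) = Affine.adR Y + Affine.adR Z :=
      LinearMap.ext fun X => lie_add X Y Z
    have h1 := (pairL d b Fil).map_add₂ ⟨_, comp_adR_mem hΦ Y⟩ ⟨_, comp_adR_mem hΦ Z⟩ ⟨Ψ, hΨ⟩
    have h2 := (pairL d b Fil ⟨Φ, hΦ⟩).map_add ⟨_, comp_adR_mem hΨ Y⟩ ⟨_, comp_adR_mem hΨ Z⟩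
    simp only [pairL_apply, AddMemClass.mk_add_mk] at h1 h2
    rw [h, LinearMap.comp_add, LinearMap.comp_add, h1, h2, hY, hZ, neg_add]
  | smul c Z hZ =>
    have h : Affine.adR (c • Z) = c • Affine.adR Z :=
      LinearMap.ext fun X => lie_smul c X Z
    have h1 := (pairL d b Fil).map_smul₂ c ⟨_, comp_adR_mem hΦ Z⟩ ⟨Ψ, hΨ⟩
    have h2 := (pairL d b Fil ⟨Φ, hΦ⟩).map_smul c ⟨_, comp_adR_mem hΨ Z⟩
    simp only [pairL_apply, SetLike.mk_smul_mk] at h1 h2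
    rw [h, LinearMap.comp_smul, LinearMap.comp_smul, h1, h2, hZ, smul_neg]

lemma pair_self_adR (hΦ : Φ ∈ modeFields Fil d) (Z : Affine d) :
    pair b Φ (Φ ∘ₗ Affine.adR Z) = 0 := by
  have h := pair_adR b hΦ hΦ Z
  rw [pair_symm b (comp_adR_mem hΦ Z) hΦ] at h
  have h2 : (2 : ℂ) • pair b Φ (Φ ∘ₗ Affine.adR Z) = 0 := by
    rw [two_smul]; nth_rewrite 1 [h]; exact neg_add_cancel _
  exact (smul_eq_zero.mp h2).resolve_left two_ne_zero

end Pairing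

/-! ### Poisson brackets with quadratic expressions in fields -/

/-- A skew-symmetric biderivation, continuous in each argument. -/
structure ContBracket (A : Type*) [CommRing A] [Algebra ℂ A] [TopologicalSpace A] where
  br : A →ₗ[ℂ] A →ₗ[ℂ] A
  skew : ∀ f g, br f g = -br g f
  leibniz : ∀ f g h, br f (g * h) = g * br f h + h * br f g
  continuous : ∀ f, Continuous (br f)

section Bracket

variable {𝔤 : Type*} [LieRing 𝔤] [LieAlgebra ℂ 𝔤] {d : DihedralData 𝔤}
variable {I : Type*} [Fintype I] [DecidableEq I] (b : Module.Basis I ℂ 𝔤)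
variable {A : Type*} [CommRing A] [Algebra ℂ A] [UniformSpace A] [IsUniformAddGroup A]
  [IsTopologicalRing A] [CompleteSpace A] [T2Space A] {Fil : ModeFiltration A}
  (B : ContBracket A) {Φ Ψ Ξ Ξ' : Affine d →ₗ[ℂ] A}

/-- The Leibniz rule for the pairing; continuity of the bracket allows its termwise application.
-/
lemma ContBracket.br_pair (hΦ : Φ ∈ modeFields Fil d) (hΨ : Ψ ∈ modeFields Fil d)
    (hΞ : Ξ ∈ modeFields Fil d) (hΞ' : Ξ' ∈ modeFields Fil d) {f : A}
    (h : ∀ X, B.br f (Φ X) = Ξ X) (h' : ∀ X, B.br f (Ψ X) = Ξ' X) :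
    B.br f (pair b Φ Ψ) = pair b Ξ Ψ + pair b Φ Ξ' := by
  have h1 := (hasSum_pair b hΦ hΨ).map (B.br f) (B.continuous f)
  have h2 := (hasSum_pair b hΞ hΨ).add (hasSum_pair b hΦ hΞ')
  refine h1.unique ?_
  convert h2 using 2 with j
  rw [Function.comp_apply, B.leibniz, h, h']
  ring

lemma lie_curDual_mem_filPos {M N : ℕ} (hN : 1 ≤ N) {j : CurIndex I}
    (h : (N : ℤ) + curDeg j ≤ M) {X : Affine d} (hX : X ∈ Affine.filPos d M) :
    ⁅X, curDual b d j⁆ ∈ Affine.filPos d N := by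
  rcases j with (_ | _) | ⟨n, a⟩
  · change ⁅X, Affine.Kel d⁆ ∈ _
    rw [Affine.lie_Kel]
    exact ⟨rfl, rfl, fun _ _ => rfl⟩
  · exact Affine.filPos_antitone (by change (N : ℤ) + 0 ≤ _ at h; omega)
      (Affine.lie_Del_mem_filPos hX)
  · exact Affine.lie_xt_mem_filPos hN (by change (N : ℤ) + n ≤ _ at h; omega) _ hX

lemma lie_curDual_mem_filNeg {M N : ℕ} (hN : 1 ≤ N) {j : CurIndex I}
    (h : (N : ℤ) - curDeg j ≤ M) {X : Affine d} (hX : X ∈ Affine.filNeg d M) :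
    ⁅X, curDual b d j⁆ ∈ Affine.filNeg d N := by
  rcases j with (_ | _) | ⟨n, a⟩
  · change ⁅X, Affine.Kel d⁆ ∈ _
    rw [Affine.lie_Kel]
    exact ⟨rfl, rfl, fun _ _ => rfl⟩
  · exact Affine.filNeg_antitone (by change (N : ℤ) - 0 ≤ _ at h; omega)
      (Affine.lie_Del_mem_filNeg hX)
  · exact Affine.lie_xt_mem_filNeg hN (by change (N : ℤ) - n ≤ _ at h; omega) _ hX

/-- If the modes of `Λ` evolve under `f` by `{f, Λ(Y)} = (N | Λ([·, Y]))`, the evolved modes again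
tend to zero. -/
lemma br_comp_mem {Λ N : Affine d →ₗ[ℂ] A} (hΛ : Λ ∈ modeFields Fil d)
    (hN : N ∈ modeFields Fil d) {f : A}
    (h : ∀ Y, B.br f (Λ Y) = pair b N (Λ ∘ₗ Affine.adR Y)) :
    B.br f ∘ₗ Λ ∈ modeFields Fil d := by
  intro n
  obtain ⟨N₁, h₁, h₂⟩ := hΛ n
  obtain ⟨N₂, h₃, h₄⟩ := hN n
  have hsum := fun Y => hasSum_pair b hN (comp_adR_mem hΛ Y)
  refine ⟨N₁ + N₂ + 2, fun Y hY => ?_, fun Y hY => ?_⟩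
  · rw [LinearMap.comp_apply, h]
    refine (Fil.isClosed_pos n).mem_of_tendsto (hsum Y) (Eventually.of_forall fun s => ?_)
    refine Ideal.sum_mem _ fun j _ => ?_
    rw [LinearMap.comp_apply, Affine.adR_apply, ← lie_skew, map_neg]
    rcases le_total (curDeg j) (N₂ + 1) with hj | hj
    · refine Ideal.mul_mem_left _ _ (neg_mem (h₁ _ ?_))
      exact Affine.filPos_antitone (Nat.le_succ N₁)
        (lie_curDual_mem_filPos b (by omega) (by omega) hY)
    · refine Ideal.mul_mem_right _ _ (h₃ _ ?_)
      exact Affine.filPos_antitone (Nat.le_succ N₂) (cur_mem_filPos b (by omega) (by omega))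
  · rw [LinearMap.comp_apply, h]
    refine (Fil.isClosed_neg n).mem_of_tendsto (hsum Y) (Eventually.of_forall fun s => ?_)
    refine Ideal.sum_mem _ fun j _ => ?_
    rw [LinearMap.comp_apply, Affine.adR_apply, ← lie_skew, map_neg]
    rcases le_total (-(N₂ + 1 : ℤ)) (curDeg j) with hj | hj
    · refine Ideal.mul_mem_left _ _ (neg_mem (h₂ _ ?_))
      exact Affine.filNeg_antitone (Nat.le_succ N₁)
        (lie_curDual_mem_filNeg b (by omega) (by omega) hY)
    · refine Ideal.mul_mem_right _ _ (h₄ _ ?_)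
      exact Affine.filNeg_antitone (Nat.le_succ N₂) (cur_mem_filNeg b (by omega) (by omega))

/-- The triple products of modes whose degrees add up to zero are summable. -/
lemma summable_triple {Λ N : Affine d →ₗ[ℂ] A} (hΛ : Λ ∈ modeFields Fil d)
    (hN : N ∈ modeFields Fil d) :
    Summable fun q : CurIndex I × CurIndex I =>
      Λ (cur b d q.1) * (N (cur b d q.2) * Λ ⁅curDual b d q.2, curDual b d q.1⁆) := by
  refine Fil.summable fun n => ?_
  obtain ⟨N₁, h₁, h₂⟩ := hΛ n
  obtain ⟨N₂, h₃, h₄⟩ := hN n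
  set M := N₁ + N₂ + 1 with hM
  refine (((finite_curDeg_lt (I := I) (2 * M)).prod (finite_curDeg_lt (I := I) (2 * M)))).subset ?_
  rintro ⟨i, j⟩ hij
  by_contra hlt
  simp only [Set.mem_prod, Set.mem_ofPred_eq, not_and_or, not_lt] at hlt
  apply hij
  -- every factor with degree at least `M` in absolute value is small
  have pi : (M : ℤ) ≤ curDeg i → Λ (cur b d i) ∈ Fil.pos n := fun h =>
    h₁ _ (Affine.filPos_antitone (by omega) (cur_mem_filPos b (N := M) (by omega) h))
  have ni : curDeg i ≤ -(M : ℤ) → Λ (cur b d i) ∈ Fil.neg n := fun h =>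
    h₂ _ (Affine.filNeg_antitone (by omega) (cur_mem_filNeg b (N := M) (by omega) h))
  have pj : (M : ℤ) ≤ curDeg j → N (cur b d j) ∈ Fil.pos n := fun h =>
    h₃ _ (Affine.filPos_antitone (by omega) (cur_mem_filPos b (N := M) (by omega) h))
  have nj : curDeg j ≤ -(M : ℤ) → N (cur b d j) ∈ Fil.neg n := fun h =>
    h₄ _ (Affine.filNeg_antitone (by omega) (cur_mem_filNeg b (N := M) (by omega) h))
  have pij : curDeg i + curDeg j ≤ -(M : ℤ) →
      Λ ⁅curDual b d j, curDual b d i⁆ ∈ Fil.pos n := fun h => by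
    refine h₁ _ (Affine.filPos_antitone (show N₁ ≤ M by omega) ?_)
    rcases le_total (curDeg i) (curDeg j) with hle | hle
    · have := lie_curDual_mem_filPos b (d := d) (N := M) (M := (curDeg i).natAbs) (by omega)
        (j := j) (by omega) (curDual_mem_filPos b (j := i) (by omega) (by omega))
      rw [← lie_skew]
      exact Affine.neg_mem_filPos this
    · exact lie_curDual_mem_filPos b (d := d) (N := M) (M := (curDeg j).natAbs) (by omega)
        (j := i) (by omega) (curDual_mem_filPos b (j := j) (by omega) (by omega))
  have nij : (M : ℤ) ≤ curDeg i + curDeg j →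
      Λ ⁅curDual b d j, curDual b d i⁆ ∈ Fil.neg n := fun h => by
    refine h₂ _ (Affine.filNeg_antitone (show N₁ ≤ M by omega) ?_)
    rcases le_total (curDeg j) (curDeg i) with hle | hle
    · have := lie_curDual_mem_filNeg b (d := d) (N := M) (M := (curDeg i).natAbs) (by omega)
        (j := j) (by omega) (curDual_mem_filNeg b (j := i) (by omega) (by omega))
      rw [← lie_skew]
      exact Affine.neg_mem_filNeg this
    · exact lie_curDual_mem_filNeg b (d := d) (N := M) (M := (curDeg j).natAbs) (by omega)
        (j := i) (by omega) (curDual_mem_filNeg b (j := j) (by omega) (by omega))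
  have hpos : (M : ℤ) ≤ curDeg i ∨ (M : ℤ) ≤ curDeg j ∨ curDeg i + curDeg j ≤ -(M : ℤ) := by omega
  have hneg : curDeg i ≤ -(M : ℤ) ∨ curDeg j ≤ -(M : ℤ) ∨ (M : ℤ) ≤ curDeg i + curDeg j := by omega
  constructor
  · rcases hpos with h | h | h
    · exact Ideal.mul_mem_right _ _ (pi h)
    · exact Ideal.mul_mem_left _ _ (Ideal.mul_mem_right _ _ (pj h))
    · exact Ideal.mul_mem_left _ _ (Ideal.mul_mem_left _ _ (pij h))
  · rcases hneg with h | h | h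
    · exact Ideal.mul_mem_right _ _ (ni h)
    · exact Ideal.mul_mem_left _ _ (Ideal.mul_mem_right _ _ (nj h))
    · exact Ideal.mul_mem_left _ _ (Ideal.mul_mem_left _ _ (nij h))

/-- A Lax equation implies the conservation of the quadratic invariant `(Λ | Λ)`: after exchanging
the order of summation in `(Λ | (N | [Λ, ·]))`, the sum that belongs to a fixed mode of `N` is a
multiple of `(Λ | Λ ∘ ad Z)`, which vanishes by invariance. -/
lemma br_pair_self_of_lax {Λ N : Affine d →ₗ[ℂ] A} (hΛ : Λ ∈ modeFields Fil d)
    (hN : N ∈ modeFields Fil d) {f : A}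
    (h : ∀ Y, B.br f (Λ Y) = pair b N (Λ ∘ₗ Affine.adR Y)) :
    B.br f (pair b Λ Λ) = 0 := by
  have hΞ := br_comp_mem b B hΛ hN h
  rw [B.br_pair b hΛ hΛ hΞ hΞ (fun _ => rfl) (fun _ => rfl), pair_symm b hΞ hΛ]
  have h0 : pair b Λ (B.br f ∘ₗ Λ) = 0 := by
    have hs := summable_triple b hΛ hN
    have e1 : pair b Λ (B.br f ∘ₗ Λ) = ∑' i : CurIndex I, ∑' j : CurIndex I,
        Λ (cur b d i) * (N (cur b d j) * Λ ⁅curDual b d j, curDual b d i⁆) := by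
      rw [pair]
      refine tsum_congr fun i => ?_
      rw [LinearMap.comp_apply, h]
      exact ((hasSum_pair b hN (comp_adR_mem hΛ _)).mul_left _).tsum_eq.symm
    rw [e1, ← hs.tsum_comm (f := fun i j => Λ (cur b d i) *
      (N (cur b d j) * Λ ⁅curDual b d j, curDual b d i⁆))]
    refine (tsum_congr fun j => ?_).trans tsum_zero
    have h2 := (hasSum_pair b hΛ (comp_adR_mem hΛ (curDual b d j))).mul_left (-N (cur b d j))
    rw [pair_self_adR b hΛ, mul_zero] at h2
    refine Eq.trans (tsum_congr fun i => ?_) h2.tsum_eq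
    rw [LinearMap.comp_apply, Affine.adR_apply, ← lie_skew (curDual b d i), map_neg]
    ring
  rw [h0, add_zero]

end Bracket

/-! ### Laurent expansions of vector-valued rational functions -/

section Expansion

open Polynomial

/-- The Laurent series `r` is the image of a rational function with values `f z`, under the
extension to rational functions of the morphism `θ`. -/
def Represents (θ : ℂ[X] →ₐ[ℂ] LaurentSeries ℂ) (f : ℂ → ℂ) (r : LaurentSeries ℂ) : Prop :=
  ∃ N D : ℂ[X], D ≠ 0 ∧ r * θ D = θ N ∧ ∀ z, D.eval z ≠ 0 → f z * D.eval z = N.eval z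

variable {θ : ℂ[X] →ₐ[ℂ] LaurentSeries ℂ} {f g : ℂ → ℂ} {r s : LaurentSeries ℂ}

lemma Represents.add (hf : Represents θ f r) (hg : Represents θ g s) :
    Represents θ (fun z => f z + g z) (r + s) := by
  obtain ⟨N, D, hD, hr, h⟩ := hf
  obtain ⟨N', D', hD', hs, h'⟩ := hg
  refine ⟨N * D' + N' * D, D * D', mul_ne_zero hD hD', ?_, fun z hz => ?_⟩
  · simp only [map_mul, map_add]
    linear_combination θ D' * hr + θ D * hs
  · rw [eval_mul] at hz
    have h1 := h z (left_ne_zero_of_mul hz)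
    have h2 := h' z (right_ne_zero_of_mul hz)
    simp only [eval_mul, eval_add]
    linear_combination D'.eval z * h1 + D.eval z * h2

lemma Represents.mul (hf : Represents θ f r) (hg : Represents θ g s) :
    Represents θ (fun z => f z * g z) (r * s) := by
  obtain ⟨N, D, hD, hr, h⟩ := hf
  obtain ⟨N', D', hD', hs, h'⟩ := hg
  refine ⟨N * N', D * D', mul_ne_zero hD hD', ?_, fun z hz => ?_⟩
  · simp only [map_mul]
    linear_combination s * θ D' * hr + θ N * hs
  · rw [eval_mul] at hz
    have h1 := h z (left_ne_zero_of_mul hz)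
    have h2 := h' z (right_ne_zero_of_mul hz)
    simp only [eval_mul]
    linear_combination (g z * D'.eval z) * h1 + N.eval z * h2

lemma Represents.eval (N : ℂ[X]) : Represents θ (fun z => N.eval z) (θ N) :=
  ⟨N, 1, one_ne_zero, by simp, fun z _ => by simp⟩

lemma Represents.const_mul (hf : Represents θ f r) (c : ℂ) :
    Represents θ (fun z => c * f z) (c • r) := by
  have h := (Represents.eval (θ := θ) (C c)).mul hf
  simp only [eval_C] at h
  convert h using 1
  rw [Polynomial.C_eq_algebraMap, AlgHom.commutes, LaurentSeries.algebraMap_apply,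
    HahnSeries.C_mul_eq_smul]

/-- If a function that vanishes at almost all points represents a Laurent series, the series
vanishes. -/
lemma Represents.eq_zero (hθ : Function.Injective θ) (hf : Represents θ f r)
    (h : ∀ᶠ z in cofinite, f z = 0) : r = 0 := by
  obtain ⟨N, D, hD, hr, hfD⟩ := hf
  have hN : N = 0 := by
    by_contra hN
    have h1 : ∀ᶠ z in cofinite, N.eval z ≠ 0 := by
      refine (N.rootSet_finite ℂ).subset fun z hz => ?_
      rw [mem_rootSet]
      exact ⟨hN, by simpa using hz⟩
    have h2 : ∀ᶠ z in cofinite, D.eval z ≠ 0 := by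
      refine (D.rootSet_finite ℂ).subset fun z hz => ?_
      rw [mem_rootSet]
      exact ⟨hD, by simpa using hz⟩
    obtain ⟨z, hz, hz1, hz2⟩ := (h.and (h1.and h2)).exists
    exact hz1 (by rw [← hfD z hz2, hz, zero_mul])
  rw [hN, map_zero] at hr
  exact (mul_eq_zero.mp hr).resolve_right ((map_ne_zero_iff θ hθ).mpr hD)

variable {V W U : Type*} [AddCommGroup V] [Module ℂ V] [AddCommGroup W] [Module ℂ W]
  [AddCommGroup U] [Module ℂ U]

/-- `HasExpansion θ F a` says that the function `F` is a finite sum of vectors multiplied with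
rational functions, and that its expansion `∑ₙ a n uⁿ`, in the sense of `θ`, has coefficients
`a`. -/
inductive HasExpansion (θ : ℂ[X] →ₐ[ℂ] LaurentSeries ℂ) : (ℂ → V) → (ℤ → V) → Prop
  | smul {f : ℂ → ℂ} {r : LaurentSeries ℂ} (h : Represents θ f r) (v : V) :
      HasExpansion θ (fun z => f z • v) (fun n => r.coeff n • v)
  | add {F G : ℂ → V} {a c : ℤ → V} (hF : HasExpansion θ F a) (hG : HasExpansion θ G c) :
      HasExpansion θ (fun z => F z + G z) (fun n => a n + c n)

namespace HasExpansion

variable {F G : ℂ → V} {a c : ℤ → V}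

lemma congr_fun (hF : HasExpansion θ F a) (h : ∀ z, G z = F z) : HasExpansion θ G a :=
  (funext h : G = F) ▸ hF

lemma zero : HasExpansion θ (fun _ => (0 : V)) (fun _ => 0) := by
  simpa using HasExpansion.smul (Represents.eval (θ := θ) 0) (0 : V)

lemma map (hF : HasExpansion θ F a) (T : V →ₗ[ℂ] W) :
    HasExpansion θ (fun z => T (F z)) (fun n => T (a n)) := by
  induction hF with
  | smul h v => simpa only [map_smul] using HasExpansion.smul h (T v)
  | add hF hG ihF ihG => simpa only [map_add] using ihF.add ihG

lemma const_smul (hF : HasExpansion θ F a) (k : ℂ) :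
    HasExpansion θ (fun z => k • F z) (fun n => k • a n) :=
  hF.map (k • LinearMap.id)

lemma neg (hF : HasExpansion θ F a) : HasExpansion θ (fun z => -F z) (fun n => -a n) :=
  hF.map (-LinearMap.id)

lemma sub (hF : HasExpansion θ F a) (hG : HasExpansion θ G c) :
    HasExpansion θ (fun z => F z - G z) (fun n => a n - c n) := by
  simpa only [sub_eq_add_neg] using hF.add hG.neg

lemma sum {ι : Type*} {S : Finset ι} {F : ι → ℂ → V} {a : ι → ℤ → V}
    (h : ∀ i ∈ S, HasExpansion θ (F i) (a i)) :
    HasExpansion θ (fun z => ∑ i ∈ S, F i z) (fun n => ∑ i ∈ S, a i n) := by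
  classical
  induction S using Finset.induction_on with
  | empty => simpa using zero
  | insert i S hi ih =>
    simp only [Finset.sum_insert hi]
    exact (h i (Finset.mem_insert_self i S)).add
      (ih fun j hj => h j (Finset.mem_insert_of_mem hj))

lemma exists_bound (hF : HasExpansion θ F a) : ∃ N : ℤ, ∀ n < N, a n = 0 := by
  induction hF with
  | @smul f r h v =>
    refine ⟨r.order, fun n hn => ?_⟩
    change r.coeff n • v = 0
    rw [HahnSeries.coeff_eq_zero_of_lt_order hn, zero_smul]
  | @add F G a c hF hG ihF ihG =>
    obtain ⟨N, hN⟩ := ihF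
    obtain ⟨M, hM⟩ := ihG
    exact ⟨min N M, fun n hn => by
      change a n + c n = 0
      rw [hN n (lt_of_lt_of_le hn (min_le_left _ _)), hM n (lt_of_lt_of_le hn (min_le_right _ _)),
        add_zero]⟩

lemma exists_represents (hF : HasExpansion θ F a) (T : V →ₗ[ℂ] ℂ) :
    ∃ r, Represents θ (fun z => T (F z)) r ∧ ∀ n, r.coeff n = T (a n) := by
  induction hF with
  | @smul f r h v =>
    refine ⟨T v • r, ?_, fun n => ?_⟩
    · convert h.const_mul (T v) using 2 with z
      rw [map_smul, smul_eq_mul, mul_comm]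
    · rw [map_smul, HahnSeries.coeff_smul, smul_eq_mul, smul_eq_mul, mul_comm]
  | add hF hG ihF ihG =>
    obtain ⟨r, hr, hr'⟩ := ihF
    obtain ⟨s, hs, hs'⟩ := ihG
    refine ⟨r + s, ?_, fun n => ?_⟩
    · simpa only [map_add] using hr.add hs
    · rw [HahnSeries.coeff_add, hr', hs', map_add]

/-- Uniqueness of the coefficients of an expansion. -/
lemma unique (hθ : Function.Injective θ) (hF : HasExpansion θ F a) (hG : HasExpansion θ G c)
    (h : ∀ᶠ z in cofinite, F z = G z) (n : ℤ) : a n = c n := by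
  rw [← sub_eq_zero, ← Module.forall_dual_apply_eq_zero_iff ℂ]
  intro T
  obtain ⟨r, hr, hr'⟩ := (hF.sub hG).exists_represents T
  rw [← hr' n, hr.eq_zero hθ (h.mono fun z hz => by rw [hz, sub_self, map_zero])]
  rfl

lemma coeff_mul_eq_finsum (r s : LaurentSeries ℂ) (n : ℤ) :
    (r * s).coeff n = ∑ᶠ i : ℤ, r.coeff i * s.coeff (n - i) := by
  classical
  rw [HahnSeries.coeff_mul]
  set S := Finset.antidiagonal r.isPWO_support s.isPWO_support n with hS
  have hmem : ∀ q : ℤ × ℤ, q ∈ S ↔ r.coeff q.1 ≠ 0 ∧ s.coeff q.2 ≠ 0 ∧ q.1 + q.2 = n := by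
    intro q
    rw [hS, Finset.mem_antidiagonal]
    rfl
  rw [finsum_eq_sum_of_support_subset (s := S.image Prod.fst), Finset.sum_image]
  · refine Finset.sum_congr rfl fun q hq => ?_
    rw [← ((hmem q).mp hq).2.2, add_sub_cancel_left]
  · intro q hq q' hq' h
    have h1 := ((hmem q).mp hq).2.2
    have h2 := ((hmem q').mp hq').2.2
    exact Prod.ext h (by omega)
  · intro i hi
    have h1 := left_ne_zero_of_mul hi
    have h2 := right_ne_zero_of_mul hi
    rw [Finset.coe_image]
    exact ⟨(i, n - i), (hmem _).mpr ⟨h1, h2, by simp⟩, rfl⟩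

lemma finite_support_of_bounds {a : ℤ → V} {c : ℤ → W} {N M : ℤ} (ha : ∀ n < N, a n = 0)
    (hc : ∀ n < M, c n = 0) (n : ℤ) (β : V → W → U) (hβ : ∀ v w, v = 0 ∨ w = 0 → β v w = 0) :
    (Function.support fun i => β (a i) (c (n - i))).Finite := by
  refine (Set.finite_Icc N (n - M)).subset fun i hi => ?_
  by_contra h
  apply hi
  refine hβ _ _ ?_
  rw [Set.mem_Icc, not_and_or, not_le, not_le] at h
  rcases h with h | h
  · exact Or.inl (ha i h)
  · exact Or.inr (hc _ (by omega))

lemma fun_smul (hf : Represents θ f r) (hF : HasExpansion θ F a) :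
    HasExpansion θ (fun z => f z • F z) (fun n => ∑ᶠ i : ℤ, r.coeff i • a (n - i)) := by
  induction hF with
  | @smul g s h v =>
    convert HasExpansion.smul (hf.mul h) v using 2 with z n
    · rw [mul_smul]
    · rw [coeff_mul_eq_finsum, finsum_smul]
      exact finsum_congr fun i => (mul_smul _ _ _).symm
  | @add F G a c hF hG ihF ihG =>
    have hr : ∀ n < r.order, r.coeff n = 0 := fun n hn =>
      HahnSeries.coeff_eq_zero_of_lt_order hn
    obtain ⟨N, hN⟩ := hF.exists_bound
    obtain ⟨M, hM⟩ := hG.exists_bound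
    convert ihF.add ihG using 2 with z n
    · rw [smul_add]
    · rw [← finsum_add_distrib
        (finite_support_of_bounds hr hN n (fun x v => x • v) (by rintro x v (rfl | rfl) <;> simp))
        (finite_support_of_bounds hr hM n (fun x v => x • v) (by rintro x v (rfl | rfl) <;> simp))]
      exact finsum_congr fun i => smul_add _ _ _

/-- Expansions can be multiplied: the coefficients of a product are the convolutions, which are
finite sums because expansions are bounded below. -/
lemma bilin {G : ℂ → W} {c : ℤ → W} (hF : HasExpansion θ F a) (hG : HasExpansion θ G c)
    (β : V →ₗ[ℂ] W →ₗ[ℂ] U) :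
    HasExpansion θ (fun z => β (F z) (G z)) (fun n => ∑ᶠ i : ℤ, β (a i) (c (n - i))) := by
  induction hF with
  | @smul g s h v =>
    simpa only [map_smul, LinearMap.smul_apply] using fun_smul h (hG.map (β v))
  | @add F F' a a' hF hF' ihF ihF' =>
    obtain ⟨N, hN⟩ := hF.exists_bound
    obtain ⟨N', hN'⟩ := hF'.exists_bound
    obtain ⟨M, hM⟩ := hG.exists_bound
    convert ihF.add ihF' using 2 with z n
    · rw [map_add, LinearMap.add_apply]
    · rw [← finsum_add_distrib
        (finite_support_of_bounds hN hM n (fun x v => β x v) (by rintro x v (rfl | rfl) <;> simp))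
        (finite_support_of_bounds hN' hM n (fun x v => β x v)
          (by rintro x v (rfl | rfl) <;> simp))]
      exact finsum_congr fun i => by rw [map_add, LinearMap.add_apply]

end HasExpansion

/-! ### Expansions of powers of linear functions -/

lemma aeval_laurent_injective {t : LaurentSeries ℂ} (ht : ∀ c : ℂ, t ≠ HahnSeries.C c) :
    Function.Injective (aeval t : ℂ[X] →ₐ[ℂ] LaurentSeries ℂ) := by
  rw [injective_iff_map_eq_zero]
  intro p hp
  by_contra hp0
  have hint : IsIntegral ℂ t := isAlgebraic_iff_isIntegral.mp ⟨p, hp0, hp⟩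
  obtain ⟨c, hc⟩ : ∃ c : ℂ, algebraMap ℂ (LaurentSeries ℂ) c = t := by
    have := minpoly.mem_range_of_degree_eq_one ℂ t
      (IsAlgClosed.degree_eq_one_of_irreducible ℂ (minpoly.irreducible hint))
    exact this
  exact ht c (by rw [← hc, LaurentSeries.algebraMap_apply])

/-- Expansion at the point `x`, in powers of `u = z - x`. -/
def expandAt (x : ℂ) : ℂ[X] →ₐ[ℂ] LaurentSeries ℂ := aeval (HahnSeries.C x + HahnSeries.single 1 1)

/-- Expansion at infinity, in powers of `u = 1 / z`. -/
def expandInf : ℂ[X] →ₐ[ℂ] LaurentSeries ℂ := aeval (HahnSeries.single (-1) 1)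

lemma expandAt_injective (x : ℂ) : Function.Injective (expandAt x) := by
  refine aeval_laurent_injective fun c h => ?_
  have h1 := congrArg (fun r => HahnSeries.coeff r (1 : ℤ)) h
  simp [HahnSeries.C_apply, HahnSeries.coeff_single_of_ne (show (1 : ℤ) ≠ 0 by norm_num)] at h1

lemma expandInf_injective : Function.Injective expandInf := by
  refine aeval_laurent_injective fun c h => ?_
  have h1 := congrArg (fun r => HahnSeries.coeff r (-1 : ℤ)) h
  simp [HahnSeries.C_apply, HahnSeries.coeff_single_of_ne (show (-1 : ℤ) ≠ 0 by norm_num)] at h1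

lemma expandAt_X_sub_C (x c : ℂ) :
    expandAt x (X - C c) = HahnSeries.ofPowerSeries ℤ ℂ (PowerSeries.X + PowerSeries.C (x - c)) := by
  rw [expandAt, map_sub, aeval_X, aeval_C, map_add, HahnSeries.ofPowerSeries_X,
    HahnSeries.ofPowerSeries_C, LaurentSeries.algebraMap_apply, RingHom.map_sub]
  ring

lemma represents_inv_pow {r : LaurentSeries ℂ} {c : ℂ} {q : ℕ}
    (h : r * θ (X - C c) ^ (q + 1) = 1) : Represents θ (fun z => ((z - c) ^ (q + 1))⁻¹) r := by
  refine ⟨1, (X - C c) ^ (q + 1), pow_ne_zero _ (X_sub_C_ne_zero c), by simpa using h,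
    fun z hz => ?_⟩
  simp only [eval_pow, eval_sub, eval_X, eval_C, eval_one] at hz ⊢
  exact inv_mul_cancel₀ hz

lemma represents_polar (x : ℂ) (q : ℕ) :
    Represents (expandAt x) (fun z => ((z - x) ^ (q + 1))⁻¹) (HahnSeries.single (-(q + 1 : ℤ)) 1) := by
  refine represents_inv_pow ?_
  rw [expandAt_X_sub_C, sub_self, map_zero, add_zero, HahnSeries.ofPowerSeries_X,
    HahnSeries.single_pow, HahnSeries.single_mul_single]
  simp

lemma exists_represents_regular {x c : ℂ} (hxc : x ≠ c) (q : ℕ) :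
    ∃ r, Represents (expandAt x) (fun z => ((z - c) ^ (q + 1))⁻¹) r ∧ (∀ n < 0, r.coeff n = 0) ∧
      ∀ n : ℕ, r.coeff n = (Nat.choose (q + n) n : ℂ) * (-1) ^ n / (x - c) ^ (q + n + 1) := by
  have he : x - c ≠ 0 := sub_ne_zero.mpr hxc
  let g : ℕ → PowerSeries ℂ := fun q => PowerSeries.mk fun n =>
    (Nat.choose (q + n) n : ℂ) * (-1) ^ n / (x - c) ^ (q + n + 1)
  have g0 : g 0 * (PowerSeries.X + PowerSeries.C (x - c)) = 1 := by
    ext n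
    rw [mul_add, map_add, PowerSeries.coeff_mul_C, PowerSeries.coeff_one]
    rcases n with _ | n
    · rw [PowerSeries.coeff_zero_mul_X]
      simp [g, he]
    · rw [PowerSeries.coeff_succ_mul_X]
      simp only [g, PowerSeries.coeff_mk, zero_add, Nat.choose_self, Nat.cast_one, one_mul]
      rw [if_neg (Nat.succ_ne_zero n)]
      field_simp
      ring
  have gs : ∀ q, g (q + 1) * (PowerSeries.X + PowerSeries.C (x - c)) = g q := by
    intro q
    ext n
    rw [mul_add, map_add, PowerSeries.coeff_mul_C]
    rcases n with _ | n
    · rw [PowerSeries.coeff_zero_mul_X]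
      simp only [g, PowerSeries.coeff_mk, Nat.choose_zero_right, Nat.cast_one, pow_zero, add_zero]
      field_simp
      ring
    · rw [PowerSeries.coeff_succ_mul_X]
      simp only [g, PowerSeries.coeff_mk]
      have h : (Nat.choose (q + 1 + (n + 1)) (n + 1) : ℂ)
          = Nat.choose (q + 1 + n) n + Nat.choose (q + (n + 1)) (n + 1) := by
        rw [show q + 1 + (n + 1) = (q + 1 + n) + 1 by ring, Nat.choose_succ_succ,
          show q + 1 + n = q + (n + 1) by ring]
        push_cast; ring
      rw [h]
      field_simp
      ring
  refine ⟨HahnSeries.ofPowerSeries ℤ ℂ (g q), represents_inv_pow ?_, fun n hn => ?_, fun n => ?_⟩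
  · rw [expandAt_X_sub_C, ← map_pow, ← map_mul]
    have : ∀ q, g q * (PowerSeries.X + PowerSeries.C (x - c)) ^ (q + 1) = 1 := by
      intro q
      induction q with
      | zero => rw [zero_add, pow_one, g0]
      | succ q ih => rw [pow_succ', ← mul_assoc, gs, ih]
    rw [this, map_one]
  · rw [PowerSeries.coeff_coe, if_pos hn]
  · rw [LaurentSeries.coeff_coe_powerSeries, PowerSeries.coeff_mk]

lemma exists_represents_pow (x : ℂ) (q : ℕ) :
    ∃ r, Represents (expandAt x) (fun z => z ^ q) r ∧ (∀ n < 0, r.coeff n = 0) ∧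
      ∀ n : ℕ, r.coeff n = (Nat.choose q n : ℂ) * x ^ (q - n) := by
  have h : expandAt x (X ^ q)
      = HahnSeries.ofPowerSeries ℤ ℂ (((X + C x : ℂ[X]) ^ q : ℂ[X]) : PowerSeries ℂ) := by
    have h1 := expandAt_X_sub_C x 0
    rw [map_zero, sub_zero, sub_zero] at h1
    rw [map_pow, h1, ← map_pow]
    simp
  have h' := Represents.eval (θ := expandAt x) (X ^ q)
  simp only [eval_pow, eval_X] at h'
  refine ⟨expandAt x (X ^ q), h', fun n hn => ?_, fun n => ?_⟩
  · rw [h, PowerSeries.coeff_coe, if_pos hn]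
  · rw [h, LaurentSeries.coeff_coe_powerSeries, Polynomial.coeff_coe, coeff_X_add_C_pow, mul_comm]

lemma represents_pow_inf (q : ℕ) :
    Represents expandInf (fun z => z ^ q) (HahnSeries.single (-(q : ℤ)) 1) := by
  have h := Represents.eval (θ := expandInf) (X ^ q)
  simp only [eval_pow, eval_X, map_pow] at h
  rw [expandInf, aeval_X, HahnSeries.single_pow] at h
  simpa [expandInf] using h

lemma exists_represents_inf (c : ℂ) (q : ℕ) :
    ∃ r, Represents expandInf (fun z => ((z - c) ^ (q + 1))⁻¹) r ∧ (∀ n ≤ 0, r.coeff n = 0) ∧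
      ∀ n : ℕ, r.coeff (n + 1) = (Nat.choose n q : ℂ) * c ^ (n - q) := by
  let g : ℕ → PowerSeries ℂ := fun q => PowerSeries.mk fun n => (Nat.choose n q : ℂ) * c ^ (n - q)
  have g0 : g 0 * (1 - PowerSeries.C c * PowerSeries.X) = 1 := by
    ext n
    rw [mul_sub, mul_one, ← mul_assoc, mul_comm (g 0), map_sub, PowerSeries.coeff_one]
    rcases n with _ | n
    · rw [PowerSeries.coeff_zero_mul_X]
      simp [g]
    · rw [PowerSeries.coeff_succ_mul_X, PowerSeries.coeff_C_mul]
      simp [g, pow_succ']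
  have gs : ∀ q, g (q + 1) * (1 - PowerSeries.C c * PowerSeries.X) = PowerSeries.X * g q := by
    intro q
    ext n
    rw [mul_sub, mul_one, ← mul_assoc, mul_comm (g (q + 1)), map_sub]
    rcases n with _ | n
    · rw [PowerSeries.coeff_zero_mul_X, PowerSeries.coeff_zero_X_mul]
      simp [g]
    · rw [PowerSeries.coeff_succ_mul_X, PowerSeries.coeff_C_mul, PowerSeries.coeff_succ_X_mul]
      simp only [g, PowerSeries.coeff_mk]
      rw [Nat.choose_succ_succ, Nat.add_sub_add_right]
      rcases le_or_gt (q + 1) n with h | h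
      · obtain ⟨k, rfl⟩ := Nat.exists_eq_add_of_le h
        rw [show q + 1 + k - q = k + 1 by omega, show q + 1 + k - (q + 1) = k by omega]
        push_cast; ring
      · rw [Nat.choose_eq_zero_of_lt h]
        push_cast; ring
  have hX : HahnSeries.ofPowerSeries ℤ ℂ PowerSeries.X * expandInf (X - C c)
      = HahnSeries.ofPowerSeries ℤ ℂ (1 - PowerSeries.C c * PowerSeries.X) := by
    rw [expandInf, map_sub, aeval_X, aeval_C, map_sub, map_mul,
      (HahnSeries.ofPowerSeries ℤ ℂ).map_one, HahnSeries.ofPowerSeries_X,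
      HahnSeries.ofPowerSeries_C, mul_sub, HahnSeries.single_mul_single,
      LaurentSeries.algebraMap_apply, mul_comm (HahnSeries.C c)]
    simp
  refine ⟨HahnSeries.ofPowerSeries ℤ ℂ (PowerSeries.X * g q), represents_inv_pow ?_,
    fun n hn => ?_, fun n => ?_⟩
  · have : ∀ q, HahnSeries.ofPowerSeries ℤ ℂ (PowerSeries.X * g q) *
        expandInf (X - C c) ^ (q + 1) = 1 := by
      intro q
      induction q with
      | zero =>
        rw [zero_add, pow_one, map_mul, mul_comm, ← mul_assoc, mul_comm (expandInf _), hX, ← map_mul,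
          mul_comm, g0, map_one]
      | succ q ih =>
        rw [pow_succ', ← mul_assoc, map_mul, mul_comm _ (HahnSeries.ofPowerSeries ℤ ℂ (g (q + 1))),
          mul_assoc (HahnSeries.ofPowerSeries ℤ ℂ (g (q + 1))), hX, ← map_mul, gs, ih]
    exact this q
  · rw [PowerSeries.coeff_coe]
    rcases hn.lt_or_eq with h | rfl
    · rw [if_pos h]
    · simp
  · have := LaurentSeries.coeff_coe_powerSeries (PowerSeries.X * g q) (n + 1)
    rw [PowerSeries.coeff_succ_X_mul, PowerSeries.coeff_mk] at this
    exact_mod_cast this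

end Expansion

/-! ### Completions of filtered rings -/

section Completion

open UniformSpace

variable {S : Type*} [CommRing S] [UniformSpace S] [IsUniformAddGroup S] [IsTopologicalRing S]

/-- The closure in the completion of (the image of) an ideal. -/
def completedIdeal (J : Ideal S) : Ideal (Completion S) where
  carrier := closure ((fun x : S => (x : Completion S)) '' J)
  add_mem' hx hy := map_mem_closure₂ continuous_add hx hy (by
    rintro _ ⟨x, hx, rfl⟩ _ ⟨y, hy, rfl⟩
    exact ⟨x + y, J.add_mem hx hy, Completion.coe_add x y⟩)
  zero_mem' := subset_closure ⟨0, J.zero_mem, Completion.coe_zero⟩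
  smul_mem' c x hx := map_mem_closure₂ continuous_mul
    (Completion.denseRange_coe (α := S) c) hx (by
      rintro _ ⟨x, rfl⟩ _ ⟨y, hy, rfl⟩
      exact ⟨x * y, J.mul_mem_left x hy, Completion.coe_mul x y⟩)

lemma coe_mem_completedIdeal {J : Ideal S} {x : S} (hx : x ∈ J) :
    (x : Completion S) ∈ completedIdeal J := subset_closure ⟨x, hx, rfl⟩

lemma completedIdeal_mono {J J' : Ideal S} (h : J ≤ J') : completedIdeal J ≤ completedIdeal J' :=
  fun _ hx => closure_mono (Set.image_mono h) hx

/-- The filtration induced on the completion. -/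
def ModeFiltration.completion (Fil : ModeFiltration S) : ModeFiltration (Completion S) where
  pos n := completedIdeal (Fil.pos n)
  neg n := completedIdeal (Fil.neg n)
  hasBasis := by
    have h := Fil.hasBasis.hasBasis_of_isDenseInducing (Completion.isDenseInducing_coe (α := S))
    rw [Completion.coe_zero] at h
    convert h using 2 with n
    have hopen : IsOpen ((Fil.pos n ⊓ Fil.neg n : Ideal S) : Set S) :=
      AddSubgroup.isOpen_of_mem_nhds (Fil.pos n ⊓ Fil.neg n).toAddSubgroup
        (Fil.hasBasis.mem_of_mem trivial)
    have hclosed : IsClosed ((Fil.pos n ⊓ Fil.neg n : Ideal S) : Set S) :=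
      AddSubgroup.isClosed_of_isOpen (Fil.pos n ⊓ Fil.neg n).toAddSubgroup hopen
    refine Set.Subset.antisymm ?_ fun x hx => ⟨completedIdeal_mono inf_le_left hx,
      completedIdeal_mono inf_le_right hx⟩
    rintro a ⟨ha, ha'⟩
    have hnhds : (completedIdeal (Fil.pos n ⊓ Fil.neg n) : Set (Completion S))
        ∈ 𝓝 (0 : Completion S) := h.mem_of_mem trivial
    have happrox : ∀ J : Ideal S, a ∈ completedIdeal J →
        ∃ f ∈ J, a - (f : Completion S) ∈ completedIdeal (Fil.pos n ⊓ Fil.neg n) := by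
      intro J hJ
      have hn : {x | a - x ∈ completedIdeal (Fil.pos n ⊓ Fil.neg n)} ∈ 𝓝 a := by
        have hc : ContinuousAt (fun x => a - x) a := (continuous_const.sub continuous_id).continuousAt
        refine hc.preimage_mem_nhds ?_
        rw [sub_self]
        exact hnhds
      obtain ⟨_, h1, f, hf, rfl⟩ := mem_closure_iff_nhds.mp hJ _ hn
      exact ⟨f, hf, h1⟩
    obtain ⟨f, hf, hfa⟩ := happrox _ ha
    obtain ⟨g, hg, hga⟩ := happrox _ ha'
    have hfg : f - g ∈ Fil.pos n ⊓ Fil.neg n := by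
      have h1 : ((f - g : S) : Completion S) ∈ completedIdeal (Fil.pos n ⊓ Fil.neg n) := by
        have := sub_mem hga hfa
        rw [sub_sub_sub_cancel_left, ← Completion.coe_sub] at this
        exact this
      have h2 : f - g ∈ closure ((Fil.pos n ⊓ Fil.neg n : Ideal S) : Set S) := by
        rw [(Completion.isDenseInducing_coe (α := S)).isInducing.closure_eq_preimage_closure_image]
        exact h1
      rwa [hclosed.closure_eq] at h2
    have hf' : f ∈ Fil.pos n ⊓ Fil.neg n := ⟨hf, by
      have := (Fil.neg n).add_mem hfg.2 hg
      rwa [sub_add_cancel] at this⟩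
    have := add_mem hfa (coe_mem_completedIdeal hf')
    rwa [sub_add_cancel] at this

end Completion

/-- The filtration that defines the topology of `idealUniformSpace`. -/
lemma idealUniformSpace_hasBasis {A : Type*} [CommRing A] {J : ℕ → Ideal A} (hJ : Antitone J) :
    letI := idealUniformSpace hJ
    (𝓝 (0 : A)).HasBasis (fun _ : ℕ => True) fun n => (J n : Set A) :=
  (idealBasis hJ).hasBasis_nhds_zero

section Fil

variable {𝔤 : Type*} [LieRing 𝔤] [LieAlgebra ℂ 𝔤] {d : DihedralData 𝔤} (P : PoleDivisor d)

/-- The filtrations of the formal observables. -/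
def formalFil : ModeFiltration (FormalObs P) := ModeFiltration.completion (S := FormalPre P)
  { pos := fun n => Ideal.span (FormalPre.ι P '' filPosD P n)
    neg := fun n => Ideal.span (FormalPre.ι P '' filNegD P n)
    hasBasis := idealUniformSpace_hasBasis (FormalPre.fil_antitone P) }

variable {P} (lev : Levels d P)

/-- The filtrations of the local observables. -/
def localFil : ModeFiltration (LocalObs lev) := ModeFiltration.completion (S := LocalPre lev)
  { pos := fun n => Ideal.span (LocalPre.ι lev '' {v | v.1 ∈ filPosD P n})
    neg := fun n => Ideal.span (LocalPre.ι lev '' {v | v.1 ∈ filNegD P n})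
    hasBasis := idealUniformSpace_hasBasis (LocalPre.fil_antitone lev) }

end Fil

/-! ### The Poisson bracket of the algebra of local observables -/

section LocalBracket

open scoped OnePoint
open UniformSpace

variable {𝔤 : Type*} [LieRing 𝔤] [LieAlgebra ℂ 𝔤] {d : DihedralData 𝔤} {P : PoleDivisor d}

lemma mem_Z' {x : ℂ} : x ∈ P.Z' ↔ x ≠ 0 ∧ P.n x ≠ 0 := by
  classical
  rw [PoleDivisor.Z', Finset.mem_filter]
  refine ⟨fun h => h.2, fun h => ⟨?_, h⟩⟩
  rw [Finset.mem_union, Finset.mem_image]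
  have h2 : (if IsRealPoint d x ∨ P.mult x ≠ 0 then P.mult x
      else P.mult (starRingEnd ℂ x)) ≠ 0 := h.2
  split_ifs at h2 with hx
  · exact Or.inl (Finsupp.mem_support_iff.mpr h2)
  · exact Or.inr ⟨_, Finsupp.mem_support_iff.mpr h2, Complex.conj_conj x⟩

lemma mem_poleSet_of_ne {x : OnePoint ℂ} (hx : P.n x ≠ 0) : x ∈ poleSet P := by
  classical
  rw [poleSet, Finset.mem_union]
  induction x using OnePoint.rec with
  | infty => exact Or.inr (by simp)
  | coe x =>
    by_cases h : x = 0
    · subst h; exact Or.inr (by simp)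
    · exact Or.inl (Finset.mem_image.mpr ⟨x, mem_Z'.mpr ⟨h, hx⟩, rfl⟩)

lemma Affine.add_mem_filPos {N : ℕ} {X Y : Affine d} (hX : X ∈ filPos d N) (hY : Y ∈ filPos d N) :
    X + Y ∈ filPos d N := by
  refine ⟨by rw [K_add, hX.1, hY.1, add_zero], by rw [D_add, hX.2.1, hY.2.1, add_zero],
    fun m hm => ?_⟩
  rw [loop_add, Finsupp.add_apply, hX.2.2 m hm, hY.2.2 m hm, add_zero]

lemma Affine.add_mem_filNeg {N : ℕ} {X Y : Affine d} (hX : X ∈ filNeg d N) (hY : Y ∈ filNeg d N) :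
    X + Y ∈ filNeg d N := by
  refine ⟨by rw [K_add, hX.1, hY.1, add_zero], by rw [D_add, hX.2.1, hY.2.1, add_zero],
    fun m hm => ?_⟩
  rw [loop_add, Finsupp.add_apply, hX.2.2 m hm, hY.2.2 m hm, add_zero]

lemma Affine.zero_mem_filPos {N : ℕ} : (0 : Affine d) ∈ filPos d N := ⟨rfl, rfl, fun _ _ => rfl⟩

lemma Affine.zero_mem_filNeg {N : ℕ} : (0 : Affine d) ∈ filNeg d N := ⟨rfl, rfl, fun _ _ => rfl⟩

lemma Affine.sum_mem_filPos {N : ℕ} {ι : Type*} {s : Finset ι} {f : ι → Affine d}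
    (h : ∀ i ∈ s, f i ∈ filPos d N) : ∑ i ∈ s, f i ∈ filPos d N :=
  Finset.sum_induction f (· ∈ filPos d N) (fun _ _ => add_mem_filPos) zero_mem_filPos h

lemma Affine.sum_mem_filNeg {N : ℕ} {ι : Type*} {s : Finset ι} {f : ι → Affine d}
    (h : ∀ i ∈ s, f i ∈ filNeg d N) : ∑ i ∈ s, f i ∈ filNeg d N :=
  Finset.sum_induction f (· ∈ filNeg d N) (fun _ _ => add_mem_filNeg) zero_mem_filNeg h

lemma Affine.lie_mem_filPos {N : ℕ} (hN : 1 ≤ N) {X Y : Affine d} (hX : X ∈ filPos d N)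
    (hY : Y ∈ filPos d N) : ⁅X, Y⁆ ∈ filPos d N := by
  rw [xt_add_K_add_D Y, hY.1, hY.2.1, zero_smul, zero_smul, add_zero, add_zero, Finsupp.sum, lie_sum]
  refine sum_mem_filPos fun k hk => ?_
  have hk' : (N : ℤ) ≤ k := by
    by_contra h
    exact (Finsupp.mem_support_iff.mp hk) (hY.2.2 k (by omega))
  exact lie_xt_mem_filPos hN (by omega) _ hX

lemma Affine.lie_mem_filNeg {N : ℕ} (hN : 1 ≤ N) {X Y : Affine d} (hX : X ∈ filNeg d N)
    (hY : Y ∈ filNeg d N) : ⁅X, Y⁆ ∈ filNeg d N := by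
  rw [xt_add_K_add_D Y, hY.1, hY.2.1, zero_smul, zero_smul, add_zero, add_zero, Finsupp.sum, lie_sum]
  refine sum_mem_filNeg fun k hk => ?_
  have hk' : k ≤ -(N : ℤ) := by
    by_contra h
    exact (Finsupp.mem_support_iff.mp hk) (hY.2.2 k (by omega))
  exact lie_xt_mem_filNeg hN (by omega) _ hX

/-- A decreasing family of subsets of `ĝᴰ` that behaves like the family of the elements with modes
`≥ n` (or `≤ -n`) only. -/
structure IsModeFamily (F : ℕ → Set (hatD P)) : Prop where
  anti : Antitone F
  shift : ∀ u : hatD P, ∃ M, ∀ N, ∀ v ∈ F (N + M), ⁅u, v⁆ ∈ F N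
  lie : ∀ n, 1 ≤ n → ∀ u ∈ F n, ∀ v ∈ F n, ⁅u, v⁆ ∈ F n

lemma TakiffSum.lie_apply' (u v : hatD P) (x : OnePoint ℂ) (k : Fin (P.n x)) :
    (⁅u, v⁆ : hatD P).1.1 x k = ∑ i : Fin (P.n x), ∑ j : Fin (P.n x),
      if (i : ℕ) + j = k then ⁅u.1.1 x i, v.1.1 x j⁆ else 0 := rfl

/-- An element of `ĝᴰ` has finitely many components, each with finitely many modes, so it shifts
the filtrations by a bounded amount. -/
lemma exists_uniform_shift (u : hatD P) : ∃ M : ℕ, ∀ (x : OnePoint ℂ) (i : Fin (P.n x)) (N : ℕ)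
    (X : Affine d), (X ∈ Affine.filPos d (N + M) → ⁅X, u.1.1 x i⁆ ∈ Affine.filPos d N) ∧
      (X ∈ Affine.filNeg d (N + M) → ⁅X, u.1.1 x i⁆ ∈ Affine.filNeg d N) := by
  choose M hM using fun (x : OnePoint ℂ) (i : Fin (P.n x)) =>
    Affine.exists_lie_mem_fil (u.1.1 x i)
  refine ⟨∑ x ∈ poleSet P, ∑ i, M x i, fun x i N X => ?_⟩
  have hx : x ∈ poleSet P := mem_poleSet_of_ne (by have := i.2; omega)
  have hle : M x i ≤ ∑ x ∈ poleSet P, ∑ i, M x i :=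
    (Finset.single_le_sum (f := fun i => M x i) (fun _ _ => Nat.zero_le _) (Finset.mem_univ i)).trans
      (Finset.single_le_sum (f := fun x => ∑ i, M x i) (fun _ _ => Nat.zero_le _) hx)
  exact ⟨fun h => (hM x i N X).1 (Affine.filPos_antitone (by omega) h),
    fun h => (hM x i N X).2 (Affine.filNeg_antitone (by omega) h)⟩

lemma isModeFamily_pos : IsModeFamily (P := P) fun n => {v | v.1 ∈ filPosD P n} where
  anti _ _ h _ hv := filPosD_antitone P h hv
  shift u := by
    obtain ⟨M, hM⟩ := exists_uniform_shift u
    refine ⟨M, fun N v hv x k => ?_⟩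
    rw [TakiffSum.lie_apply']
    refine Affine.sum_mem_filPos fun i _ => Affine.sum_mem_filPos fun j _ => ?_
    split_ifs
    · rw [← lie_skew]
      exact Affine.neg_mem_filPos ((hM x i N _).1 (hv x j))
    · exact Affine.zero_mem_filPos
  lie n hn u hu v hv x k := by
    rw [TakiffSum.lie_apply']
    refine Affine.sum_mem_filPos fun i _ => Affine.sum_mem_filPos fun j _ => ?_
    split_ifs
    · exact Affine.lie_mem_filPos hn (hu x i) (hv x j)
    · exact Affine.zero_mem_filPos

lemma isModeFamily_neg : IsModeFamily (P := P) fun n => {v | v.1 ∈ filNegD P n} where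
  anti _ _ h _ hv := filNegD_antitone P h hv
  shift u := by
    obtain ⟨M, hM⟩ := exists_uniform_shift u
    refine ⟨M, fun N v hv x k => ?_⟩
    rw [TakiffSum.lie_apply']
    refine Affine.sum_mem_filNeg fun i _ => Affine.sum_mem_filNeg fun j _ => ?_
    split_ifs
    · rw [← lie_skew]
      exact Affine.neg_mem_filNeg ((hM x i N _).2 (hv x j))
    · exact Affine.zero_mem_filNeg
  lie n hn u hu v hv x k := by
    rw [TakiffSum.lie_apply']
    refine Affine.sum_mem_filNeg fun i _ => Affine.sum_mem_filNeg fun j _ => ?_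
    split_ifs
    · exact Affine.lie_mem_filNeg hn (hu x i) (hv x j)
    · exact Affine.zero_mem_filNeg

variable (lev : Levels d P)

namespace LocalPre

/-- The quotient map. -/
def mk : SymmetricAlgebra ℂ (hatD P) →ₐ[ℂ] LocalPre lev := Ideal.Quotient.mkₐ ℂ (levelIdeal lev)

lemma mk_surjective : Function.Surjective (mk lev) := Ideal.Quotient.mk_surjective

lemma ι_eq_mk (v : hatD P) : ι lev v = mk lev (SymmetricAlgebra.ι ℂ (hatD P) v) := rfl

lemma bracket_mk (f g : SymmetricAlgebra ℂ (hatD P)) :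
    bracket lev (mk lev f) (mk lev g) = mk lev (poisson f g) := rfl

lemma bracket_ι_ι (u v : hatD P) : bracket lev (ι lev u) (ι lev v) = ι lev ⁅u, v⁆ := by
  rw [ι_eq_mk, ι_eq_mk, bracket_mk, poisson_ι_ι, ι_eq_mk]

lemma bracket_add_left (f g h : LocalPre lev) :
    bracket lev (f + g) h = bracket lev f h + bracket lev g h := by
  obtain ⟨f, rfl⟩ := mk_surjective lev f
  obtain ⟨g, rfl⟩ := mk_surjective lev g
  obtain ⟨h, rfl⟩ := mk_surjective lev h
  rw [← map_add, bracket_mk, bracket_mk, bracket_mk, poisson_add_left, map_add]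

lemma bracket_skew (f g : LocalPre lev) : bracket lev f g = -bracket lev g f := by
  obtain ⟨f, rfl⟩ := mk_surjective lev f
  obtain ⟨g, rfl⟩ := mk_surjective lev g
  rw [bracket_mk, bracket_mk, poisson_skew, map_neg]

lemma bracket_add_right (f g h : LocalPre lev) :
    bracket lev f (g + h) = bracket lev f g + bracket lev f h := by
  rw [bracket_skew, bracket_add_left, neg_add, ← bracket_skew, ← bracket_skew]

lemma bracket_mul_right (f g h : LocalPre lev) :
    bracket lev f (g * h) = g * bracket lev f h + h * bracket lev f g := by
  obtain ⟨f, rfl⟩ := mk_surjective lev f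
  obtain ⟨g, rfl⟩ := mk_surjective lev g
  obtain ⟨h, rfl⟩ := mk_surjective lev h
  rw [← map_mul, bracket_mk, bracket_mk, bracket_mk, poisson_mul_right, map_add, map_mul, map_mul]

lemma bracket_mul_left (f g h : LocalPre lev) :
    bracket lev (f * g) h = f * bracket lev g h + g * bracket lev f h := by
  rw [bracket_skew, bracket_mul_right, neg_add, bracket_skew lev h, bracket_skew lev h]
  ring

lemma bracket_algebraMap_left (c : ℂ) (g : LocalPre lev) :
    bracket lev (algebraMap ℂ _ c) g = 0 := by
  obtain ⟨g, rfl⟩ := mk_surjective lev g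
  rw [← (mk lev).commutes c, bracket_mk, poisson_algebraMap_left, map_zero]

lemma bracket_smul_left (c : ℂ) (f g : LocalPre lev) :
    bracket lev (c • f) g = c • bracket lev f g := by
  rw [Algebra.smul_def, bracket_mul_left, bracket_algebraMap_left, mul_zero, add_zero,
    Algebra.smul_def]

lemma bracket_smul_right (c : ℂ) (f g : LocalPre lev) :
    bracket lev f (c • g) = c • bracket lev f g := by
  rw [bracket_skew, bracket_smul_left, ← smul_neg, ← bracket_skew]

@[elab_as_elim]
lemma induction {p : LocalPre lev → Prop} (algebraMap : ∀ c, p (algebraMap ℂ _ c))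
    (ι : ∀ v, p (ι lev v)) (mul : ∀ f g, p f → p g → p (f * g))
    (add : ∀ f g, p f → p g → p (f + g)) (f : LocalPre lev) : p f := by
  obtain ⟨f, rfl⟩ := mk_surjective lev f
  induction f using SymmetricAlgebra.induction with
  | algebraMap c => rw [(mk lev).commutes]; exact algebraMap c
  | ι v => exact ι v
  | mul f g hf hg => rw [map_mul]; exact mul _ _ hf hg
  | add f g hf hg => rw [map_add]; exact add _ _ hf hg

/-- The ideal generated by a member of a family of subsets of `ĝᴰ`. -/
abbrev modeIdeal (F : ℕ → Set (hatD P)) (n : ℕ) : Ideal (LocalPre lev) :=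
  Ideal.span (ι lev '' F n)

variable {lev} {F : ℕ → Set (hatD P)} (hF : IsModeFamily F)

/-- A bracket can be estimated on the generators of an ideal, by the Leibniz rule. -/
lemma bracket_mem_of_gen {J J' : Ideal (LocalPre lev)} {s : Set (hatD P)} {f : LocalPre lev}
    (hJ : J' = Ideal.span (ι lev '' s)) (hs : J' ≤ J)
    (h : ∀ v ∈ s, bracket lev f (ι lev v) ∈ J) {g : LocalPre lev} (hg : g ∈ J') :
    bracket lev f g ∈ J := by
  subst hJ
  induction hg using Submodule.span_induction with
  | mem x hx => obtain ⟨v, hv, rfl⟩ := hx; exact h v hv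
  | zero =>
    have : bracket lev f 0 = 0 := by simpa using bracket_smul_right lev 0 f 0
    rw [this]
    exact J.zero_mem
  | add x y _ _ hx hy => rw [bracket_add_right]; exact J.add_mem hx hy
  | smul a x hx' hx =>
    rw [smul_eq_mul, bracket_mul_right]
    exact J.add_mem (J.mul_mem_left _ hx) (J.mul_mem_right _ (hs hx'))

lemma modeIdeal_antitone (hF : IsModeFamily F) : Antitone (modeIdeal lev F) :=
  fun _ _ h => Ideal.span_mono (Set.image_mono (hF.anti h))

/-- Bracketing with a fixed element shifts the filtration by a bounded amount: this is continuity
of the bracket in one argument. -/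
lemma exists_bracket_shift (hF : IsModeFamily F) (f : LocalPre lev) : ∃ M, ∀ N,
    ∀ g ∈ modeIdeal lev F (N + M), bracket lev f g ∈ modeIdeal lev F N := by
  induction f using LocalPre.induction with
  | algebraMap c =>
    exact ⟨0, fun N g _ => by rw [bracket_algebraMap_left]; exact Ideal.zero_mem _⟩
  | ι u =>
    obtain ⟨M, hM⟩ := hF.shift u
    refine ⟨M, fun N g hg => bracket_mem_of_gen rfl (modeIdeal_antitone hF (Nat.le_add_right N M))
      (fun v hv => ?_) hg⟩
    rw [bracket_ι_ι]
    exact Ideal.subset_span ⟨_, hM N v hv, rfl⟩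
  | mul f₁ f₂ h₁ h₂ =>
    obtain ⟨M₁, h₁⟩ := h₁
    obtain ⟨M₂, h₂⟩ := h₂
    refine ⟨M₁ + M₂, fun N g hg => ?_⟩
    rw [bracket_mul_left]
    exact Ideal.add_mem _
      (Ideal.mul_mem_left _ _ (h₂ N g (modeIdeal_antitone hF (by omega) hg)))
      (Ideal.mul_mem_left _ _ (h₁ N g (modeIdeal_antitone hF (by omega) hg)))
  | add f₁ f₂ h₁ h₂ =>
    obtain ⟨M₁, h₁⟩ := h₁
    obtain ⟨M₂, h₂⟩ := h₂
    refine ⟨M₁ + M₂, fun N g hg => ?_⟩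
    rw [bracket_add_left]
    exact Ideal.add_mem _ (h₁ N g (modeIdeal_antitone hF (by omega) hg))
      (h₂ N g (modeIdeal_antitone hF (by omega) hg))

/-- The ideals of the filtration are closed under the bracket: this is joint continuity of the
bracket at the origin. -/
lemma bracket_mem_modeIdeal (hF : IsModeFamily F) {n : ℕ} (hn : 1 ≤ n) {f g : LocalPre lev}
    (hf : f ∈ modeIdeal lev F n) (hg : g ∈ modeIdeal lev F n) :
    bracket lev f g ∈ modeIdeal lev F n := by
  refine bracket_mem_of_gen rfl le_rfl (fun v hv => ?_) hg
  rw [bracket_skew]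
  refine neg_mem (bracket_mem_of_gen rfl le_rfl (fun u hu => ?_) hf)
  rw [bracket_ι_ι]
  exact Ideal.subset_span ⟨_, hF.lie n hn v hv u hu, rfl⟩

variable (lev) in
/-- The bracket as a biadditive map. -/
def bracketHom : LocalPre lev →+ LocalPre lev →+ LocalPre lev :=
  AddMonoidHom.mk' (fun f => AddMonoidHom.mk' (bracket lev f) (bracket_add_right lev f))
    fun f g => AddMonoidHom.ext fun h => bracket_add_left lev f g h

lemma hasBasis : (𝓝 (0 : LocalPre lev)).HasBasis (fun _ : ℕ => True)
    fun n => (fil lev n : Set (LocalPre lev)) :=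
  idealUniformSpace_hasBasis (fil_antitone lev)

/-- The Poisson bracket of `S_ℓ` is jointly continuous, so it extends to the completion. -/
lemma continuous_bracket :
    Continuous fun q : LocalPre lev × LocalPre lev => bracketHom lev q.1 q.2 := by
  have hl : ∀ f : LocalPre lev, ContinuousAt (bracketHom lev f) 0 := by
    intro f
    rw [ContinuousAt, map_zero, hasBasis.tendsto_iff hasBasis]
    intro n _
    obtain ⟨M₁, h₁⟩ := exists_bracket_shift (lev := lev) isModeFamily_pos f
    obtain ⟨M₂, h₂⟩ := exists_bracket_shift (lev := lev) isModeFamily_neg f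
    refine ⟨n + (M₁ + M₂), trivial, fun g hg => ?_⟩
    exact ⟨h₁ n g (modeIdeal_antitone isModeFamily_pos (by omega) hg.1),
      h₂ n g (modeIdeal_antitone isModeFamily_neg (by omega) hg.2)⟩
  refine continuous_of_continuousAt_zero₂ (bracketHom lev) ?_ hl fun g => ?_
  · rw [ContinuousAt, nhds_prod_eq, map_zero,
      (hasBasis.prod_self).tendsto_iff hasBasis]
    intro n _
    refine ⟨n + 1, trivial, ?_⟩
    rintro ⟨f, g⟩ ⟨hf, hg⟩
    refine fil_antitone lev (Nat.le_succ n) ?_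
    exact ⟨bracket_mem_modeIdeal isModeFamily_pos (by omega) hf.1 hg.1,
      bracket_mem_modeIdeal isModeFamily_neg (by omega) hf.2 hg.2⟩
  · have h : (fun f => bracketHom lev f g) = fun f => -bracketHom lev g f :=
      funext fun f => bracket_skew lev f g
    rw [h]
    exact (hl g).neg

end LocalPre

lemma continuous_localBracket :
    Continuous fun q : LocalObs lev × LocalObs lev => localBracket lev q.1 q.2 := by
  have h := (Completion.isDenseInducing_toCompl (LocalPre lev)).extend_Z_bilin
    (Completion.isDenseInducing_toCompl (LocalPre lev))
    (φ := (AddMonoidHom.compHom Completion.toCompl).comp (LocalPre.bracketHom lev))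
    (Completion.continuous_toCompl.comp (LocalPre.continuous_bracket (lev := lev)))
  exact h

lemma localBracket_coe (f g : LocalPre lev) :
    localBracket lev f g = (LocalPre.bracket lev f g : LocalPre lev) := by
  have h := (Completion.isDenseInducing_coe (α := LocalPre lev)).prodMap
    (Completion.isDenseInducing_coe (α := LocalPre lev))
  exact h.extend_eq (Completion.continuous_toCompl.comp (LocalPre.continuous_bracket (lev := lev)))
    (f, g)

lemma localBracket_add_left (f g h : LocalObs lev) :
    localBracket lev (f + g) h = localBracket lev f h + localBracket lev g h := by
  have hc := continuous_localBracket lev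
  induction f, g, h using Completion.induction_on₃ with
  | hp =>
    have e1 : Continuous fun q : LocalObs lev × LocalObs lev × LocalObs lev =>
        localBracket lev (q.1 + q.2.1) q.2.2 :=
      hc.comp ((continuous_fst.add (continuous_fst.comp continuous_snd)).prodMk
        (continuous_snd.comp continuous_snd))
    have e2 : Continuous fun q : LocalObs lev × LocalObs lev × LocalObs lev =>
        localBracket lev q.1 q.2.2 :=
      hc.comp (continuous_fst.prodMk (continuous_snd.comp continuous_snd))
    have e3 : Continuous fun q : LocalObs lev × LocalObs lev × LocalObs lev =>
        localBracket lev q.2.1 q.2.2 := hc.comp continuous_snd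
    exact isClosed_eq e1 (e2.add e3)
  | ih f g h =>
    rw [← Completion.coe_add, localBracket_coe, localBracket_coe, localBracket_coe,
      ← Completion.coe_add, LocalPre.bracket_add_left]

lemma localBracket_smul_left (c : ℂ) (f g : LocalObs lev) :
    localBracket lev (c • f) g = c • localBracket lev f g := by
  have hc := continuous_localBracket lev
  induction f, g using Completion.induction_on₂ with
  | hp =>
    exact isClosed_eq (hc.comp ((continuous_fst.const_smul c).prodMk continuous_snd))
      (hc.const_smul c)
  | ih f g =>
    rw [← Completion.coe_smul, localBracket_coe, localBracket_coe,
      ← Completion.coe_smul, LocalPre.bracket_smul_left]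

lemma localBracket_skew (f g : LocalObs lev) :
    localBracket lev f g = -localBracket lev g f := by
  have hc := continuous_localBracket lev
  induction f, g using Completion.induction_on₂ with
  | hp => exact isClosed_eq hc (hc.comp continuous_swap).neg
  | ih f g =>
    rw [localBracket_coe, localBracket_coe, ← Completion.coe_neg, LocalPre.bracket_skew]

lemma localBracket_mul_right (f g h : LocalObs lev) :
    localBracket lev f (g * h) = g * localBracket lev f h + h * localBracket lev f g := by
  have hc := continuous_localBracket lev
  induction f, g, h using Completion.induction_on₃ with
  | hp =>
    have e0 : Continuous fun q : LocalObs lev × LocalObs lev × LocalObs lev =>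
        localBracket lev q.1 (q.2.1 * q.2.2) :=
      hc.comp (continuous_fst.prodMk ((continuous_fst.comp continuous_snd).mul
        (continuous_snd.comp continuous_snd)))
    have e1 : Continuous fun q : LocalObs lev × LocalObs lev × LocalObs lev =>
        localBracket lev q.1 q.2.2 :=
      hc.comp (continuous_fst.prodMk (continuous_snd.comp continuous_snd))
    have e2 : Continuous fun q : LocalObs lev × LocalObs lev × LocalObs lev =>
        localBracket lev q.1 q.2.1 :=
      hc.comp (continuous_fst.prodMk (continuous_fst.comp continuous_snd))
    exact isClosed_eq e0 (((continuous_fst.comp continuous_snd).mul e1).add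
      ((continuous_snd.comp continuous_snd).mul e2))
  | ih f g h =>
    rw [← Completion.coe_mul, localBracket_coe, localBracket_coe, localBracket_coe,
      ← Completion.coe_mul, ← Completion.coe_mul, ← Completion.coe_add, LocalPre.bracket_mul_right]

/-- The Poisson bracket of the local observables as a continuous biderivation. -/
def localContBracket : ContBracket (LocalObs lev) where
  br := LinearMap.mk₂ ℂ (localBracket lev)
    (localBracket_add_left lev)
    (localBracket_smul_left lev)
    (fun f g h => by
      rw [localBracket_skew lev f, localBracket_add_left, localBracket_skew lev f g,
        localBracket_skew lev f h, neg_add])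
    (fun c f g => by
      rw [localBracket_skew lev f, localBracket_smul_left, localBracket_skew lev f g, smul_neg])
  skew f g := localBracket_skew lev f g
  leibniz f g h := localBracket_mul_right lev f g h
  continuous f := (continuous_localBracket lev).comp (continuous_const.prodMk continuous_id)

lemma localContBracket_apply (f g : LocalObs lev) :
    (localContBracket lev).br f g = localBracket lev f g := rfl

lemma br_localLin (u v : hatD P) :
    (localContBracket lev).br (localLin lev u) (localLin lev v) = localLin lev ⁅u, v⁆ := by
  rw [localContBracket_apply]
  exact (localBracket_coe lev _ _).trans (congrArg _ (LocalPre.bracket_ι_ι lev u v))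

end LocalBracket

/-! ### The homomorphism from the formal to the local observables -/

section PiHat

open scoped OnePoint
open UniformSpace

variable {𝔤 : Type*} [LieRing 𝔤] [LieAlgebra ℂ 𝔤] {d : DihedralData 𝔤} {P : PoleDivisor d}
variable {I : Type*} [Fintype I] [DecidableEq I] (b : Module.Basis I ℂ 𝔤) (lev : Levels d P)

lemma localLin_mem_pos {N : ℕ} {v : hatD P} (hv : v.1 ∈ filPosD P N) :
    localLin lev v ∈ (localFil lev).pos N :=
  coe_mem_completedIdeal (Ideal.subset_span ⟨v, hv, rfl⟩)

lemma localLin_mem_neg {N : ℕ} {v : hatD P} (hv : v.1 ∈ filNegD P N) :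
    localLin lev v ∈ (localFil lev).neg N :=
  coe_mem_completedIdeal (Ideal.subset_span ⟨v, hv, rfl⟩)

lemma hatPart_mem_filPosD {N : ℕ} {v : gD P} (hv : v ∈ filPosD P N) :
    (hatPart P v).1 ∈ filPosD P N := fun x p => ⟨(hv x p).1, rfl, (hv x p).2.2⟩

lemma hatPart_mem_filNegD {N : ℕ} {v : gD P} (hv : v ∈ filNegD P N) :
    (hatPart P v).1 ∈ filNegD P N := fun x p => ⟨(hv x p).1, rfl, (hv x p).2.2⟩

lemma piLin_of_mem_hatD {v : gD P} (hv : v ∈ hatD P) :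
    piLin b lev v = localLin lev ⟨v, hv⟩ := by
  rw [piLin, LinearMap.add_apply, LinearMap.sum_apply, Finset.sum_eq_zero, add_zero,
    LinearMap.comp_apply]
  · congr 1
    refine Subtype.ext (Subtype.ext (TakiffSum.ext fun x p => ?_))
    exact Affine.ext rfl rfl (hv x p).symm
  · intro x _
    rw [LinearMap.sum_apply]
    refine Finset.sum_eq_zero fun p _ => ?_
    rw [LinearMap.smulRight_apply]
    have : coeffDD P x p v = 0 := hv x p
    rw [this, zero_smul]

lemma filPosD_subset_hatD {N : ℕ} {v : gD P} (hv : v ∈ filPosD P N) : v ∈ hatD P :=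
  fun x p => (hv x p).2.1

lemma filNegD_subset_hatD {N : ℕ} {v : gD P} (hv : v ∈ filNegD P N) : v ∈ hatD P :=
  fun x p => (hv x p).2.1

lemma piLin_mem_pos {N : ℕ} {v : gD P} (hv : v ∈ filPosD P N) :
    piLin b lev v ∈ (localFil lev).pos N := by
  rw [piLin_of_mem_hatD b lev (filPosD_subset_hatD hv)]
  exact localLin_mem_pos lev hv

lemma piLin_mem_neg {N : ℕ} {v : gD P} (hv : v ∈ filNegD P N) :
    piLin b lev v ∈ (localFil lev).neg N := by
  rw [piLin_of_mem_hatD b lev (filNegD_subset_hatD hv)]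
  exact localLin_mem_neg lev hv

lemma piSym_ι (v : gD P) : piSym b lev (FormalPre.ι P v) = piLin b lev v :=
  SymmetricAlgebra.lift_ι_apply _ _

/-- The morphism `π_ℓ` respects the filtrations, so it extends to the completion. -/
lemma uniformContinuous_piSym : UniformContinuous (piSym b lev) := by
  refine uniformContinuous_addMonoidHom_of_continuous (f := (piSym b lev).toRingHom.toAddMonoidHom)
    (continuous_of_continuousAt_zero _ ?_)
  change Tendsto _ (𝓝 0) (𝓝 _)
  rw [map_zero, (idealUniformSpace_hasBasis (FormalPre.fil_antitone P)).tendsto_iff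
    (localFil lev).hasBasis]
  intro n _
  refine ⟨n, trivial, fun f hf => ⟨?_, ?_⟩⟩
  · have h : Ideal.span (FormalPre.ι P '' filPosD P n) ≤
        ((localFil lev).pos n).comap (piSym b lev).toRingHom := by
      rw [Ideal.span_le]
      rintro _ ⟨v, hv, rfl⟩
      change piSym b lev (FormalPre.ι P v) ∈ (localFil lev).pos n
      rw [piSym_ι]
      exact piLin_mem_pos b lev hv
    exact h hf.1
  · have h : Ideal.span (FormalPre.ι P '' filNegD P n) ≤
        ((localFil lev).neg n).comap (piSym b lev).toRingHom := by
      rw [Ideal.span_le]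
      rintro _ ⟨v, hv, rfl⟩
      change piSym b lev (FormalPre.ι P v) ∈ (localFil lev).neg n
      rw [piSym_ι]
      exact piLin_mem_neg b lev hv
    exact h hf.2

lemma continuous_piHat : Continuous (piHat b lev) := Completion.continuous_extension

lemma piHat_coe (f : FormalPre P) : piHat b lev f = piSym b lev f :=
  Completion.extension_coe (uniformContinuous_piSym b lev) f

lemma piHat_mul (f g : FormalObs P) : piHat b lev (f * g) = piHat b lev f * piHat b lev g := by
  have hc := continuous_piHat b lev
  induction f, g using Completion.induction_on₂ with
  | hp =>
    exact isClosed_eq (hc.comp continuous_mul)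
      ((hc.comp continuous_fst).mul (hc.comp continuous_snd))
  | ih f g => rw [← Completion.coe_mul, piHat_coe, piHat_coe, piHat_coe, map_mul]

lemma piHat_add (f g : FormalObs P) : piHat b lev (f + g) = piHat b lev f + piHat b lev g := by
  have hc := continuous_piHat b lev
  induction f, g using Completion.induction_on₂ with
  | hp =>
    exact isClosed_eq (hc.comp continuous_add)
      ((hc.comp continuous_fst).add (hc.comp continuous_snd))
  | ih f g => rw [← Completion.coe_add, piHat_coe, piHat_coe, piHat_coe, map_add]

lemma piHat_smul (c : ℂ) (f : FormalObs P) : piHat b lev (c • f) = c • piHat b lev f := by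
  have hc := continuous_piHat b lev
  induction f using Completion.induction_on with
  | hp => exact isClosed_eq (hc.comp (continuous_const_smul c)) (hc.const_smul c)
  | ih f => rw [← Completion.coe_smul, piHat_coe, piHat_coe, map_smul]

/-- `π_ℓ` as a linear map. -/
def piHatL : FormalObs P →ₗ[ℂ] LocalObs lev where
  toFun := piHat b lev
  map_add' := piHat_add b lev
  map_smul' := piHat_smul b lev

lemma piHatL_formalLin (v : gD P) : piHatL b lev (formalLin P v) = piLin b lev v :=
  (piHat_coe b lev _).trans (piSym_ι b lev v)

variable (P) in
/-- The formal fields compatible with the filtrations by modes. -/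
def modeFormalFields : Submodule ℂ (FormalField P) where
  carrier := {Φ | ∀ N, (∀ X ∈ Affine.filPos d N, Φ X ∈ filPosD P N) ∧
    ∀ X ∈ Affine.filNeg d N, Φ X ∈ filNegD P N}
  add_mem' {Φ Ψ} hΦ hΨ N :=
    ⟨fun X hX x p => Affine.add_mem_filPos ((hΦ N).1 X hX x p) ((hΨ N).1 X hX x p),
      fun X hX x p => Affine.add_mem_filNeg ((hΦ N).2 X hX x p) ((hΨ N).2 X hX x p)⟩
  zero_mem' _ := ⟨fun _ _ _ _ => Affine.zero_mem_filPos, fun _ _ _ _ => Affine.zero_mem_filNeg⟩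
  smul_mem' c Φ hΦ N := by
    refine ⟨fun X hX x p => ?_, fun X hX x p => ?_⟩
    · have h := (hΦ N).1 X hX x p
      refine ⟨?_, ?_, fun m hm => ?_⟩
      · change c * ((Φ X).1 x p).K = 0
        rw [h.1, mul_zero]
      · change c * ((Φ X).1 x p).D = 0
        rw [h.2.1, mul_zero]
      · change c • ((Φ X).1 x p).loop m = 0
        rw [h.2.2 m hm, smul_zero]
    · have h := (hΦ N).2 X hX x p
      refine ⟨?_, ?_, fun m hm => ?_⟩
      · change c * ((Φ X).1 x p).K = 0
        rw [h.1, mul_zero]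
      · change c * ((Φ X).1 x p).D = 0
        rw [h.2.1, mul_zero]
      · change c • ((Φ X).1 x p).loop m = 0
        rw [h.2.2 m hm, smul_zero]

lemma Affine.smul_mem_filPos {N : ℕ} {X : Affine d} (c : ℂ) (h : X ∈ filPos d N) :
    c • X ∈ filPos d N := by
  refine ⟨by rw [K_smul, h.1, mul_zero], by rw [D_smul, h.2.1, mul_zero], fun m hm => ?_⟩
  rw [loop_smul, Finsupp.smul_apply, h.2.2 m hm, smul_zero]

lemma Affine.smul_mem_filNeg {N : ℕ} {X : Affine d} (c : ℂ) (h : X ∈ filNeg d N) :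
    c • X ∈ filNeg d N := by
  refine ⟨by rw [K_smul, h.1, mul_zero], by rw [D_smul, h.2.1, mul_zero], fun m hm => ?_⟩
  rw [loop_smul, Finsupp.smul_apply, h.2.2 m hm, smul_zero]

lemma Affine.eigenproj_apply (j : ℤ) (X : Affine d) : eigenproj d j X
    = (d.T : ℂ)⁻¹ • ∑ k ∈ Finset.range d.T, d.ω ^ (-(j * k)) • ((sigma d) ^ (k : ℤ)) X := by
  simp only [eigenproj, LinearMap.smul_apply, LinearMap.sum_apply, LinearEquiv.coe_coe,
    zpow_natCast]

lemma Affine.pointProj_mem (x : OnePoint ℂ) (p N : ℕ) :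
    (∀ X ∈ filPos d N, pointProj d x p X ∈ filPos d N) ∧
      ∀ X ∈ filNeg d N, pointProj d x p X ∈ filNeg d N := by
  have he : ∀ j : ℤ, (∀ X ∈ filPos d N, eigenproj d j X ∈ filPos d N) ∧
      ∀ X ∈ filNeg d N, eigenproj d j X ∈ filNeg d N := by
    intro j
    refine ⟨fun X hX => ?_, fun X hX => ?_⟩
    · rw [eigenproj_apply]
      exact smul_mem_filPos _ (sum_mem_filPos fun k _ =>
        smul_mem_filPos _ (sigma_zpow_mem_filPos hX))
    · rw [eigenproj_apply]
      exact smul_mem_filNeg _ (sum_mem_filNeg fun k _ =>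
        smul_mem_filNeg _ (sigma_zpow_mem_filNeg hX))
  induction x using OnePoint.rec with
  | infty =>
    by_cases h : p = 0
    · have h0 : pointProj d ∞ p = 0 := by simp [pointProj, h]
      rw [h0]
      exact ⟨fun _ _ => zero_mem_filPos, fun _ _ => zero_mem_filNeg⟩
    · have h0 : pointProj d ∞ p = eigenproj d (-(p : ℤ)) := by simp [pointProj, h]
      rw [h0]; exact he _
  | coe x =>
    by_cases h : x = 0
    · have h0 : pointProj d x p = eigenproj d (p : ℤ) := by simp [pointProj, h]
      rw [h0]; exact he _
    · have h0 : pointProj d x p = LinearMap.id := by simp [pointProj, h]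
      rw [h0]; exact ⟨fun _ h => h, fun _ h => h⟩

open Classical in
lemma emb_apply (x : OnePoint ℂ) (p : ℕ) (X : Affine d) (y : OnePoint ℂ) (q : Fin (P.n y)) :
    (emb P x p X).1 y q = if y = x ∧ (q : ℕ) = p then pointProj d x p X else 0 := rfl

lemma emb_mem_modeFormalFields (x : OnePoint ℂ) (p : ℕ) :
    emb P x p ∈ modeFormalFields P := by
  classical
  refine fun N => ⟨fun X hX y q => ?_, fun X hX y q => ?_⟩
  · rw [emb_apply]
    split_ifs
    · exact (Affine.pointProj_mem x p N).1 X hX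
    · exact Affine.zero_mem_filPos
  · rw [emb_apply]
    split_ifs
    · exact (Affine.pointProj_mem x p N).2 X hX
    · exact Affine.zero_mem_filNeg

lemma sigmaField_apply (k : ℕ) (Φ : FormalField P) (X : Affine d) :
    sigmaField k Φ X = Φ (((Affine.sigma d) ^ (-(k : ℤ))) X) := by
  rw [zpow_neg, zpow_natCast]; rfl

lemma formalLin_comp_mem {Φ : FormalField P} (hΦ : Φ ∈ modeFormalFields P) :
    formalLin P ∘ₗ Φ ∈ modeFields (formalFil P) d := fun N => ⟨N,
  fun X hX => coe_mem_completedIdeal (Ideal.subset_span ⟨_, (hΦ N).1 X hX, rfl⟩),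
  fun X hX => coe_mem_completedIdeal (Ideal.subset_span ⟨_, (hΦ N).2 X hX, rfl⟩)⟩

lemma piLin_comp_mem {Φ : FormalField P} (hΦ : Φ ∈ modeFormalFields P) :
    piLin b lev ∘ₗ Φ ∈ modeFields (localFil lev) d := fun N => ⟨N,
  fun X hX => piLin_mem_pos b lev ((hΦ N).1 X hX),
  fun X hX => piLin_mem_neg b lev ((hΦ N).2 X hX)⟩

/-- On fields compatible with the filtrations, the pairing of the formal fields is the sum over
the pair of dual bases `cur` and `curDual`. -/
lemma pairing_eq_pair {Φ Ψ : FormalField P} (hΦ : Φ ∈ modeFormalFields P)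
    (hΨ : Ψ ∈ modeFormalFields P) :
    pairing b Φ Ψ = pair b (formalLin P ∘ₗ Φ) (formalLin P ∘ₗ Ψ) :=
  (pair_eq b (formalLin_comp_mem hΦ) (formalLin_comp_mem hΨ)).symm

/-- The morphism `π_ℓ` is continuous and multiplicative, so it maps the pairing of two formal
fields to the pairing of their images. -/
lemma piHatL_pairing {Φ Ψ : FormalField P} (hΦ : Φ ∈ modeFormalFields P)
    (hΨ : Ψ ∈ modeFormalFields P) :
    piHatL b lev (pairing b Φ Ψ) = pair b (piLin b lev ∘ₗ Φ) (piLin b lev ∘ₗ Ψ) := by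
  rw [pairing_eq_pair b hΦ hΨ]
  have h1 := (hasSum_pair b (formalLin_comp_mem hΦ) (formalLin_comp_mem hΨ)).map (piHatL b lev)
    (continuous_piHat b lev)
  refine h1.unique ?_
  convert hasSum_pair b (piLin_comp_mem b lev hΦ) (piLin_comp_mem b lev hΨ) using 2 with j
  simp only [Function.comp_apply, LinearMap.comp_apply]
  refine (piHat_mul b lev _ _).trans (congrArg₂ _ ?_ ?_)
  · exact piHatL_formalLin b lev _
  · exact piHatL_formalLin b lev _

lemma algebraMap_localObs (c : ℂ) :
    algebraMap ℂ (LocalObs lev) c = ((algebraMap ℂ (LocalPre lev) c : LocalPre lev) :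
      LocalObs lev) := rfl

/-- The level: `K_p^{(x)}` acts as the number `i ℓˣₚ`. -/
lemma localLin_hatPart_emb_Kel (x : OnePoint ℂ) (p : ℕ) :
    localLin lev (hatPart P (emb P x p (Affine.Kel d)))
      = algebraMap ℂ _ (Complex.I * lev.ℓ x p) := by
  rw [algebraMap_localObs]
  have h : LocalPre.ι lev (hatPart P (emb P x p (Affine.Kel d)))
      = algebraMap ℂ (LocalPre lev) (Complex.I * lev.ℓ x p) := by
    refine (Ideal.Quotient.eq (I := levelIdeal lev)).mpr ?_
    exact Ideal.subset_span ⟨(x, p), rfl⟩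
  exact congrArg (fun y : LocalPre lev => (y : LocalObs lev)) h

end PiHat

/-! ### The coefficients of the generalised Segal-Sugawara construction -/

section Kappa

/-- A sum over compositions of a positive number, decomposed with respect to the first block. -/
lemma sum_composition_succ {M : Type*} [AddCommMonoid M] (f : List ℕ → M) (m : ℕ) :
    ∑ c : Composition (m + 1), f c.blocks
      = ∑ j ∈ Finset.range (m + 1), ∑ c : Composition (m - j), f ((j + 1) :: c.blocks) := by
  rw [Finset.sum_sigma']
  symm
  refine Finset.sum_bij (fun q hq => ⟨(q.1 + 1) :: q.2.blocks, fun {i} hi => ?_, ?_⟩)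
    (fun _ _ => Finset.mem_univ _) ?_ ?_ (fun _ _ => rfl)
  · rcases List.mem_cons.mp hi with rfl | hi
    · omega
    · exact q.2.blocks_pos hi
  · have h : q.1 < m + 1 := Finset.mem_range.mp (Finset.mem_sigma.mp hq).1
    rw [List.sum_cons, q.2.blocks_sum]
    omega
  · rintro ⟨j, c⟩ _ ⟨j', c'⟩ _ h
    have h' := congrArg Composition.blocks h
    simp only [List.cons.injEq, add_left_inj] at h'
    obtain ⟨rfl, h'⟩ := h'
    rw [Composition.ext h']
  · rintro ⟨l, hpos, hsum⟩ _
    cases l with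
    | nil => simp at hsum
    | cons i l =>
      have hi : 0 < i := hpos (List.mem_cons_self)
      have hs := hsum
      rw [List.sum_cons] at hs
      refine ⟨⟨i - 1, ⟨l, fun hk => hpos (List.mem_cons_of_mem _ hk), by omega⟩⟩, ?_, ?_⟩
      · rw [Finset.mem_sigma]
        exact ⟨Finset.mem_range.mpr (show i - 1 < m + 1 by omega), Finset.mem_univ _⟩
      · apply Composition.ext
        simp only [List.cons.injEq, and_true]
        omega

variable (N : ℕ) (ℓ : ℕ → ℂ)

lemma kappa_of_lt {k : ℤ} (h : k < (N : ℤ) - 1) : kappa N ℓ k = 0 := if_pos h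

lemma kappa_add (m : ℕ) : kappa N ℓ ((N : ℤ) - 1 + m) = ∑ c : Composition m,
    (-1) ^ c.blocks.length * (c.blocks.map fun m => ℓ (N - 1 - m)).prod
      / ℓ (N - 1) ^ (c.blocks.length + 1) := by
  rw [kappa, if_neg (by omega)]
  obtain h : ((N : ℤ) - 1 + m - N + 1).toNat = m := by omega
  rw [h]

lemma kappa_top : kappa N ℓ ((N : ℤ) - 1) = (ℓ (N - 1))⁻¹ := by
  have h := kappa_add N ℓ 0
  rw [Nat.cast_zero, add_zero] at h
  rw [h, Fintype.sum_eq_single (default : Composition 0)]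
  · have h0 : (default : Composition 0).blocks = [] := by
      rw [Composition.blocks_eq_nil]
    rw [h0]
    simp
  · intro c hc
    refine absurd (Composition.ext ?_) hc
    rw [c.blocks_eq_nil.mpr rfl, (default : Composition 0).blocks_eq_nil.mpr rfl]

lemma kappa_succ (m : ℕ) : kappa N ℓ ((N : ℤ) - 1 + (m + 1 : ℕ))
    = -(ℓ (N - 1))⁻¹ * ∑ j ∈ Finset.range (m + 1),
      ℓ (N - 1 - (j + 1)) * kappa N ℓ ((N : ℤ) - 1 + (m - j : ℕ)) := by
  rw [kappa_add, sum_composition_succ (fun l => (-1) ^ l.length *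
    (l.map fun m => ℓ (N - 1 - m)).prod / ℓ (N - 1) ^ (l.length + 1)), Finset.mul_sum]
  refine Finset.sum_congr rfl fun j _ => ?_
  rw [kappa_add, Finset.mul_sum, Finset.mul_sum]
  refine Finset.sum_congr rfl fun c _ => ?_
  rw [List.length_cons, List.map_cons, List.prod_cons]
  ring

/-- The sequence `κ` is inverse to the sequence of levels with respect to convolution. -/
lemma sum_kappa_mul (htop : ℓ (N - 1) ≠ 0) {q r : ℕ} (hq : q < N) (hr : r < N) :
    ∑ p ∈ Finset.range N, kappa N ℓ ((p : ℤ) + q - r) * ℓ p = if q = r then 1 else 0 := by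
  rw [← Finset.sum_range_reflect]
  rcases lt_trichotomy q r with h | h | h
  · rw [if_neg h.ne]
    refine Finset.sum_eq_zero fun j hj => ?_
    rw [kappa_of_lt, zero_mul]
    have := Finset.mem_range.mp hj
    omega
  · subst h
    rw [if_pos rfl, Finset.sum_eq_single 0]
    · have e : ((N - 1 - 0 : ℕ) : ℤ) + q - q = (N : ℤ) - 1 := by omega
      rw [e, kappa_top, Nat.sub_zero, inv_mul_cancel₀ htop]
    · intro j hj h0
      have := Finset.mem_range.mp hj
      rw [kappa_of_lt _ _ (by omega), zero_mul]
    · intro h0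
      exact absurd (Finset.mem_range.mpr (by omega)) h0
  · rw [if_neg h.ne']
    obtain ⟨m, rfl⟩ : ∃ m, q = r + (m + 1) := ⟨q - r - 1, by omega⟩
    have hle : m + 2 ≤ N := by omega
    rw [← Finset.sum_subset (Finset.range_subset_range.mpr hle), Finset.sum_range_succ']
    · have e0 : ((N - 1 - 0 : ℕ) : ℤ) + (r + (m + 1) : ℕ) - r = (N : ℤ) - 1 + (m + 1 : ℕ) := by
        push_cast; omega
      have e1 : ∀ j ∈ Finset.range (m + 1), kappa N ℓ (((N - 1 - (j + 1) : ℕ) : ℤ)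
          + (r + (m + 1) : ℕ) - r) * ℓ (N - 1 - (j + 1))
          = ℓ (N - 1 - (j + 1)) * kappa N ℓ ((N : ℤ) - 1 + (m - j : ℕ)) := by
        intro j hj
        have := Finset.mem_range.mp hj
        have e : ((N - 1 - (j + 1) : ℕ) : ℤ) + (r + (m + 1) : ℕ) - r
          = (N : ℤ) - 1 + (m - j : ℕ) := by omega
        rw [e, mul_comm]
      rw [Finset.sum_congr rfl e1, e0, kappa_succ, Nat.sub_zero]
      field_simp
      ring
    · intro j hj hj'
      have h1 := Finset.mem_range.mp hj
      rw [Finset.mem_range, not_lt] at hj'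
      rw [kappa_of_lt _ _ (by omega), zero_mul]

end Kappa

/-! ### Eigenspaces of the automorphism and homogeneous elements of the Takiff algebras -/

section PointProj

open scoped OnePoint

variable {𝔤 : Type*} [LieRing 𝔤] [LieAlgebra ℂ 𝔤] {d : DihedralData 𝔤} {P : PoleDivisor d}

lemma DihedralData.ω_ne_zero (d : DihedralData 𝔤) : d.ω ≠ 0 :=
  d.ω_primitive.ne_zero d.T_pos.ne'

lemma DihedralData.T_ne_zero (d : DihedralData 𝔤) : (d.T : ℂ) ≠ 0 :=
  Nat.cast_ne_zero.mpr d.T_pos.ne'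

namespace Affine

lemma sigma_zpow_natCast_of_eig {j : ℤ} {Y : Affine d} (hY : sigma d Y = d.ω ^ j • Y) (k : ℕ) :
    ((sigma d) ^ (k : ℤ)) Y = d.ω ^ (j * k) • Y := by
  rw [zpow_natCast]
  induction k with
  | zero => simp
  | succ k ih =>
    rw [pow_succ', LinearEquiv.mul_apply, ih, map_smul, hY, smul_smul, ← zpow_add₀ d.ω_ne_zero]
    congr 2
    push_cast; ring

lemma eigenproj_lie {j : ℤ} {Y : Affine d} (hY : sigma d Y = d.ω ^ j • Y) (i : ℤ) (X : Affine d) :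
    eigenproj d (i + j) ⁅X, Y⁆ = ⁅eigenproj d i X, Y⁆ := by
  rw [eigenproj_apply, eigenproj_apply, smul_lie, sum_lie]
  congr 1
  refine Finset.sum_congr rfl fun k _ => ?_
  rw [sigma_zpow_lie, sigma_zpow_natCast_of_eig hY, lie_smul, smul_smul, smul_lie,
    ← zpow_add₀ d.ω_ne_zero]
  congr 2
  ring

lemma eigenproj_of_eig {j : ℤ} {Y : Affine d} (hY : sigma d Y = d.ω ^ j • Y) :
    eigenproj d j Y = Y := by
  rw [eigenproj_apply]
  have h : ∀ k ∈ Finset.range d.T, d.ω ^ (-(j * k)) • ((sigma d) ^ (k : ℤ)) Y = Y := by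
    intro k _
    rw [sigma_zpow_natCast_of_eig hY, smul_smul, ← zpow_add₀ d.ω_ne_zero, neg_add_cancel, zpow_zero,
      one_smul]
  rw [Finset.sum_congr rfl h, Finset.sum_const, Finset.card_range, ← Nat.cast_smul_eq_nsmul ℂ,
    smul_smul, inv_mul_cancel₀ d.T_ne_zero, one_smul]

end Affine

lemma pointProj_infty_zero : pointProj d ∞ 0 = 0 := by simp [pointProj]

lemma pointProj_infty {p : ℕ} (hp : p ≠ 0) :
    pointProj d ∞ p = Affine.eigenproj d (-(p : ℤ)) := by simp [pointProj, hp]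

lemma pointProj_zero (p : ℕ) : pointProj d ((0 : ℂ) : OnePoint ℂ) p = Affine.eigenproj d p := by
  simp [pointProj]

lemma pointProj_coe {x : ℂ} (hx : x ≠ 0) (p : ℕ) : pointProj d x p = LinearMap.id := by
  simp [pointProj, hx]

lemma pointProj_idem (x : OnePoint ℂ) (p : ℕ) (X : Affine d) :
    pointProj d x p (pointProj d x p X) = pointProj d x p X := by
  induction x using OnePoint.rec with
  | infty =>
    by_cases h : p = 0
    · subst h; rw [pointProj_infty_zero]; rfl
    · rw [pointProj_infty h]
      exact Affine.eigenproj_of_eig (Affine.sigma_eigenproj _ _)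
  | coe x =>
    by_cases h : x = 0
    · subst h; rw [pointProj_zero]
      exact Affine.eigenproj_of_eig (Affine.sigma_eigenproj _ _)
    · rw [pointProj_coe h]; rfl

lemma pointProj_lie {x : OnePoint ℂ} {q s : ℕ} {Y : Affine d} (hY : pointProj d x s Y = Y)
    (hq : x = ∞ → q ≠ 0) (X : Affine d) :
    pointProj d x (q + s) ⁅X, Y⁆ = ⁅pointProj d x q X, Y⁆ := by
  induction x using OnePoint.rec with
  | infty =>
    have hq' := hq rfl
    by_cases h : s = 0
    · subst h
      rw [pointProj_infty_zero] at hY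
      rw [← hY]
      simp
    · rw [pointProj_infty h] at hY
      rw [pointProj_infty hq', pointProj_infty (by omega : q + s ≠ 0),
        ← Affine.eigenproj_lie (j := -(s : ℤ)) (by
          conv_lhs => rw [← hY]
          rw [Affine.sigma_eigenproj, hY])]
      congr 1
      push_cast
      ring_nf
  | coe x =>
    by_cases h : x = 0
    · subst h
      rw [pointProj_zero] at hY
      rw [pointProj_zero, pointProj_zero, ← Affine.eigenproj_lie (j := (s : ℤ)) (by
          conv_lhs => rw [← hY]
          rw [Affine.sigma_eigenproj, hY])]
      push_cast
      rfl
    · rw [pointProj_coe h, pointProj_coe h]; rfl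

lemma eraseD_eigenproj (j : ℤ) (X : Affine d) :
    Affine.eraseD d (Affine.eigenproj d j X) = Affine.eigenproj d j (Affine.eraseD d X) := by
  rw [Affine.eigenproj_apply, Affine.eigenproj_apply, map_smul, map_sum]
  congr 1
  refine Finset.sum_congr rfl fun k _ => ?_
  rw [map_smul, Affine.sigma_zpow_apply, Affine.sigma_zpow_apply]
  rfl

lemma eraseD_pointProj (x : OnePoint ℂ) (p : ℕ) (X : Affine d) :
    Affine.eraseD d (pointProj d x p X) = pointProj d x p (Affine.eraseD d X) := by
  induction x using OnePoint.rec with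
  | infty =>
    by_cases h : p = 0
    · subst h; rw [pointProj_infty_zero]; rfl
    · rw [pointProj_infty h, eraseD_eigenproj]
  | coe x =>
    by_cases h : x = 0
    · subst h; rw [pointProj_zero, eraseD_eigenproj]
    · rw [pointProj_coe h]; rfl

lemma eraseD_lie (X Y : Affine d) : Affine.eraseD d ⁅X, Y⁆ = ⁅X, Y⁆ := rfl

lemma eraseD_eraseD (X : Affine d) :
    Affine.eraseD d (Affine.eraseD d X) = Affine.eraseD d X := rfl

lemma eraseD_add_Del (X : Affine d) : X = Affine.eraseD d X + X.D • Affine.Del d := by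
  ext1 <;> simp [Affine.eraseD, Affine.Del]

open Classical in
variable (P) in
/-- The element `X εᵖ` at the point `x`. -/
def embRaw (x : OnePoint ℂ) (p : ℕ) : Affine d →ₗ[ℂ] TakiffSum P where
  toFun X := fun y q => if y = x ∧ (q : ℕ) = p then X else 0
  map_add' X Y := by
    refine TakiffSum.ext fun y q => ?_
    refine Eq.trans ?_ (TakiffSum.add_apply _ _ _ _).symm
    split_ifs <;> simp
  map_smul' c X := by
    refine TakiffSum.ext fun y q => ?_
    refine Eq.trans ?_ (TakiffSum.smul_apply _ _ _ _).symm
    split_ifs <;> simp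

open Classical in
lemma embRaw_apply (x : OnePoint ℂ) (p : ℕ) (X : Affine d) (y : OnePoint ℂ) (q : Fin (P.n y)) :
    embRaw P x p X y q = if y = x ∧ (q : ℕ) = p then X else 0 := rfl

lemma coe_emb (x : OnePoint ℂ) (p : ℕ) (X : Affine d) :
    (emb P x p X).1 = embRaw P x p (pointProj d x p X) := rfl

lemma coe_hatPart_emb (x : OnePoint ℂ) (p : ℕ) (X : Affine d) :
    (hatPart P (emb P x p X)).1.1 = embRaw P x p (Affine.eraseD d (pointProj d x p X)) := by
  refine TakiffSum.ext fun y q => ?_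
  change Affine.eraseD d (embRaw P x p (pointProj d x p X) y q) = _
  rw [embRaw_apply, embRaw_apply]
  split_ifs
  · rfl
  · rfl

lemma embRaw_of_le {x : OnePoint ℂ} {p : ℕ} (h : P.n x ≤ p) (X : Affine d) :
    embRaw P x p X = 0 := by
  refine TakiffSum.ext fun y q => ?_
  rw [embRaw_apply, if_neg]
  · rfl
  · rintro ⟨rfl, hq⟩
    have := q.2
    omega

lemma lie_embRaw (x : OnePoint ℂ) (p q : ℕ) (X Y : Affine d) :
    ⁅embRaw P x p X, embRaw P x q Y⁆ = embRaw P x (p + q) ⁅X, Y⁆ := by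
  refine TakiffSum.ext fun y k => ?_
  rw [TakiffSum.lie_apply]
  simp only [embRaw_apply]
  by_cases h : y = x ∧ (k : ℕ) = p + q
  · have hk := k.2
    rw [if_pos h, Finset.sum_eq_single (⟨p, by omega⟩ : Fin (P.n y)),
      Finset.sum_eq_single (⟨q, by omega⟩ : Fin (P.n y))]
    · rw [if_pos h.2.symm, if_pos ⟨h.1, rfl⟩, if_pos ⟨h.1, rfl⟩]
    · intro j _ hj
      rw [if_neg (c := y = x ∧ (j : ℕ) = q) fun e => hj (Fin.ext e.2), lie_zero, ite_self]
    · exact fun e => absurd (Finset.mem_univ _) e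
    · intro i _ hi
      refine Finset.sum_eq_zero fun j _ => ?_
      rw [if_neg (c := y = x ∧ (i : ℕ) = p) fun e => hi (Fin.ext e.2), zero_lie, ite_self]
    · exact fun e => absurd (Finset.mem_univ _) e
  · rw [if_neg h]
    refine Finset.sum_eq_zero fun i _ => Finset.sum_eq_zero fun j _ => ?_
    split_ifs with h1 h2 h3
    · exact absurd ⟨h2.1, by omega⟩ h
    · exact lie_zero _
    · exact zero_lie _
    · exact zero_lie _
    · rfl

lemma lie_embRaw_of_ne {x y : OnePoint ℂ} (h : x ≠ y) (p q : ℕ) (X Y : Affine d) :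
    ⁅embRaw P x p X, embRaw P y q Y⁆ = 0 := by
  refine TakiffSum.ext fun z k => ?_
  rw [TakiffSum.lie_apply]
  simp only [embRaw_apply]
  refine Finset.sum_eq_zero fun i _ => Finset.sum_eq_zero fun j _ => ?_
  split_ifs with h1 h2 h3
  · exact absurd (h2.1.symm.trans h3.1) h
  · exact lie_zero _
  · exact zero_lie _
  · exact zero_lie _
  · rfl

lemma emb_pointProj (x : OnePoint ℂ) (p : ℕ) (X : Affine d) :
    emb P x p (pointProj d x p X) = emb P x p X := by
  refine Subtype.ext ?_
  rw [coe_emb, coe_emb, pointProj_idem]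

lemma emb_of_le {x : OnePoint ℂ} {p : ℕ} (h : P.n x ≤ p) : emb P x p = 0 :=
  LinearMap.ext fun X => Subtype.ext ((coe_emb x p X).trans (embRaw_of_le h _))

lemma emb_infty_zero : emb P ∞ 0 = 0 :=
  LinearMap.ext fun X => Subtype.ext ((coe_emb ∞ 0 X).trans (by
    rw [pointProj_infty_zero, LinearMap.zero_apply, map_zero]; rfl))

lemma lie_emb {x : OnePoint ℂ} {q s : ℕ} {Y : Affine d} (hY : pointProj d x s Y = Y)
    (hq : x = ∞ → q ≠ 0) (X : Affine d) :
    ⁅emb P x q X, emb P x s Y⁆ = emb P x (q + s) ⁅X, Y⁆ := by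
  refine Subtype.ext ?_
  rw [LieSubalgebra.coe_bracket, coe_emb, coe_emb, coe_emb, lie_embRaw, hY, pointProj_lie hY hq]

lemma lie_emb_of_ne {x y : OnePoint ℂ} (h : x ≠ y) (p q : ℕ) (X Y : Affine d) :
    ⁅emb P x p X, emb P y q Y⁆ = 0 := by
  refine Subtype.ext ?_
  rw [LieSubalgebra.coe_bracket, coe_emb, coe_emb, lie_embRaw_of_ne h]
  rfl

lemma pointProj_coe_apply (v : gD P) (x : OnePoint ℂ) (p : Fin (P.n x)) :
    pointProj d x p (v.1 x p) = v.1 x p := by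
  induction x using OnePoint.rec with
  | infty =>
    by_cases h : (p : ℕ) = 0
    · rw [v.2.2.2 p h, map_zero]
    · rw [pointProj_infty h]
      exact Affine.eigenproj_of_eig (v.2.2.1 p)
  | coe x =>
    by_cases h : x = 0
    · subst h; rw [pointProj_zero]
      exact Affine.eigenproj_of_eig (v.2.1 p)
    · rw [pointProj_coe h]; rfl

lemma gD_eq_sum (v : gD P) :
    v = ∑ x ∈ poleSet P, ∑ p : Fin (P.n x), emb P x p (v.1 x p) := by
  let ev (y : OnePoint ℂ) (q : Fin (P.n y)) : gD P →ₗ[ℂ] Affine d :=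
    { toFun := fun v => v.1 y q
      map_add' := fun _ _ => rfl
      map_smul' := fun _ _ => rfl }
  refine Subtype.ext (TakiffSum.ext fun y q => ?_)
  change v.1 y q = ev y q _
  simp only [map_sum]
  rw [Finset.sum_eq_single y, Finset.sum_eq_single q]
  · change v.1 y q = (emb P y q (v.1 y q)).1 y q
    rw [coe_emb, embRaw_apply, if_pos ⟨rfl, rfl⟩, pointProj_coe_apply]
  · intro p _ hp
    change embRaw P y p _ y q = 0
    rw [embRaw_apply, if_neg fun h => hp (Fin.ext h.2.symm)]
  · exact fun h => absurd (Finset.mem_univ _) h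
  · intro x _ hx
    refine Finset.sum_eq_zero fun p _ => ?_
    change embRaw P x p _ y q = 0
    rw [embRaw_apply, if_neg fun h => hx h.1.symm]
  · exact fun h => absurd (mem_poleSet_of_ne (by have := q.2; omega)) h

/-- It suffices to check linear properties of `g̃ᴰ` on homogeneous elements at a single point. -/
lemma gD_induction {p : gD P → Prop}
    (emb : ∀ x s X, pointProj d x s X = X → s < P.n x → p (emb P x s X)) (zero : p 0)
    (add : ∀ u v, p u → p v → p (u + v)) (v : gD P) : p v := by
  rw [gD_eq_sum v]
  exact Finset.sum_induction _ p add zero fun x _ =>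
    Finset.sum_induction _ p add zero fun s _ => emb x s _ (pointProj_coe_apply v x s) s.2

end PointProj

/-! ### The Segal-Sugawara elements generate the derivations of the local copies -/

section Sugawara

open scoped OnePoint

variable {𝔤 : Type*} [LieRing 𝔤] [LieAlgebra ℂ 𝔤] {d : DihedralData 𝔤} {P : PoleDivisor d}
variable {I : Type*} [Fintype I] [DecidableEq I] (b : Module.Basis I ℂ 𝔤) (lev : Levels d P)

/-- The field of the modes of the local copy `X ↦ X_p^{(x)}`, without the derivation. -/
def modeField (x : OnePoint ℂ) (p : ℕ) : Affine d →ₗ[ℂ] LocalObs lev :=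
  localLin lev ∘ₗ hatPart P ∘ₗ emb P x p

lemma modeField_mem (x : OnePoint ℂ) (p : ℕ) :
    modeField lev x p ∈ modeFields (localFil lev) d := fun N =>
  have h := emb_mem_modeFormalFields (P := P) x p N
  ⟨N, fun X hX => localLin_mem_pos lev (hatPart_mem_filPosD (h.1 X hX)),
    fun X hX => localLin_mem_neg lev (hatPart_mem_filNegD (h.2 X hX))⟩

lemma modeField_of_le {x : OnePoint ℂ} {p : ℕ} (h : P.n x ≤ p) : modeField lev x p = 0 := by
  rw [modeField, emb_of_le h, LinearMap.comp_zero, LinearMap.comp_zero]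

lemma modeField_Kel (x : OnePoint ℂ) (p : ℕ) : modeField lev x p (Affine.Kel d)
    = algebraMap ℂ _ (Complex.I * lev.ℓ x p) := localLin_hatPart_emb_Kel lev x p

lemma modeField_eraseD (x : OnePoint ℂ) (p : ℕ) (X : Affine d) :
    modeField lev x p (Affine.eraseD d X) = modeField lev x p X := by
  refine congrArg (localLin lev) (Subtype.ext (Subtype.ext ?_))
  change (hatPart P (emb P x p (Affine.eraseD d X))).1.1 = (hatPart P (emb P x p X)).1.1
  rw [coe_hatPart_emb, coe_hatPart_emb, eraseD_pointProj, eraseD_pointProj, eraseD_eraseD]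

lemma modeField_Del (x : OnePoint ℂ) (p : ℕ) : modeField lev x p (Affine.Del d) = 0 := by
  rw [← modeField_eraseD]
  have : Affine.eraseD d (Affine.Del d) = 0 := rfl
  rw [this, map_zero]

lemma modeField_pointProj (x : OnePoint ℂ) (p : ℕ) (X : Affine d) :
    modeField lev x p (pointProj d x p X) = modeField lev x p X :=
  congrArg (fun v => localLin lev (hatPart P v)) (emb_pointProj x p X)

lemma br_modeField_of_ne {x y : OnePoint ℂ} (h : x ≠ y) (p q : ℕ) (X Y : Affine d) :
    (localContBracket lev).br (modeField lev x p X) (modeField lev y q Y) = 0 := by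
  refine (br_localLin lev (hatPart P (emb P x p X)) (hatPart P (emb P y q Y))).trans ?_
  have h0 : ⁅hatPart P (emb P x p X), hatPart P (emb P y q Y)⁆ = 0 := by
    refine Subtype.ext (Subtype.ext ?_)
    rw [LieSubalgebra.coe_bracket, LieSubalgebra.coe_bracket, coe_hatPart_emb, coe_hatPart_emb,
      lie_embRaw_of_ne h]
    rfl
  rw [h0, map_zero]

lemma br_modeField {x : OnePoint ℂ} {q s : ℕ} {Y : Affine d} (hY : pointProj d x s Y = Y)
    (hq : x = ∞ → q ≠ 0) (X : Affine d) :
    (localContBracket lev).br (modeField lev x q X) (modeField lev x s Y)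
      = modeField lev x (q + s) ⁅Affine.eraseD d X, Affine.eraseD d Y⁆ := by
  refine (br_localLin lev (hatPart P (emb P x q X)) (hatPart P (emb P x s Y))).trans
    (congrArg (localLin lev) (Subtype.ext (Subtype.ext ?_)))
  change _ = (hatPart P (emb P x (q + s) ⁅Affine.eraseD d X, Affine.eraseD d Y⁆)).1.1
  have hY' : pointProj d x s (Affine.eraseD d Y) = Affine.eraseD d Y := by
    rw [← eraseD_pointProj, hY]
  rw [LieSubalgebra.coe_bracket, LieSubalgebra.coe_bracket, coe_hatPart_emb, coe_hatPart_emb,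
    coe_hatPart_emb, lie_embRaw, hY, eraseD_pointProj, pointProj_lie hY' hq, eraseD_lie]

lemma sugawara_eq (x : OnePoint ℂ) (r : ℕ) : sugawara b lev x r
    = (Complex.I / 2) • ∑ p ∈ Finset.range (P.n x), ∑ q ∈ Finset.range (P.n x),
      kappa (P.n x) (lev.ℓ x) ((p : ℤ) + q - r) •
        pair b (modeField lev x p) (modeField lev x q) := by
  rw [sugawara]
  refine congrArg _ (Finset.sum_congr rfl fun p _ => Finset.sum_congr rfl fun q _ => ?_)
  congr 1
  rw [pair_symm b (modeField_mem lev x p) (modeField_mem lev x q),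
    pair_eq b (modeField_mem lev x q) (modeField_mem lev x p), modeField_Del, modeField_Del,
    mul_zero, zero_mul, zero_add, zero_add]
  refine tsum_congr fun n => Finset.sum_congr rfl fun a _ => ?_
  rw [mul_comm]
  rfl

section PairLemmas

variable {A : Type*} [CommRing A] [Algebra ℂ A] [UniformSpace A] [IsUniformAddGroup A]
  [IsTopologicalRing A] [CompleteSpace A] [T2Space A] {Fil : ModeFiltration A}
  {Φ Ψ Ξ : Affine d →ₗ[ℂ] A}

lemma pair_sub_right (hΦ : Φ ∈ modeFields Fil d) (hΨ : Ψ ∈ modeFields Fil d)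
    (hΞ : Ξ ∈ modeFields Fil d) : pair b Φ (Ψ - Ξ) = pair b Φ Ψ - pair b Φ Ξ :=
  map_sub (pairL d b Fil ⟨Φ, hΦ⟩) ⟨Ψ, hΨ⟩ ⟨Ξ, hΞ⟩

lemma pair_neg_right (hΦ : Φ ∈ modeFields Fil d) (hΨ : Ψ ∈ modeFields Fil d) :
    pair b Φ (-Ψ) = -pair b Φ Ψ :=
  map_neg (pairL d b Fil ⟨Φ, hΦ⟩) ⟨Ψ, hΨ⟩

lemma pair_zero_right : pair b Φ 0 = 0 := by
  simp [pair]

lemma pair_zero_left : pair b 0 Φ = 0 := by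
  simp [pair]

lemma coeffD_smulRight_mem (c : A) : (Affine.coeffD d).smulRight c ∈ modeFields Fil d := by
  refine fun n => ⟨0, fun X hX => ?_, fun X hX => ?_⟩
  · rw [LinearMap.smulRight_apply]
    have h : Affine.coeffD d X = 0 := hX.2.1
    rw [h, zero_smul]
    exact Ideal.zero_mem _
  · rw [LinearMap.smulRight_apply]
    have h : Affine.coeffD d X = 0 := hX.2.1
    rw [h, zero_smul]
    exact Ideal.zero_mem _

lemma pair_coeffD_right (hΦ : Φ ∈ modeFields Fil d) (c : A) :
    pair b Φ ((Affine.coeffD d).smulRight c) = Φ (Affine.Kel d) * c := by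
  have hK : Affine.coeffD d (Affine.Kel d) = 0 := rfl
  have hD : Affine.coeffD d (Affine.Del d) = 1 := rfl
  have hxt : ∀ n x, Affine.coeffD d (Affine.xt d n x) = 0 := fun _ _ => rfl
  rw [pair_eq b hΦ (coeffD_smulRight_mem c)]
  simp [hK, hD, hxt]

/-- The `κ`-weighted sums of the products of the shifted fields vanish by antisymmetry: the pairing
is invariant, and the shift by `s` loses only terms with `κ = 0`. -/
lemma sum_kappa_pair_adR {N : ℕ} (ℓ : ℕ → ℂ) (Φ : ℕ → Affine d →ₗ[ℂ] A)
    (hΦ : ∀ p, Φ p ∈ modeFields Fil d) (h0 : ∀ p, N ≤ p → Φ p = 0) (r s : ℕ) (Z : Affine d) :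
    ∑ p ∈ Finset.range N, ∑ q ∈ Finset.range N, kappa N ℓ ((p : ℤ) + q - r) •
      pair b (Φ p) (Φ (q + s) ∘ₗ Affine.adR Z) = 0 := by
  have hshift : ∀ p ∈ Finset.range N,
      ∑ q ∈ Finset.range N, kappa N ℓ ((p : ℤ) + q - r) • pair b (Φ p) (Φ (q + s) ∘ₗ Affine.adR Z)
      = ∑ u ∈ Finset.range N, kappa N ℓ ((p : ℤ) + u - s - r) •
          pair b (Φ p) (Φ u ∘ₗ Affine.adR Z) := by
    intro p hp
    have hp' := Finset.mem_range.mp hp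
    set f : ℕ → A := fun u => kappa N ℓ ((p : ℤ) + u - s - r) •
      pair b (Φ p) (Φ u ∘ₗ Affine.adR Z) with hf
    have h1 := Finset.sum_range_add f s N
    have h2 := Finset.sum_range_add f N s
    have h3 : ∑ u ∈ Finset.range s, f u = 0 := Finset.sum_eq_zero fun u hu => by
      have := Finset.mem_range.mp hu
      rw [hf]
      simp only
      rw [kappa_of_lt _ _ (by omega), zero_smul]
    have h4 : ∑ u ∈ Finset.range s, f (N + u) = 0 := Finset.sum_eq_zero fun u _ => by
      rw [hf]
      simp only
      rw [h0 (N + u) (by omega), LinearMap.zero_comp, pair_zero_right, smul_zero]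
    rw [h3, zero_add] at h1
    rw [h4, add_zero, add_comm N s, h1] at h2
    rw [← h2]
    refine Finset.sum_congr rfl fun q _ => ?_
    rw [hf]
    simp only
    rw [add_comm q s]
    congr 2
    push_cast
    ring
  rw [Finset.sum_congr rfl hshift]
  set S := ∑ p ∈ Finset.range N, ∑ u ∈ Finset.range N, kappa N ℓ ((p : ℤ) + u - s - r) •
          pair b (Φ p) (Φ u ∘ₗ Affine.adR Z) with hS
  have hanti : S = -S := by
    conv_lhs => rw [hS, Finset.sum_comm]
    rw [hS, ← Finset.sum_neg_distrib]
    refine Finset.sum_congr rfl fun u _ => ?_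
    rw [← Finset.sum_neg_distrib]
    refine Finset.sum_congr rfl fun p _ => ?_
    rw [pair_symm b (hΦ p) (comp_adR_mem (hΦ u) Z), pair_adR b (hΦ u) (hΦ p), smul_neg,
      add_comm (p : ℤ) u]
  have h2 : (2 : ℂ) • S = 0 := by
    rw [two_smul]
    nth_rewrite 1 [hanti]
    exact neg_add_cancel S
  exact (smul_eq_zero.mp h2).resolve_left two_ne_zero

end PairLemmas

variable {lev} in
lemma level_top_ne_zero {x : OnePoint ℂ} {r : ℕ} (hr : r < P.n x) (hx : x = ∞ → r ≠ 0) :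
    lev.ℓ x (P.n x - 1) ≠ 0 := by
  induction x using OnePoint.rec with
  | infty =>
    have := hx rfl
    exact lev.top_ne_zero_infty (by omega)
  | coe x => exact lev.top_ne_zero x (by omega)

/-- The Segal-Sugawara element `π_ℓ(D_r)` acts on the modes as the derivation `D_r`. As the fields
of modes vanish on `D`, the bracket with `Y_s` acts on them as `ad Y`, up to a correction on `D`.
The first part contributes zero by `sum_kappa_pair_adR`. In the second part the correction is
paired with the values of the fields on `K`, the levels, which cancel the coefficients `κ` by
`sum_kappa_mul`. -/
lemma br_sugawara_modeField {x : OnePoint ℂ} {r s : ℕ} (hr : r < P.n x) (hx : x = ∞ → r ≠ 0)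
    {Y : Affine d} (hY : pointProj d x s Y = Y) :
    (localContBracket lev).br (sugawara b lev x r) (modeField lev x s Y)
      = modeField lev x (r + s) ⁅Affine.Del d, Y⁆ := by
  have hY' : pointProj d x s (Affine.eraseD d Y) = Affine.eraseD d Y := by
    rw [← eraseD_pointProj, hY]
  have hDY : ⁅Affine.Del d, Y⁆ = ⁅Affine.Del d, Affine.eraseD d Y⁆ := by
    conv_lhs => rw [eraseD_add_Del Y, lie_add, lie_smul, lie_self, smul_zero, add_zero]
  rw [← modeField_eraseD lev x s Y, hDY]
  have hYE : Affine.eraseD d (Affine.eraseD d Y) = Affine.eraseD d Y := rfl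
  generalize Affine.eraseD d Y = Y at hY' hYE
  clear hY hDY
  set B := localContBracket lev
  set Φ := modeField lev x with hΦdef
  have hΦ : ∀ p, Φ p ∈ modeFields (localFil lev) d := modeField_mem lev x
  -- `Ξ p` is the bracket of `Y_s` with the field `Φ p`; its first term is the correction on `D`
  set c : ℕ → LocalObs lev := fun p => Φ (p + s) ⁅Affine.Del d, Y⁆ with hc
  set Ξ : ℕ → Affine d →ₗ[ℂ] LocalObs lev :=
    fun p => (Affine.coeffD d).smulRight (c p) - Φ (p + s) ∘ₗ Affine.adR Y with hΞdef
  have hΞ : ∀ p, Ξ p ∈ modeFields (localFil lev) d := fun p =>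
    Submodule.sub_mem _ (coeffD_smulRight_mem _) (comp_adR_mem (hΦ _) Y)
  have hbr : ∀ p, (x = ∞ → p ≠ 0) → ∀ X, B.br (Φ s Y) (Φ p X) = Ξ p X := by
    intro p hp X
    rw [B.skew, hΦdef, br_modeField lev hY' hp, hYE]
    simp only [hΞdef, hc, LinearMap.sub_apply, LinearMap.smulRight_apply, LinearMap.comp_apply,
      Affine.adR_apply]
    have hX : ⁅X, Y⁆ = ⁅Affine.eraseD d X, Y⁆ + X.D • ⁅Affine.Del d, Y⁆ := by
      conv_lhs => rw [eraseD_add_Del X, add_lie, smul_lie]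
    rw [hX, map_add, map_smul]
    change _ = X.D • _ - _
    rw [hΦdef]
    abel
  set t : ℕ → ℕ → LocalObs lev := fun p q =>
    Φ p (Affine.Kel d) * c q - pair b (Φ p) (Φ (q + s) ∘ₗ Affine.adR Y) with ht
  have hpair : ∀ p q, pair b (Φ p) (Ξ q) = t p q := fun p q => by
    rw [pair_sub_right b (hΦ p) (coeffD_smulRight_mem _) (comp_adR_mem (hΦ _) Y),
      pair_coeffD_right b (hΦ p)]
  have hterm : ∀ p q : ℕ, kappa (P.n x) (lev.ℓ x) ((p : ℤ) + q - r) •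
      B.br (Φ s Y) (pair b (Φ p) (Φ q))
      = kappa (P.n x) (lev.ℓ x) ((p : ℤ) + q - r) • (t q p + t p q) ∨ P.n x ≤ p ∨ P.n x ≤ q := by
    intro p q
    by_cases hpN : P.n x ≤ p
    · exact Or.inr (Or.inl hpN)
    by_cases hqN : P.n x ≤ q
    · exact Or.inr (Or.inr hqN)
    refine Or.inl ?_
    -- at infinity there are no modes with index `0`, but there `κ` vanishes
    by_cases hinf : x = ∞ ∧ (p = 0 ∨ q = 0)
    · have hr0 := hx hinf.1
      have : kappa (P.n x) (lev.ℓ x) ((p : ℤ) + q - r) = 0 :=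
        kappa_of_lt _ _ (by rcases hinf.2 with h | h <;> omega)
      rw [this, zero_smul, zero_smul]
    · rw [not_and_or, not_or] at hinf
      congr 1
      rw [B.br_pair b (hΦ p) (hΦ q) (hΞ p) (hΞ q)
        (hbr p fun h => (hinf.resolve_left (not_not.mpr h)).1)
        (hbr q fun h => (hinf.resolve_left (not_not.mpr h)).2),
        pair_symm b (hΞ p) (hΦ q), hpair, hpair]
  have hsum : ∑ p ∈ Finset.range (P.n x), ∑ q ∈ Finset.range (P.n x),
      kappa (P.n x) (lev.ℓ x) ((p : ℤ) + q - r) • t p q = Complex.I • c r := by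
    have h1 := sum_kappa_pair_adR b (N := P.n x) (lev.ℓ x) Φ hΦ
      (fun p hp => modeField_of_le lev hp) r s Y
    have h2 : ∀ q ∈ Finset.range (P.n x), ∑ p ∈ Finset.range (P.n x),
        kappa (P.n x) (lev.ℓ x) ((p : ℤ) + q - r) • (Φ p (Affine.Kel d) * c q)
        = if q = r then Complex.I • c r else 0 := by
      intro q hq
      have h3 := sum_kappa_mul (P.n x) (lev.ℓ x) (level_top_ne_zero hr hx) (Finset.mem_range.mp hq) hr
      have h4 : ∀ p : ℕ, kappa (P.n x) (lev.ℓ x) ((p : ℤ) + q - r) • (Φ p (Affine.Kel d) * c q)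
          = (kappa (P.n x) (lev.ℓ x) ((p : ℤ) + q - r) * lev.ℓ x p) • (Complex.I • c q) := by
        intro p
        rw [hΦdef, modeField_Kel, ← Algebra.smul_def, smul_smul, smul_smul]
        congr 1
        ring
      rw [Finset.sum_congr rfl fun p _ => h4 p, ← Finset.sum_smul, h3]
      split_ifs with h
      · rw [h, one_smul]
      · rw [zero_smul]
    simp only [ht, smul_sub, Finset.sum_sub_distrib]
    rw [h1, sub_zero, Finset.sum_comm, Finset.sum_congr rfl h2, Finset.sum_ite_eq',
      if_pos (Finset.mem_range.mpr hr)]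
  have hfin : B.br (Φ s Y) (sugawara b lev x r) = -c r := by
    rw [sugawara_eq, map_smul, map_sum]
    have h5 : ∀ p ∈ Finset.range (P.n x), B.br (Φ s Y) (∑ q ∈ Finset.range (P.n x),
        kappa (P.n x) (lev.ℓ x) ((p : ℤ) + q - r) • pair b (Φ p) (Φ q))
        = ∑ q ∈ Finset.range (P.n x), (kappa (P.n x) (lev.ℓ x) ((p : ℤ) + q - r) • t q p
          + kappa (P.n x) (lev.ℓ x) ((p : ℤ) + q - r) • t p q) := by
      intro p hp
      rw [map_sum]
      refine Finset.sum_congr rfl fun q hq => ?_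
      have hp' := Finset.mem_range.mp hp
      have hq' := Finset.mem_range.mp hq
      rw [map_smul, ← smul_add]
      exact (hterm p q).resolve_right (by omega)
    rw [Finset.sum_congr rfl h5]
    simp only [Finset.sum_add_distrib]
    rw [Finset.sum_comm (f := fun p q : ℕ => kappa (P.n x) (lev.ℓ x) ((p : ℤ) + q - r) • t q p)]
    have h6 : ∀ p q : ℕ, kappa (P.n x) (lev.ℓ x) ((q : ℤ) + p - r)
        = kappa (P.n x) (lev.ℓ x) ((p : ℤ) + q - r) := fun p q => by rw [add_comm (q : ℤ)]
    simp only [h6]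
    rw [hsum, ← two_smul ℂ, smul_smul, smul_smul]
    rw [show Complex.I / 2 * 2 * Complex.I = -1 by
      linear_combination Complex.I_mul_I, neg_one_smul]
  rw [B.skew, hfin, neg_neg]

lemma br_modeField_sugawara_of_ne {x y : OnePoint ℂ} (h : x ≠ y) (r s : ℕ) (Y : Affine d) :
    (localContBracket lev).br (modeField lev y s Y) (sugawara b lev x r) = 0 := by
  rw [sugawara_eq, map_smul, map_sum]
  refine (congrArg _ (Finset.sum_eq_zero fun p _ => ?_)).trans (smul_zero _)
  rw [map_sum]
  refine Finset.sum_eq_zero fun q _ => ?_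
  rw [map_smul, (localContBracket lev).br_pair b (modeField_mem lev x p) (modeField_mem lev x q)
    (Submodule.zero_mem _) (Submodule.zero_mem _)
    (fun X => br_modeField_of_ne lev h.symm s p Y X)
    (fun X => br_modeField_of_ne lev h.symm s q Y X), pair_zero_left, pair_zero_right, add_zero,
    smul_zero]

lemma br_sugawara_of_ne {x y : OnePoint ℂ} (h : x ≠ y) (r s : ℕ) :
    (localContBracket lev).br (sugawara b lev x r) (sugawara b lev y s) = 0 := by
  have h0 : ∀ p X, (localContBracket lev).br (sugawara b lev x r) (modeField lev y p X) = 0 := by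
    intro p X
    rw [(localContBracket lev).skew, br_modeField_sugawara_of_ne b lev h, neg_zero]
  rw [sugawara_eq b lev y, map_smul, map_sum]
  refine (congrArg _ (Finset.sum_eq_zero fun p _ => ?_)).trans (smul_zero _)
  rw [map_sum]
  refine Finset.sum_eq_zero fun q _ => ?_
  rw [map_smul, (localContBracket lev).br_pair b (modeField_mem lev y p) (modeField_mem lev y q)
    (Submodule.zero_mem _) (Submodule.zero_mem _) (h0 p) (h0 q), pair_zero_left, pair_zero_right,
    add_zero, smul_zero]

/-- Segal-Sugawara elements at the same point commute. The hypothesis `hT` says that a shift by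
`r` does not change the eigenspace allowed at `x`; at the origin and at infinity this means that
`T` divides `r`, which is the condition for `D_r` to be nonzero. -/
lemma br_sugawara {x : OnePoint ℂ} {r s : ℕ} (hr : r < P.n x) (hx : x = ∞ → r ≠ 0 ∧ s ≠ 0)
    (hT : ∀ p, (x = ∞ → p ≠ 0) → pointProj d x (r + p) = pointProj d x p) :
    (localContBracket lev).br (sugawara b lev x r) (sugawara b lev x s) = 0 := by
  have h0 : ∀ p, (x = ∞ → p ≠ 0) → ∀ X,
      (localContBracket lev).br (sugawara b lev x r) (modeField lev x p X)
      = (-(modeField lev x (p + r) ∘ₗ Affine.adR (Affine.Del d))) X := by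
    intro p hp X
    rw [← modeField_pointProj lev x p X, br_sugawara_modeField b lev hr (fun h => (hx h).1)
      (pointProj_idem x p X), LinearMap.neg_apply, LinearMap.comp_apply, Affine.adR_apply,
      ← map_neg, lie_skew, add_comm p r, ← modeField_pointProj lev x (r + p), ← lie_skew, map_neg,
      hT p hp]
    have hD : pointProj d x p ⁅pointProj d x p X, Affine.Del d⁆
        = pointProj d x p ⁅X, Affine.Del d⁆ := by
      have h1 : ∀ j : ℤ, ∀ X, Affine.eigenproj d j ⁅X, Affine.Del d⁆
          = ⁅Affine.eigenproj d j X, Affine.Del d⁆ := by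
        intro j X
        have h2 := Affine.eigenproj_lie (j := 0) (Y := Affine.Del d) (by
          rw [zpow_zero, one_smul]
          have := Affine.sigma_zpow_Del (d := d) 1
          rwa [zpow_one] at this) j X
        rwa [add_zero] at h2
      induction x using OnePoint.rec with
      | infty =>
        rw [pointProj_infty (hp rfl), h1, h1]
        rw [Affine.eigenproj_of_eig (Affine.sigma_eigenproj _ _)]
      | coe x =>
        by_cases h : x = 0
        · subst h
          rw [pointProj_zero, h1, h1]
          rw [Affine.eigenproj_of_eig (Affine.sigma_eigenproj _ _)]
        · rw [pointProj_coe h]; rfl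
    rw [hD, ← map_neg, lie_skew, ← hT p hp, modeField_pointProj]
  have hm : ∀ p, -(modeField lev x (p + r) ∘ₗ Affine.adR (Affine.Del d))
      ∈ modeFields (localFil lev) d := fun p =>
    Submodule.neg_mem _ (comp_adR_mem (modeField_mem lev x _) _)
  set t : ℕ → ℕ → LocalObs lev := fun p q =>
    pair b (modeField lev x p) (modeField lev x (q + r) ∘ₗ Affine.adR (Affine.Del d)) with ht
  have hterm : ∀ p ∈ Finset.range (P.n x), ∀ q ∈ Finset.range (P.n x),
      kappa (P.n x) (lev.ℓ x) ((p : ℤ) + q - s) • (localContBracket lev).br (sugawara b lev x r)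
        (pair b (modeField lev x p) (modeField lev x q))
      = -(kappa (P.n x) (lev.ℓ x) ((p : ℤ) + q - s) • t q p
        + kappa (P.n x) (lev.ℓ x) ((p : ℤ) + q - s) • t p q) := by
    intro p hp q hq
    have hp' := Finset.mem_range.mp hp
    have hq' := Finset.mem_range.mp hq
    by_cases hinf : x = ∞ ∧ (p = 0 ∨ q = 0)
    · have hs0 := (hx hinf.1).2
      have : kappa (P.n x) (lev.ℓ x) ((p : ℤ) + q - s) = 0 :=
        kappa_of_lt _ _ (by rcases hinf.2 with h | h <;> omega)
      rw [this, zero_smul, zero_smul, zero_smul, add_zero, neg_zero]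
    · rw [not_and_or, not_or] at hinf
      rw [(localContBracket lev).br_pair b (modeField_mem lev x p) (modeField_mem lev x q) (hm p)
        (hm q) (h0 p fun h => (hinf.resolve_left (not_not.mpr h)).1)
        (h0 q fun h => (hinf.resolve_left (not_not.mpr h)).2),
        pair_symm b (hm p) (modeField_mem lev x q),
        pair_neg_right b (modeField_mem lev x q) (comp_adR_mem (modeField_mem lev x _) _),
        pair_neg_right b (modeField_mem lev x p) (comp_adR_mem (modeField_mem lev x _) _),
        ← smul_add, ← smul_neg, neg_add]
  have hsum : ∑ p ∈ Finset.range (P.n x), ∑ q ∈ Finset.range (P.n x),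
      kappa (P.n x) (lev.ℓ x) ((p : ℤ) + q - s) • t p q = 0 :=
    sum_kappa_pair_adR b (N := P.n x) (lev.ℓ x) (modeField lev x) (modeField_mem lev x)
      (fun p hp => modeField_of_le lev hp) s r (Affine.Del d)
  rw [sugawara_eq b lev x s, map_smul, map_sum]
  refine (congrArg _ ?_).trans (smul_zero _)
  have h5 : ∀ p ∈ Finset.range (P.n x), (localContBracket lev).br (sugawara b lev x r)
      (∑ q ∈ Finset.range (P.n x), kappa (P.n x) (lev.ℓ x) ((p : ℤ) + q - s) •
        pair b (modeField lev x p) (modeField lev x q))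
      = ∑ q ∈ Finset.range (P.n x), -(kappa (P.n x) (lev.ℓ x) ((p : ℤ) + q - s) • t q p
          + kappa (P.n x) (lev.ℓ x) ((p : ℤ) + q - s) • t p q) := by
    intro p hp
    rw [map_sum]
    refine Finset.sum_congr rfl fun q hq => ?_
    rw [map_smul]
    exact hterm p hp q hq
  rw [Finset.sum_congr rfl h5]
  simp only [Finset.sum_neg_distrib, Finset.sum_add_distrib]
  rw [hsum, add_zero, Finset.sum_comm]
  have h6 : ∀ p q : ℕ, kappa (P.n x) (lev.ℓ x) ((q : ℤ) + p - s)
      = kappa (P.n x) (lev.ℓ x) ((p : ℤ) + q - s) := fun p q => by rw [add_comm (q : ℤ)]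
  simp only [h6]
  rw [hsum, neg_zero]

/-- The morphism `π_ℓ` on homogeneous elements that are allowed as coefficients of `εᵖ` at `x`. -/
lemma piLin_emb {x : OnePoint ℂ} {p : ℕ} (hp : p < P.n x) {X : Affine d}
    (hX : pointProj d x p X = X) :
    piLin b lev (emb P x p X) = modeField lev x p X + X.D • sugawara b lev x p := by
  rw [piLin, LinearMap.add_apply]
  congr 1
  rw [LinearMap.sum_apply, Finset.sum_eq_single x, LinearMap.sum_apply,
    Finset.sum_eq_single (⟨p, hp⟩ : Fin (P.n x))]
  · rw [LinearMap.smulRight_apply]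
    congr 1
    change ((emb P x p X).1 x ⟨p, hp⟩).D = _
    rw [coe_emb, embRaw_apply, if_pos ⟨rfl, rfl⟩, hX]
  · intro q _ hq
    rw [LinearMap.smulRight_apply]
    have : coeffDD P x q (emb P x p X) = 0 := by
      change ((emb P x p X).1 x q).D = _
      rw [coe_emb, embRaw_apply, if_neg fun h => hq (Fin.ext h.2)]
      rfl
    rw [this, zero_smul]
  · exact fun h => absurd (Finset.mem_univ _) h
  · intro y _ hy
    rw [LinearMap.sum_apply]
    refine Finset.sum_eq_zero fun q _ => ?_
    rw [LinearMap.smulRight_apply]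
    have : coeffDD P y q (emb P x p X) = 0 := by
      change ((emb P x p X).1 y q).D = _
      rw [coe_emb, embRaw_apply, if_neg fun h => hy h.1]
      rfl
    rw [this, zero_smul]
  · exact fun h => absurd (mem_poleSet_of_ne (by omega)) h

lemma piLin_emb_of_D_eq_zero {x : OnePoint ℂ} {p : ℕ} {X : Affine d} (hX : X.D = 0) :
    piLin b lev (emb P x p X) = modeField lev x p X := by
  have h : emb P x p X ∈ hatD P := by
    intro y q
    rw [coe_emb, embRaw_apply]
    split_ifs
    · have he : X = Affine.eraseD d X := Affine.ext rfl rfl hX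
      rw [he, ← eraseD_pointProj]
      rfl
    · rfl
  rw [piLin_of_mem_hatD b lev h]
  refine congrArg (localLin lev) (Subtype.ext (Subtype.ext (TakiffSum.ext fun y q => ?_)))
  exact Affine.ext rfl rfl (h y q)

/-- If an element with a component along `D` is allowed as coefficient of `εʳ` at the origin or at
infinity, then `r` is divisible by `T`. -/
lemma pointProj_add_of_D_ne_zero {x : OnePoint ℂ} {r : ℕ} {X : Affine d}
    (hX : pointProj d x r X = X) (hD : X.D ≠ 0) (p : ℕ) (hp : x = ∞ → p ≠ 0) :
    pointProj d x (r + p) = pointProj d x p := by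
  have key : ∀ j : ℤ, Affine.eigenproj d j X = X → d.ω ^ j = 1 := by
    intro j hj
    have h1 := Affine.sigma_eigenproj j X
    rw [hj] at h1
    have h2 : X.D = d.ω ^ j * X.D := congrArg Affine.D h1
    exact (mul_right_cancel₀ hD (by rw [one_mul]; exact h2)).symm
  have heig : ∀ i j : ℤ, d.ω ^ i = 1 → Affine.eigenproj d (i + j) = Affine.eigenproj d j := by
    intro i j hi
    refine LinearMap.ext fun Z => ?_
    rw [Affine.eigenproj_apply, Affine.eigenproj_apply]
    congr 1
    refine Finset.sum_congr rfl fun k _ => ?_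
    congr 1
    rw [add_mul, neg_add, zpow_add₀ d.ω_ne_zero, zpow_neg, zpow_mul, hi, one_zpow, inv_one, one_mul]
  induction x using OnePoint.rec with
  | infty =>
    have hp' := hp rfl
    have hr : r ≠ 0 := by
      rintro rfl
      rw [pointProj_infty_zero] at hX
      exact hD (by rw [← hX]; rfl)
    rw [pointProj_infty hr] at hX
    rw [pointProj_infty hp', pointProj_infty (by omega), ← heig _ (-(p : ℤ)) (key _ hX)]
    congr 1
    push_cast; ring
  | coe x =>
    by_cases h : x = 0
    · subst h
      rw [pointProj_zero] at hX
      rw [pointProj_zero, pointProj_zero, ← heig _ (p : ℤ) (key _ hX)]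
      push_cast
      rfl
    · rw [pointProj_coe h, pointProj_coe h]

/-- The linear map `π_ℓ` is a homomorphism of Lie algebras: on the derivations this is the
Segal-Sugawara construction at each pole. -/
theorem br_piLin (u v : gD P) : (localContBracket lev).br (piLin b lev u) (piLin b lev v)
    = piLin b lev ⁅u, v⁆ := by
  induction u using gD_induction with
  | zero => rw [zero_lie, map_zero, map_zero, LinearMap.zero_apply]
  | add u u' hu hu' => rw [add_lie, map_add, map_add, LinearMap.add_apply, hu, hu', map_add]
  | emb x q X hX hq =>
    induction v using gD_induction with
    | zero => rw [lie_zero, map_zero, map_zero]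
    | add v v' hv hv' => rw [lie_add, map_add, map_add, hv, hv', map_add]
    | emb y s Y hY hs =>
      set B := localContBracket lev
      rw [piLin_emb b lev hq hX, piLin_emb b lev hs hY]
      simp only [map_add, map_smul, LinearMap.add_apply, LinearMap.smul_apply]
      by_cases hxy : x = y
      · subst hxy
        by_cases hinf : x = ∞ ∧ (q = 0 ∨ s = 0)
        · -- one of the two elements is zero
          obtain ⟨rfl, h | h⟩ := hinf
          · subst h
            rw [pointProj_infty_zero] at hX
            rw [← hX]
            simp
          · subst h
            rw [pointProj_infty_zero] at hY
            rw [← hY]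
            simp
        · have hq0 : x = ∞ → q ≠ 0 := fun h h' => hinf ⟨h, Or.inl h'⟩
          have hs0 : x = ∞ → s ≠ 0 := fun h h' => hinf ⟨h, Or.inr h'⟩
          rw [lie_emb hY hq0, piLin_emb_of_D_eq_zero b lev rfl, br_modeField lev hY hq0]
          have h1 : X.D • B.br (sugawara b lev x q) (modeField lev x s Y)
              = X.D • modeField lev x (q + s) ⁅Affine.Del d, Y⁆ := by
            rw [br_sugawara_modeField b lev hq hq0 hY]
          have h2 : B.br (modeField lev x q X) (sugawara b lev x s)
              = -modeField lev x (q + s) ⁅Affine.Del d, X⁆ := by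
            rw [B.skew, br_sugawara_modeField b lev hs hs0 hX, add_comm]
          have h3 : X.D • B.br (sugawara b lev x q) (sugawara b lev x s) = 0 := by
            by_cases hD : X.D = 0
            · rw [hD, zero_smul]
            · rw [br_sugawara b lev hq (fun h => ⟨hq0 h, hs0 h⟩)
                (pointProj_add_of_D_ne_zero hX hD), smul_zero]
          rw [h1, h2, h3, add_zero, ← map_smul, smul_neg, ← map_smul, ← map_neg,
            ← map_add, ← map_add]
          congr 1
          conv_rhs => rw [eraseD_add_Del X, eraseD_add_Del Y]
          have h4 : ⁅Affine.Del d, X⁆ = ⁅Affine.Del d, Affine.eraseD d X⁆ := by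
            conv_lhs => rw [eraseD_add_Del X, lie_add, lie_smul, lie_self, smul_zero, add_zero]
          have h5 : ⁅Affine.Del d, Y⁆ = ⁅Affine.Del d, Affine.eraseD d Y⁆ := by
            conv_lhs => rw [eraseD_add_Del Y, lie_add, lie_smul, lie_self, smul_zero, add_zero]
          rw [h4, h5, lie_add, add_lie, add_lie, lie_smul, lie_smul, smul_lie, smul_lie, lie_self,
            ← lie_skew (Affine.eraseD d X) (Affine.Del d)]
          simp only [smul_zero, smul_neg, add_zero]
      · rw [lie_emb_of_ne hxy, map_zero, br_modeField_of_ne lev hxy,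
          br_modeField_sugawara_of_ne b lev (Ne.symm hxy), br_sugawara_of_ne b lev hxy, B.skew,
          br_modeField_sugawara_of_ne b lev hxy]
        simp

end Sugawara

/-! ### The formal Lax matrix as an average over the cyclic group -/

section PeriodicSums

variable {V : Type*} [AddCommGroup V] {T : ℕ}

lemma sum_range_int_shift (f : ℤ → V) (hf : ∀ k, f (k + T) = f k) (m : ℤ) :
    ∑ k ∈ Finset.range T, f (k + m) = ∑ k ∈ Finset.range T, f k := by
  have h1 : ∀ g : ℤ → V, (∀ k, g (k + T) = g k) →
      ∑ k ∈ Finset.range T, g (k + 1) = ∑ k ∈ Finset.range T, g k := by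
    intro g hg
    have h := Finset.sum_range_succ' (fun k : ℕ => g k) T
    rw [Finset.sum_range_succ] at h
    have h0 : g ((T : ℕ) : ℤ) = g ((0 : ℕ) : ℤ) := by
      have := hg 0
      rwa [zero_add] at this
    rw [h0] at h
    push_cast at h
    exact (add_right_cancel h).symm
  have h2 : ∀ n : ℤ, ∑ k ∈ Finset.range T, f (k + (n + 1)) = ∑ k ∈ Finset.range T, f (k + n) := by
    intro n
    rw [← h1 (fun k => f (k + n)) fun k => by rw [← hf (k + n)]; congr 1; ring]
    exact Finset.sum_congr rfl fun k _ => by congr 1; ring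
  induction m using Int.induction_on with
  | zero => simp
  | succ m ih => rw [h2, ih]
  | pred m ih => rw [← ih, ← h2]; congr! 3; ring

lemma sum_range_int_neg (f : ℤ → V) (hf : ∀ k, f (k + T) = f k) :
    ∑ k ∈ Finset.range T, f (-k) = ∑ k ∈ Finset.range T, f k := by
  rw [← Finset.sum_range_reflect (fun k : ℕ => f k), ← sum_range_int_shift (fun k => f (-k))
    (fun k => by rw [← hf (-(k + T))]; congr 1; ring) (1 - T)]
  refine Finset.sum_congr rfl fun k hk => ?_
  have := Finset.mem_range.mp hk
  congr 1
  omega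

lemma sum_range_int_sub (f : ℤ → V) (hf : ∀ k, f (k + T) = f k) (m : ℤ) :
    ∑ k ∈ Finset.range T, f (m - k) = ∑ k ∈ Finset.range T, f k := by
  rw [← sum_range_int_shift f hf m, ← sum_range_int_neg (fun k => f (k + m))
    fun k => by rw [← hf (k + m)]; congr 1; ring]
  exact Finset.sum_congr rfl fun k _ => by congr 1; ring

end PeriodicSums

section RMatrix

open scoped OnePoint

variable {𝔤 : Type*} [LieRing 𝔤] [LieAlgebra ℂ 𝔤] {d : DihedralData 𝔤} {P : PoleDivisor d}

lemma DihedralData.ω_zpow_T (d : DihedralData 𝔤) : d.ω ^ (d.T : ℤ) = 1 := by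
  rw [zpow_natCast]; exact d.ω_primitive.pow_eq_one

lemma DihedralData.ω_zpow_add_T (d : DihedralData 𝔤) (k : ℤ) : d.ω ^ (k + d.T) = d.ω ^ k := by
  rw [zpow_add₀ d.ω_ne_zero, d.ω_zpow_T, mul_one]

lemma DihedralData.exists_pow_eq_zpow (d : DihedralData 𝔤) (k : ℤ) :
    ∃ m < d.T, d.ω ^ k = d.ω ^ m := by
  have hT : (d.T : ℤ) ≠ 0 := by have := d.T_pos; omega
  have h1 : (((k % d.T).toNat : ℕ) : ℤ) = k % d.T :=
    Int.toNat_of_nonneg (Int.emod_nonneg _ hT)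
  refine ⟨(k % d.T).toNat, ?_, ?_⟩
  · have := Int.emod_lt_of_pos k (show (0 : ℤ) < d.T by have := d.T_pos; omega)
    omega
  · rw [← zpow_natCast, h1]
    conv_lhs => rw [← Int.emod_add_mul_ediv k d.T]
    rw [zpow_add₀ d.ω_ne_zero, zpow_mul, d.ω_zpow_T, one_zpow, mul_one]

lemma Affine.sigma_zpow_T : (sigma d) ^ (d.T : ℤ) = 1 := by
  rw [zpow_natCast, sigma_pow_T]

lemma Affine.sigma_zpow_add_T (k : ℤ) : (sigma d) ^ (k + d.T) = (sigma d) ^ k := by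
  rw [zpow_add, sigma_zpow_T, mul_one]

lemma Affine.sigma_zpow_zpow (k l : ℤ) (X : Affine d) :
    ((sigma d) ^ k) (((sigma d) ^ l) X) = ((sigma d) ^ (k + l)) X := by
  rw [zpow_add, LinearEquiv.mul_apply]

lemma Affine.eigenproj_apply_neg (j : ℤ) (X : Affine d) : eigenproj d j X
    = (d.T : ℂ)⁻¹ • ∑ k ∈ Finset.range d.T, d.ω ^ (j * k) • ((sigma d) ^ (-(k : ℤ))) X := by
  rw [eigenproj_apply, ← sum_range_int_neg (fun k : ℤ => d.ω ^ (-(j * k)) • ((sigma d) ^ k) X)]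
  · congr 1
    exact Finset.sum_congr rfl fun k _ => by rw [mul_neg, neg_neg]
  · intro k
    rw [sigma_zpow_add_T, mul_add, neg_add, zpow_add₀ d.ω_ne_zero, mul_comm j (d.T : ℤ), zpow_neg _
      ((d.T : ℤ) * j), zpow_mul, d.ω_zpow_T, one_zpow, inv_one, mul_one]

variable (P) in
/-- The twist `Φ ↦ Φ ∘ σᵏ` of formal fields, which is the action of `σ⁻ᵏ` on the first tensor
factor. -/
def twistF (k : ℤ) : modeFormalFields P →ₗ[ℂ] modeFormalFields P where
  toFun Φ := ⟨Φ.1 ∘ₗ (((Affine.sigma d) ^ k : Affine d ≃ₗ[ℂ] Affine d) : Affine d →ₗ[ℂ] Affine d),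
    fun N => ⟨fun _ hX => (Φ.2 N).1 _ (Affine.sigma_zpow_mem_filPos hX),
      fun _ hX => (Φ.2 N).2 _ (Affine.sigma_zpow_mem_filNeg hX)⟩⟩
  map_add' _ _ := rfl
  map_smul' _ _ := rfl

variable (P) in
/-- The field `𝒜ˣₚ`, as an element of `modeFormalFields`. -/
def fieldF (x : OnePoint ℂ) (p : ℕ) : modeFormalFields P := ⟨emb P x p, emb_mem_modeFormalFields x p⟩

variable (P) in
/-- The formal Lax matrix `ℒ(z)`, as an element of `modeFormalFields`. -/
def laxF (z : ℂ) : modeFormalFields P :=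
  laxSum P (fun k x p => twistF P (-(k : ℤ)) (fieldF P x p)) z

variable (P) in
/-- The formal field `ℳˣₚ(z)`, as an element of `modeFormalFields`. -/
def partnerF (x : OnePoint ℂ) (p : ℕ) (z : ℂ) : modeFormalFields P :=
  partnerSum P (fun k x p => twistF P (-(k : ℤ)) (fieldF P x p)) x p z

section Map

variable {V W : Type*} [AddCommGroup V] [Module ℂ V] [AddCommGroup W] [Module ℂ W]

lemma map_laxSum (S : V →ₗ[ℂ] W) (c : ℕ → OnePoint ℂ → ℕ → V) (z : ℂ) :
    S (laxSum P c z) = laxSum P (fun k x p => S (c k x p)) z := by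
  simp only [laxSum, map_add, map_sub, map_smul, map_sum]

lemma map_partnerSum (S : V →ₗ[ℂ] W) (c : ℕ → OnePoint ℂ → ℕ → V) (x : OnePoint ℂ) (p : ℕ)
    (z : ℂ) : S (partnerSum P c x p z) = partnerSum P (fun k x p => S (c k x p)) x p z := by
  induction x using OnePoint.rec with
  | infty => simp only [partnerSum, OnePoint.elim_infty, map_smul, map_sum]
  | coe x =>
    simp only [partnerSum, OnePoint.elim_some]
    split_ifs <;> simp only [map_smul, map_sum]

end Map

lemma coe_twistF_fieldF (k : ℕ) (x : OnePoint ℂ) (p : ℕ) :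
    (twistF P (-(k : ℤ)) (fieldF P x p)).1 = sigmaField k (fieldA P x p) :=
  LinearMap.ext fun X => (sigmaField_apply k (fieldA P x p) X).symm

lemma coe_laxF (z : ℂ) : (laxF P z).1 = formalLax P z := by
  have h := map_laxSum (P := P) (modeFormalFields P).subtype
    (fun k x p => twistF P (-(k : ℤ)) (fieldF P x p)) z
  simp only [Submodule.subtype_apply, coe_twistF_fieldF] at h
  exact h

lemma coe_partnerF (x : OnePoint ℂ) (p : ℕ) (z : ℂ) : (partnerF P x p z).1 = formalM P x p z := by
  have h := map_partnerSum (P := P) (modeFormalFields P).subtype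
    (fun k x p => twistF P (-(k : ℤ)) (fieldF P x p)) x p z
  simp only [Submodule.subtype_apply, coe_twistF_fieldF] at h
  exact h

/-- The coefficients of `∑ₚ εᵖ / (z - y)^{p+1} = 1 / (z - y - ε)` at finite `y`, and of
`-∑_{p ≥ 1} z^{p-1} εᵖ = -ε / (1 - z ε)` at infinity. -/
def polarCoeff (z : ℂ) (y : OnePoint ℂ) (p : ℕ) : ℂ :=
  y.elim (if p = 0 then 0 else -z ^ (p - 1)) fun y => ((z - y) ^ (p + 1))⁻¹

variable (P) in
/-- The expansion of `X / (z - ·)` at all poles simultaneously. -/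
def polarRaw (z : ℂ) : Affine d →ₗ[ℂ] TakiffSum P where
  toFun X := fun y p => polarCoeff z y p • X
  map_add' X Y := by
    refine TakiffSum.ext fun y q => ?_
    exact smul_add _ _ _
  map_smul' c X := by
    refine TakiffSum.ext fun y q => ?_
    exact smul_comm _ _ _

lemma polarRaw_apply (z : ℂ) (X : Affine d) (y : OnePoint ℂ) (p : Fin (P.n y)) :
    polarRaw P z X y p = polarCoeff z y p • X := rfl

lemma sum_fin_antidiagonal {M : Type*} [AddCommMonoid M] {n : ℕ} (k : Fin n) (f : ℕ → ℕ → M) :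
    ∑ i : Fin n, ∑ j : Fin n, (if (i : ℕ) + j = k then f i j else 0)
      = ∑ i ∈ Finset.range (k + 1), f i (k - i) := by
  have hinner : ∀ i : Fin n, ∑ j : Fin n, (if (i : ℕ) + j = k then f i j else 0)
      = if (i : ℕ) ≤ k then f i (k - i) else 0 := by
    intro i
    have hk := k.2
    split_ifs with h
    · rw [Finset.sum_eq_single (⟨k - i, by omega⟩ : Fin n)]
      · rw [if_pos (show (i : ℕ) + (k - i) = k by omega)]
      · intro j _ hj
        exact if_neg fun e => hj (Fin.ext (show (j : ℕ) = k - i by omega))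
      · exact fun e => absurd (Finset.mem_univ _) e
    · exact Finset.sum_eq_zero fun j _ => if_neg (by omega)
  simp only [hinner]
  rw [Fin.sum_univ_eq_sum_range (fun i => if i ≤ (k : ℕ) then f i (k - i) else 0) n]
  have hk := k.2
  rw [← Finset.sum_subset (Finset.range_subset_range.mpr (show (k : ℕ) + 1 ≤ n by omega))]
  · refine Finset.sum_congr rfl fun i hi => if_pos ?_
    have := Finset.mem_range.mp hi
    omega
  · intro i _ hi
    rw [Finset.mem_range] at hi
    exact if_neg (by omega)

/-- The identity `1/((z-t)(w-t)) = (1/(z-t) - 1/(w-t)) / (w-z)`, expanded at the pole `y`. -/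
lemma sum_polarCoeff {z w : ℂ} (hzw : w ≠ z) (y : OnePoint ℂ)
    (hz : ∀ y' : ℂ, y = y' → z ≠ y') (hw : ∀ y' : ℂ, y = y' → w ≠ y') (k : ℕ) :
    ∑ i ∈ Finset.range (k + 1), polarCoeff z y i * polarCoeff w y (k - i)
      = (w - z)⁻¹ * (polarCoeff z y k - polarCoeff w y k) := by
  have hwz : w - z ≠ 0 := sub_ne_zero.mpr hzw
  rw [eq_inv_mul_iff_mul_eq₀ hwz]
  induction y using OnePoint.rec with
  | infty =>
    simp only [polarCoeff, OnePoint.elim_infty]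
    rcases k with _ | k
    · simp
    rw [Finset.sum_range_succ, Finset.sum_range_succ']
    rw [if_pos (show k + 1 - (k + 1) = 0 by omega), if_pos rfl, mul_zero, zero_mul, add_zero,
      add_zero, if_neg (Nat.succ_ne_zero k), if_neg (Nat.succ_ne_zero k)]
    have h := geom_sum₂_mul z w k
    have e : ∀ i ∈ Finset.range k, (if i + 1 = 0 then (0 : ℂ) else -z ^ (i + 1 - 1)) *
        (if k + 1 - (i + 1) = 0 then 0 else -w ^ (k + 1 - (i + 1) - 1))
        = z ^ i * w ^ (k - 1 - i) := by
      intro i hi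
      have := Finset.mem_range.mp hi
      rw [if_neg (Nat.succ_ne_zero i), if_neg (by omega), Nat.add_sub_cancel, neg_mul_neg,
        show k + 1 - (i + 1) - 1 = k - 1 - i by omega]
    rw [Finset.sum_congr rfl e, Nat.add_sub_cancel]
    linear_combination -h
  | coe y =>
    have hz' : z - y ≠ 0 := sub_ne_zero.mpr (hz y rfl)
    have hw' : w - y ≠ 0 := sub_ne_zero.mpr (hw y rfl)
    simp only [polarCoeff, OnePoint.elim_some]
    set a := (z - y)⁻¹ with ha
    set c := (w - y)⁻¹ with hc
    have h := geom_sum₂_mul a c (k + 1)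
    have hac : a - c = (w - z) * (a * c) := by
      rw [ha, hc]; field_simp; ring
    have e : ∀ i ∈ Finset.range (k + 1), ((z - y) ^ (i + 1))⁻¹ * ((w - y) ^ (k - i + 1))⁻¹
        = (a * c) * (a ^ i * c ^ (k + 1 - 1 - i)) := by
      intro i _
      rw [← inv_pow, ← inv_pow, Nat.add_sub_cancel]
      ring
    rw [Finset.sum_congr rfl e, ← Finset.mul_sum, ← inv_pow, ← inv_pow]
    linear_combination h - (∑ i ∈ Finset.range (k + 1), a ^ i * c ^ (k + 1 - 1 - i)) * hac

/-- The bracket of two expansions `X / (z - t)` and `Y / (w - t)`, by partial fractions in `t`. -/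
lemma lie_polarRaw {z w : ℂ} (hzw : w ≠ z) (hz : ∀ y : ℂ, P.n y ≠ 0 → z ≠ y)
    (hw : ∀ y : ℂ, P.n y ≠ 0 → w ≠ y) (X Y : Affine d) :
    ⁅polarRaw P z X, polarRaw P w Y⁆
      = (w - z)⁻¹ • (polarRaw P z ⁅X, Y⁆ - polarRaw P w ⁅X, Y⁆) := by
  refine TakiffSum.ext fun y k => ?_
  have hny : P.n y ≠ 0 := by have := k.2; omega
  rw [TakiffSum.lie_apply]
  simp only [polarRaw_apply, smul_lie, lie_smul, smul_smul]
  rw [sum_fin_antidiagonal k (fun i j => (polarCoeff w y j * polarCoeff z y i) • ⁅X, Y⁆),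
    ← Finset.sum_smul]
  have h := sum_polarCoeff hzw y (fun y' h => hz y' (h ▸ hny)) (fun y' h => hw y' (h ▸ hny)) k
  rw [Finset.sum_congr rfl fun i _ => mul_comm (polarCoeff w y (k - i)) (polarCoeff z y i), h]
  change _ = (w - z)⁻¹ • (polarCoeff z y k • ⁅X, Y⁆ - polarCoeff w y k • ⁅X, Y⁆)
  rw [← sub_smul, smul_smul]

variable (P) in
/-- The average of `polarRaw` over the cyclic group. -/
def laxRaw (z : ℂ) (X : Affine d) : TakiffSum P :=
  (d.T : ℂ)⁻¹ • ∑ k ∈ Finset.range d.T, d.ω ^ (-(k : ℤ)) •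
    polarRaw P (d.ω ^ (-(k : ℤ)) * z) (((Affine.sigma d) ^ (-(k : ℤ))) X)

lemma laxRaw_apply (z : ℂ) (X : Affine d) (y : OnePoint ℂ) (p : Fin (P.n y)) :
    laxRaw P z X y p = (d.T : ℂ)⁻¹ • ∑ k ∈ Finset.range d.T,
      (d.ω ^ (-(k : ℤ)) * polarCoeff (d.ω ^ (-(k : ℤ)) * z) y p) •
        ((Affine.sigma d) ^ (-(k : ℤ))) X := by
  let ev : TakiffSum P →ₗ[ℂ] Affine d :=
    { toFun := fun v => v y p
      map_add' := fun _ _ => rfl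
      map_smul' := fun _ _ => rfl }
  change ev (laxRaw P z X) = _
  unfold laxRaw
  rw [map_smul, map_sum]
  refine congrArg _ (Finset.sum_congr rfl fun k _ => ?_)
  rw [map_smul]
  change d.ω ^ (-(k : ℤ)) • polarCoeff (d.ω ^ (-(k : ℤ)) * z) y p •
    (((Affine.sigma d) ^ (-(k : ℤ))) X) = _
  rw [smul_smul]

/-- The Lax matrix, contracted with `X` in its first tensor factor, is the average over the cyclic
group of the expansions of `X / (z - ·)`. The averages at the origin and at infinity produce the
projections onto the eigenspaces of `σ`. -/
lemma coe_laxF_apply (z : ℂ) (X : Affine d) : ((laxF P z).1 X).1 = laxRaw P z X := by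
  classical
  refine TakiffSum.ext fun y p => ?_
  have hny : P.n y ≠ 0 := by have := p.2; omega
  let ev : modeFormalFields P →ₗ[ℂ] Affine d :=
    { toFun := fun Φ => (Φ.1 X).1 y p
      map_add' := fun _ _ => rfl
      map_smul' := fun _ _ => rfl }
  have h0 : ∀ (k : ℕ) x q, ev (twistF P (-(k : ℤ)) (fieldF P x q)) = if y = x ∧ (p : ℕ) = q then
      pointProj d x q (((Affine.sigma d) ^ (-(k : ℤ))) X) else 0 := fun k x q => rfl
  have h0' : ∀ x q, ev (twistF P 0 (fieldF P x q)) = if y = x ∧ (p : ℕ) = q then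
      pointProj d x q X else 0 := fun x q => rfl
  change ev (laxF P z) = _
  rw [laxF, map_laxSum, laxRaw_apply]
  simp only [h0, laxSum, Nat.cast_zero, neg_zero, h0']
  induction y using OnePoint.rec with
  | infty =>
    simp only [OnePoint.infty_ne_coe, false_and, if_false, smul_zero, Finset.sum_const_zero,
      true_and, zero_sub, add_zero]
    have hpc : ∀ w : ℂ, polarCoeff w ∞ p = if (p : ℕ) = 0 then 0 else -w ^ ((p : ℕ) - 1) :=
      fun _ => rfl
    simp only [hpc]
    by_cases hp : (p : ℕ) = 0
    · simp only [hp, if_true, mul_zero, zero_smul, Finset.sum_const_zero, smul_zero]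
      rw [Finset.sum_eq_zero, neg_zero]
      intro q _
      rw [if_neg (by omega), smul_zero]
    · simp only [if_neg hp]
      rw [Finset.sum_eq_single ((p : ℕ) - 1)]
      · rw [if_pos (by omega), show (p : ℕ) - 1 + 1 = p by omega, pointProj_infty hp,
          Affine.eigenproj_apply_neg, smul_comm, ← smul_neg, Finset.smul_sum,
          ← Finset.sum_neg_distrib]
        refine congrArg _ (Finset.sum_congr rfl fun k _ => ?_)
        rw [smul_smul, ← neg_smul, mul_pow, ← zpow_natCast (d.ω ^ (-(k : ℤ))), ← zpow_mul]
        congr 1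
        have e : -((p : ℕ) : ℤ) * k = -(k : ℤ) + -(k : ℤ) * ((p : ℕ) - 1 : ℕ) := by
          rw [Nat.cast_sub (by omega)]; push_cast; ring
        rw [e, zpow_add₀ d.ω_ne_zero]
        ring
      · intro q _ hq
        rw [if_neg (by omega), smul_zero]
      · intro h
        exact absurd (Finset.mem_range.mpr (by have := p.2; omega)) h
  | coe y =>
    have hpc : ∀ w : ℂ, polarCoeff w (y : OnePoint ℂ) p = ((w - y) ^ ((p : ℕ) + 1))⁻¹ :=
      fun _ => rfl
    simp only [hpc, OnePoint.coe_ne_infty, false_and, if_false, smul_zero, Finset.sum_const_zero,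
      sub_zero, OnePoint.coe_eq_coe]
    by_cases hy : y = 0
    · subst hy
      have h1 : ∀ k ∈ Finset.range d.T, ∑ x ∈ P.Z', ∑ q ∈ Finset.range (P.n x),
          ((d.ω ^ k)⁻¹ / ((d.ω ^ k)⁻¹ * z - x) ^ (q + 1)) • (if (0 : ℂ) = x ∧ (p : ℕ) = q then
            pointProj d x q (((Affine.sigma d) ^ (-(k : ℤ))) X) else 0) = 0 := by
        intro k _
        refine Finset.sum_eq_zero fun x hx => Finset.sum_eq_zero fun q _ => ?_
        rw [if_neg fun h => (mem_Z'.mp hx).1 h.1.symm, smul_zero]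
      rw [Finset.sum_congr rfl h1, Finset.sum_const_zero, smul_zero, zero_add]
      simp only [true_and]
      rw [Finset.sum_eq_single (p : ℕ), if_pos rfl, pointProj_zero, Affine.eigenproj_apply_neg,
        smul_comm, Finset.smul_sum]
      · refine congrArg _ (Finset.sum_congr rfl fun k _ => ?_)
        rw [smul_smul, sub_zero, mul_pow, mul_inv]
        congr 1
        rw [← zpow_natCast (d.ω ^ (-(k : ℤ))), ← zpow_mul, ← zpow_neg, ← mul_assoc,
          ← zpow_add₀ d.ω_ne_zero, mul_comm]
        congr 2
        push_cast; ring
      · intro q _ hq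
        rw [if_neg (Ne.symm hq), smul_zero]
      · intro h
        exact absurd (Finset.mem_range.mpr p.2) h
    · have h2 : ∑ q ∈ Finset.range (P.n (0 : ℂ)), (z ^ (q + 1))⁻¹ • (if y = 0 ∧ (p : ℕ) = q then
          pointProj d ((0 : ℂ) : OnePoint ℂ) q X else 0) = 0 := by
        refine Finset.sum_eq_zero fun q _ => ?_
        rw [if_neg fun h => hy h.1, smul_zero]
      rw [h2, add_zero]
      refine congrArg _ (Finset.sum_congr rfl fun k _ => ?_)
      rw [Finset.sum_eq_single y, Finset.sum_eq_single (p : ℕ), if_pos ⟨rfl, rfl⟩, pointProj_coe hy,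
        show d.ω ^ (-(k : ℤ)) = (d.ω ^ k)⁻¹ by rw [zpow_neg, zpow_natCast]]
      · rfl
      · intro q _ hq
        rw [if_neg fun h => hq h.2.symm, smul_zero]
      · intro h
        exact absurd (Finset.mem_range.mpr p.2) h
      · intro x _ hx
        refine Finset.sum_eq_zero fun q _ => ?_
        rw [if_neg fun h => hx h.1.symm, smul_zero]
      · intro h
        exact absurd (mem_Z'.mpr ⟨hy, hny⟩) h

lemma IsRegularPoint.zpow_mul_ne {z : ℂ} (hz : IsRegularPoint P z) (k : ℤ) {y : ℂ}
    (hy : P.n y ≠ 0) : d.ω ^ k * z ≠ y := by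
  intro h
  obtain ⟨m, -, hm⟩ := d.exists_pow_eq_zpow (-k)
  refine hz y m hy ?_
  rw [← hm, ← h, ← mul_assoc, ← zpow_add₀ d.ω_ne_zero, neg_add_cancel, zpow_zero, one_mul]

/-- The bracket of two values of the Lax matrix, contracted with arbitrary elements in the first
tensor factors: the `r`-matrix form of the Lax algebra, with the cyclic average of `1 / (w - z)`
as `r`-matrix. -/
lemma lie_laxRaw {z w : ℂ} (hz : IsRegularPoint P z) (hw : IsRegularPoint P w)
    (hzw : ∀ k : ℤ, w ≠ d.ω ^ k * z) (X Y : Affine d) :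
    ⁅laxRaw P z X, laxRaw P w Y⁆ = (d.T : ℂ)⁻¹ • ∑ m ∈ Finset.range d.T,
      ((w - d.ω ^ (-(m : ℤ)) * z)⁻¹ • laxRaw P z ⁅X, ((Affine.sigma d) ^ (m : ℤ)) Y⁆ -
        (d.ω ^ (-(m : ℤ)) * w - z)⁻¹ • laxRaw P w ⁅((Affine.sigma d) ^ (m : ℤ)) X, Y⁆) := by
  have hω := d.ω_ne_zero
  have hne : ∀ k l : ℤ, d.ω ^ l * w - d.ω ^ k * z ≠ 0 := by
    intro k l h
    refine hzw (k - l) ?_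
    rw [zpow_sub₀ hω]
    field_simp
    linear_combination h
  -- the double sums over the cyclic group, reindexed by the difference of the two indices
  have hS1 : ∀ k : ℕ, ∑ l ∈ Finset.range d.T, (d.ω ^ (-(k : ℤ)) * d.ω ^ (-(l : ℤ))) •
      (d.ω ^ (-(l : ℤ)) * w - d.ω ^ (-(k : ℤ)) * z)⁻¹ • polarRaw P (d.ω ^ (-(k : ℤ)) * z)
        ⁅((Affine.sigma d) ^ (-(k : ℤ))) X, ((Affine.sigma d) ^ (-(l : ℤ))) Y⁆
      = ∑ m ∈ Finset.range d.T, (w - d.ω ^ (-(m : ℤ)) * z)⁻¹ • d.ω ^ (-(k : ℤ)) •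
        polarRaw P (d.ω ^ (-(k : ℤ)) * z) (((Affine.sigma d) ^ (-(k : ℤ)))
          ⁅X, ((Affine.sigma d) ^ (m : ℤ)) Y⁆) := by
    intro k
    rw [← sum_range_int_sub (fun l : ℤ => (d.ω ^ (-(k : ℤ)) * d.ω ^ (-l)) •
      (d.ω ^ (-l) * w - d.ω ^ (-(k : ℤ)) * z)⁻¹ • polarRaw P (d.ω ^ (-(k : ℤ)) * z)
        ⁅((Affine.sigma d) ^ (-(k : ℤ))) X, ((Affine.sigma d) ^ (-l)) Y⁆) (fun l => by
          have e1 : d.ω ^ (-(l + d.T)) = d.ω ^ (-l) := by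
            rw [← d.ω_zpow_add_T (-(l + d.T))]; congr 1; ring
          have e2 : (Affine.sigma d) ^ (-(l + d.T)) = (Affine.sigma d) ^ (-l) := by
            rw [← Affine.sigma_zpow_add_T (-(l + d.T))]; congr 1; ring
          simp only [e1, e2]) k]
    refine Finset.sum_congr rfl fun m _ => ?_
    rw [Affine.sigma_zpow_lie, Affine.sigma_zpow_zpow, smul_smul, smul_smul,
      show -((k : ℤ) - m) = -(k : ℤ) + m by ring]
    congr 1
    have h1 := hne (-(m : ℤ)) 0
    rw [zpow_zero, one_mul] at h1
    have h2 := hne (-(k : ℤ)) (-(k : ℤ) + m)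
    rw [← div_eq_mul_inv, div_eq_iff h2, zpow_add₀ hω, zpow_neg d.ω (m : ℤ)]
    rw [zpow_neg] at h1
    have hm : d.ω ^ (m : ℤ) ≠ 0 := zpow_ne_zero _ hω
    have h4 := hne 0 m
    rw [zpow_zero, one_mul] at h4
    field_simp
  have hS2 : ∀ l : ℕ, ∑ k ∈ Finset.range d.T, (d.ω ^ (-(k : ℤ)) * d.ω ^ (-(l : ℤ))) •
      (d.ω ^ (-(l : ℤ)) * w - d.ω ^ (-(k : ℤ)) * z)⁻¹ • polarRaw P (d.ω ^ (-(l : ℤ)) * w)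
        ⁅((Affine.sigma d) ^ (-(k : ℤ))) X, ((Affine.sigma d) ^ (-(l : ℤ))) Y⁆
      = ∑ m ∈ Finset.range d.T, (d.ω ^ (-(m : ℤ)) * w - z)⁻¹ • d.ω ^ (-(l : ℤ)) •
        polarRaw P (d.ω ^ (-(l : ℤ)) * w) (((Affine.sigma d) ^ (-(l : ℤ)))
          ⁅((Affine.sigma d) ^ (m : ℤ)) X, Y⁆) := by
    intro l
    rw [← sum_range_int_sub (fun k : ℤ => (d.ω ^ (-k) * d.ω ^ (-(l : ℤ))) •
      (d.ω ^ (-(l : ℤ)) * w - d.ω ^ (-k) * z)⁻¹ • polarRaw P (d.ω ^ (-(l : ℤ)) * w)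
        ⁅((Affine.sigma d) ^ (-k)) X, ((Affine.sigma d) ^ (-(l : ℤ))) Y⁆) (fun k => by
          have e1 : d.ω ^ (-(k + d.T)) = d.ω ^ (-k) := by
            rw [← d.ω_zpow_add_T (-(k + d.T))]; congr 1; ring
          have e2 : (Affine.sigma d) ^ (-(k + d.T)) = (Affine.sigma d) ^ (-k) := by
            rw [← Affine.sigma_zpow_add_T (-(k + d.T))]; congr 1; ring
          simp only [e1, e2]) l]
    refine Finset.sum_congr rfl fun m _ => ?_
    rw [Affine.sigma_zpow_lie, Affine.sigma_zpow_zpow, smul_smul, smul_smul,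
      show -((l : ℤ) - m) = -(l : ℤ) + m by ring]
    congr 1
    have h1 := hne 0 (-(m : ℤ))
    rw [zpow_zero, one_mul] at h1
    have h2 := hne (-(l : ℤ) + m) (-(l : ℤ))
    rw [← div_eq_mul_inv, div_eq_iff h2, zpow_add₀ hω, zpow_neg d.ω (m : ℤ)]
    rw [zpow_neg] at h1
    have hm : d.ω ^ (m : ℤ) ≠ 0 := zpow_ne_zero _ hω
    have h4 := hne m 0
    rw [zpow_zero, one_mul] at h4
    field_simp
  have hexp : ⁅laxRaw P z X, laxRaw P w Y⁆ = (d.T : ℂ)⁻¹ • (d.T : ℂ)⁻¹ •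
      (∑ k ∈ Finset.range d.T, ∑ l ∈ Finset.range d.T,
        ((d.ω ^ (-(k : ℤ)) * d.ω ^ (-(l : ℤ))) •
        (d.ω ^ (-(l : ℤ)) * w - d.ω ^ (-(k : ℤ)) * z)⁻¹ • polarRaw P (d.ω ^ (-(k : ℤ)) * z)
        ⁅((Affine.sigma d) ^ (-(k : ℤ))) X, ((Affine.sigma d) ^ (-(l : ℤ))) Y⁆
        - (d.ω ^ (-(k : ℤ)) * d.ω ^ (-(l : ℤ))) •
        (d.ω ^ (-(l : ℤ)) * w - d.ω ^ (-(k : ℤ)) * z)⁻¹ • polarRaw P (d.ω ^ (-(l : ℤ)) * w)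
        ⁅((Affine.sigma d) ^ (-(k : ℤ))) X, ((Affine.sigma d) ^ (-(l : ℤ))) Y⁆)) := by
    rw [laxRaw, laxRaw, smul_lie, lie_smul, sum_lie]
    refine congrArg _ (congrArg _ (Finset.sum_congr rfl fun k _ => ?_))
    rw [lie_sum]
    refine Finset.sum_congr rfl fun l _ => ?_
    rw [smul_lie, lie_smul, lie_polarRaw (fun h => hne (-(k : ℤ)) (-(l : ℤ)) (sub_eq_zero.mpr h))
      (fun y hy => hz.zpow_mul_ne _ hy) (fun y hy => hw.zpow_mul_ne _ hy), smul_smul, smul_sub,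
      smul_sub]
  rw [hexp]
  simp only [Finset.sum_sub_distrib]
  rw [Finset.sum_congr rfl fun k _ => hS1 k]
  rw [Finset.sum_comm (s := Finset.range d.T) (t := Finset.range d.T)
    (f := fun k l : ℕ => (d.ω ^ (-(k : ℤ)) * d.ω ^ (-(l : ℤ))) •
      (d.ω ^ (-(l : ℤ)) * w - d.ω ^ (-(k : ℤ)) * z)⁻¹ • polarRaw P (d.ω ^ (-(l : ℤ)) * w)
        ⁅((Affine.sigma d) ^ (-(k : ℤ))) X, ((Affine.sigma d) ^ (-(l : ℤ))) Y⁆),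
    Finset.sum_congr rfl fun l _ => hS2 l]
  refine congrArg _ ?_
  rw [Finset.sum_comm (s := Finset.range d.T) (t := Finset.range d.T), smul_sub, Finset.smul_sum]
  congr 1
  · refine Finset.sum_congr rfl fun m _ => ?_
    rw [laxRaw, ← Finset.smul_sum, smul_comm]
  · rw [Finset.sum_comm (s := Finset.range d.T) (t := Finset.range d.T), Finset.smul_sum]
    refine Finset.sum_congr rfl fun m _ => ?_
    rw [laxRaw, ← Finset.smul_sum, smul_comm]

/-- The `r`-matrix form of the Lax algebra, in terms of `laxF`. -/
lemma lie_laxF {z w : ℂ} (hz : IsRegularPoint P z) (hw : IsRegularPoint P w)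
    (hzw : ∀ k : ℤ, w ≠ d.ω ^ k * z) (X Y : Affine d) :
    ⁅(laxF P z).1 X, (laxF P w).1 Y⁆ = (d.T : ℂ)⁻¹ • ∑ m ∈ Finset.range d.T,
      ((w - d.ω ^ (-(m : ℤ)) * z)⁻¹ • (laxF P z).1 ⁅X, ((Affine.sigma d) ^ (m : ℤ)) Y⁆ -
        (d.ω ^ (-(m : ℤ)) * w - z)⁻¹ • (laxF P w).1 ⁅((Affine.sigma d) ^ (m : ℤ)) X, Y⁆) := by
  refine Subtype.ext ?_
  let incl : gD P →ₗ[ℂ] TakiffSum P :=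
    { toFun := fun v => v.1
      map_add' := fun _ _ => rfl
      map_smul' := fun _ _ => rfl }
  have hi : ∀ z X, incl ((laxF P z).1 X) = laxRaw P z X := coe_laxF_apply
  rw [LieSubalgebra.coe_bracket, coe_laxF_apply, coe_laxF_apply, lie_laxRaw hz hw hzw]
  change _ = incl ((d.T : ℂ)⁻¹ • ∑ m ∈ Finset.range d.T,
      ((w - d.ω ^ (-(m : ℤ)) * z)⁻¹ • (laxF P z).1 ⁅X, ((Affine.sigma d) ^ (m : ℤ)) Y⁆ -
        (d.ω ^ (-(m : ℤ)) * w - z)⁻¹ • (laxF P w).1 ⁅((Affine.sigma d) ^ (m : ℤ)) X, Y⁆))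
  simp only [map_smul, map_sum, map_sub, hi]

end RMatrix

section LaxEvolution

open scoped OnePoint

variable {𝔤 : Type*} [LieRing 𝔤] [LieAlgebra ℂ 𝔤] {d : DihedralData 𝔤} {P : PoleDivisor d}
variable {I : Type*} [Fintype I] [DecidableEq I] (b : Module.Basis I ℂ 𝔤) (lev : Levels d P)

/-- The image of formal fields under `π_ℓ`. -/
def toLocal : modeFormalFields P →ₗ[ℂ] modeFields (localFil lev) d where
  toFun Φ := ⟨piLin b lev ∘ₗ Φ.1, piLin_comp_mem b lev Φ.2⟩
  map_add' _ _ := Subtype.ext (LinearMap.comp_add _ _ _)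
  map_smul' _ _ := Subtype.ext (LinearMap.comp_smul _ _ _)

/-- The pairing `π_ℓ (Φ | Ψ)` of formal fields. -/
def localPair : modeFormalFields P →ₗ[ℂ] modeFormalFields P →ₗ[ℂ] LocalObs lev :=
  (pairL d b (localFil lev)).compl₁₂ (toLocal b lev) (toLocal b lev)

lemma localPair_eq (Φ Ψ : modeFormalFields P) :
    localPair b lev Φ Ψ = piHatL b lev (pairing b Φ.1 Ψ.1) :=
  (piHatL_pairing b lev Φ.2 Ψ.2).symm

lemma localPair_symm (Φ Ψ : modeFormalFields P) : localPair b lev Φ Ψ = localPair b lev Ψ Φ :=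
  pair_symm b (toLocal b lev Φ).2 (toLocal b lev Ψ).2

lemma localPair_twistF (k : ℤ) (Φ Ψ : modeFormalFields P) :
    localPair b lev (twistF P k Φ) Ψ = localPair b lev Φ (twistF P (-k) Ψ) :=
  pair_twist b (toLocal b lev Φ).2 (toLocal b lev Ψ).2 k

variable (P) in
/-- The Lax partner of the generating function `½ (ℒ(z) | ℒ(z))` for the flow of `ℒ(w)`. -/
def laxGen (w z : ℂ) : modeFormalFields P :=
  (d.T : ℂ)⁻¹ • ∑ m ∈ Finset.range d.T,
    (z - d.ω ^ (-(m : ℤ)) * w)⁻¹ • twistF P (-(m : ℤ)) (laxF P z)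

/-- The flow of the generating function `½ (ℒ(z) | ℒ(z))` on the Lax matrix is a Lax equation: of
the two terms of the `r`-matrix bracket, the one with `ℒ(z)` twice vanishes by invariance of the
pairing. -/
lemma br_generating_lax {z w : ℂ} (hz : IsRegularPoint P z) (hw : IsRegularPoint P w)
    (hzw : ∀ k : ℤ, w ≠ d.ω ^ k * z) (Y : Affine d) :
    (localContBracket lev).br ((1 / 2 : ℂ) • localPair b lev (laxF P z) (laxF P z))
        ((toLocal b lev (laxF P w)).1 Y)
      = pair b (toLocal b lev (laxGen P w z)).1
          ((toLocal b lev (laxF P w)).1 ∘ₗ Affine.adR Y) := by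
  set B := localContBracket lev
  set Λz := (toLocal b lev (laxF P z)).1 with hΛz
  set Λw := (toLocal b lev (laxF P w)).1 with hΛw
  have mz : Λz ∈ modeFields (localFil lev) d := (toLocal b lev (laxF P z)).2
  have mw : Λw ∈ modeFields (localFil lev) d := (toLocal b lev (laxF P w)).2
  set U : ℕ → modeFields (localFil lev) d := fun m =>
    ⟨Λz ∘ₗ Affine.adR (((Affine.sigma d) ^ (m : ℤ)) Y), comp_adR_mem mz _⟩ with hU
  set W : ℕ → modeFields (localFil lev) d := fun m =>
    ⟨twistField (m : ℤ) (Λw ∘ₗ Affine.adR Y), twistField_mem (comp_adR_mem mw _) _⟩ with hW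
  set Ξ : modeFields (localFil lev) d := (d.T : ℂ)⁻¹ • ∑ m ∈ Finset.range d.T,
    ((d.ω ^ (-(m : ℤ)) * w - z)⁻¹ • W m + (-(w - d.ω ^ (-(m : ℤ)) * z)⁻¹) • U m) with hΞ
  have hbr : ∀ X, B.br (Λw Y) (Λz X) = Ξ.1 X := by
    intro X
    rw [B.skew]
    have h1 : B.br (Λz X) (Λw Y) = piLin b lev ⁅(laxF P z).1 X, (laxF P w).1 Y⁆ :=
      br_piLin b lev _ _
    let ev : modeFields (localFil lev) d →ₗ[ℂ] LocalObs lev :=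
      { toFun := fun Φ => Φ.1 X
        map_add' := fun _ _ => rfl
        map_smul' := fun _ _ => rfl }
    have hevU : ∀ m, ev (U m)
        = piLin b lev ((laxF P z).1 ⁅X, ((Affine.sigma d) ^ (m : ℤ)) Y⁆) := fun m => rfl
    have hevW : ∀ m, ev (W m)
        = piLin b lev ((laxF P w).1 ⁅((Affine.sigma d) ^ (m : ℤ)) X, Y⁆) := fun m => rfl
    change _ = ev Ξ
    rw [h1, lie_laxF hz hw hzw, hΞ]
    rw [LinearMap.map_smul, map_sum, LinearMap.map_smul, map_sum, ← smul_neg,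
      ← Finset.sum_neg_distrib]
    refine congrArg _ (Finset.sum_congr rfl fun m _ => ?_)
    rw [map_sub, LinearMap.map_add, LinearMap.map_smul, LinearMap.map_smul,
      LinearMap.map_smul, LinearMap.map_smul, hevU, hevW, neg_sub, neg_smul, ← sub_eq_add_neg]
  have hL : localPair b lev (laxF P z) (laxF P z) = pair b Λz Λz := rfl
  have hU0 : ∀ m, pairL d b (localFil lev) ⟨Λz, mz⟩ (U m) = 0 := fun m => pair_self_adR b mz _
  have hW0 : ∀ m : ℕ, pairL d b (localFil lev) ⟨Λz, mz⟩ (W m)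
      = pair b (twistField (-(m : ℤ)) Λz) (Λw ∘ₗ Affine.adR Y) := by
    intro m
    rw [pair_twist b mz (comp_adR_mem mw Y), neg_neg]
    rfl
  have h2 : pair b Λz Ξ.1 = (d.T : ℂ)⁻¹ • ∑ m ∈ Finset.range d.T,
      (d.ω ^ (-(m : ℤ)) * w - z)⁻¹ • pair b (twistField (-(m : ℤ)) Λz) (Λw ∘ₗ Affine.adR Y) := by
    change pairL d b (localFil lev) ⟨Λz, mz⟩ Ξ = _
    rw [hΞ]
    rw [LinearMap.map_smul, map_sum]
    refine congrArg _ (Finset.sum_congr rfl fun m _ => ?_)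
    rw [LinearMap.map_add, LinearMap.map_smul, LinearMap.map_smul, hU0, hW0, smul_zero, add_zero]
  have h3 : pair b (toLocal b lev (laxGen P w z)).1 (Λw ∘ₗ Affine.adR Y)
      = (d.T : ℂ)⁻¹ • ∑ m ∈ Finset.range d.T, (z - d.ω ^ (-(m : ℤ)) * w)⁻¹ •
        pair b (twistField (-(m : ℤ)) Λz) (Λw ∘ₗ Affine.adR Y) := by
    change (pairL d b (localFil lev)).flip ⟨_, comp_adR_mem mw Y⟩ (toLocal b lev (laxGen P w z)) = _
    rw [laxGen, LinearMap.map_smul, map_sum, LinearMap.map_smul, map_sum]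
    refine congrArg _ (Finset.sum_congr rfl fun m _ => ?_)
    rw [LinearMap.map_smul, LinearMap.map_smul]
    rfl
  rw [B.skew, map_smul, hL, B.br_pair b mz mz Ξ.2 Ξ.2 hbr hbr, pair_symm b Ξ.2 mz, ← two_smul ℂ,
    smul_smul, show (1 / 2 : ℂ) * 2 = 1 by norm_num, one_smul, h2, h3, ← smul_neg,
    ← Finset.sum_neg_distrib]
  refine congrArg _ (Finset.sum_congr rfl fun m _ => ?_)
  rw [← neg_smul, ← inv_neg, neg_sub]

end LaxEvolution

/-! ### Polar and regular parts of Laurent expansions -/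

section Laurent

open Polynomial

variable {θ : ℂ[X] →ₐ[ℂ] LaurentSeries ℂ}
variable {V W : Type*} [AddCommGroup V] [Module ℂ V] [AddCommGroup W] [Module ℂ W]

/-- The function `F` has the expansion `∑_q α q u^{-q-1} + ∑ₙ ρ n uⁿ`. -/
def HasLaurent (θ : ℂ[X] →ₐ[ℂ] LaurentSeries ℂ) (F : ℂ → V) (α ρ : ℕ → V) : Prop :=
  ∃ a, HasExpansion θ F a ∧ (∀ q : ℕ, a (-(q + 1)) = α q) ∧ ∀ n : ℕ, a n = ρ n

namespace HasLaurent

variable {F G : ℂ → V} {α ρ α' ρ' : ℕ → V}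

lemma add (hF : HasLaurent θ F α ρ) (hG : HasLaurent θ G α' ρ') :
    HasLaurent θ (fun z => F z + G z) (fun q => α q + α' q) (fun n => ρ n + ρ' n) := by
  obtain ⟨a, ha, h1, h2⟩ := hF
  obtain ⟨c, hc, h1', h2'⟩ := hG
  exact ⟨_, ha.add hc, fun q => by rw [h1, h1'], fun n => by rw [h2, h2']⟩

lemma sub (hF : HasLaurent θ F α ρ) (hG : HasLaurent θ G α' ρ') :
    HasLaurent θ (fun z => F z - G z) (fun q => α q - α' q) (fun n => ρ n - ρ' n) := by
  obtain ⟨a, ha, h1, h2⟩ := hF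
  obtain ⟨c, hc, h1', h2'⟩ := hG
  exact ⟨_, ha.sub hc, fun q => by rw [h1, h1'], fun n => by rw [h2, h2']⟩

lemma const_smul (hF : HasLaurent θ F α ρ) (k : ℂ) :
    HasLaurent θ (fun z => k • F z) (fun q => k • α q) (fun n => k • ρ n) := by
  obtain ⟨a, ha, h1, h2⟩ := hF
  exact ⟨_, ha.const_smul k, fun q => by rw [h1], fun n => by rw [h2]⟩

lemma sum {ι : Type*} {S : Finset ι} {F : ι → ℂ → V} {α ρ : ι → ℕ → V}
    (h : ∀ i ∈ S, HasLaurent θ (F i) (α i) (ρ i)) :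
    HasLaurent θ (fun z => ∑ i ∈ S, F i z) (fun q => ∑ i ∈ S, α i q)
      (fun n => ∑ i ∈ S, ρ i n) := by
  choose! a ha using h
  exact ⟨_, HasExpansion.sum fun i hi => (ha i hi).1,
    fun q => Finset.sum_congr rfl fun i hi => (ha i hi).2.1 q,
    fun n => Finset.sum_congr rfl fun i hi => (ha i hi).2.2 n⟩

lemma of_regular {g : ℂ → ℂ} {r : LaurentSeries ℂ} (hg : Represents θ g r)
    (h0 : ∀ n < 0, r.coeff n = 0) (v : V) :
    HasLaurent θ (fun z => g z • v) (fun _ => 0) (fun n => r.coeff n • v) :=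
  ⟨_, HasExpansion.smul hg v, fun q => by rw [h0 _ (by omega), zero_smul], fun _ => rfl⟩

lemma of_single {g : ℂ → ℂ} {q : ℕ} (hg : Represents θ g (HahnSeries.single (-(q + 1 : ℤ)) 1))
    (v : V) : HasLaurent θ (fun z => g z • v) (fun j => if j = q then v else 0) (fun _ => 0) := by
  refine ⟨_, HasExpansion.smul hg v, fun j => ?_, fun n => ?_⟩
  · dsimp only
    split_ifs with h
    · rw [h, HahnSeries.coeff_single_same, one_smul]
    · rw [HahnSeries.coeff_single_of_ne (by omega), zero_smul]
  · rw [HahnSeries.coeff_single_of_ne (by omega), zero_smul]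

lemma polar (x : ℂ) (q : ℕ) (v : V) : HasLaurent (expandAt x)
    (fun z => ((z - x) ^ (q + 1))⁻¹ • v) (fun j => if j = q then v else 0) (fun _ => 0) :=
  of_single (represents_polar x q) v

lemma regular {x c : ℂ} (hxc : x ≠ c) (q : ℕ) (v : V) : HasLaurent (expandAt x)
    (fun z => ((z - c) ^ (q + 1))⁻¹ • v) (fun _ => 0)
    (fun n => ((Nat.choose (q + n) n : ℂ) * (-1) ^ n / (x - c) ^ (q + n + 1)) • v) := by
  obtain ⟨r, hr, h0, h1⟩ := exists_represents_regular hxc q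
  have := of_regular hr h0 v
  simpa only [h1] using this

lemma pow (x : ℂ) (q : ℕ) (v : V) : HasLaurent (expandAt x)
    (fun z => z ^ q • v) (fun _ => 0)
    (fun n => ((Nat.choose q n : ℂ) * x ^ (q - n)) • v) := by
  obtain ⟨r, hr, h0, h1⟩ := exists_represents_pow x q
  have := of_regular hr h0 v
  simpa only [h1] using this

lemma exists_represents_mul_inf (c : ℂ) (q : ℕ) :
    ∃ r, Represents expandInf (fun z => z * ((z - c) ^ (q + 1))⁻¹) r ∧ (∀ n < 0, r.coeff n = 0) ∧
      ∀ n : ℕ, r.coeff n = (Nat.choose n q : ℂ) * c ^ (n - q) := by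
  obtain ⟨r, hr, h0, h1⟩ := exists_represents_inf c q
  have h := (represents_pow_inf 1).mul hr
  simp only [pow_one] at h
  have hc : ∀ n : ℤ, (HahnSeries.single (-((1 : ℕ) : ℤ)) (1 : ℂ) * r).coeff n = r.coeff (n + 1) := by
    intro n
    have := HahnSeries.coeff_single_mul_add (r := (1 : ℂ)) (x := r) (a := n + 1)
      (b := -((1 : ℕ) : ℤ))
    rw [one_mul] at this
    rw [← this]
    congr 1
    push_cast; ring
  exact ⟨_, h, fun n hn => by rw [hc, h0 _ (by omega)], fun n => by rw [hc, h1]⟩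

lemma polar_inf (q : ℕ) (v : V) : HasLaurent expandInf
    (fun z => z ^ (q + 1) • v) (fun j => if j = q then v else 0) (fun _ => 0) := by
  refine of_single ?_ v
  have := represents_pow_inf (q + 1)
  exact_mod_cast this

/-- In powers of `1/z`, the function `z / (z - c)^{q+1}` is regular at infinity. -/
lemma regular_inf (c : ℂ) (q : ℕ) (v : V) : HasLaurent expandInf
    (fun z => (z * ((z - c) ^ (q + 1))⁻¹) • v) (fun _ => 0)
    (fun n => ((Nat.choose n q : ℂ) * c ^ (n - q)) • v) := by
  obtain ⟨r, hr, h0, h1⟩ := exists_represents_mul_inf c q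
  have := of_regular hr h0 v
  simpa only [h1] using this

/-- A sum over the integers from `-(p + N)` to `N - 1`, split at `0` and at `-p`. For a
convolution at the index `-(p + 1)`, the middle range is where both factors are polar. -/
lemma finsum_int_split (f : ℤ → V) (p N : ℕ) (h1 : ∀ i : ℤ, N ≤ i → f i = 0)
    (h2 : ∀ i : ℤ, i < -(p + N : ℤ) → f i = 0) :
    ∑ᶠ i, f i = ∑ s ∈ Finset.range N, f s + ∑ q ∈ Finset.range p, f (-(q + 1)) +
      ∑ s ∈ Finset.range N, f (-(p + s + 1)) := by
  classical
  rw [finsum_eq_sum_of_support_subset (s := (Finset.range (N + p + N)).image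
    fun j : ℕ => (j : ℤ) - (p + N)), Finset.sum_image fun i _ j _ h => by simpa using h,
    Finset.sum_range_add, Finset.sum_range_add]
  · rw [← Finset.sum_range_reflect (fun j : ℕ => f ((j : ℤ) - (p + N))) N,
      ← Finset.sum_range_reflect (fun j : ℕ => f (((N + j : ℕ) : ℤ) - (p + N))) p]
    rw [add_comm, add_comm (∑ j ∈ Finset.range N, f (((N - 1 - j : ℕ) : ℤ) - (p + N))), ← add_assoc]
    congr 1
    · congr 1
      · exact Finset.sum_congr rfl fun j _ => by congr 1; push_cast; ring
      · refine Finset.sum_congr rfl fun j hj => ?_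
        have := Finset.mem_range.mp hj
        congr 1; omega
    · refine Finset.sum_congr rfl fun j hj => ?_
      have := Finset.mem_range.mp hj
      congr 1; omega
  · intro i hi
    have hi1 : i < N := by
      by_contra h
      exact hi (h1 i (by omega))
    have hi2 : -(p + N : ℤ) ≤ i := by
      by_contra h
      exact hi (h2 i (by omega))
    rw [Finset.coe_image]
    exact ⟨(i + (p + N)).toNat, by simp; omega, by dsimp only; omega⟩

/-- The polar coefficients of a square. If `F = ∑ α_q u^{-q-1} + ∑ ρ_n uⁿ`, the coefficient of
`u^{-p-1}` in `½ β(F, F)` collects the products of `α` with `ρ`, each once, and the products of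
two `α`, with the factor `½`. -/
lemma half_bilin (hF : HasLaurent θ F α ρ) (β : V →ₗ[ℂ] V →ₗ[ℂ] W) (hβ : ∀ u v, β u v = β v u)
    {N : ℕ} (hN : ∀ q, N ≤ q → α q = 0) :
    ∃ h, HasExpansion θ (fun z => (1 / 2 : ℂ) • β (F z) (F z)) h ∧ ∀ p : ℕ, h (-(p + 1)) =
      ∑ s ∈ Finset.range N, β (α (p + s)) (ρ s) +
        (1 / 2 : ℂ) • ∑ q ∈ Finset.range p, β (α q) (α (p - q - 1)) := by
  obtain ⟨a, ha, h1, h2⟩ := hF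
  refine ⟨_, (ha.bilin ha β).const_smul (1 / 2), fun p => ?_⟩
  have ha0 : ∀ i : ℤ, i < -N → a i = 0 := by
    intro i hi
    have := h1 (-i - 1).toNat
    rw [hN _ (by omega)] at this
    rw [← this]
    congr 1
    omega
  rw [finsum_int_split _ p N]
  · have e1 : ∀ s ∈ Finset.range N, β (a s) (a (-(p + 1 : ℤ) - s)) = β (α (p + s)) (ρ s) := by
      intro s _
      rw [hβ, h2, ← h1]
      congr 3
      push_cast; ring
    have e2 : ∀ q ∈ Finset.range p, β (a (-(q + 1))) (a (-(p + 1 : ℤ) - -(q + 1)))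
        = β (α q) (α (p - q - 1)) := by
      intro q hq
      have := Finset.mem_range.mp hq
      rw [h1, ← h1 (p - q - 1)]
      congr 2
      omega
    have e3 : ∀ s ∈ Finset.range N, β (a (-(p + s + 1))) (a (-(p + 1 : ℤ) - -(p + s + 1)))
        = β (α (p + s)) (ρ s) := by
      intro s _
      rw [← h2, ← h1]
      congr 2
      ring
    rw [Finset.sum_congr rfl e1, Finset.sum_congr rfl e2, Finset.sum_congr rfl e3, smul_add,
      smul_add]
    have : ∀ v : W, v = (1 / 2 : ℂ) • v + (1 / 2 : ℂ) • v := by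
      intro v
      rw [← add_smul]; norm_num
    nth_rewrite 3 [this (∑ s ∈ Finset.range N, β (α (p + s)) (ρ s))]
    abel
  · intro i hi
    rw [ha0 (-(p + 1 : ℤ) - i) (by omega), map_zero]
  · intro i hi
    rw [ha0 i (by omega), map_zero, LinearMap.zero_apply]

/-- The polar coefficients of the product with a regular function. -/
lemma regular_smul (hF : HasLaurent θ F α ρ) {g : ℂ → ℂ} {r : LaurentSeries ℂ}
    (hg : Represents θ g r) (h0 : ∀ n < 0, r.coeff n = 0) {N : ℕ} (hN : ∀ q, N ≤ q → α q = 0) :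
    ∃ h, HasExpansion θ (fun z => g z • F z) h ∧ ∀ p : ℕ, h (-(p + 1)) =
      ∑ s ∈ Finset.range N, r.coeff s • α (p + s) := by
  obtain ⟨a, ha, h1, h2⟩ := hF
  refine ⟨_, ha.fun_smul hg, fun p => ?_⟩
  have ha0 : ∀ i : ℤ, i < -N → a i = 0 := by
    intro i hi
    have := h1 (-i - 1).toNat
    rw [hN _ (by omega)] at this
    rw [← this]
    congr 1
    omega
  rw [finsum_int_split _ p N]
  · rw [Finset.sum_eq_zero (s := Finset.range p) fun q _ => by rw [h0 _ (by omega), zero_smul],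
      Finset.sum_eq_zero (s := Finset.range N) (f := fun s : ℕ => r.coeff (-(p + s + 1 : ℤ)) •
        a (-(p + 1 : ℤ) - -(p + s + 1))) fun s _ => by rw [h0 _ (by omega), zero_smul],
      add_zero, add_zero]
    refine Finset.sum_congr rfl fun s _ => ?_
    rw [← h1]
    congr 2
    push_cast; ring
  · intro i hi
    rw [ha0 (-(p + 1 : ℤ) - i) (by omega), smul_zero]
  · intro i hi
    rw [h0 i (by omega), zero_smul]

end HasLaurent

end Laurent

/-! ### Orbits of the poles -/

section Orbits

open scoped OnePoint ComplexConjugate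

variable {𝔤 : Type*} [LieRing 𝔤] [LieAlgebra ℂ 𝔤] {d : DihedralData 𝔤} {P : PoleDivisor d}

lemma DihedralData.conj_ω (d : DihedralData 𝔤) : conj d.ω = d.ω⁻¹ := by
  have h := Complex.norm_eq_one_of_pow_eq_one d.ω_primitive.pow_eq_one d.T_pos.ne'
  refine eq_inv_of_mul_eq_one_left ?_
  rw [mul_comm, Complex.mul_conj, Complex.normSq_eq_norm_sq, h]
  norm_num

lemma mult_of_n_ne_zero {x : ℂ} (h : P.n x ≠ 0) :
    P.mult x ≠ 0 ∨ (¬ IsRealPoint d x ∧ P.mult (conj x) ≠ 0) := by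
  classical
  have hn : P.n x = if IsRealPoint d x ∨ P.mult x ≠ 0 then P.mult x else P.mult (conj x) := rfl
  rw [hn] at h
  split_ifs at h with h1
  · exact Or.inl h
  · rw [not_or] at h1
    exact Or.inr ⟨h1.1, h⟩

/-- Distinct points of `𝒵'` have distinct orbits under the cyclic group. -/
lemma eq_of_cyclic_orbit {x y : ℂ} (hx : P.n x ≠ 0) (hy : P.n y ≠ 0) {k : ℕ}
    (h : x = d.ω ^ k * y) : x = y := by
  obtain ⟨m, -, hm⟩ := d.exists_pow_eq_zpow (-(k : ℤ))
  rw [zpow_neg, zpow_natCast] at hm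
  have hωk : d.ω ^ k ≠ 0 := pow_ne_zero _ d.ω_ne_zero
  have hc : conj x = d.ω ^ m * conj y := by
    rw [h, map_mul, map_pow, d.conj_ω, inv_pow, hm]
  by_contra hxy
  rcases mult_of_n_ne_zero hx with hx1 | ⟨hx0, hx1⟩ <;>
    rcases mult_of_n_ne_zero hy with hy1 | ⟨hy0, hy1⟩
  · exact (P.disjoint_orbits y x hy1 hx1 (Ne.symm hxy) k).1 h
  · by_cases e : conj y = x
    · refine hy0 ⟨m, ?_⟩
      rw [e, ← hm, h, inv_mul_cancel_left₀ hωk]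
    · refine (P.disjoint_orbits (conj y) x hy1 hx1 e k).2 ?_
      rw [Complex.conj_conj]; exact h
  · by_cases e : y = conj x
    · exact hx0 ⟨k, by rw [← e]; exact h⟩
    · exact (P.disjoint_orbits y (conj x) hy1 hx1 e m).2 hc
  · exact (P.disjoint_orbits (conj y) (conj x) hy1 hx1
      (fun e => hxy ((starRingEnd ℂ).injective e).symm) m).1 hc

/-- A nonzero point has a trivial stabilizer in the cyclic group. -/
lemma eq_zero_of_cyclic_orbit {x : ℂ} (hx : x ≠ 0) {k : ℕ} (hk : k < d.T)
    (h : x = d.ω ^ k * x) : k = 0 := by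
  have h1 : d.ω ^ k = 1 := by
    have : (d.ω ^ k - 1) * x = 0 := by linear_combination -h
    exact sub_eq_zero.mp ((mul_eq_zero.mp this).resolve_right hx)
  exact Nat.eq_zero_of_dvd_of_lt ((d.ω_primitive.pow_eq_one_iff_dvd k).mp h1) hk

variable (P) in
lemma eventually_isRegularPoint : ∀ᶠ z in cofinite, IsRegularPoint P z := by
  classical
  refine (((Finset.range d.T) ×ˢ (insert 0 P.Z')).image
    fun q => d.ω ^ q.1 * q.2).finite_toSet.subset fun z hz => ?_
  have hz' : ¬ ∀ (x : ℂ) (k : ℕ), P.n x ≠ 0 → z ≠ d.ω ^ k * x := hz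
  push Not at hz'
  obtain ⟨x, k, hx, rfl⟩ := hz'
  obtain ⟨m, hm, h⟩ := d.exists_pow_eq_zpow k
  rw [zpow_natCast] at h
  rw [Finset.mem_coe, Finset.mem_image]
  refine ⟨(m, x), Finset.mem_product.mpr ⟨Finset.mem_range.mpr hm, Finset.mem_insert.mpr ?_⟩,
    by rw [h]⟩
  rcases eq_or_ne x 0 with h0 | h0
  · exact Or.inl h0
  · exact Or.inr (mem_Z'.mpr ⟨h0, hx⟩)

lemma eventually_zpow_mul_ne (d : DihedralData 𝔤) (w : ℂ) :
    ∀ᶠ z in cofinite, ∀ k : ℤ, w ≠ d.ω ^ k * z := by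
  classical
  refine ((Finset.range d.T).image fun m => d.ω ^ m * w).finite_toSet.subset fun z hz => ?_
  have hz' : ¬ ∀ k : ℤ, w ≠ d.ω ^ k * z := hz
  push Not at hz'
  obtain ⟨k, rfl⟩ := hz'
  obtain ⟨m, hm, h⟩ := d.exists_pow_eq_zpow (-k)
  rw [Finset.mem_coe, Finset.mem_image]
  refine ⟨m, Finset.mem_range.mpr hm, ?_⟩
  rw [← h, zpow_neg, inv_mul_cancel_left₀ (zpow_ne_zero _ d.ω_ne_zero)]

end Orbits

/-! ### The Hamiltonians as Laurent coefficients -/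

section HamExpansion

open scoped OnePoint

variable {𝔤 : Type*} [LieRing 𝔤] [LieAlgebra ℂ 𝔤] {d : DihedralData 𝔤} {P : PoleDivisor d}

lemma eigenproj_sigma_zpow (j k : ℤ) (X : Affine d) : Affine.eigenproj d j
    (((Affine.sigma d) ^ k) X) = d.ω ^ (j * k) • Affine.eigenproj d j X := by
  have h := sum_range_int_shift (fun m : ℤ => d.ω ^ (-(j * m)) • ((Affine.sigma d) ^ m) X)
    (fun m => by
      rw [Affine.sigma_zpow_add_T, mul_add, neg_add, zpow_add₀ d.ω_ne_zero, mul_comm j (d.T : ℤ),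
        zpow_neg _ ((d.T : ℤ) * j), zpow_mul, d.ω_zpow_T, one_zpow, inv_one, mul_one]) k
  rw [Affine.eigenproj_apply, Affine.eigenproj_apply, ← h, smul_comm]
  congr 1
  rw [Finset.smul_sum]
  refine Finset.sum_congr rfl fun m _ => ?_
  rw [smul_smul, Affine.sigma_zpow_zpow, ← zpow_add₀ d.ω_ne_zero]
  congr 2
  ring

/-- At the fixed point `0` the fields are equivariant for `σ`. -/
lemma twistF_fieldF_zero (k : ℤ) (p : ℕ) : twistF P k (fieldF P ((0 : ℂ) : OnePoint ℂ) p)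
    = d.ω ^ ((p : ℤ) * k) • fieldF P ((0 : ℂ) : OnePoint ℂ) p := by
  refine Subtype.ext (LinearMap.ext fun X => ?_)
  change emb P ((0 : ℂ) : OnePoint ℂ) p (((Affine.sigma d) ^ k) X)
    = d.ω ^ ((p : ℤ) * k) • emb P ((0 : ℂ) : OnePoint ℂ) p X
  rw [← emb_pointProj, pointProj_zero, eigenproj_sigma_zpow, map_smul, ← pointProj_zero,
    emb_pointProj]

/-- At the fixed point `∞` the fields are equivariant for `σ`. -/
lemma twistF_fieldF_infty (k : ℤ) (p : ℕ) : twistF P k (fieldF P ∞ p)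
    = d.ω ^ (-((p : ℤ) * k)) • fieldF P ∞ p := by
  refine Subtype.ext (LinearMap.ext fun X => ?_)
  change emb P ∞ p (((Affine.sigma d) ^ k) X) = d.ω ^ (-((p : ℤ) * k)) • emb P ∞ p X
  rcases eq_or_ne p 0 with rfl | hp
  · rw [emb_infty_zero]; simp
  · rw [← emb_pointProj, pointProj_infty hp, eigenproj_sigma_zpow, map_smul, ← pointProj_infty hp,
      emb_pointProj, neg_mul]

lemma fieldF_of_le {x : OnePoint ℂ} {p : ℕ} (h : P.n x ≤ p) : fieldF P x p = 0 :=
  Subtype.ext (emb_of_le h)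

lemma laxCoeff_eq (d : DihedralData 𝔤) (k q : ℕ) (z y : ℂ) :
    (d.ω ^ k)⁻¹ / ((d.ω ^ k)⁻¹ * z - y) ^ (q + 1)
      = d.ω ^ (k * q) * ((z - d.ω ^ k * y) ^ (q + 1))⁻¹ := by
  have hk : d.ω ^ k ≠ 0 := pow_ne_zero _ d.ω_ne_zero
  have h : (d.ω ^ k)⁻¹ * z - y = (d.ω ^ k)⁻¹ * (z - d.ω ^ k * y) := by
    rw [mul_sub, inv_mul_cancel_left₀ hk]
  rw [h, mul_pow, pow_mul, div_eq_mul_inv, mul_inv, inv_pow, inv_inv, ← mul_assoc, pow_succ (d.ω ^ k),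
    mul_comm ((d.ω ^ k) ^ q), inv_mul_cancel_left₀ hk]

/-- The Lax matrix with the poles of its summands displayed. -/
lemma laxF_eq (z : ℂ) : laxF P z = (d.T : ℂ)⁻¹ • ∑ k ∈ Finset.range d.T, ∑ y ∈ P.Z',
      ∑ q ∈ Finset.range (P.n y), d.ω ^ (k * q) • ((z - d.ω ^ k * y) ^ (q + 1))⁻¹ •
        twistF P (-(k : ℤ)) (fieldF P y q) +
    ∑ q ∈ Finset.range (P.n (0 : ℂ)), ((z - 0) ^ (q + 1))⁻¹ • fieldF P ((0 : ℂ) : OnePoint ℂ) q -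
    ∑ q ∈ Finset.range (P.n ∞), z ^ q • fieldF P ∞ (q + 1) := by
  simp only [laxF, laxSum, laxCoeff_eq, mul_smul, sub_zero]
  rfl

/-- The pole at the origin, included in the average over the cyclic group. -/
lemma T_smul_laxF (z : ℂ) : (d.T : ℂ) • laxF P z =
    ∑ q ∈ Finset.range d.T ×ˢ insert 0 P.Z',
      ∑ s ∈ Finset.range (P.n q.2), d.ω ^ (q.1 * s) • ((z - d.ω ^ q.1 * q.2) ^ (s + 1))⁻¹ •
        twistF P (-(q.1 : ℤ)) (fieldF P q.2 s) -
    (d.T : ℂ) • ∑ q ∈ Finset.range (P.n ∞), z ^ q • fieldF P ∞ (q + 1) := by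
  have h0 : ∀ k ∈ Finset.range d.T, ∑ s ∈ Finset.range (P.n (0 : ℂ)), d.ω ^ (k * s) •
      ((z - d.ω ^ k * 0) ^ (s + 1))⁻¹ • twistF P (-(k : ℤ)) (fieldF P ((0 : ℂ) : OnePoint ℂ) s)
      = ∑ s ∈ Finset.range (P.n (0 : ℂ)),
        ((z - 0) ^ (s + 1))⁻¹ • fieldF P ((0 : ℂ) : OnePoint ℂ) s := by
    intro k _
    refine Finset.sum_congr rfl fun s _ => ?_
    rw [twistF_fieldF_zero, mul_zero, smul_comm, smul_smul (d.ω ^ (k * s)), ← zpow_natCast d.ω (k * s),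
      ← zpow_add₀ d.ω_ne_zero]
    rw [show ((k * s : ℕ) : ℤ) + (s : ℤ) * -(k : ℤ) = 0 by push_cast; ring, zpow_zero, one_smul]
  rw [Finset.sum_product]
  simp only [Finset.sum_insert (show (0 : ℂ) ∉ P.Z' from fun h => (mem_Z'.mp h).1 rfl)]
  rw [Finset.sum_add_distrib, Finset.sum_congr rfl h0, Finset.sum_const, Finset.card_range,
    laxF_eq, smul_sub, smul_add, smul_inv_smul₀ d.T_ne_zero, ← Nat.cast_smul_eq_nsmul ℂ]
  congr 1
  rw [add_comm]

lemma sum_range_ite_eq_fieldF (x : OnePoint ℂ) (j : ℕ) :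
    ∑ q ∈ Finset.range (P.n x), (if j = q then fieldF P x q else 0) = fieldF P x j := by
  rw [Finset.sum_ite_eq]
  split_ifs with h
  · rfl
  · exact (fieldF_of_le (by simpa using h)).symm

/-- The Laurent expansion of `T ℒ(z)` at a pole in `𝒵'`: the polar coefficients are the fields at
that pole, and the other points of its orbit contribute to the regular part. -/
lemma hasLaurent_laxF_coe {x : ℂ} (hx : x ∈ P.Z') :
    HasLaurent (expandAt x) (fun z => (d.T : ℂ) • laxF P z) (fun j => fieldF P x j)
      (fun n => ∑ k ∈ Finset.range d.T, ∑ y ∈ (insert 0 P.Z').filter fun y => ¬ (k = 0 ∧ y = x),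
        ∑ q ∈ Finset.range (P.n y), ((Nat.choose (q + n) n : ℂ) * (-1) ^ n * d.ω ^ (k * q) /
          (x - d.ω ^ k * y) ^ (q + n + 1)) • twistF P (-(k : ℤ)) (fieldF P y q) -
        (d.T : ℂ) • ∑ q ∈ Finset.range (P.n ∞), ((Nat.choose q n : ℂ) * x ^ (q - n)) •
          fieldF P ∞ (q + 1)) := by
  classical
  have hx' := mem_Z'.mp hx
  set S := (Finset.range d.T) ×ˢ (insert 0 P.Z') with hS
  have hne : ∀ q ∈ S, q ≠ (0, x) → x ≠ d.ω ^ q.1 * q.2 := by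
    rintro ⟨k, y⟩ hq hne h
    rw [hS, Finset.mem_product, Finset.mem_range, Finset.mem_insert] at hq
    have hy0 : y ≠ 0 := by
      rintro rfl
      exact hx'.1 (by simpa using h)
    have hy := (mem_Z'.mp (hq.2.resolve_left hy0)).2
    obtain rfl := eq_of_cyclic_orbit hx'.2 hy h
    exact hne (Prod.ext (eq_zero_of_cyclic_orbit hx'.1 hq.1 h) rfl)
  have h1 : ∀ q ∈ S, HasLaurent (expandAt x)
      (fun z => ∑ s ∈ Finset.range (P.n q.2), d.ω ^ (q.1 * s) •
        ((z - d.ω ^ q.1 * q.2) ^ (s + 1))⁻¹ • twistF P (-(q.1 : ℤ)) (fieldF P q.2 s))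
      (fun j => if q = (0, x) then fieldF P x j else 0)
      (fun n => if q = (0, x) then 0 else ∑ s ∈ Finset.range (P.n q.2),
        ((Nat.choose (s + n) n : ℂ) * (-1) ^ n * d.ω ^ (q.1 * s) /
          (x - d.ω ^ q.1 * q.2) ^ (s + n + 1)) • twistF P (-(q.1 : ℤ)) (fieldF P q.2 s)) := by
    intro q hq
    by_cases h : q = (0, x)
    · subst h
      simp only [if_true, zero_mul, pow_zero, one_smul, one_mul]
      have := HasLaurent.sum (θ := expandAt x) fun s (_ : s ∈ Finset.range (P.n x)) =>
        HasLaurent.polar x s (twistF P (-((0 : ℕ) : ℤ)) (fieldF P x s))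
      simp only [Finset.sum_const_zero] at this
      convert this using 2 with j
      exact (sum_range_ite_eq_fieldF (x : OnePoint ℂ) j).symm
    · simp only [if_neg h]
      have := HasLaurent.sum (θ := expandAt x) fun s (_ : s ∈ Finset.range (P.n q.2)) =>
        (HasLaurent.regular (hne q hq h) s
          (twistF P (-(q.1 : ℤ)) (fieldF P q.2 s))).const_smul (d.ω ^ (q.1 * s))
      simp only [smul_zero, Finset.sum_const_zero, smul_smul] at this
      simp only [smul_smul]
      convert this using 5
      ring
  have h2 := (HasLaurent.sum (θ := expandAt x) fun q (_ : q ∈ Finset.range (P.n ∞)) =>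
    HasLaurent.pow x q (fieldF P ∞ (q + 1))).const_smul (d.T : ℂ)
  have h3 := (HasLaurent.sum h1).sub h2
  simp only [T_smul_laxF]
  have h0S : ((0 : ℕ), x) ∈ S := by
    rw [hS, Finset.mem_product]
    exact ⟨Finset.mem_range.mpr d.T_pos, Finset.mem_insert_of_mem hx⟩
  convert h3 using 2 with j n
  · rw [Finset.sum_const_zero, smul_zero, sub_zero, Finset.sum_ite_eq' S (0, x) fun _ => _,
      if_pos h0S]
  · congr 1
    rw [hS, Finset.sum_product]
    refine Finset.sum_congr rfl fun k _ => ?_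
    rw [Finset.sum_filter]
    refine Finset.sum_congr rfl fun y _ => ?_
    simp only [Prod.mk.injEq, ite_not]

/-- The Laurent expansion of `ℒ(z)` at the origin. -/
lemma hasLaurent_laxF_zero :
    HasLaurent (expandAt 0) (fun z => (1 : ℂ) • laxF P z) (fun j => fieldF P ((0 : ℂ) : OnePoint ℂ) j)
      (fun n => (d.T : ℂ)⁻¹ • ∑ k ∈ Finset.range d.T, ∑ y ∈ P.Z',
        ∑ q ∈ Finset.range (P.n y), (d.ω ^ (k * q) * ((Nat.choose (q + n) n : ℂ) * (-1) ^ n /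
          (0 - d.ω ^ k * y) ^ (q + n + 1))) • twistF P (-(k : ℤ)) (fieldF P y q) -
        fieldF P ∞ (n + 1)) := by
  have h1 := (HasLaurent.sum (θ := expandAt 0) fun k (_ : k ∈ Finset.range d.T) =>
    HasLaurent.sum fun y (hy : y ∈ P.Z') => HasLaurent.sum fun q (_ : q ∈ Finset.range (P.n y)) =>
      (HasLaurent.regular (x := 0) (c := d.ω ^ k * y) (mul_ne_zero (pow_ne_zero _ d.ω_ne_zero)
        (mem_Z'.mp hy).1).symm q (twistF P (-(k : ℤ)) (fieldF P y q))).const_smul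
          (d.ω ^ (k * q))).const_smul (d.T : ℂ)⁻¹
  have h2 := HasLaurent.sum (θ := expandAt 0) fun q (_ : q ∈ Finset.range (P.n (0 : ℂ))) =>
    HasLaurent.polar 0 q (fieldF P ((0 : ℂ) : OnePoint ℂ) q)
  have h3 := HasLaurent.sum (θ := expandAt 0) fun q (_ : q ∈ Finset.range (P.n ∞)) =>
    HasLaurent.pow 0 q (fieldF P ∞ (q + 1))
  have h4 := (h1.add h2).sub h3
  simp only [laxF_eq, one_smul]
  convert h4 using 2 with j n
  · simp only [smul_zero, Finset.sum_const_zero, zero_add, sub_zero]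
    exact (sum_range_ite_eq_fieldF _ j).symm
  · simp only [Finset.sum_const_zero, add_zero, smul_smul]
    congr 1
    have e : ∀ q ∈ Finset.range (P.n ∞), ((Nat.choose q n : ℂ) * 0 ^ (q - n)) • fieldF P ∞ (q + 1)
        = if n = q then fieldF P ∞ (n + 1) else 0 := by
      intro q _
      rcases lt_trichotomy q n with h | rfl | h
      · rw [Nat.choose_eq_zero_of_lt h, if_neg (by omega)]; simp
      · simp
      · rw [zero_pow (by omega), if_neg (by omega)]; simp
    rw [Finset.sum_congr rfl e, Finset.sum_ite_eq]
    split_ifs with h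
    · rfl
    · exact fieldF_of_le (by rw [Finset.mem_range] at h; omega)

/-- The Laurent expansion of `z ℒ(z)` at infinity. The factor `z` turns the polynomial part of `ℒ`
into a polar part in the variable `1/z` and leaves the poles in `ℂ` regular at infinity. -/
lemma hasLaurent_laxF_infty :
    HasLaurent expandInf (fun z => z • laxF P z) (fun j => -fieldF P ∞ (j + 1))
      (fun n => (d.T : ℂ)⁻¹ • ∑ k ∈ Finset.range d.T, ∑ y ∈ P.Z',
        ∑ q ∈ Finset.range (P.n y), (d.ω ^ (k * q) * ((Nat.choose n q : ℂ) *
          (d.ω ^ k * y) ^ (n - q))) • twistF P (-(k : ℤ)) (fieldF P y q) +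
        fieldF P ((0 : ℂ) : OnePoint ℂ) n) := by
  have h1 := (HasLaurent.sum (θ := expandInf) fun k (_ : k ∈ Finset.range d.T) =>
    HasLaurent.sum fun y (hy : y ∈ P.Z') => HasLaurent.sum fun q (_ : q ∈ Finset.range (P.n y)) =>
      (HasLaurent.regular_inf (d.ω ^ k * y) q (twistF P (-(k : ℤ)) (fieldF P y q))).const_smul
          (d.ω ^ (k * q))).const_smul (d.T : ℂ)⁻¹
  have h2 := HasLaurent.sum (θ := expandInf) fun q (_ : q ∈ Finset.range (P.n (0 : ℂ))) =>
    HasLaurent.regular_inf 0 q (fieldF P ((0 : ℂ) : OnePoint ℂ) q)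
  have h3 := HasLaurent.sum (θ := expandInf) fun q (_ : q ∈ Finset.range (P.n ∞)) =>
    HasLaurent.polar_inf q (fieldF P ∞ (q + 1))
  have h4 := (h1.add h2).sub h3
  have h5 : ∀ z : ℂ, z • laxF P z = (d.T : ℂ)⁻¹ • ∑ k ∈ Finset.range d.T, ∑ y ∈ P.Z',
      ∑ q ∈ Finset.range (P.n y), d.ω ^ (k * q) • (z * ((z - d.ω ^ k * y) ^ (q + 1))⁻¹) •
        twistF P (-(k : ℤ)) (fieldF P y q) +
      ∑ q ∈ Finset.range (P.n (0 : ℂ)),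
        (z * ((z - 0) ^ (q + 1))⁻¹) • fieldF P ((0 : ℂ) : OnePoint ℂ) q -
      ∑ q ∈ Finset.range (P.n ∞), z ^ (q + 1) • fieldF P ∞ (q + 1) := by
    intro z
    have e : ∀ (k q : ℕ) (y : ℂ), z • (d.ω ^ (k * q) • ((z - d.ω ^ k * y) ^ (q + 1))⁻¹ •
        twistF P (-(k : ℤ)) (fieldF P y q)) = d.ω ^ (k * q) •
          (z * ((z - d.ω ^ k * y) ^ (q + 1))⁻¹) • twistF P (-(k : ℤ)) (fieldF P y q) :=
      fun k q y => by rw [smul_comm z, smul_smul z]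
    rw [laxF_eq, smul_sub, smul_add, smul_comm z, Finset.smul_sum (r := z),
      Finset.smul_sum (r := z), Finset.smul_sum (r := z)]
    simp only [Finset.smul_sum (r := z), e]
    simp only [smul_smul, pow_succ' z]
  simp only [h5]
  convert h4 using 2 with j n
  · simp only [smul_zero, Finset.sum_const_zero, zero_add, zero_sub]
    rw [Finset.sum_ite_eq]
    split_ifs with h
    · rfl
    · rw [fieldF_of_le (by rw [Finset.mem_range] at h; omega)]
  · simp only [Finset.sum_const_zero, sub_zero, smul_smul]
    congr 1
    have e : ∀ q ∈ Finset.range (P.n (0 : ℂ)), ((Nat.choose n q : ℂ) * 0 ^ (n - q)) •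
        fieldF P ((0 : ℂ) : OnePoint ℂ) q
        = if n = q then fieldF P ((0 : ℂ) : OnePoint ℂ) q else 0 := by
      intro q _
      rcases lt_trichotomy n q with h | rfl | h
      · rw [Nat.choose_eq_zero_of_lt h, if_neg (by omega)]; simp
      · simp
      · rw [zero_pow (by omega), if_neg (by omega)]; simp
    rw [Finset.sum_congr rfl e, sum_range_ite_eq_fieldF]

end HamExpansion

section HamCoeff

open scoped OnePoint
open Polynomial

variable {𝔤 : Type*} [LieRing 𝔤] [LieAlgebra ℂ 𝔤] {d : DihedralData 𝔤} {P : PoleDivisor d}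
variable {I : Type*} [Fintype I] [DecidableEq I] (b : Module.Basis I ℂ 𝔤) (lev : Levels d P)

lemma sum_range_eq_of_zero {V : Type*} [AddCommMonoid V] {f : ℕ → V} {M N : ℕ}
    (hM : ∀ s, M ≤ s → f s = 0) (hN : ∀ s, N ≤ s → f s = 0) :
    ∑ s ∈ Finset.range M, f s = ∑ s ∈ Finset.range N, f s := by
  have h : ∀ {M N : ℕ}, M ≤ N → (∀ s, M ≤ s → f s = 0) →
      ∑ s ∈ Finset.range M, f s = ∑ s ∈ Finset.range N, f s := fun hMN h0 =>
    Finset.sum_subset (Finset.range_subset_range.mpr hMN) fun s _ hs =>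
      h0 s (by simpa using hs)
  rcases le_total M N with hMN | hMN
  · exact h hMN hM
  · exact (h hMN hN).symm

lemma piHatL_pairing_fieldA (x y : OnePoint ℂ) (p q : ℕ) :
    piHatL b lev (pairing b (fieldA P x p) (fieldA P y q))
      = localPair b lev (fieldF P x p) (fieldF P y q) :=
  (localPair_eq b lev (fieldF P x p) (fieldF P y q)).symm

lemma piHatL_pairing_sigmaField (x y : OnePoint ℂ) (p q l : ℕ) :
    piHatL b lev (pairing b (fieldA P x p) (sigmaField l (fieldA P y q)))
      = localPair b lev (fieldF P x p) (twistF P (-(l : ℤ)) (fieldF P y q)) := by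
  rw [localPair_eq, coe_twistF_fieldF]
  rfl

lemma localPair_fieldF_of_le {x : OnePoint ℂ} {p : ℕ} (h : P.n x ≤ p) (Φ : modeFormalFields P) :
    localPair b lev (fieldF P x p) Φ = 0 := by
  rw [fieldF_of_le h, map_zero, LinearMap.zero_apply]

/-- The Hamiltonians at a pole in `𝒵'`, by the polar and regular parts of `T ℒ(z)` at that pole.
-/
lemma localHam_coe {x : ℂ} (hx : x ≠ 0) (p : ℕ) : localHam b lev x p =
    ∑ s ∈ Finset.range (P.n x), localPair b lev (fieldF P x (p + s))
      (∑ k ∈ Finset.range d.T, ∑ y ∈ (insert 0 P.Z').filter fun y => ¬ (k = 0 ∧ y = x),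
        ∑ q ∈ Finset.range (P.n y), ((Nat.choose (q + s) s : ℂ) * (-1) ^ s * d.ω ^ (k * q) /
          (x - d.ω ^ k * y) ^ (q + s + 1)) • twistF P (-(k : ℤ)) (fieldF P y q) -
        (d.T : ℂ) • ∑ q ∈ Finset.range (P.n ∞), ((Nat.choose q s : ℂ) * x ^ (q - s)) •
          fieldF P ∞ (q + 1)) +
      (1 / 2 : ℂ) • ∑ q ∈ Finset.range p,
        localPair b lev (fieldF P x q) (fieldF P x (p - q - 1)) := by
  have h0 : localHam b lev x p = piHatL b lev (formalHamFinite b P x p) := by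
    change piHatL b lev (formalHam b P x p) = _
    rw [formalHam, OnePoint.elim_some, if_neg hx]
  rw [h0, formalHamFinite]
  simp only [map_add, map_sub, map_sum, map_smul, piHatL_pairing_fieldA,
    piHatL_pairing_sigmaField, Finset.sum_sub_distrib]
  congr 2
  · rw [Finset.sum_comm]
    refine Finset.sum_congr rfl fun k _ => ?_
    rw [Finset.sum_comm]
    refine Finset.sum_congr rfl fun y _ => ?_
    rw [Finset.sum_comm]
  · rw [← Finset.smul_sum, Finset.sum_comm]
    refine congrArg _ (Finset.sum_congr rfl fun q _ => sum_range_eq_of_zero ?_ ?_)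
    · intro s hs
      rw [Nat.choose_eq_zero_of_lt hs]; simp
    · intro s hs
      rw [localPair_fieldF_of_le b lev (by omega), smul_zero]

lemma localPair_twist_right (Φ Ψ : modeFormalFields P) (k : ℤ) :
    localPair b lev Φ (twistF P (-k) Ψ) = localPair b lev (twistF P k Φ) Ψ :=
  (localPair_twistF b lev k Φ Ψ).symm

lemma DihedralData.ω_zpow_eq_one (d : DihedralData 𝔤) {k : ℤ} (h : (d.T : ℤ) ∣ k) :
    d.ω ^ k = 1 := by
  obtain ⟨m, rfl⟩ := h
  rw [zpow_mul, d.ω_zpow_T, one_zpow]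

/-- The Hamiltonians at the origin, by the polar and regular parts of `ℒ(z)`. As `p ≡ 1` modulo
`T`, the powers of `ω` from the average over the cyclic group cancel. -/
lemma localHam_zero {p : ℕ} (hp : p ≡ 1 [MOD d.T]) :
    localHam b lev ((0 : ℂ) : OnePoint ℂ) p =
    ∑ s ∈ Finset.range (P.n (0 : ℂ)), localPair b lev (fieldF P ((0 : ℂ) : OnePoint ℂ) (p + s))
      ((d.T : ℂ)⁻¹ • ∑ k ∈ Finset.range d.T, ∑ y ∈ P.Z',
        ∑ q ∈ Finset.range (P.n y), (d.ω ^ (k * q) * ((Nat.choose (q + s) s : ℂ) * (-1) ^ s /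
          (0 - d.ω ^ k * y) ^ (q + s + 1))) • twistF P (-(k : ℤ)) (fieldF P y q) -
        fieldF P ∞ (s + 1)) +
      (1 / 2 : ℂ) • ∑ q ∈ Finset.range p, localPair b lev (fieldF P ((0 : ℂ) : OnePoint ℂ) q)
        (fieldF P ((0 : ℂ) : OnePoint ℂ) (p - q - 1)) := by
  have h0 : localHam b lev ((0 : ℂ) : OnePoint ℂ) p = piHatL b lev (formalHamZero b P p) := by
    change piHatL b lev (formalHam b P _ p) = _
    rw [formalHam, OnePoint.elim_some, if_pos rfl]
  have hdvd : (d.T : ℤ) ∣ p - 1 := by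
    have := (Nat.modEq_iff_dvd.mp hp.symm)
    simpa using this
  have hc : ∀ (k s q : ℕ) (y : ℂ), (d.ω ^ (k * q) * ((Nat.choose (q + s) s : ℂ) * (-1) ^ s /
      (0 - d.ω ^ k * y) ^ (q + s + 1))) * d.ω ^ (((p + s : ℕ) : ℤ) * k)
      = (-1) ^ (q + 1) * (Nat.choose (q + s) s : ℂ) / y ^ (q + s + 1) := by
    intro k s q y
    have hk : d.ω ^ k ≠ 0 := pow_ne_zero _ d.ω_ne_zero
    have e1 : d.ω ^ (((p + s : ℕ) : ℤ) * k) * d.ω ^ (k * q) = (d.ω ^ k) ^ (q + s + 1) := by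
      rw [← pow_mul, ← zpow_natCast, ← zpow_natCast, ← zpow_add₀ d.ω_ne_zero]
      have e : ((p + s : ℕ) : ℤ) * k + (k * q : ℕ) = (p - 1) * k + (k * (q + s + 1) : ℕ) := by
        push_cast; ring
      rw [e, zpow_add₀ d.ω_ne_zero, d.ω_zpow_eq_one (Dvd.dvd.mul_right hdvd _), one_mul]
    have e2 : (0 - d.ω ^ k * y) ^ (q + s + 1)
        = (-1) ^ (q + s + 1) * ((d.ω ^ k) ^ (q + s + 1) * y ^ (q + s + 1)) := by
      rw [← mul_pow, ← mul_pow]; congr 1; ring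
    have e3 : ((-1 : ℂ) ^ (q + s + 1))⁻¹ * (-1) ^ s = (-1) ^ (q + 1) := by
      rw [← inv_pow, show (-1 : ℂ)⁻¹ = -1 by norm_num, ← pow_add,
        show q + s + 1 + s = (q + 1) + 2 * s by ring, pow_add, pow_mul, neg_one_sq, one_pow, mul_one]
    rw [e2, div_eq_mul_inv, div_eq_mul_inv, mul_inv, mul_inv, ← e3]
    have e4 : ((d.ω ^ k) ^ (q + s + 1))⁻¹ * (d.ω ^ (((p + s : ℕ) : ℤ) * k) * d.ω ^ (k * q)) = 1 := by
      rw [e1, inv_mul_cancel₀ (pow_ne_zero _ hk)]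
    linear_combination (((-1 : ℂ) ^ (q + s + 1))⁻¹ * (-1) ^ s * (Nat.choose (q + s) s : ℂ) *
      (y ^ (q + s + 1))⁻¹) * e4
  rw [h0, formalHamZero]
  simp only [map_add, map_sub, map_sum, map_smul, piHatL_pairing_fieldA, Finset.sum_sub_distrib,
    localPair_twist_right, twistF_fieldF_zero, LinearMap.smul_apply]
  congr 2
  · rw [← Finset.smul_sum]
    have e : ∀ s ∈ Finset.range (P.n (0 : ℂ)), ∑ k ∈ Finset.range d.T, ∑ y ∈ P.Z',
        ∑ q ∈ Finset.range (P.n y), (d.ω ^ (k * q) * ((Nat.choose (q + s) s : ℂ) * (-1) ^ s /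
          (0 - d.ω ^ k * y) ^ (q + s + 1))) • d.ω ^ (((p + s : ℕ) : ℤ) * k) •
          localPair b lev (fieldF P ((0 : ℂ) : OnePoint ℂ) (p + s)) (fieldF P y q)
        = (d.T : ℂ) • ∑ y ∈ P.Z', ∑ q ∈ Finset.range (P.n y),
          ((-1) ^ (q + 1) * (Nat.choose (q + s) s : ℂ) / y ^ (q + s + 1)) •
          localPair b lev (fieldF P ((0 : ℂ) : OnePoint ℂ) (p + s)) (fieldF P y q) := by
      intro s _
      simp only [smul_smul, hc]
      rw [Finset.sum_const, Finset.card_range, Nat.cast_smul_eq_nsmul]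
    rw [Finset.sum_congr rfl e, ← Finset.smul_sum, inv_smul_smul₀ d.T_ne_zero, Finset.sum_comm]
    refine Finset.sum_congr rfl fun y _ => ?_
    rw [Finset.sum_comm]
  · refine sum_range_eq_of_zero ?_ ?_
    · intro q hq
      rw [fieldF_of_le (x := ∞) (by omega), map_zero]
    · intro q hq
      rw [localPair_fieldF_of_le b lev (by omega)]
  · exact Finset.sum_congr rfl fun q _ => localPair_symm b lev _ _

/-- The Hamiltonians at infinity, by the polar and regular parts of `z ℒ(z)`. As `p + 2 ≡ 0`
modulo `T`, the powers of `ω` from the average over the cyclic group cancel. -/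
lemma localHam_infty {p : ℕ} (hp : d.T ∣ p + 2) : localHam b lev ∞ p =
    ∑ s ∈ Finset.range (P.n ∞), localPair b lev (-fieldF P ∞ (p + 1 + s + 1))
      ((d.T : ℂ)⁻¹ • ∑ k ∈ Finset.range d.T, ∑ y ∈ P.Z',
        ∑ q ∈ Finset.range (P.n y), (d.ω ^ (k * q) * ((Nat.choose s q : ℂ) *
          (d.ω ^ k * y) ^ (s - q))) • twistF P (-(k : ℤ)) (fieldF P y q) +
        fieldF P ((0 : ℂ) : OnePoint ℂ) s) +
      (1 / 2 : ℂ) • ∑ q ∈ Finset.range (p + 1), localPair b lev (-fieldF P ∞ (q + 1))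
        (-fieldF P ∞ (p + 1 - q - 1 + 1)) := by
  have h0 : localHam b lev ∞ p = piHatL b lev (formalHamInfty b P p) := by
    change piHatL b lev (formalHam b P _ p) = _
    rw [formalHam, OnePoint.elim_infty]
  have hdvd : (d.T : ℤ) ∣ p + 2 := by exact_mod_cast hp
  have hc : ∀ (k s q : ℕ) (y : ℂ), (d.ω ^ (k * q) * ((Nat.choose s q : ℂ) *
          (d.ω ^ k * y) ^ (s - q))) * d.ω ^ (-(((p + 1 + s + 1 : ℕ) : ℤ) * k))
      = (Nat.choose s q : ℂ) * y ^ (s - q) := by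
    intro k s q y
    rcases lt_or_ge s q with h | h
    · rw [Nat.choose_eq_zero_of_lt h]; simp
    obtain ⟨t, rfl⟩ := Nat.exists_eq_add_of_le h
    rw [Nat.add_sub_cancel_left, mul_pow, ← pow_mul]
    have e1 : d.ω ^ (-(((p + 1 + (q + t) + 1 : ℕ) : ℤ) * k)) * d.ω ^ (k * q) * d.ω ^ (k * t) = 1 := by
      rw [← zpow_natCast, ← zpow_natCast, ← zpow_add₀ d.ω_ne_zero, ← zpow_add₀ d.ω_ne_zero]
      refine d.ω_zpow_eq_one ?_
      have e : -(((p + 1 + (q + t) + 1 : ℕ) : ℤ) * k) + (k * q : ℕ) + (k * t : ℕ)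
          = ((p : ℤ) + 2) * -k := by push_cast; ring
      rw [e]
      exact Dvd.dvd.mul_right hdvd _
    linear_combination ((Nat.choose (q + t) q : ℂ) * y ^ t) * e1
  rw [h0, formalHamInfty]
  simp only [map_add, map_sub, map_sum, map_smul, map_neg, LinearMap.neg_apply,
    piHatL_pairing_fieldA, Finset.sum_add_distrib, neg_neg, smul_neg,
    localPair_twist_right, twistF_fieldF_infty, LinearMap.smul_apply, Finset.sum_neg_distrib]
  rw [sub_eq_add_neg]
  congr 2
  · congr 1
    rw [← Finset.smul_sum]
    have e : ∀ s ∈ Finset.range (P.n ∞), ∑ k ∈ Finset.range d.T, ∑ y ∈ P.Z',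
        ∑ q ∈ Finset.range (P.n y), (d.ω ^ (k * q) * ((Nat.choose s q : ℂ) *
          (d.ω ^ k * y) ^ (s - q))) • d.ω ^ (-(((p + 1 + s + 1 : ℕ) : ℤ) * k)) •
          localPair b lev (fieldF P ∞ (p + 1 + s + 1)) (fieldF P y q)
        = (d.T : ℂ) • ∑ y ∈ P.Z', ∑ q ∈ Finset.range (P.n y),
          ((Nat.choose s q : ℂ) * y ^ (s - q)) •
          localPair b lev (fieldF P ∞ (p + 1 + s + 1)) (fieldF P y q) := by
      intro s _
      simp only [smul_smul, hc]
      rw [Finset.sum_const, Finset.card_range, Nat.cast_smul_eq_nsmul]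
    rw [Finset.sum_congr rfl e, ← Finset.smul_sum, inv_smul_smul₀ d.T_ne_zero, Finset.sum_comm]
    refine Finset.sum_congr rfl fun y _ => ?_
    rw [Finset.sum_comm]
    refine Finset.sum_congr rfl fun q _ => ?_
    rw [Finset.sum_filter]
    refine Finset.sum_congr rfl fun s _ => ?_
    split_ifs with h
    · rw [localPair_symm, show p + s + 2 = p + 1 + s + 1 by ring]
    · rw [Nat.choose_eq_zero_of_lt (by omega)]; simp
  · congr 1
    rw [sum_range_eq_of_zero (M := P.n (0 : ℂ)) (N := P.n ∞)]
    · refine Finset.sum_congr rfl fun s _ => ?_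
      rw [localPair_symm, show p + s + 2 = p + 1 + s + 1 by ring]
    · intro s hs
      rw [localPair_fieldF_of_le b lev hs]
    · intro s hs
      rw [fieldF_of_le (x := ∞) (by omega), map_zero]
  · refine Finset.sum_congr rfl fun q hq => ?_
    have := Finset.mem_range.mp hq
    rw [show p + 1 - q - 1 + 1 = p - q + 1 by omega]

lemma HasLaurent.map {V W : Type*} [AddCommGroup V] [Module ℂ V] [AddCommGroup W] [Module ℂ W]
    {θ : ℂ[X] →ₐ[ℂ] LaurentSeries ℂ} {F : ℂ → V} {α ρ : ℕ → V} (hF : HasLaurent θ F α ρ)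
    (S : V →ₗ[ℂ] W) :
    HasLaurent θ (fun z => S (F z)) (fun q => S (α q)) (fun n => S (ρ n)) := by
  obtain ⟨a, ha, h1, h2⟩ := hF
  exact ⟨_, ha.map S, fun q => by rw [h1], fun n => by rw [h2]⟩

/-- The polar coefficients of the Lax partner `laxGen`, where the kernel `f(z) / (z - ω⁻ᵐ w)` is
regular at the point of expansion. -/
lemma exists_hasExpansion_laxGen {θ : ℂ[X] →ₐ[ℂ] LaurentSeries ℂ} {f : ℂ → ℂ}
    {α ρ : ℕ → modeFormalFields P} (hF : HasLaurent θ (fun z => f z • laxF P z) α ρ) {N : ℕ}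
    (hN : ∀ q, N ≤ q → α q = 0) {w : ℂ} {r : ℕ → ℕ → ℂ}
    (hr : ∀ m : ℕ, ∃ t, Represents θ (fun z => f z * (z - d.ω ^ (-(m : ℤ)) * w)⁻¹) t ∧
      (∀ n < 0, t.coeff n = 0) ∧ ∀ n : ℕ, t.coeff n = r m n) :
    ∃ ν, HasExpansion θ (fun z => (f z) ^ 2 • laxGen P w z) ν ∧ ∀ p : ℕ, ν (-(p + 1)) =
      (d.T : ℂ)⁻¹ • ∑ m ∈ Finset.range d.T, ∑ s ∈ Finset.range N,
        r m s • twistF P (-(m : ℤ)) (α (p + s)) := by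
  choose t ht h0 hc using hr
  choose h hh hhc using fun m : ℕ => (hF.map (twistF P (-(m : ℤ)))).regular_smul (ht m) (h0 m)
    (N := N) (fun q hq => by rw [hN q hq, map_zero])
  refine ⟨_, ((HasExpansion.sum (S := Finset.range d.T) fun m _ => hh m).const_smul
    (d.T : ℂ)⁻¹).congr_fun fun z => ?_, fun p => ?_⟩
  · rw [laxGen, smul_comm]
    congr 1
    rw [Finset.smul_sum]
    refine Finset.sum_congr rfl fun m _ => ?_
    rw [map_smul, smul_smul, smul_smul]
    congr 1
    ring
  · refine congrArg _ (Finset.sum_congr rfl fun m _ => ?_)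
    rw [hhc]
    exact Finset.sum_congr rfl fun s _ => by rw [hc]

lemma exists_represents_sub_inv {x c : ℂ} (h : c ≠ x) :
    ∃ t, Represents (expandAt x) (fun z => (z - c)⁻¹) t ∧ (∀ n < 0, t.coeff n = 0) ∧
      ∀ n : ℕ, t.coeff n = -((c - x) ^ (n + 1))⁻¹ := by
  obtain ⟨t, ht, h0, h1⟩ := exists_represents_regular h.symm 0
  simp only [zero_add, pow_one] at ht
  refine ⟨t, ht, h0, fun n => ?_⟩
  have h2 : c - x ≠ 0 := sub_ne_zero.mpr h
  rw [h1, zero_add, Nat.choose_self, show x - c = -1 * (c - x) by ring, mul_pow, pow_succ (-1 : ℂ)]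
  have h3 : (-1 : ℂ) ^ n ≠ 0 := pow_ne_zero _ (by norm_num)
  field_simp
  simp

/-- Every Hamiltonian is a Laurent coefficient of the generating function `½ (ℒ(z) | ℒ(z))`, and
the same coefficient of the Lax partner of the generating function is `-ℳˣₚ(w)`. The weight `f` of
the Lax matrix is `z` at infinity, `1` at the origin and `T` at the other poles. -/
theorem exists_hamExpansion {x : OnePoint ℂ} {p : ℕ} (h : IsHamIndex P x p) :
    ∃ (θ : ℂ[X] →ₐ[ℂ] LaurentSeries ℂ) (f : ℂ → ℂ) (a : ℤ → LocalObs lev) (n : ℤ),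
      Function.Injective θ ∧
      HasExpansion θ (fun z => (1 / 2 : ℂ) • localPair b lev (f z • laxF P z) (f z • laxF P z)) a ∧
      a n = localHam b lev x p ∧ ∀ w, IsRegularPoint P w →
        ∃ ν, HasExpansion θ (fun z => (f z) ^ 2 • laxGen P w z) ν ∧ ν n = -partnerF P x p w := by
  induction x using OnePoint.rec with
  | infty =>
    have hα : ∀ q, P.n ∞ ≤ q → -fieldF P ∞ (q + 1) = 0 := fun q hq => by
      rw [fieldF_of_le (by omega), neg_zero]
    obtain ⟨a, ha, h1⟩ := hasLaurent_laxF_infty.half_bilin (localPair b lev) (localPair_symm b lev) hα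
    refine ⟨expandInf, fun z => z, a, -((p + 1 : ℕ) + 1), expandInf_injective, ha,
      (h1 (p + 1)).trans (localHam_infty b lev h.2).symm, fun w hw => ?_⟩
    obtain ⟨ν, hν, h2⟩ := exists_hasExpansion_laxGen (w := w) hasLaurent_laxF_infty hα
      (r := fun m s => (d.ω ^ (-(m : ℤ)) * w) ^ s) fun m => by
        obtain ⟨t, ht, h0, h1⟩ := HasLaurent.exists_represents_mul_inf (d.ω ^ (-(m : ℤ)) * w) 0
        exact ⟨t, by simpa using ht, h0, fun n => by rw [h1]; simp⟩
    refine ⟨ν, hν, (h2 (p + 1)).trans ?_⟩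
    have hdvd : (d.T : ℤ) ∣ p + 2 := by exact_mod_cast h.2
    have e : ∀ m ∈ Finset.range d.T, ∑ s ∈ Finset.range (P.n ∞), (d.ω ^ (-(m : ℤ)) * w) ^ s •
        twistF P (-(m : ℤ)) (-fieldF P ∞ (p + 1 + s + 1))
        = -∑ s ∈ Finset.range (P.n ∞), w ^ s • fieldF P ∞ (p + s + 2) := by
      intro m _
      rw [← Finset.sum_neg_distrib]
      refine Finset.sum_congr rfl fun s _ => ?_
      rw [map_neg, smul_neg, twistF_fieldF_infty, smul_smul, mul_pow, ← zpow_natCast (d.ω ^ _),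
        ← zpow_mul, mul_right_comm, ← zpow_add₀ d.ω_ne_zero, d.ω_zpow_eq_one, one_mul,
        show p + 1 + s + 1 = p + s + 2 by ring]
      have e : -(m : ℤ) * s + -(((p + 1 + s + 1 : ℕ) : ℤ) * -m) = ((p : ℤ) + 2) * m := by
        push_cast; ring
      rw [e]
      exact Dvd.dvd.mul_right hdvd _
    rw [Finset.sum_congr rfl e, Finset.sum_const, Finset.card_range, ← Nat.cast_smul_eq_nsmul ℂ,
      inv_smul_smul₀ d.T_ne_zero, partnerF, partnerSum, OnePoint.elim_infty]
    congr 1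
  | coe x =>
    rcases eq_or_ne x 0 with rfl | hx
    · have hα : ∀ q, P.n (0 : ℂ) ≤ q → fieldF P ((0 : ℂ) : OnePoint ℂ) q = 0 := fun q hq =>
        fieldF_of_le hq
      have hL := hasLaurent_laxF_zero (P := P)
      obtain ⟨a, ha, h1⟩ := hL.half_bilin (localPair b lev) (localPair_symm b lev) hα
      refine ⟨expandAt 0, fun _ => 1, a, -(p + 1), expandAt_injective 0, ha,
        (h1 p).trans (localHam_zero b lev (h.2.2 rfl)).symm, fun w hw => ?_⟩
      obtain ⟨ν, hν, h2⟩ := exists_hasExpansion_laxGen (w := w) (f := fun _ => 1) hL hα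
        (r := fun m s => -((d.ω ^ (-(m : ℤ)) * w) ^ (s + 1))⁻¹) fun m => by
          obtain ⟨t, ht, h0, h1⟩ := exists_represents_sub_inv (hw.zpow_mul_ne (-(m : ℤ)) h.1)
          exact ⟨t, by simpa using ht, h0, fun n => by rw [h1, sub_zero]⟩
      refine ⟨ν, hν, (h2 p).trans ?_⟩
      have hdvd : (d.T : ℤ) ∣ p - 1 := by
        have := (Nat.modEq_iff_dvd.mp (h.2.2 rfl).symm)
        simpa using this
      have e : ∀ m ∈ Finset.range d.T, ∑ s ∈ Finset.range (P.n (0 : ℂ)),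
          -((d.ω ^ (-(m : ℤ)) * w) ^ (s + 1))⁻¹ •
            twistF P (-(m : ℤ)) (fieldF P ((0 : ℂ) : OnePoint ℂ) (p + s))
          = -∑ s ∈ Finset.range (P.n (0 : ℂ)),
            (w ^ (s + 1))⁻¹ • fieldF P ((0 : ℂ) : OnePoint ℂ) (p + s) := by
        intro m _
        rw [← Finset.sum_neg_distrib]
        refine Finset.sum_congr rfl fun s _ => ?_
        refine (neg_smul (R := ℂ) (M := modeFormalFields P) _ _).trans (congrArg Neg.neg ?_)
        rw [twistF_fieldF_zero, smul_smul, mul_pow, mul_inv, ← zpow_natCast (d.ω ^ _),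
          ← zpow_mul, ← zpow_neg, mul_right_comm, ← zpow_add₀ d.ω_ne_zero, d.ω_zpow_eq_one, one_mul]
        have e : -(-(m : ℤ) * ((s + 1 : ℕ) : ℤ)) + ((p + s : ℕ) : ℤ) * -m = ((p : ℤ) - 1) * -m := by
          push_cast; ring
        rw [e]
        exact Dvd.dvd.mul_right hdvd _
      rw [Finset.sum_congr rfl e, Finset.sum_const, Finset.card_range, ← Nat.cast_smul_eq_nsmul ℂ,
        inv_smul_smul₀ d.T_ne_zero, partnerF, partnerSum, OnePoint.elim_some, if_pos rfl]
      congr 1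
    · have hα : ∀ q, P.n x ≤ q → fieldF P x q = 0 := fun q hq => fieldF_of_le hq
      have hL := hasLaurent_laxF_coe (mem_Z'.mpr ⟨hx, h.1⟩)
      obtain ⟨a, ha, h1⟩ := hL.half_bilin (localPair b lev) (localPair_symm b lev) hα
      refine ⟨expandAt x, fun _ => (d.T : ℂ), a, -(p + 1), expandAt_injective x, ha,
        (h1 p).trans (localHam_coe b lev hx p).symm, fun w hw => ?_⟩
      obtain ⟨ν, hν, h2⟩ := exists_hasExpansion_laxGen (w := w) (f := fun _ => (d.T : ℂ)) hL hα
        (r := fun m s => (d.T : ℂ) * -((d.ω ^ (-(m : ℤ)) * w - x) ^ (s + 1))⁻¹) fun m => by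
          obtain ⟨t, ht, h0, h1⟩ := exists_represents_sub_inv (hw.zpow_mul_ne (-(m : ℤ)) h.1)
          exact ⟨_, ht.const_mul _, fun n hn => by rw [HahnSeries.coeff_smul, h0 n hn, smul_zero],
            fun n => by rw [HahnSeries.coeff_smul, h1, smul_eq_mul]⟩
      refine ⟨ν, hν, (h2 p).trans ?_⟩
      rw [partnerF, partnerSum, OnePoint.elim_some, if_neg hx]
      simp only [mul_smul, ← Finset.smul_sum]
      rw [inv_smul_smul₀ d.T_ne_zero]
      simp only [neg_smul, Finset.sum_neg_distrib, zpow_neg, zpow_natCast]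

/-! ### Lax equations of the Hamiltonians -/

lemma half_localPair_smul (c : ℂ) (Φ : modeFormalFields P) :
    (1 / 2 : ℂ) • localPair b lev (c • Φ) (c • Φ)
      = c ^ 2 • ((1 / 2 : ℂ) • localPair b lev Φ Φ) := by
  rw [LinearMap.map_smul₂, LinearMap.map_smul, smul_smul c, ← pow_two, smul_comm]

/-- The flow of a Hamiltonian on the Lax matrix is a Lax equation, as is seen by comparing Laurent
coefficients in the Lax equation `br_generating_lax` of the generating function. -/
theorem br_localHam_lax {x : OnePoint ℂ} {p : ℕ} (h : IsHamIndex P x p) {w : ℂ}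
    (hw : IsRegularPoint P w) (Y : Affine d) :
    (localContBracket lev).br (localHam b lev x p) ((toLocal b lev (laxF P w)).1 Y)
      = pair b (toLocal b lev (-partnerF P x p w)).1
          ((toLocal b lev (laxF P w)).1 ∘ₗ Affine.adR Y) := by
  obtain ⟨θ, f, a, n, hθ, ha, han, hν⟩ := exists_hamExpansion b lev h
  obtain ⟨ν, hν, hνn⟩ := hν w hw
  rw [← han, ← hνn]
  -- both sides are rational functions of `z`, so it suffices to compare them at almost all `z`
  refine HasExpansion.unique hθ
    (ha.map ((localContBracket lev).br.flip ((toLocal b lev (laxF P w)).1 Y)))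
    (hν.map ((pairL d b (localFil lev)).flip
      ⟨_, comp_adR_mem (toLocal b lev (laxF P w)).2 Y⟩ ∘ₗ toLocal b lev)) ?_ n
  filter_upwards [eventually_isRegularPoint P, eventually_zpow_mul_ne d w] with z hz hzw
  have h1 := br_generating_lax b lev hz hw hzw Y
  rw [half_localPair_smul]
  refine (LinearMap.map_smul _ _ _).trans ?_
  refine Eq.trans ?_ (LinearMap.map_smul _ _ _).symm
  exact congrArg (f z ^ 2 • ·) h1

/-- The Hamiltonians Poisson commute: by its Lax equation a Hamiltonian commutes with
`(ℒ(w) | ℒ(w))`, hence with all Laurent coefficients of this function of `w`. -/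
theorem br_localHam_localHam {x y : OnePoint ℂ} {p q : ℕ} (hx : IsHamIndex P x p)
    (hy : IsHamIndex P y q) :
    (localContBracket lev).br (localHam b lev x p) (localHam b lev y q) = 0 := by
  obtain ⟨θ, f, a, n, hθ, ha, han, -⟩ := exists_hamExpansion b lev hy
  rw [← han]
  refine HasExpansion.unique hθ (ha.map ((localContBracket lev).br (localHam b lev x p)))
    HasExpansion.zero ?_ n
  filter_upwards [eventually_isRegularPoint P] with w hw
  have h1 : (localContBracket lev).br (localHam b lev x p)
      (localPair b lev (laxF P w) (laxF P w)) = 0 :=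
    br_pair_self_of_lax b (localContBracket lev) (toLocal b lev (laxF P w)).2
      (toLocal b lev (-partnerF P x p w)).2 fun Y => br_localHam_lax b lev hx hw Y
  rw [half_localPair_smul, LinearMap.map_smul, LinearMap.map_smul, h1, smul_zero, smul_zero]

end HamCoeff

/-! ### The zero curvature equation -/

section ZeroCurvature

open scoped OnePoint

variable {𝔤 : Type*} [LieRing 𝔤] [LieAlgebra ℂ 𝔤] {d : DihedralData 𝔤} {P : PoleDivisor d}
variable {I : Type*} [Fintype I] [DecidableEq I] (b : Module.Basis I ℂ 𝔤) (lev : Levels d P)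

/-- The value of `π_ℓ` of a formal field on `K`, as a linear map. -/
def kelValue : modeFormalFields P →ₗ[ℂ] LocalObs lev where
  toFun Φ := piLin b lev (Φ.1 (Affine.Kel d))
  map_add' _ _ := map_add (piLin b lev) _ _
  map_smul' _ _ := map_smul (piLin b lev) _ _

lemma kelValue_twistF_fieldF (k : ℤ) (x : OnePoint ℂ) (p : ℕ) :
    kelValue b lev (twistF P k (fieldF P x p))
      = (Complex.I • Algebra.linearMap ℂ (LocalObs lev)) (lev.ℓ x p) := by
  change piLin b lev (emb P x p (((Affine.sigma d) ^ k) (Affine.Kel d))) = _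
  rw [Affine.sigma_zpow_Kel, piLin_emb_of_D_eq_zero b lev rfl, modeField_Kel, map_mul,
    ← Algebra.smul_def]
  rfl

/-- The central component of the Lax matrix is the twist function. -/
lemma piLin_laxF_Kel (z : ℂ) : piLin b lev ((laxF P z).1 (Affine.Kel d))
    = Complex.I • algebraMap ℂ (LocalObs lev) (twist lev z) := by
  change kelValue b lev (laxF P z) = _
  rw [laxF, map_laxSum]
  simp only [kelValue_twistF_fieldF]
  exact (map_laxSum (P := P) (Complex.I • Algebra.linearMap ℂ (LocalObs lev))
    (fun _ x p => lev.ℓ x p) z).symm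

lemma piLin_partnerF_Kel (x : OnePoint ℂ) (p : ℕ) (z : ℂ) :
    piLin b lev ((partnerF P x p z).1 (Affine.Kel d))
      = Complex.I • algebraMap ℂ (LocalObs lev) (twistM lev x p z) := by
  change kelValue b lev (partnerF P x p z) = _
  rw [partnerF, map_partnerSum]
  simp only [kelValue_twistF_fieldF]
  exact (map_partnerSum (P := P) (Complex.I • Algebra.linearMap ℂ (LocalObs lev))
    (fun _ x p => lev.ℓ x p) x p z).symm

lemma neg_I_smul_I_smul {V : Type*} [AddCommGroup V] [Module ℂ V] (v : V) :
    -Complex.I • Complex.I • v = v := by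
  rw [smul_smul, neg_mul, Complex.I_mul_I, neg_neg, one_smul]

lemma summable_modes {Φ Ψ : Affine d →ₗ[ℂ] LocalObs lev} (hΦ : Φ ∈ modeFields (localFil lev) d)
    (hΨ : Ψ ∈ modeFields (localFil lev) d) (u v : 𝔤) (k : ℤ) :
    Summable fun m : ℤ => Φ (Affine.xt d (-m) u) * Ψ (Affine.xt d (m - k) v) := by
  refine (localFil lev).summable fun n => ?_
  obtain ⟨N, h₁, h₂⟩ := hΦ n
  obtain ⟨M, h₃, h₄⟩ := hΨ n
  refine (Set.finite_Icc (-(N + M + k.natAbs : ℤ)) (N + M + k.natAbs)).subset fun m hm => ?_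
  by_contra h
  apply hm
  rw [Set.mem_Icc, not_and_or, not_le, not_le] at h
  rcases h with h | h
  · exact ⟨Ideal.mul_mem_right _ _ (h₁ _ (Affine.xt_mem_filPos (by omega) _)),
      Ideal.mul_mem_left _ _ (h₄ _ (Affine.xt_mem_filNeg (by omega) _))⟩
  · exact ⟨Ideal.mul_mem_left _ _ (h₃ _ (Affine.xt_mem_filPos (by omega) _)),
      Ideal.mul_mem_right _ _ (h₂ _ (Affine.xt_mem_filNeg (by omega) _))⟩

/-- The components of the `𝔤`-valued field defined by the restriction to the loop algebra. -/
def currents (Φ : Affine d →ₗ[ℂ] LocalObs lev) : ClassicalField I lev :=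
  fun a n => Φ (Affine.xt d (-n) (dualB d b a))

lemma summable_currents {Φ Ψ : Affine d →ₗ[ℂ] LocalObs lev} (hΦ : Φ ∈ modeFields (localFil lev) d)
    (hΨ : Ψ ∈ modeFields (localFil lev) d) (a a' : I) (n : ℤ) :
    Summable fun m : ℤ => currents b lev Φ a m * currents b lev Ψ a' (n - m) := by
  simpa only [currents, neg_sub] using summable_modes lev hΦ hΨ (dualB d b a) (dualB d b a') n

/-- The commutator of a field with itself vanishes; the double sum is antisymmetric under the
exchange of the two factors. -/
lemma comm_self (X : ClassicalField I lev) : ClassicalField.comm b X X = 0 := by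
  funext c n
  have h : ClassicalField.comm b X X c n = -ClassicalField.comm b X X c n := by
    conv_lhs => rw [ClassicalField.comm, Finset.sum_comm]
    rw [ClassicalField.comm, ← Finset.sum_neg_distrib]
    refine Finset.sum_congr rfl fun a _ => ?_
    rw [← Finset.sum_neg_distrib]
    refine Finset.sum_congr rfl fun a' _ => ?_
    rw [← lie_skew (b a) (b a'), map_neg, Finsupp.neg_apply, neg_smul, neg_neg]
    have h3 : ∑' m : ℤ, X a' m * X a (n - m) = ∑' m : ℤ, X a m * X a' (n - m) := by
      rw [← (Equiv.subLeft n).tsum_eq fun m : ℤ => X a' m * X a (n - m)]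
      refine tsum_congr fun m => ?_
      rw [Equiv.subLeft_apply, sub_sub_cancel, mul_comm]
    rw [h3]
  have h2 : (2 : ℂ) • ClassicalField.comm b X X c n = 0 := by
    rw [two_smul]; nth_rewrite 1 [h]; simp
  exact (smul_eq_zero.mp h2).resolve_left two_ne_zero

lemma comm_smul_left (k : ℂ) (X Y : ClassicalField I lev) (c : I) (n : ℤ) :
    ClassicalField.comm b (k • X) Y c n = k • ClassicalField.comm b X Y c n := by
  simp only [ClassicalField.comm, Finset.smul_sum, Pi.smul_apply, smul_mul_assoc, tsum_const_smul'']
  exact Finset.sum_congr rfl fun a _ => Finset.sum_congr rfl fun a' _ => smul_comm _ _ _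

lemma comm_sub_right {X Y Z : ClassicalField I lev}
    (hY : ∀ a a' n, Summable fun m : ℤ => X a m * Y a' (n - m))
    (hZ : ∀ a a' n, Summable fun m : ℤ => X a m * Z a' (n - m)) (k : ℂ) :
    ClassicalField.comm b X (k • Y - Z)
      = k • ClassicalField.comm b X Y - ClassicalField.comm b X Z := by
  funext c n
  simp only [ClassicalField.comm, Pi.sub_apply, Pi.smul_apply, Finset.smul_sum,
    ← Finset.sum_sub_distrib]
  refine Finset.sum_congr rfl fun a _ => Finset.sum_congr rfl fun a' _ => ?_
  rw [smul_comm k, ← smul_sub]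
  refine congrArg _ (Eq.trans ?_ (congrArg (· - _) (tsum_const_smul'' k)))
  rw [← Summable.tsum_sub ((hY a a' n).const_smul k) (hZ a a' n)]
  exact tsum_congr fun m => by rw [mul_sub, mul_smul_comm]

lemma lie_basis_dualB (a c : I) : ⁅b a, dualB d b c⁆
    = ∑ a', b.repr ⁅b a', b a⁆ c • dualB d b a' := by
  conv_lhs => rw [← sum_form_smul_dualB b (d := d) ⁅b a, dualB d b c⁆]
  refine Finset.sum_congr rfl fun a' _ => ?_
  rw [repr_eq_form (d := d), ← lie_skew, map_neg, LinearMap.neg_apply, d.form_invariant,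
    ← lie_skew (b a'), map_neg]

/-- The part of the pairing with an adjoint action that lies in the loop algebra. -/
lemma tsum_currents_lie {Λ N : Affine d →ₗ[ℂ] LocalObs lev} (hΛ : Λ ∈ modeFields (localFil lev) d)
    (hN : N ∈ modeFields (localFil lev) d) (c : I) (n : ℤ) :
    ∑' m : ℤ, ∑ a, N (Affine.xt d m (dualB d b a)) *
        Λ (Affine.xt d (-m + -n) ⁅b a, dualB d b c⁆)
      = ClassicalField.comm b (currents b lev Λ) (currents b lev N) c n := by
  have h1 : ∀ m : ℤ, ∑ a, N (Affine.xt d (m - n) (dualB d b a)) *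
        Λ (Affine.xt d (-(m - n) + -n) ⁅b a, dualB d b c⁆)
      = ∑ a', ∑ a, b.repr ⁅b a', b a⁆ c •
        (currents b lev Λ a' m * currents b lev N a (n - m)) := by
    intro m
    rw [Finset.sum_comm]
    refine Finset.sum_congr rfl fun a _ => ?_
    rw [lie_basis_dualB, map_sum, map_sum, Finset.mul_sum]
    refine Finset.sum_congr rfl fun a' _ => ?_
    rw [map_smul, map_smul, mul_smul_comm, mul_comm, currents, currents,
      show -(m - n) + -n = -m by ring, show -(n - m) = m - n by ring]
  rw [← (Equiv.subRight n).tsum_eq]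
  simp only [Equiv.subRight_apply, h1]
  rw [Summable.tsum_finsetSum fun a' _ => summable_sum fun a _ =>
    (summable_currents b lev hΛ hN a' a n).const_smul _]
  refine Finset.sum_congr rfl fun a' _ => ?_
  rw [Summable.tsum_finsetSum fun a _ => (summable_currents b lev hΛ hN a' a n).const_smul _]
  exact Finset.sum_congr rfl fun a _ => tsum_const_smul'' _

/-- The right-hand side of a Lax equation in components: the derivation and the cocycle, paired
with the central components of the two fields, give the derivatives (`∂` multiplies the `n`-th
Fourier mode with `i n`), and the brackets in the loop algebra give the commutator. -/
lemma pair_comp_adR_xt {Λ N : Affine d →ₗ[ℂ] LocalObs lev} (hΛ : Λ ∈ modeFields (localFil lev) d)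
    (hN : N ∈ modeFields (localFil lev) d) (c : I) (n : ℤ) :
    pair b N (Λ ∘ₗ Affine.adR (Affine.xt d (-n) (dualB d b c)))
      = -(n : ℂ) • (N (Affine.Kel d) * currents b lev Λ c n) +
        (n : ℂ) • (currents b lev N c n * Λ (Affine.Kel d)) +
        ClassicalField.comm b (currents b lev Λ) (currents b lev N) c n := by
  have hL := summable_loop b hN (comp_adR_mem hΛ (Affine.xt d (-n) (dualB d b c)))
  rw [pair_eq b hN (comp_adR_mem hΛ _)]
  simp only [LinearMap.comp_apply, Affine.adR_apply, Affine.Kel_lie, map_zero, mul_zero, add_zero,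
    Affine.lie_Del_xt, map_smul, Affine.lie_xt_xt, map_add, mul_add, Finset.sum_add_distrib] at hL ⊢
  -- the cocycle contributes to a single term of the sum
  have eR : ∀ m : ℤ, (∑ a, N (Affine.xt d m (dualB d b a)) *
      ((if -m + -n = 0 then ((-m : ℤ) : ℂ) * d.form (b a) (dualB d b c) else 0) •
        Λ (Affine.Kel d)))
      = if m = -n then (n : ℂ) • (currents b lev N c n * Λ (Affine.Kel d)) else 0 := by
    intro m
    by_cases h : m = -n
    · subst h
      simp only [neg_neg, add_neg_cancel, if_true]
      rw [Finset.sum_eq_single c]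
      · rw [d.form_symm, form_dualB_left, if_pos rfl, mul_one, mul_smul_comm]
        rfl
      · intro a _ ha
        rw [d.form_symm, form_dualB_left, if_neg ha, mul_zero, zero_smul, mul_zero]
      · exact fun h => absurd (Finset.mem_univ _) h
    · rw [if_neg h]
      simp only [if_neg (show ¬ -m + -n = 0 by omega), zero_smul, mul_zero, Finset.sum_const_zero]
  simp only [eR] at hL ⊢
  have hR := hasSum_ite_eq (-n) ((n : ℂ) • (currents b lev N c n * Λ (Affine.Kel d)))
  have hS := hL.sub hR.summable
  simp only [add_sub_cancel_right] at hS
  rw [Summable.tsum_add hS hR.summable, hR.tsum_eq, tsum_currents_lie b lev hΛ hN, mul_smul_comm]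
  push_cast
  simp only [currents]
  abel

/-- The zero curvature equation is the Lax equation `br_localHam_lax` in components, divided by
the twist function. The term `∂ 𝒩` comes from the derivation and the cocycle of the affine
algebra. Adding `φˣₚ ℒ` to the Lax partner does not change the commutator. -/
theorem zero_curvature {x : OnePoint ℂ} {p : ℕ} (h : IsHamIndex P x p) {z : ℂ}
    (hz : IsRegularPoint P z) (hφ : twist lev z ≠ 0) :
    ClassicalField.poisson (localHam b lev x p) (lax b lev z)
      = ClassicalField.deriv (laxN b lev x p z)
        + ClassicalField.comm b (lax b lev z) (laxN b lev x p z) := by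
  set Λ := (toLocal b lev (laxF P z)).1 with hΛ
  set N := (toLocal b lev (partnerF P x p z)).1 with hN
  have mΛ : Λ ∈ modeFields (localFil lev) d := (toLocal b lev (laxF P z)).2
  have mN : N ∈ modeFields (localFil lev) d := (toLocal b lev (partnerF P x p z)).2
  have hlax : lax b lev z = (twist lev z)⁻¹ • currents b lev Λ := by
    rw [lax, ← coe_laxF]; rfl
  have hlaxN : laxN b lev x p z = twistM lev x p z • lax b lev z - currents b lev N := by
    rw [laxN, ← coe_partnerF]; rfl
  have hcomm : ClassicalField.comm b (lax b lev z) (laxN b lev x p z)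
      = -((twist lev z)⁻¹ • ClassicalField.comm b (currents b lev Λ) (currents b lev N)) := by
    rw [hlaxN, comm_sub_right, comm_self, smul_zero, zero_sub, hlax]
    · congr 1
      funext c n
      exact comm_smul_left b lev _ _ _ c n
    · intro a a' n
      rw [hlax]
      simpa only [Pi.smul_apply, smul_mul_assoc, mul_smul_comm] using
        ((summable_currents b lev mΛ mΛ a a' n).const_smul (twist lev z)⁻¹).const_smul
          (twist lev z)⁻¹
    · intro a a' n
      rw [hlax]
      simpa only [Pi.smul_apply, smul_mul_assoc] using
        (summable_currents b lev mΛ mN a a' n).const_smul (twist lev z)⁻¹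
  have hK : Λ (Affine.Kel d) = Complex.I • algebraMap ℂ (LocalObs lev) (twist lev z) :=
    piLin_laxF_Kel b lev z
  have hK' : N (Affine.Kel d) = Complex.I • algebraMap ℂ (LocalObs lev) (twistM lev x p z) :=
    piLin_partnerF_Kel b lev x p z
  funext c n
  have h1 : localBracket lev (localHam b lev x p) (currents b lev Λ c n)
      = -pair b N (Λ ∘ₗ Affine.adR (Affine.xt d (-n) (dualB d b c))) := by
    refine (br_localHam_lax b lev h hz (Affine.xt d (-n) (dualB d b c))).trans ?_
    change (pairL d b (localFil lev)).flip ⟨_, comp_adR_mem mΛ _⟩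
      (toLocal b lev (-partnerF P x p z)) = _
    rw [map_neg, map_neg]
    rfl
  have h2 : ClassicalField.poisson (localHam b lev x p) (lax b lev z) c n
      = (twist lev z)⁻¹ • localBracket lev (localHam b lev x p) (currents b lev Λ c n) := by
    rw [hlax]
    exact LinearMap.map_smul ((localContBracket lev).br (localHam b lev x p)) _ _
  rw [h2, h1, pair_comp_adR_xt b lev mΛ mN, hK, hK', Pi.add_apply, Pi.add_apply, hcomm,
    ClassicalField.deriv, hlaxN, hlax]
  simp only [Pi.neg_apply, Pi.smul_apply, Pi.sub_apply, smul_mul_assoc, mul_smul_comm,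
    ← Algebra.smul_def, mul_comm _ (algebraMap ℂ (LocalObs lev) _)]
  simp only [smul_sub, smul_add, smul_neg, smul_smul, neg_add_rev]
  have e1 : (twist lev z)⁻¹ * ((n : ℂ) * (Complex.I * twist lev z)) = Complex.I * n := by
    field_simp
  have e2 : (twist lev z)⁻¹ * (-(n : ℂ) * (Complex.I * twistM lev x p z))
      = -(Complex.I * n * (twistM lev x p z * (twist lev z)⁻¹)) := by ring
  rw [e1, e2, neg_smul, neg_neg]
  abel

end ZeroCurvature

end DihedralGaudin

end

theorem mainTheorem4 {𝔤 : Type*} [LieRing 𝔤] [LieAlgebra ℂ 𝔤]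
    {I : Type*} [Fintype I] [DecidableEq I] (b : Module.Basis I ℂ 𝔤)
    (d : DihedralData 𝔤) (P : PoleDivisor d) (lev : Levels d P) :
    (∀ (x y : OnePoint ℂ) (p q : ℕ), IsHamIndex P x p → IsHamIndex P y q →
      localBracket lev (localHam b lev x p) (localHam b lev y q) = 0) ∧
    ∀ (x : OnePoint ℂ) (p : ℕ), IsHamIndex P x p →
      ∀ z : ℂ, IsRegularPoint P z → twist lev z ≠ 0 →
        rhoPi b lev (formalLax P z)
          = (algebraMap ℂ _ (twist lev z), twist lev z • lax b lev z) ∧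
        rhoPi b lev (formalM P x p z)
          = (algebraMap ℂ _ (twistM lev x p z),
              twistM lev x p z • lax b lev z - laxN b lev x p z) ∧
        ClassicalField.poisson (localHam b lev x p) (lax b lev z)
          = ClassicalField.deriv (laxN b lev x p z)
            + ClassicalField.comm b (lax b lev z) (laxN b lev x p z) := by
  refine ⟨fun x y p q hx hy => br_localHam_localHam b lev hx hy, fun x p h z hz hφ =>
    ⟨Prod.ext ?_ ?_, Prod.ext ?_ ?_, zero_curvature b lev h hz hφ⟩⟩
  · change -Complex.I • piLin b lev (formalLax P z (Affine.Kel d)) = _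
    rw [← coe_laxF, piLin_laxF_Kel, neg_I_smul_I_smul]
  · exact (smul_inv_smul₀ hφ _).symm
  · change -Complex.I • piLin b lev (formalM P x p z (Affine.Kel d)) = _
    rw [← coe_partnerF, piLin_partnerF_Kel, neg_I_smul_I_smul]
  · exact (sub_sub_cancel _ _).symm
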